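/- Let $k$ be a field of characteristic $0$. **Gravity algebras.** A gravity algebra is a graded vector space $V$ with multilinear brackets $\{x_1,\dots,x_m\}$, $m\ge 2$, of degree $-1$ (so $|\{x_1,\dots,x_m\}|=\sum|x_i|-1$), graded skew-symmetric for the shifted degree $|x|+1$, i.e. $\{\dots,a,b,\dots\}=-(-1)^{(|a|+1)(|b|+1)}\{\dots,b,a,\dots\}$, such that for all homogeneous $x_1,\dots,x_r$, $y_1,\dots,y_s$ with $r\ge 2$ (and $r\ge 3$ if $s=0$) $$\sum_{1\le i<j\le r}(-1)^{\epsilon_{ij}+i+j-1}\{\{x_i,x_j\},x_1,\dots,\widehat{x_i},\dots,\widehat{x_j},\dots,x_r,y_1,\dots,y_s\}=\begin{cases}(-1)^r\{\{x_1,\dots,x_r\},y_1,\dots,y_s\}& s\ge1,\\ 0& s=0,\end{cases}$$ where $\epsilon_{ij}=(|x_i|+1)(|x_1|+\dots+|x_{i-1}|+i-1)+(|x_j|+1)(|x_1|+\dots+|x_{j-1}|+j-1)-(|x_i|+1)(|x_j|+1)$. **Mixed complexes.** A mixed complex $(C_\bullet,b,B)$ has $b$ of degree $-1$, $B$ of degree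 $+1$, $b^2=B^2=bB+Bb=0$. Its negative cyclic complex in degree $m$ consists of the series $\sum_{i\ge0}x_iu^i$, $x_i\in C_{m+2i}$, with differential $b+uB$; $HH_\bullet$ is the $b$-homology and $HC^-_\bullet$ the negative cyclic homology. Let $\pi_*:HC^-_m\to HH_m$ be induced by $\sum x_iu^i\mapsto x_0$ and let $\beta:HH_m\to HC^-_{m+1}$, $[z]\mapsto[Bz]$, be the connecting map. **(1)** Let $A$ be a Poisson algebra over $k$ with differential forms $\Omega^\bullet(A)$ (Kähler forms; or smooth forms if $A=C^\infty(X)$; in general, the exterior algebra of an $A$-module $\Omega^1$ with a $k$-linear derivation $d:A\to\Omega^1$ such that $dA$ spans $\Omega^1$, every derivation of $A$ factors through $d$ by an $A$-linear map $\Omega^1\to A$, and $d$ extends by $d(a\,df_1\cdots df_p)=da\,df_1\cdots df_p$). Let $\mathfrak X^p(A)$ be the skew-symmetric $p$-derivations of $A$, with Poisson coboundary $\delta$ and cohomology $HP^p(A)$. For $P\in\mathfrak X^p(A)$ put $\iota_P(\omega_1\cdots\omega_i)=(-1)^{p(p-1)/2}\sum_{s}\mathrm{sgn}(s)P(\omega_{s(1)},\dots,\omega_{s(p)})\,\omega_{s(p+1)}\cdots\omega_{s(i)}$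 (sum over $(p,i-p)$-shuffles). Let $\eta\in\Omega^n(A)$ be a volume form, i.e. $\iota_{(-)}\eta:\mathfrak X^\bullet(A)\to\Omega^\bullet(A)$ is an isomorphism; put $\mathrm{Div}=(\iota_{(-)}\eta)^{-1}\circ d\circ\iota_{(-)}\eta$ and let $\nu=-\mathrm{Div}(\pi)$ be the modular vector, where $\pi(f,g)=\{f,g\}$. Suppose that $\nu$ is semisimple: $A$ is spanned by eigenvectors of $\nu$. Put $\{m,a\}_\nu=\{m,a\}+m\,\nu(a)$, let $$\partial_\nu(m\,df_1\cdots df_p)=\sum_i(-1)^{i-1}\{m,f_i\}_\nu\,df_1\cdots\widehat{df_i}\cdots df_p+\sum_{i<j}(-1)^{j-i}m\,d\{f_i,f_j\}\,df_1\cdots\widehat{df_i}\cdots\widehat{df_j}\cdots df_p,$$ and let $CP^0_p(A,A_\nu)\subset\Omega^p(A)$ be the span of the forms $f_0\,df_1\cdots df_p$ with $\nu(f_i)=\lambda_if_i$ and $\sum\lambda_i=0$. Then $(CP^0_\bullet(A,A_\nu),\partial_\nu,d)$ is a mixed complex, and contraction with $\eta$ (followed, modulo $\partial_\nu$-boundaries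 of all forms, by passing to a representative in $CP^0$) is an isomorphism $HP^p(A)\cong HH_{n-p}$. The wedge product of polyvectors, transported along it, gives a product $\bullet$ which with the operator induced by $d$ makes $HH_\bullet$, graded by $|HH_m|=n-m$, a unital Batalin–Vilkovisky algebra. The negative cyclic homology $PC^-_\bullet(A)$ of this mixed complex, graded by $|PC^-_m|=n-m$, is a gravity algebra with the brackets generated by the Batalin–Vilkovisky operator: $$\{x_1,\dots,x_m\}=(-1)^{\varepsilon_m}\beta\big(\pi_*(x_1)\bullet\cdots\bullet\pi_*(x_m)\big),\qquad \varepsilon_m=(m-1)|x_1|+(m-2)|x_2|+\dots+|x_{m-1}|,\quad m\ge2.$$ **(2)** Let $A^!=\Lambda(\xi_1,\dots,\xi_n)$, let $|f|$ be the number of generators in a homogeneous $f$, and let $A^!$ carry a graded Poisson bracket of degree $0$: $\{a,b\}=-(-1)^{|a||b|}\{b,a\}$, $\{a,bc\}=\{a,b\}c+(-1)^{|a||b|}b\{a,c\}$, $\{a,\{b,c\}\}=\{\{a,b\},c\}+(-1)^{|a||b|}\{b,\{a,c\}\}$. Let $A^{\vee}=(A^!)^*$ and let $\eta^!:A^!\cong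 A^{\vee}$, $\eta^!(a)(b)=$ the coefficient of $\xi_1\cdots\xi_n$ in $ab$. For $M=A^!$ or $A^{\vee}$ let $\mathfrak X^\bullet(M)$ be the space of (finite sums over all arities of) graded skew-symmetric multiderivations of $A^!$ with values in $M$. Let $\delta$ be the Poisson coboundary on $\mathfrak X^\bullet(A^!)$ and $HP^t(A^!)$ its cohomology, where a cochain $Q$ has degree $t$ if $|Q(f_1,\dots,f_p)|=\sum|f_i|-p+t$. On $\mathfrak X^\bullet(A^{\vee})$ put $d^*Q(f_1,\dots,f_p)(f_0)=(-1)^{p+1}Q(f_1,\dots,f_p,f_0)(1)$, $\mathrm{Div}=(\eta^!)^{-1}\circ d^*\circ\eta^!$ and $\nu^!=-\mathrm{Div}(\pi^!)$ with $\pi^!(f,g)=\{f,g\}$. Suppose that $\nu^!$ is semisimple (diagonalizable on $A^!$). Let $\partial_{\nu^!}$ be the Poisson coboundary with coefficients in $A^{\vee}_{\nu^!}$, whose bracket is $\{m,a\}_{\nu}(c)=m(\{a,c\})+m(\nu^!(a)c)$, and let $CP_0(A^!,A^{\vee}_{\nu^!})$ be the subspace of those $Q$ with $Q(f_1,\dots,f_p)(f_0)=0$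 whenever the $f_i$ are eigenvectors of $\nu^!$ whose eigenvalues have non-zero sum; $Q$ has chain degree $m$ if $Q(f_1,\dots,f_p)(f_0)\ne0$ (for homogeneous $f_i$) implies $\sum_{i=0}^p|f_i|=m+p$. Then $(CP_0(A^!,A^{\vee}_{\nu^!}),\partial_{\nu^!},d^*)$ is a mixed complex for this grading, composition with $\eta^!$ (modulo $\partial_{\nu^!}$-boundaries) is an isomorphism $HP^t(A^!)\cong HH_{n-t}$, the cup product of $HP^\bullet(A^!)$, transported along it, makes $HH_\bullet$, graded by $|HH_m|=n-m$, a unital Batalin–Vilkovisky algebra with the operator induced by $d^*$, and the cyclic Poisson cohomology $PC^\bullet(A^!)$, that is the $HC^-_\bullet$ of this mixed complex graded by $|HC^-_m|=n-m$, is a gravity algebra with brackets given by the same formula as in (1). Here the cup product of $X$ (degree $s$) and $Y$ (degree $t$) is $$(X\cup Y)(f_1,\dots,f_r)=\sum_{I\sqcup J=\{1,\dots,r\}}\mathrm{sgn}(I,J)\,(-1)^{(s+\#I)\,\#J+(t+\#J)\sum_{i\in I}|f_i|}\,X(f_I)\,Y(f_J),$$ with $\mathrm{sgn}(I,J)$ the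 graded sign of moving $f_I$ in front of $f_J$ (exchanging $a,b$ costs $-(-1)^{|a||b|}$). -/

import Mathlib

open scoped DirectSum

universe u v w

noncomputable section

namespace PoissonGravity

/-! ## Mixed complexes, negative cyclic homology -/

section Mixed

variable (k : Type*) [Field k] (E : Type*) [AddCommGroup E] [Module k E]

/-- A mixed (chain) complex: graded pieces `C m` (`m : ℤ`), realised inside an ambient vector
space `E`, with a differential `b` of degree `-1` and a differential `B` of degree `+1` that
anticommute. -/
structure MixedComplex where
  C : ℤ → Submodule k E
  b : E →ₗ[k] E
  B : E →ₗ[k] E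
  b_mem : ∀ m, ∀ x ∈ C m, b x ∈ C (m - 1)
  B_mem : ∀ m, ∀ x ∈ C m, B x ∈ C (m + 1)
  b_b : ∀ m, ∀ x ∈ C m, b (b x) = 0
  B_B : ∀ m, ∀ x ∈ C m, B (B x) = 0
  b_B : ∀ m, ∀ x ∈ C m, b (B x) + B (b x) = 0

end Mixed

namespace MixedComplex

variable {k : Type*} [Field k] {E : Type*} [AddCommGroup E] [Module k E] (M : MixedComplex k E)

/-- The `b`-cycles of degree `m`. -/
def cycles (m : ℤ) : Submodule k E := M.C m ⊓ LinearMap.ker M.b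

/-- The `b`-boundaries of degree `m`. -/
def boundaries (m : ℤ) : Submodule k E := (M.C (m + 1)).map M.b

/-- The `b`-homology `HH_m` of a mixed complex. -/
def HH (m : ℤ) : Type _ := M.cycles m ⧸ (M.boundaries m).submoduleOf (M.cycles m)

instance (m : ℤ) : AddCommGroup (M.HH m) :=
  inferInstanceAs (AddCommGroup (M.cycles m ⧸ (M.boundaries m).submoduleOf (M.cycles m)))

instance (m : ℤ) : Module k (M.HH m) :=
  inferInstanceAs (Module k (M.cycles m ⧸ (M.boundaries m).submoduleOf (M.cycles m)))

/-- The negative cyclic chains of degree `m`: formal series `∑ i, x i * u ^ i` with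
`x i ∈ C (m + 2 i)`, where `u` has degree `-2`. -/
def ncChains (m : ℤ) : Submodule k (ℕ → E) :=
  Submodule.pi Set.univ fun i : ℕ => M.C (m + 2 * (i : ℤ))

/-- The differential `b + u B` of the negative cyclic complex. -/
def ncDiff : (ℕ → E) →ₗ[k] (ℕ → E) :=
  LinearMap.pi fun i : ℕ => match i with
    | 0 => M.b ∘ₗ LinearMap.proj 0
    | j + 1 => M.b ∘ₗ LinearMap.proj (j + 1) + M.B ∘ₗ LinearMap.proj j

/-- The negative cyclic cycles of degree `m`. -/
def ncCycles (m : ℤ) : Submodule k (ℕ → E) := M.ncChains m ⊓ LinearMap.ker M.ncDiff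

/-- The negative cyclic boundaries of degree `m`. -/
def ncBoundaries (m : ℤ) : Submodule k (ℕ → E) := (M.ncChains (m + 1)).map M.ncDiff

/-- The negative cyclic homology `HC⁻_m` of a mixed complex. -/
def HC (m : ℤ) : Type _ := M.ncCycles m ⧸ (M.ncBoundaries m).submoduleOf (M.ncCycles m)

instance (m : ℤ) : AddCommGroup (M.HC m) :=
  inferInstanceAs (AddCommGroup (M.ncCycles m ⧸ (M.ncBoundaries m).submoduleOf (M.ncCycles m)))

instance (m : ℤ) : Module k (M.HC m) :=
  inferInstanceAs (Module k (M.ncCycles m ⧸ (M.ncBoundaries m).submoduleOf (M.ncCycles m)))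

lemma ncDiff_zero (x : ℕ → E) : M.ncDiff x 0 = M.b (x 0) := rfl

lemma ncDiff_succ (x : ℕ → E) (j : ℕ) :
    M.ncDiff x (j + 1) = M.b (x (j + 1)) + M.B (x j) := rfl

lemma mem_ncChains {m : ℤ} {x : ℕ → E} :
    x ∈ M.ncChains m ↔ ∀ i : ℕ, x i ∈ M.C (m + 2 * (i : ℤ)) := by
  simp [ncChains, Submodule.mem_pi]

/-- On cycles, the projection `∑ i, x i * u ^ i ↦ x 0`. -/
def piCycles (m : ℤ) : M.ncCycles m →ₗ[k] M.cycles m :=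
  (LinearMap.proj (R := k) (φ := fun _ : ℕ => E) 0).restrict fun x hx => by
    refine ⟨by simpa using M.mem_ncChains.1 hx.1 0, ?_⟩
    have h : M.ncDiff x = 0 := hx.2
    simpa [ncDiff_zero] using congrFun h 0

/-- The map `π_* : HC⁻_m → HH_m` induced by `∑ i, x i * u ^ i ↦ x 0`. -/
def piStar (m : ℤ) : M.HC m →ₗ[k] M.HH m :=
  Submodule.mapQ _ _ (M.piCycles m) (by
    rintro ⟨x, hx⟩ hxb
    obtain ⟨y, hy, hyx⟩ := (Submodule.mem_comap.1 hxb : x ∈ M.ncBoundaries m)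
    refine Submodule.mem_comap.2 (Submodule.mem_comap.2 ?_)
    exact ⟨y 0, by simpa using M.mem_ncChains.1 hy 0, congrFun hyx 0⟩)

lemma single_mem_ncChains {m : ℤ} {z : E} (hz : z ∈ M.C m) :
    (Pi.single (M := fun _ : ℕ => E) 0 z) ∈ M.ncChains m := by
  refine M.mem_ncChains.2 fun i => ?_
  cases i with
  | zero => simpa using hz
  | succ j => simp

lemma ncDiff_single_B {m : ℤ} {z : E} (hz : z ∈ M.C m) :
    M.ncDiff (Pi.single (M := fun _ : ℕ => E) 0 (M.B z)) = Pi.single 0 (M.b (M.B z)) := by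
  funext i
  match i with
  | 0 => simp [ncDiff_zero]
  | 1 => simp [ncDiff_succ, M.B_B m z hz]
  | j + 2 => simp [ncDiff_succ]

/-- On cycles, the map `z ↦ B z`, seen in the constant term of a negative cyclic chain. -/
def betaCycles (m : ℤ) : M.cycles m →ₗ[k] M.ncCycles (m + 1) :=
  ((LinearMap.single k (fun _ : ℕ => E) 0) ∘ₗ M.B).restrict fun z hz => by
    refine ⟨M.single_mem_ncChains (M.B_mem m z hz.1), ?_⟩
    have hb : M.b z = 0 := hz.2
    have h := M.b_B m z hz.1
    rw [hb, map_zero, add_zero] at h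
    change M.ncDiff (Pi.single (M := fun _ : ℕ => E) 0 (M.B z)) = 0
    rw [M.ncDiff_single_B hz.1, h, Pi.single_zero]

/-- The connecting map `β : HH_m → HC⁻_{m+1}` of the short exact sequence
`0 → u CC⁻_{•+2} → CC⁻_• → C_• → 0`: lifting a cycle `z` to the constant series `z` gives
`(b + u B) z = u (B z)`, so `β [z] = [B z]`. -/
def beta (m : ℤ) : M.HH m →ₗ[k] M.HC (m + 1) :=
  Submodule.mapQ _ _ (M.betaCycles m) (by
    rintro ⟨z, hz⟩ hzb
    obtain ⟨y, hy, hyz⟩ := (Submodule.mem_comap.1 hzb : z ∈ M.boundaries m)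
    refine Submodule.mem_comap.2 (Submodule.mem_comap.2 ?_)
    refine ⟨Pi.single (M := fun _ : ℕ => E) 0 (M.B (-y)),
      M.single_mem_ncChains (M.B_mem _ _ (Submodule.neg_mem _ hy)), ?_⟩
    rw [M.ncDiff_single_B (Submodule.neg_mem _ hy)]
    have h := M.b_B _ y hy
    change _ = Pi.single (M := fun _ : ℕ => E) 0 (M.B z)
    congr 1
    have hyz' : M.b y = z := hyz
    rw [← hyz', map_neg, map_neg]
    exact neg_eq_of_add_eq_zero_right h)

/-- The total homology `HH_•`. -/
abbrev HHtot : Type _ := ⨁ m : ℤ, M.HH m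

/-- The total negative cyclic homology `HC⁻_•`. -/
abbrev HCtot : Type _ := ⨁ m : ℤ, M.HC m

/-- `π_*` on total homology. -/
def piTot : M.HCtot →ₗ[k] M.HHtot :=
  DirectSum.toModule k ℤ _ fun m => DirectSum.lof k ℤ M.HH m ∘ₗ M.piStar m

/-- `β` on total homology. -/
def betaTot : M.HHtot →ₗ[k] M.HCtot :=
  DirectSum.toModule k ℤ _ fun m => DirectSum.lof k ℤ M.HC (m + 1) ∘ₗ M.beta m

/-- The operator induced by `B` on homology, `π_* ∘ β`. -/
def Bstar : M.HHtot →ₗ[k] M.HHtot := M.piTot ∘ₗ M.betaTot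

/-- The class in `HH_•` of a cycle of degree `m`. -/
def hhClass (m : ℤ) (z : M.cycles m) : M.HHtot :=
  DirectSum.lof k ℤ M.HH m (Submodule.Quotient.mk z : M.cycles m ⧸ (M.boundaries m).submoduleOf (M.cycles m))

/-- `HH_•` regraded: the part of degree `t` is `HH_{n-t}`. -/
def hhDeg (n t : ℤ) : Submodule k M.HHtot := LinearMap.range (DirectSum.lof k ℤ M.HH (n - t))

/-- `HC⁻_•` regraded: the part of degree `t` is `HC⁻_{n-t}`. -/
def hcDeg (n t : ℤ) : Submodule k M.HCtot := LinearMap.range (DirectSum.lof k ℤ M.HC (n - t))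

end MixedComplex

/-! ## Batalin-Vilkovisky and gravity algebras -/

section Algebras

variable {k : Type*} [Field k] {V : Type*} [AddCommGroup V] [Module k V]

/-- A (unital) Batalin-Vilkovisky algebra on the graded vector space `V` with pieces `gr i`. -/
structure IsBVAlgebra (gr : ℤ → Submodule k V) (one : V) (mul : V →ₗ[k] V →ₗ[k] V)
    (Δ : V →ₗ[k] V) : Prop where
  one_mem : one ∈ gr 0
  one_mul : ∀ a, mul one a = a
  mul_mem : ∀ i j, ∀ a ∈ gr i, ∀ b ∈ gr j, mul a b ∈ gr (i + j)
  mul_comm : ∀ i j, ∀ a ∈ gr i, ∀ b ∈ gr j, mul a b = (i * j).negOnePow • mul b a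
  mul_assoc : ∀ a b c, mul (mul a b) c = mul a (mul b c)
  delta_mem : ∀ i, ∀ a ∈ gr i, Δ a ∈ gr (i - 1)
  delta_delta : ∀ a, Δ (Δ a) = 0
  second_order : ∀ i j l, ∀ a ∈ gr i, ∀ b ∈ gr j, ∀ c ∈ gr l,
    Δ (mul (mul a b) c) =
      mul (Δ (mul a b)) c + i.negOnePow • mul a (Δ (mul b c))
        + ((i - 1) * j).negOnePow • mul b (Δ (mul a c))
        - mul (mul (Δ a) b) c - i.negOnePow • mul (mul a (Δ b)) c
        - (i + j).negOnePow • mul (mul a b) (Δ c)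

/-- The sum of the degrees of a list of (degree, element) pairs. -/
def totalDeg (l : List (ℤ × V)) : ℤ := (l.map Prod.fst).sum

/-- `l` is a list of homogeneous elements, each paired with its degree. -/
def IsHomogeneousList (gr : ℤ → Submodule k V) (l : List (ℤ × V)) : Prop :=
  ∀ a ∈ l, a.2 ∈ gr a.1

/-- The bracket `{x₁, …, x_m}` of a list of homogeneous elements, paired with its degree
`|x₁| + ⋯ + |x_m| - 1`. -/
def bracketList (br : ∀ m : ℕ, MultilinearMap k (fun _ : Fin m => V) V) (l : List (ℤ × V)) :
    ℤ × V :=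
  (totalDeg l - 1, br l.length fun r => (l.get r).2)

/-- The sign exponent `ε_{ij}` of the gravity identities (positions `i < j` counted from `0`):
`(|x_i|+1)(|x_1|+⋯+|x_{i-1}|+i-1) + (|x_j|+1)(|x_1|+⋯+|x_{j-1}|+j-1) - (|x_i|+1)(|x_j|+1)`
when positions are counted from `1`. -/
def gravityEps (l : List (ℤ × V)) (i j : Fin l.length) : ℤ :=
  ((l.get i).1 + 1) * (totalDeg (l.take i) + (i : ℤ))
    + ((l.get j).1 + 1) * (totalDeg (l.take j) + (j : ℤ))
    - ((l.get i).1 + 1) * ((l.get j).1 + 1)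

/-- A gravity algebra structure on the graded vector space with pieces `gr t`: brackets
`{x₁, …, x_m}`, `m ≥ 2`, of degree `-1`, graded skew-symmetric for the shifted degree `|x| + 1`,
satisfying the generalized Jacobi identities. The sign in front of
`{{x_i, x_j}, x_1, …, x̂_i, …, x̂_j, …}` is `(-1) ^ ε_{ij}` times the sign `(-1) ^ (i + j - 1)`
(positions counted from `1`) of the permutation that moves `x_i, x_j` to the front;
the overall sign on the right is `(-1) ^ (number of x's)`. -/
structure IsGravityAlgebra (gr : ℤ → Submodule k V)
    (br : ∀ m : ℕ, MultilinearMap k (fun _ : Fin m => V) V) : Prop where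
  bracket_mem : ∀ l, 2 ≤ l.length → IsHomogeneousList gr l →
    (bracketList br l).2 ∈ gr (totalDeg l - 1)
  skew : ∀ l₁ l₂ a b, IsHomogeneousList gr (l₁ ++ a :: b :: l₂) →
    (bracketList br (l₁ ++ a :: b :: l₂)).2 =
      -(((a.1 + 1) * (b.1 + 1)).negOnePow • (bracketList br (l₁ ++ b :: a :: l₂)).2)
  jacobi : ∀ xs ys, IsHomogeneousList gr xs → IsHomogeneousList gr ys → 2 ≤ xs.length →
    (ys = [] → 3 ≤ xs.length) →
    (∑ i : Fin xs.length, ∑ j : Fin xs.length, if i < j then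
        (gravityEps xs i j + i + j + 1).negOnePow •
          (bracketList br
            (bracketList br [xs.get i, xs.get j] ::
              ((xs.eraseIdx j).eraseIdx i ++ ys))).2
      else 0) =
    if ys = [] then 0
    else (xs.length : ℤ).negOnePow • (bracketList br (bracketList br xs :: ys)).2

/-- `ε_m = (m-1)|x₁| + (m-2)|x₂| + ⋯ + |x_{m-1}|`. -/
def decalageEps (l : List (ℤ × V)) : ℤ :=
  ∑ i : Fin l.length, ((l.length : ℤ) - 1 - i) * (l.get i).1

/-- Given a product `mul` (with unit `one`) on `HH_•(M)`: the negative cyclic homology of `M`,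
with degree `t` part `HC⁻_{n-t}`, carries a gravity algebra structure whose brackets are
`{x₁, …, x_m} = (-1) ^ ε_m β (π_* x₁ • ⋯ • π_* x_m)`. -/
def HasInducedGravityStructure {E : Type*} [AddCommGroup E] [Module k E] (M : MixedComplex k E)
    (n : ℤ) (one : M.HHtot) (mul : M.HHtot →ₗ[k] M.HHtot →ₗ[k] M.HHtot) : Prop :=
  ∃ br : ∀ m : ℕ, MultilinearMap k (fun _ : Fin m => M.HCtot) M.HCtot,
    IsGravityAlgebra (M.hcDeg n) br ∧
    ∀ l, 2 ≤ l.length → IsHomogeneousList (M.hcDeg n) l →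
      (bracketList br l).2 = (decalageEps l).negOnePow •
        M.betaTot ((l.map fun a => M.piTot a.2).foldr (fun a b => mul a b) one)

end Algebras

/-! ## Differential forms and multiderivations -/

section Calculus

variable (k : Type u) [Field k] (A : Type v) [CommRing A] [Algebra k A]
  (Ω : Type w) [AddCommGroup Ω] [Module A Ω] [Module k Ω] [IsScalarTower k A Ω]

/-- A calculus of differential forms on `A`, with one-forms `Ω` and `Ω^•(A)` the exterior algebra
of `Ω` over `A`. It consists of the universal derivation `D`, the one-forms being spanned over `A`
by the `D f` and every derivation of `A` being of the form `f ↦ L (D f)`, and of the de Rham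
differential `d(a df₁ ∧ ⋯ ∧ df_p) = da ∧ df₁ ∧ ⋯ ∧ df_p` (such forms span, so `d` is determined).
Kähler differentials give such a calculus for every `A` (`kaehlerCalculus`); for a smooth manifold
`X` and `A = C^∞(X)`, so do the smooth differential forms. -/
structure FormCalculus where
  D : Derivation k A Ω
  span_D : Submodule.span A (Set.range D) = ⊤
  exists_lift : ∀ X : Derivation k A A, ∃ L : Ω →ₗ[A] A, ∀ a, L (D a) = X a
  d : ExteriorAlgebra A Ω →ₗ[k] ExteriorAlgebra A Ω
  d_apply : ∀ (a : A) (l : List A),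
    d (a • (l.map fun f => ExteriorAlgebra.ι A (D f)).prod) =
      ((a :: l).map fun f => ExteriorAlgebra.ι A (D f)).prod

end Calculus

namespace FormCalculus
variable {k : Type u} [Field k] {A : Type v} [CommRing A] [Algebra k A]
  {Ω : Type w} [AddCommGroup Ω] [Module A Ω] [Module k Ω] [IsScalarTower k A Ω]
  (F : FormCalculus k A Ω)

lemma linearMap_ext {M : Type*} [AddCommGroup M] [Module A M] {f g : Ω →ₗ[A] M}
    (h : ∀ a, f (F.D a) = g (F.D a)) : f = g :=
  LinearMap.ext_on_range F.span_D h

lemma multilinear_ext {M : Type*} [AddCommGroup M] [Module A M] {p : ℕ}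
    {f g : MultilinearMap A (fun _ : Fin p => Ω) M}
    (h : ∀ a : Fin p → A, f (fun r => F.D (a r)) = g (fun r => F.D (a r))) : f = g := by
  induction p with
  | zero =>
    ext x
    have := h Fin.elim0
    convert this using 2
  | succ p ih =>
    have : f.curryLeft = g.curryLeft := by
      apply F.linearMap_ext
      intro a
      apply ih
      intro b
      have := h (Fin.cons a b)
      simp only [MultilinearMap.curryLeft_apply]
      convert this using 2 <;>
      · funext r
        refine Fin.cases ?_ (fun i => ?_) r <;> simp
    rw [← MultilinearMap.uncurry_curryLeft f, this, MultilinearMap.uncurry_curryLeft]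

/-- `P` is a derivation of `A` in each argument. -/
def IsMultiderivation {p : ℕ} (P : (Fin p → A) → A) : Prop :=
  ∀ (f : Fin p → A) (i : Fin p) (a b : A),
    P (Function.update f i (a * b)) =
      a * P (Function.update f i b) + b * P (Function.update f i a)

theorem exists_multilinear {p : ℕ} (P : MultilinearMap k (fun _ : Fin p => A) A)
    (hP : IsMultiderivation P) :
    ∃ Q : MultilinearMap A (fun _ : Fin p => Ω) A, ∀ f, Q (fun r => F.D (f r)) = P f := by
  induction p with
  | zero =>
    refine ⟨MultilinearMap.constOfIsEmpty A _ (P Fin.elim0), fun f => ?_⟩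
    rw [MultilinearMap.constOfIsEmpty_apply, Function.const_apply]
    exact congrArg P (Subsingleton.elim _ _)
  | succ p ih =>
    have h1 : ∀ a, ∃ Q : MultilinearMap A (fun _ : Fin p => Ω) A,
        ∀ f, Q (fun r => F.D (f r)) = P (Fin.cons a f) := fun a =>
      ih (P.curryLeft a) (by
        intro f i x y
        have := hP (Fin.cons a f) i.succ x y
        simpa only [MultilinearMap.curryLeft_apply, ← Fin.cons_update] using this)
    choose Q hQ using h1
    have hadd : ∀ a b, Q (a + b) = Q a + Q b := fun a b => F.multilinear_ext fun f => by
      simp only [hQ, add_apply]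
      simpa using P.map_update_add (Fin.cons 0 f) 0 a b
    have hsmul : ∀ (c : k) a, Q (c • a) = c • Q a := fun c a => F.multilinear_ext fun f => by
      simp only [hQ, smul_apply]
      simpa using P.map_update_smul (Fin.cons 0 f) 0 c a
    have hmul : ∀ a b, Q (a * b) = a • Q b + b • Q a := fun a b =>
      F.multilinear_ext fun f => by
        simp only [hQ, add_apply, smul_apply, smul_eq_mul]
        simpa using hP (Fin.cons 0 f) 0 a b
    have h2 : ∀ w : Fin p → Ω, ∃ L : Ω →ₗ[A] A, ∀ a, L (F.D a) = Q a w := fun w =>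
      F.exists_lift (Derivation.mk'
        { toFun := fun a => Q a w
          map_add' := fun a b => by simp [hadd]
          map_smul' := fun c a => by simp [hsmul] } fun a b => by simp [hmul])
    choose G hG using h2
    let H : Ω →ₗ[A] MultilinearMap A (fun _ : Fin p => Ω) A :=
      { toFun := fun x =>
          { toFun := fun w => G w x
            map_update_add' := by
              intro _ w i a b
              have : G (Function.update w i (a + b)) =
                  G (Function.update w i a) + G (Function.update w i b) :=
                F.linearMap_ext fun c => by
                  simp only [hG, LinearMap.add_apply]
                  exact (Q c).map_update_add ..
              rw [this]; rfl
            map_update_smul' := by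
              intro _ w i c a
              have : G (Function.update w i (c • a)) = c • G (Function.update w i a) :=
                F.linearMap_ext fun e => by
                  simp only [hG, LinearMap.smul_apply]
                  exact (Q e).map_update_smul ..
              rw [this]; rfl }
        map_add' := fun x y => by ext w; simp
        map_smul' := fun c x => by ext w; simp }
    refine ⟨H.uncurryLeft, fun f => ?_⟩
    have : f = Fin.cons (f 0) (Fin.tail f) := (Fin.cons_self_tail f).symm
    simp only [LinearMap.uncurryLeft_apply]
    change G (Fin.tail fun r => F.D (f r)) (F.D (f 0)) = _
    rw [hG]
    have := hQ (f 0) (Fin.tail f)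
    rw [Fin.cons_self_tail] at this
    exact this

variable [CharZero k]

/-- Skew-symmetric multiderivations of `A` are the same as alternating `A`-multilinear forms on
the one-forms. -/
theorem existsUnique_polyvector {p : ℕ} (P : A [⋀^Fin p]→ₗ[k] A) (hP : IsMultiderivation P) :
    ∃! Q : Ω [⋀^Fin p]→ₗ[A] A, ∀ f, Q (fun r => F.D (f r)) = P f := by
  obtain ⟨Q, hQ⟩ := F.exists_multilinear P.toMultilinearMap hP
  have hswap : ∀ (i j : Fin p), i ≠ j → ∀ w : Fin p → Ω,
      Q (w ∘ Equiv.swap i j) = - Q w := by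
    intro i j hij w
    have : Q.domDomCongr (Equiv.swap i j) = -Q := F.multilinear_ext fun a => by
      rw [MultilinearMap.domDomCongr_apply, neg_apply, hQ]
      exact (P.map_swap a hij).trans (congrArg Neg.neg (hQ a).symm)
    exact congrArg (fun R : MultilinearMap A (fun _ : Fin p => Ω) A => R w) this
  refine ⟨{ Q with map_eq_zero_of_eq' := ?_ }, hQ, ?_⟩
  · intro w i j hw hij
    have h := hswap i j hij w
    have hww : w ∘ Equiv.swap i j = w := by
      funext r
      by_cases hi : r = i
      · subst hi; simp [hw]
      · by_cases hj : r = j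
        · subst hj; simp [hw]
        · simp [Equiv.swap_apply_of_ne_of_ne hi hj]
    rw [hww] at h
    have h2 : (2 : k) • Q w = 0 := by rw [two_smul]; nth_rewrite 1 [h]; simp
    exact (smul_eq_zero_iff_right (two_ne_zero)).1 h2
  · intro R hR
    apply AlternatingMap.coe_multilinearMap_injective
    exact F.multilinear_ext fun a => (hR a).trans (hQ a).symm

end FormCalculus

namespace Kaehler

open scoped KaehlerDifferential
open ExteriorAlgebra

variable (k : Type u) [Field k] (A : Type v) [CommRing A] [Algebra k A]

/-- Pairs `(x, y)` of Kähler forms, with `A` acting by `f (x, y) = (f x, f y + df ∧ x)`; the map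
`x ↦ (x, dx)` will be `A`-linear for this action. -/
structure Jet where
  fst : ExteriorAlgebra A (Ω[A⁄k])
  snd : ExteriorAlgebra A (Ω[A⁄k])

/-- Jets as pairs. -/
def Jet.equivProd : Jet k A ≃ ExteriorAlgebra A (Ω[A⁄k]) × ExteriorAlgebra A (Ω[A⁄k]) where
  toFun x := (x.fst, x.snd)
  invFun x := ⟨x.1, x.2⟩

instance : AddCommGroup (Jet k A) := Equiv.addCommGroup (Jet.equivProd k A)

instance : SMul A (Jet k A) where
  smul f x := ⟨f • x.1, f • x.2 + ι A (KaehlerDifferential.D k A f) * x.1⟩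

variable {k A}

@[ext] lemma Jet.ext {x y : Jet k A} (h1 : x.1 = y.1) (h2 : x.2 = y.2) : x = y := by
  cases x; cases y; simp_all
@[simp] lemma Jet.add_fst (x y : Jet k A) : (x + y).1 = x.1 + y.1 := rfl
@[simp] lemma Jet.add_snd (x y : Jet k A) : (x + y).2 = x.2 + y.2 := rfl
@[simp] lemma Jet.zero_fst : (0 : Jet k A).1 = 0 := rfl
@[simp] lemma Jet.zero_snd : (0 : Jet k A).2 = 0 := rfl
@[simp] lemma Jet.smul_fst (f : A) (x : Jet k A) : (f • x).1 = f • x.1 := rfl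
@[simp] lemma Jet.smul_snd (f : A) (x : Jet k A) :
    (f • x).2 = f • x.2 + ι A (KaehlerDifferential.D k A f) * x.1 := rfl

lemma ι_anticomm (a b : Ω[A⁄k]) : ι A a * ι A b = - (ι A b * ι A a) :=
  eq_neg_of_add_eq_zero_left (ExteriorAlgebra.ι_add_mul_swap a b)

instance : Module A (Jet k A) where
  one_smul x := by ext <;> simp
  mul_smul f g x := by
    ext
    · simp [mul_smul]
    · simp only [Jet.smul_snd, Jet.smul_fst, Derivation.leibniz, map_add, map_smul, smul_add,
        mul_smul, add_mul, smul_mul_assoc, mul_smul_comm]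
      abel
  smul_zero f := by ext <;> simp
  smul_add f x y := by
    ext
    · simp
    · simp only [Jet.smul_snd, Jet.add_fst, Jet.add_snd, smul_add, mul_add]; abel
  add_smul f g x := by
    ext
    · simp [add_smul]
    · simp only [Jet.smul_snd, Jet.add_snd, add_smul, map_add, add_mul]; abel
  zero_smul x := by ext <;> simp

instance : Module k (Jet k A) := Module.compHom (Jet k A) (algebraMap k A)

instance : IsScalarTower k A (Jet k A) := IsScalarTower.of_algebraMap_smul fun _ _ => rfl

@[simp] lemma Jet.ksmul_fst (c : k) (x : Jet k A) : (c • x).1 = c • x.1 :=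
  algebraMap_smul A c x.1

@[simp] lemma Jet.ksmul_snd (c : k) (x : Jet k A) : (c • x).2 = c • x.2 := by
  change algebraMap k A c • x.2 + ι A (KaehlerDifferential.D k A (algebraMap k A c)) * x.1 = _
  rw [Derivation.map_algebraMap, map_zero, zero_mul, add_zero, algebraMap_smul]

/-- `ω ↦ (ω, dω)` on one-forms, from the universal property. -/
def jetOne : Ω[A⁄k] →ₗ[A] Jet k A :=
  (Derivation.mk'
    { toFun := fun a => ⟨ι A (KaehlerDifferential.D k A a), 0⟩
      map_add' := fun a b => by ext <;> simp
      map_smul' := fun c a => by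
        ext
        · simp
        · simp }
    (fun a b => by
      ext
      · simp
      · simp only [LinearMap.coe_mk, AddHom.coe_mk, Jet.add_snd, Jet.smul_snd, smul_zero, zero_add]
        rw [ι_anticomm]; simp) : Derivation k A (Jet k A)).liftKaehlerDifferential

lemma jetOne_D (a : A) :
    jetOne (KaehlerDifferential.D k A a) = ⟨ι A (KaehlerDifferential.D k A a), 0⟩ := by
  simp [jetOne]

lemma span_D : Submodule.span A (Set.range (KaehlerDifferential.D k A)) = ⊤ :=
  KaehlerDifferential.span_range_derivation k A

lemma jetOne_fst (x : Ω[A⁄k]) : (jetOne x).1 = ι A x := by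
  have hx : x ∈ Submodule.span A (Set.range (KaehlerDifferential.D k A)) := by
    rw [span_D]; trivial
  induction hx using Submodule.span_induction with
  | mem x h => obtain ⟨a, rfl⟩ := h; rw [jetOne_D]
  | zero => simp
  | add x y _ _ hx hy => simp [hx, hy]
  | smul a x _ hx => simp [hx]

lemma jetOne_snd_comm (x y : Ω[A⁄k]) : (jetOne x).2 * ι A y = ι A y * (jetOne x).2 := by
  have hx : x ∈ Submodule.span A (Set.range (KaehlerDifferential.D k A)) := by
    rw [span_D]; trivial
  induction hx using Submodule.span_induction with
  | mem x h => obtain ⟨a, rfl⟩ := h; rw [jetOne_D]; simp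
  | zero => simp
  | add x y _ _ hx hy => simp [hx, hy, add_mul, mul_add]
  | smul a x _ hx =>
    simp only [map_smul, Jet.smul_snd, jetOne_fst, add_mul, mul_add, smul_mul_assoc,
      mul_smul_comm, hx]
    rw [mul_assoc, ι_anticomm x y, mul_neg, ← mul_assoc, ι_anticomm _ y, neg_mul, neg_neg,
      mul_assoc]

/-- Left multiplication by a one-form on jets: `ω (x, y) = (ω ∧ x, dω ∧ x - ω ∧ y)`. -/
def jetMul : Ω[A⁄k] →ₗ[A] Module.End A (Jet k A) where
  toFun w :=
    { toFun := fun x => ⟨ι A w * x.1, (jetOne w).2 * x.1 - ι A w * x.2⟩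
      map_add' := fun x y => by
        ext
        · simp [mul_add]
        · simp only [Jet.add_fst, Jet.add_snd, mul_add]; abel
      map_smul' := fun f x => by
        ext
        · simp
        · simp only [Jet.smul_fst, Jet.smul_snd, mul_add, mul_smul_comm, RingHom.id_apply,
            smul_sub]
          rw [← mul_assoc, ι_anticomm w, neg_mul, mul_assoc]; abel }
  map_add' v w := by
    ext x
    · simp [add_mul]
    · simp only [map_add, Jet.add_snd, LinearMap.coe_mk, AddHom.coe_mk, LinearMap.add_apply,
        add_mul]
      abel
  map_smul' f w := by
    ext x
    · simp
    · simp only [map_smul, Jet.smul_snd, jetOne_fst, LinearMap.coe_mk, AddHom.coe_mk,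
        LinearMap.smul_apply, RingHom.id_apply, add_mul, smul_mul_assoc, smul_sub, mul_assoc]
      abel

/-- The action of Kähler forms on jets. -/
def jetLift : ExteriorAlgebra A (Ω[A⁄k]) →ₐ[A] Module.End A (Jet k A) :=
  ExteriorAlgebra.lift A ⟨jetMul, fun w => by
    ext x
    · simp [jetMul, ← mul_assoc]
    · simp only [jetMul, LinearMap.coe_mk, AddHom.coe_mk, Module.End.mul_apply,
        LinearMap.zero_apply, Jet.zero_snd, mul_sub]
      rw [← mul_assoc, ← mul_assoc, ← mul_assoc, jetOne_snd_comm]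
      simp⟩

/-- The de Rham differential on Kähler forms. -/
def deRham : ExteriorAlgebra A (Ω[A⁄k]) →ₗ[k] ExteriorAlgebra A (Ω[A⁄k]) where
  toFun x := (jetLift x ⟨1, 0⟩).2
  map_add' x y := by simp
  map_smul' c x := by
    rw [← algebraMap_smul A c x, map_smul, LinearMap.smul_apply, algebraMap_smul]
    simp

lemma jetLift_prod (l : List A) :
    jetLift (l.map fun f => ι A (KaehlerDifferential.D k A f)).prod (⟨1, 0⟩ : Jet k A) =
      ⟨(l.map fun f => ι A (KaehlerDifferential.D k A f)).prod, 0⟩ := by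
  induction l with
  | nil => simp
  | cons a l ih =>
    rw [List.map_cons, List.prod_cons, map_mul, Module.End.mul_apply, ih]
    ext
    · simp [jetLift, jetMul]
    · simp [jetLift, jetMul, jetOne_D]

lemma deRham_apply (a : A) (l : List A) :
    deRham (a • (l.map fun f => ι A (KaehlerDifferential.D k A f)).prod) =
      ((a :: l).map fun f => ι A (KaehlerDifferential.D k A f)).prod := by
  change (jetLift _ (⟨1, 0⟩ : Jet k A)).2 = _
  rw [map_smul, LinearMap.smul_apply, jetLift_prod]
  simp
end Kaehler

open scoped KaehlerDifferential in
/-- The calculus of Kähler differential forms. -/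
def kaehlerCalculus (k : Type u) [Field k] (A : Type v) [CommRing A] [Algebra k A] :
    FormCalculus k A (Ω[A⁄k]) where
  D := KaehlerDifferential.D k A
  span_D := Kaehler.span_D
  exists_lift X := ⟨X.liftKaehlerDifferential, fun a => by simp⟩
  d := Kaehler.deRham
  d_apply := Kaehler.deRham_apply

/-! ## Poisson algebras: polyvectors, forms, the modular vector -/

/-- A Poisson bracket on the commutative `k`-algebra `A`. -/
structure PoissonBracket (k : Type u) [Field k] (A : Type v) [CommRing A] [Algebra k A] where
  br : A →ₗ[k] A →ₗ[k] A
  br_self : ∀ a, br a a = 0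
  jacobi : ∀ a b c, br a (br b c) = br (br a b) c + br b (br a c)
  leibniz : ∀ a b c, br a (b * c) = b * br a c + br a b * c

namespace FormCalculus

variable {k : Type u} [Field k] {A : Type v} [CommRing A] [Algebra k A]
  {Ω : Type w} [AddCommGroup Ω] [Module A Ω] [Module k Ω] [IsScalarTower k A Ω]

/-- The `p`-vectors `𝔛^p(A)`, as alternating `A`-multilinear forms on one-forms. By
`existsUnique_polyvector` these are the skew-symmetric maps `A^p → A` that are derivations in each
argument, through `P(f₁, …, f_p) = P(df₁, …, df_p)`. -/
def Polyvector (_F : FormCalculus k A Ω) (p : ℕ) : Type _ := Ω [⋀^Fin p]→ₗ[A] A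

instance (F : FormCalculus k A Ω) (p : ℕ) : AddCommGroup (F.Polyvector p) :=
  inferInstanceAs (AddCommGroup (Ω [⋀^Fin p]→ₗ[A] A))

instance (F : FormCalculus k A Ω) (p : ℕ) : Module k (F.Polyvector p) :=
  inferInstanceAs (Module k (Ω [⋀^Fin p]→ₗ[A] A))

/-- A polyvector as an alternating form on one-forms. -/
def Polyvector.alt {F : FormCalculus k A Ω} {p : ℕ} (P : F.Polyvector p) :
    Ω [⋀^Fin p]→ₗ[A] A := P

/-- All differential forms `Ω^•(A)`. -/
abbrev Forms (_F : FormCalculus k A Ω) : Type _ := ExteriorAlgebra A Ω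

variable (F : FormCalculus k A Ω)

/-- `df₁ ∧ ⋯ ∧ df_p` for a list `f₁, …, f_p`. -/
def dwedge (l : List A) : F.Forms := (l.map fun f => ExteriorAlgebra.ι A (F.D f)).prod

/-- The value `P(f₁, …, f_p)` of a `p`-vector at a list of length `p`. -/
def eval {p : ℕ} (P : F.Polyvector p) (l : List A) : A := P.alt fun r => F.D (l.getD r 0)

/-- The wedge product of polyvectors (a signed sum over shuffles). -/
def wedge {p q : ℕ} (P : F.Polyvector p) (Q : F.Polyvector q) : F.Polyvector (p + q) :=
  ((LinearMap.mul' A A).compAlternatingMap (P.alt.domCoprod Q.alt)).domDomCongr finSumFinEquiv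

/-- The contraction `ι_P` of forms with a `p`-vector `P`:
`ι_P(ω₁ ∧ ⋯ ∧ ω_i) = (-1)^(p(p-1)/2) ∑ sgn(s) P(ω_{s(1)}, …, ω_{s(p)}) ω_{s(p+1)} ∧ ⋯ ∧ ω_{s(i)}`,
the sum over the `(p, i-p)`-shuffles. The sign is the one for which
`ι_{P ∧ Q} = ι_P ∘ ι_Q`. -/
def contract {p : ℕ} (P : F.Polyvector p) : F.Forms →ₗ[A] F.Forms :=
  ((-1 : A) ^ (p * (p - 1) / 2)) • ExteriorAlgebra.liftAlternating fun i =>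
    if h : p ≤ i then
      ((TensorProduct.lid A (ExteriorAlgebra A Ω)).toLinearMap.compAlternatingMap
        (P.alt.domCoprod (ExteriorAlgebra.ιMulti A (M := Ω) (i - p)))).domDomCongr
          (finSumFinEquiv.trans (finCongr (Nat.add_sub_of_le h)))
    else 0

/-- The map `P ↦ ι_P η`, on `p`-vectors. -/
def contractForm (η : F.Forms) (p : ℕ) : F.Polyvector p →ₗ[k] F.Forms where
  toFun P := F.contract P η
  map_add' P Q := by
    have : F.contract (P + Q) = F.contract P + F.contract Q := by
      unfold contract
      rw [← smul_add, ← map_add]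
      congr 2
      funext i
      by_cases h : p ≤ i
      · simp only [h, dite_true, Pi.add_apply]
        have e : (P + Q).alt.domCoprod (ExteriorAlgebra.ιMulti A (M := Ω) (i - p)) =
            P.alt.domCoprod (ExteriorAlgebra.ιMulti A (M := Ω) (i - p)) +
              Q.alt.domCoprod (ExteriorAlgebra.ιMulti A (M := Ω) (i - p)) := by
          rw [← AlternatingMap.domCoprod'_apply, ← AlternatingMap.domCoprod'_apply,
            ← AlternatingMap.domCoprod'_apply, ← map_add, ← TensorProduct.add_tmul]
          rfl
        rw [e]
        ext x
        simp
      · simp [h]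
    rw [this, LinearMap.add_apply]
  map_smul' c P := by
    have : F.contract (c • P) = algebraMap k A c • F.contract P := by
      unfold contract
      rw [smul_comm (algebraMap k A c)]
      congr 1
      rw [← map_smul]
      congr 1
      funext i
      by_cases h : p ≤ i
      · simp only [h, dite_true, Pi.smul_apply]
        have e : (c • P).alt.domCoprod (ExteriorAlgebra.ιMulti A (M := Ω) (i - p)) =
            algebraMap k A c •
              P.alt.domCoprod (ExteriorAlgebra.ιMulti A (M := Ω) (i - p)) := by
          have e' : (c • P).alt = algebraMap k A c • P.alt :=
            AlternatingMap.ext fun x => (algebraMap_smul A c (P.alt x)).symm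
          rw [e', ← AlternatingMap.domCoprod'_apply, ← AlternatingMap.domCoprod'_apply,
            ← map_smul, TensorProduct.smul_tmul']
        rw [e]
        ext x
        simp
      · simp [h]
    rw [this, LinearMap.smul_apply, algebraMap_smul, RingHom.id_apply]

/-- The map `ι_(-) η : 𝔛^•(A) → Ω^•(A)`. -/
def contractTotal (η : F.Forms) : (⨁ p : ℕ, F.Polyvector p) →ₗ[k] F.Forms :=
  DirectSum.toModule k ℕ _ (F.contractForm η)

/-- A volume form of degree `n`: an `n`-form `η` such that
`ι_(-) η : 𝔛^•(A) → Ω^{n-•}(A)` is an isomorphism. -/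
structure VolumeForm (n : ℕ) where
  form : F.Forms
  form_mem : form ∈ ⋀[A]^n Ω
  bijective : Function.Bijective (F.contractTotal form)

variable {F} {n : ℕ} (η : F.VolumeForm n)

/-- The isomorphism `ι_(-) η` of a volume form. -/
def VolumeForm.equiv : (⨁ p : ℕ, F.Polyvector p) ≃ₗ[k] F.Forms :=
  LinearEquiv.ofBijective _ η.bijective

/-- The divergence operator `Div = (ι_(-) η)⁻¹ ∘ d ∘ ι_(-) η` on polyvectors. -/
def VolumeForm.div : (⨁ p : ℕ, F.Polyvector p) →ₗ[k] (⨁ p : ℕ, F.Polyvector p) :=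
  η.equiv.symm.toLinearMap ∘ₗ F.d ∘ₗ η.equiv.toLinearMap

variable (F) in
lemma exists_bivector [CharZero k] (P : PoissonBracket k A) :
    ∃ π : F.Polyvector 2, ∀ a b, π.alt ![F.D a, F.D b] = P.br a b := by
  have hskew : ∀ a b, P.br a b = - P.br b a := fun a b => by
    have h := P.br_self (a + b)
    simp only [map_add, LinearMap.add_apply, P.br_self] at h
    exact eq_neg_of_add_eq_zero_right (by simpa using h)
  let Q : A [⋀^Fin 2]→ₗ[k] A :=
    { toFun := fun f => P.br (f 0) (f 1)
      map_update_add' := by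
        intro _ f i a b
        fin_cases i <;> simp
      map_update_smul' := by
        intro _ f i c a
        fin_cases i <;> simp
      map_eq_zero_of_eq' := by
        intro f i j hf hij
        have h01 : f 0 = f 1 := by
          fin_cases i <;> fin_cases j <;> first | exact absurd rfl hij | exact hf | exact hf.symm
        simp [h01, P.br_self] }
  obtain ⟨π, hπ, -⟩ := F.existsUnique_polyvector Q (by
    intro f i a b
    fin_cases i
    · simp only [Q, AlternatingMap.coe_mk, MultilinearMap.coe_mk]
      simp [hskew _ (f 1), P.leibniz]; ring
    · simp only [Q, AlternatingMap.coe_mk, MultilinearMap.coe_mk]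
      simp [P.leibniz]; ring)
  refine ⟨π, fun a b => ?_⟩
  have h := hπ ![a, b]
  refine Eq.trans ?_ h
  congr 1
  funext r
  fin_cases r <;> rfl

variable (F) in
/-- The Poisson bivector `π`, with `π(df, dg) = {f, g}`. -/
def bivector [CharZero k] (P : PoissonBracket k A) : F.Polyvector 2 :=
  (F.exists_bivector P).choose

/-- The modular vector `ν = -Div(π)`, an element of `𝔛^1(A)`. -/
def VolumeForm.modularVector [CharZero k] (P : PoissonBracket k A) : F.Polyvector 1 :=
  -(η.div (DirectSum.lof k ℕ F.Polyvector 2 (F.bivector P)) 1)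

/-- The modular vector as a derivation `ν : A → A`. -/
def VolumeForm.modularDerivation [CharZero k] (P : PoissonBracket k A) : A →ₗ[k] A :=
  (((AlternatingMap.ofSubsingleton A Ω A (0 : Fin 1)).symm
    (η.modularVector P).alt).restrictScalars k) ∘ₗ F.D.toLinearMap

end FormCalculus

/-- A linear endomorphism is semisimple (diagonalizable) if its eigenspaces span. -/
def IsDiagonalizable {k V : Type*} [Field k] [AddCommGroup V] [Module k V] (ν : V →ₗ[k] V) :
    Prop :=
  ⨆ c : k, Module.End.eigenspace ν c = ⊤

/-- `f₀, …, f_p` are eigenvectors of `ν` with eigenvalues `c₀, …, c_p`. -/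
def HasWeights {k V : Type*} [Field k] [AddCommGroup V] [Module k V] (ν : V →ₗ[k] V)
    (fs : List V) (cs : List k) : Prop :=
  List.Forall₂ (fun f c => ν f = c • f) fs cs

namespace FormCalculus

variable {k : Type u} [Field k] {A : Type v} [CommRing A] [Algebra k A]
  {Ω : Type w} [AddCommGroup Ω] [Module A Ω] [Module k Ω] [IsScalarTower k A Ω]
  (F : FormCalculus k A Ω)

/-! ### The Poisson chain complex with coefficients in `A_ν` -/

/-- The bracket `{m, a}_ν = {m, a} + m ν(a)` of the Poisson module `A_ν`. -/
def twistedBr (P : PoissonBracket k A) (ν : A →ₗ[k] A) (m a : A) : A := P.br m a + m * ν a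

/-- `∂` is the boundary `∂_ν` of the Poisson chain complex `CP_•(A, A_ν)`:
`∂_ν(m ⊗ df₁ ∧ ⋯ ∧ df_p) = ∑_i (-1)^(i-1) {m, f_i}_ν ⊗ df₁ ∧ ⋯ d̂f_i ⋯ ∧ df_p
  + ∑_{i<j} (-1)^(j-i) m ⊗ d{f_i, f_j} ∧ df₁ ∧ ⋯ d̂f_i ⋯ d̂f_j ⋯ ∧ df_p`.
These forms span, so this determines `∂`. -/
def IsPoissonBoundary (P : PoissonBracket k A) (ν : A →ₗ[k] A) (bd : F.Forms →ₗ[k] F.Forms) :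
    Prop :=
  ∀ (m : A) (l : List A), bd (m • F.dwedge l) =
    (∑ i : Fin l.length,
      ((-1 : A) ^ (i : ℕ) * twistedBr P ν m (l.get i)) • F.dwedge (l.eraseIdx i)) +
    ∑ i : Fin l.length, ∑ j : Fin l.length, if i < j then
      ((-1 : A) ^ (j - i : ℕ) * m) •
        F.dwedge (P.br (l.get i) (l.get j) :: (l.eraseIdx j).eraseIdx i)
    else 0

/-- The weight-zero forms `CP^0_m(A, A_ν)` of degree `m`: the span of the forms
`f₀ df₁ ∧ ⋯ ∧ df_m` with `ν(f_i) = λ_i f_i` and `∑ λ_i = 0`. -/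
def weightZero (ν : A →ₗ[k] A) (m : ℤ) : Submodule k F.Forms :=
  Submodule.span k {x | ∃ (f : A) (l : List A) (cs : List k),
    (l.length : ℤ) = m ∧ HasWeights ν (f :: l) cs ∧ cs.sum = 0 ∧ x = f • F.dwedge l}

/-! ### Poisson cohomology -/

/-- The value of `δ^π(P)` at `f₀, …, f_p`. -/
def deltaAt (P : PoissonBracket k A) {p : ℕ} (X : F.Polyvector p) (l : List A) : A :=
  (∑ i : Fin l.length, (-1 : A) ^ (i : ℕ) * P.br (l.get i) (F.eval X (l.eraseIdx i))) +
  ∑ i : Fin l.length, ∑ j : Fin l.length, if i < j then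
    (-1 : A) ^ (i + j : ℕ) * F.eval X (P.br (l.get i) (l.get j) :: (l.eraseIdx j).eraseIdx i)
  else 0

/-- The Poisson coboundary `δ^π` on `p`-vectors, with values in functions of `p + 1` arguments. -/
def delta (P : PoissonBracket k A) (p : ℕ) :
    F.Polyvector p →ₗ[k] ((Fin (p + 1) → A) → A) where
  toFun X f := F.deltaAt P X (List.ofFn f)
  map_add' X Y := by
    funext f
    have e : ∀ l, F.eval (X + Y) l = F.eval X l + F.eval Y l := fun l => rfl
    simp only [deltaAt, e, map_add, mul_add, Finset.sum_add_distrib, Pi.add_apply]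
    rw [add_add_add_comm]
    congr 1
    simp only [← Finset.sum_add_distrib]
    refine Finset.sum_congr rfl fun i _ => Finset.sum_congr rfl fun j _ => ?_
    split_ifs <;> simp
  map_smul' c X := by
    funext f
    have e : ∀ l, F.eval (c • X) l = c • F.eval X l := fun l => rfl
    simp only [deltaAt, e, map_smul, mul_smul_comm, Pi.smul_apply, RingHom.id_apply, smul_add,
      Finset.smul_sum, smul_ite, smul_zero]

/-- A `p`-vector as a function of `p` arguments in `A`. -/
def toFunction (p : ℕ) : F.Polyvector p →ₗ[k] ((Fin p → A) → A) where
  toFun X f := X.alt fun r => F.D (f r)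
  map_add' _ _ := rfl
  map_smul' _ _ := rfl

/-- Poisson `p`-cocycles. -/
def cocycles (P : PoissonBracket k A) (p : ℕ) : Submodule k (F.Polyvector p) :=
  LinearMap.ker (F.delta P p)

/-- Poisson `p`-coboundaries. -/
def coboundaries (P : PoissonBracket k A) : (p : ℕ) → Submodule k (F.Polyvector p)
  | 0 => ⊥
  | p + 1 => (LinearMap.range (F.delta P p)).comap (F.toFunction (p + 1))

/-- The Poisson cohomology `HP^p(A)`. -/
def HP (P : PoissonBracket k A) (p : ℕ) : Type _ :=
  F.cocycles P p ⧸ (F.coboundaries P p).submoduleOf (F.cocycles P p)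

instance (P : PoissonBracket k A) (p : ℕ) : AddCommGroup (F.HP P p) :=
  inferInstanceAs (AddCommGroup (F.cocycles P p ⧸ _))

instance (P : PoissonBracket k A) (p : ℕ) : Module k (F.HP P p) :=
  inferInstanceAs (Module k (F.cocycles P p ⧸ _))

/-- The class in `HP^•(A)` of a Poisson `p`-cocycle. -/
def hpClass (P : PoissonBracket k A) (p : ℕ) (X : F.cocycles P p) : ⨁ p : ℕ, F.HP P p :=
  DirectSum.lof k ℕ (F.HP P) p (Submodule.Quotient.mk X :
    F.cocycles P p ⧸ (F.coboundaries P p).submoduleOf (F.cocycles P p))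

end FormCalculus

/-! ## Exterior algebras with a Poisson structure -/

section Exterior

open Module

variable (k : Type u) [Field k] (n : ℕ)

/-- The exterior algebra `Λ(ξ₁, …, ξ_n)`. -/
abbrev Lam : Type u := ExteriorAlgebra k (Fin n → k)

/-- The part of `Λ(ξ₁, …, ξ_n)` spanned by the monomials in `d` of the generators. -/
abbrev lamDeg (d : ℕ) : Submodule k (Lam k n) := ⋀[k]^d (Fin n → k)

/-- The basis of monomials `ξ_{i₁} ⋯ ξ_{i_d}`, `i₁ < ⋯ < i_d`. -/
def monoBasis : Basis (Finset (Fin n)) k (Lam k n) := (Pi.basisFun k (Fin n)).ExteriorAlgebra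

lemma monoBasis_mem (s : Finset (Fin n)) : monoBasis k n s ∈ lamDeg k n s.card := by
  have h := ExteriorAlgebra.basis_eq_coe_basis (Pi.basisFun k (Fin n))
    (⟨s, rfl⟩ : Set.powersetCard (Fin n) s.card)
  have h' : monoBasis k n s = _ := h
  rw [h']
  exact Subtype.property _

/-- The coefficient of `ξ₁ ⋯ ξ_n`. -/
def vol : Lam k n →ₗ[k] k := (monoBasis k n).coord Finset.univ

/-- The map `η^! : Λ → Λ^*`, `η^!(a)(b) = ` the coefficient of `ξ₁ ⋯ ξ_n` in `a b`. -/
def frob : Lam k n →ₗ[k] Dual k (Lam k n) := (LinearMap.mul k (Lam k n)).compr₂ (vol k n)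

lemma vol_mono_mul_compl (s : Finset (Fin n)) :
    vol k n (monoBasis k n s * monoBasis k n sᶜ) ≠ 0 := by
  let S : Set.powersetCard (Fin n) s.card := ⟨s, rfl⟩
  let T : Set.powersetCard (Fin n) sᶜ.card := ⟨sᶜ, rfl⟩
  have hd : Disjoint S.val T.val := disjoint_compl_right
  have h : monoBasis k n s * monoBasis k n sᶜ =
      (Set.powersetCard.permOfDisjoint hd).sign •
        monoBasis k n (Set.powersetCard.disjUnion hd : Finset (Fin n)) :=
    ExteriorAlgebra.basis_mul_of_disjoint (Pi.basisFun k (Fin n)) S T hd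
  have hu : (Set.powersetCard.disjUnion hd : Finset (Fin n)) = Finset.univ := by
    ext x
    rw [Set.powersetCard.coe_disjUnion, Finset.mem_disjUnion]
    simp [S, T, em]
  rw [h, hu, vol, Units.smul_def, map_zsmul, Basis.coord_apply, Basis.repr_self,
    Finsupp.single_eq_same]
  rcases Int.units_eq_one_or (Set.powersetCard.permOfDisjoint hd).sign with h1 | h1 <;> simp [h1]

lemma vol_mono_mul_of_ne {s t : Finset (Fin n)} (h : t ≠ s) :
    vol k n (monoBasis k n t * monoBasis k n sᶜ) = 0 := by
  let S : Set.powersetCard (Fin n) t.card := ⟨t, rfl⟩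
  let T : Set.powersetCard (Fin n) sᶜ.card := ⟨sᶜ, rfl⟩
  by_cases hd : Disjoint S.val T.val
  · have h2 : monoBasis k n t * monoBasis k n sᶜ =
        (Set.powersetCard.permOfDisjoint hd).sign •
          monoBasis k n (Set.powersetCard.disjUnion hd : Finset (Fin n)) :=
      ExteriorAlgebra.basis_mul_of_disjoint (Pi.basisFun k (Fin n)) S T hd
    have hu : (Set.powersetCard.disjUnion hd : Finset (Fin n)) ≠ Finset.univ := by
      intro hu
      refine h (Finset.ext fun x => ⟨fun hx => ?_, fun hx => ?_⟩)
      · by_contra hxs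
        exact Finset.disjoint_left.1 hd hx (Finset.mem_compl.2 hxs)
      · have hx' : x ∈ (Set.powersetCard.disjUnion hd : Finset (Fin n)) := by rw [hu]; simp
        rw [Set.powersetCard.coe_disjUnion, Finset.mem_disjUnion] at hx'
        rcases hx' with hx' | hx'
        · exact hx'
        · exact absurd hx (Finset.mem_compl.1 hx')
    rw [h2, vol, Units.smul_def, map_zsmul, Basis.coord_apply, Basis.repr_self,
      Finsupp.single_eq_of_ne hu.symm, smul_zero]
  · have h2 : monoBasis k n t * monoBasis k n sᶜ = 0 :=
      ExteriorAlgebra.basis_mul_of_not_disjoint (Pi.basisFun k (Fin n)) S T hd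
    rw [h2, map_zero]

lemma frob_injective : Function.Injective (frob k n) := by
  rw [← LinearMap.ker_eq_bot, LinearMap.ker_eq_bot']
  intro a ha
  refine (monoBasis k n).ext_elem fun s => ?_
  have h : frob k n a (monoBasis k n sᶜ) = 0 := by rw [ha]; rfl
  rw [← (monoBasis k n).sum_repr a] at h
  simp only [map_sum, map_smul, LinearMap.sum_apply, LinearMap.smul_apply, smul_eq_mul] at h
  rw [Finset.sum_eq_single s] at h
  · have := vol_mono_mul_compl k n s
    simpa using (mul_eq_zero.1 h).resolve_right this
  · intro t _ hts
    exact mul_eq_zero_of_right _ (vol_mono_mul_of_ne k n hts)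
  · simp

/-- `η^!` is an isomorphism: `Λ(ξ₁, …, ξ_n)` is a Frobenius algebra. -/
def frobEquiv : Lam k n ≃ₗ[k] Dual k (Lam k n) :=
  haveI : Module.Finite k (Lam k n) := Module.Finite.of_basis (monoBasis k n)
  LinearEquiv.ofInjectiveOfFinrankEq (frob k n) (frob_injective k n)
    Subspace.dual_finrank_eq.symm

/-- A (graded) Poisson structure on `Λ(ξ₁, …, ξ_n)`: a bracket of degree `0`, graded
skew-symmetric, satisfying the graded Leibniz rule and the graded Jacobi identity. -/
structure ExteriorPoisson where
  br : Lam k n →ₗ[k] Lam k n →ₗ[k] Lam k n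
  br_mem : ∀ i j, ∀ a ∈ lamDeg k n i, ∀ b ∈ lamDeg k n j, br a b ∈ lamDeg k n (i + j)
  skew : ∀ i j, ∀ a ∈ lamDeg k n i, ∀ b ∈ lamDeg k n j, br a b = -((-1 : k) ^ (i * j) • br b a)
  leibniz : ∀ i j, ∀ a ∈ lamDeg k n i, ∀ b ∈ lamDeg k n j, ∀ c,
    br a (b * c) = br a b * c + (-1 : k) ^ (i * j) • (b * br a c)
  jacobi : ∀ i j, ∀ a ∈ lamDeg k n i, ∀ b ∈ lamDeg k n j, ∀ c,
    br a (br b c) = br (br a b) c + (-1 : k) ^ (i * j) • br b (br a c)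

/-- A homogeneous element of `Λ(ξ₁, …, ξ_n)` together with its degree. -/
abbrev Homog : Type u := Σ d : ℕ, lamDeg k n d

variable {k n}

/-- The underlying element. -/
def Homog.val (a : Homog k n) : Lam k n := a.2

/-- The product of homogeneous elements. -/
def Homog.mul (a b : Homog k n) : Homog k n :=
  ⟨a.1 + b.1, a.2 * b.2, SetLike.mul_mem_graded a.2.2 b.2.2⟩

/-- The basis monomials as homogeneous elements. -/
def Homog.mono (s : Finset (Fin n)) : Homog k n := ⟨s.card, monoBasis k n s, monoBasis_mem k n s⟩

/-- The total degree of a list of homogeneous elements. -/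
def degSum (l : List (Homog k n)) : ℕ := (l.map Sigma.fst).sum

/-- The bracket of homogeneous elements. -/
def ExteriorPoisson.hbr (P : ExteriorPoisson k n) (a b : Homog k n) : Homog k n :=
  ⟨a.1 + b.1, P.br a.2 b.2, P.br_mem _ _ _ a.2.2 _ b.2.2⟩

variable (k n) in
/-- Coefficients for Poisson cochains: a graded vector space with a right action of
`Λ(ξ₁, …, ξ_n)` and a right bracket, `br a m = {m, a}`. -/
structure Coefficients (M : Type*) [AddCommGroup M] [Module k M] where
  gr : ℤ → Submodule k M
  act : M →ₗ[k] Lam k n →ₗ[k] M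
  br : Lam k n →ₗ[k] M →ₗ[k] M

namespace Coefficients

variable {M : Type*} [AddCommGroup M] [Module k M] (S : Coefficients k n M)

/-- The graded skew-symmetric multiderivations of `Λ(ξ₁, …, ξ_n)` with values in `M`, of all
arities at once (the value on the lists of length `p` is the component of arity `p`). -/
def multiderivations : Submodule k (List (Homog k n) → M) where
  carrier := {Q |
    (∀ l₁ l₂ (d : ℕ) (x y : lamDeg k n d),
      Q (l₁ ++ ⟨d, x + y⟩ :: l₂) = Q (l₁ ++ ⟨d, x⟩ :: l₂) + Q (l₁ ++ ⟨d, y⟩ :: l₂)) ∧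
    (∀ l₁ l₂ (d : ℕ) (c : k) (x : lamDeg k n d),
      Q (l₁ ++ ⟨d, c • x⟩ :: l₂) = c • Q (l₁ ++ ⟨d, x⟩ :: l₂)) ∧
    (∀ l₁ l₂ a b,
      Q (l₁ ++ a :: b :: l₂) = -((-1 : k) ^ (a.1 * b.1) • Q (l₁ ++ b :: a :: l₂))) ∧
    ∀ l a b, Q (l ++ [a.mul b]) =
      S.act (Q (l ++ [a])) b.val + (-1 : k) ^ (a.1 * b.1) • S.act (Q (l ++ [b])) a.val}
  zero_mem' := by simp
  add_mem' := by
    rintro P Q ⟨h1, h2, h3, h4⟩ ⟨g1, g2, g3, g4⟩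
    refine ⟨fun l₁ l₂ d x y => ?_, fun l₁ l₂ d c x => ?_, fun l₁ l₂ a b => ?_, fun l a b => ?_⟩
    · simp only [Pi.add_apply, h1, g1]; abel
    · simp only [Pi.add_apply, h2, g2, smul_add]
    · simp only [Pi.add_apply]; rw [h3, g3, smul_add]; abel
    · simp only [Pi.add_apply, h4, g4, map_add, LinearMap.add_apply, smul_add]; abel
  smul_mem' := by
    rintro e Q ⟨g1, g2, g3, g4⟩
    refine ⟨fun l₁ l₂ d x y => ?_, fun l₁ l₂ d c x => ?_, fun l₁ l₂ a b => ?_, fun l a b => ?_⟩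
    · simp only [Pi.smul_apply, g1, smul_add]
    · simp only [Pi.smul_apply, g2, smul_comm c]
    · simp only [Pi.smul_apply]; rw [g3, smul_neg, smul_comm e]
    · simp only [Pi.smul_apply, g4, map_smul, LinearMap.smul_apply, smul_add, smul_comm e]

/-- The cochains of (homological) degree `m`: the finite sums of multiderivations whose value at
`f₁, …, f_p` has degree `m + p - (|f₁| + ⋯ + |f_p|)`, where `|f|` counts the generators `ξ_i`. -/
def cochains (m : ℤ) : Submodule k (List (Homog k n) → M) where
  carrier := {Q | Q ∈ S.multiderivations ∧ (∃ N : ℕ, ∀ l, N < l.length → Q l = 0) ∧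
    ∀ l, Q l ∈ S.gr (m + l.length - degSum l)}
  zero_mem' := ⟨Submodule.zero_mem _, ⟨0, fun _ _ => rfl⟩, fun _ => Submodule.zero_mem _⟩
  add_mem' := by
    rintro P Q ⟨h1, ⟨N, hN⟩, h3⟩ ⟨g1, ⟨N', hN'⟩, g3⟩
    refine ⟨Submodule.add_mem _ h1 g1, ⟨max N N', fun l hl => ?_⟩,
      fun l => Submodule.add_mem _ (h3 l) (g3 l)⟩
    rw [Pi.add_apply, hN l (lt_of_le_of_lt (le_max_left _ _) hl),
      hN' l (lt_of_le_of_lt (le_max_right _ _) hl), add_zero]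
  smul_mem' := by
    rintro e Q ⟨g1, ⟨N', hN'⟩, g3⟩
    refine ⟨Submodule.smul_mem _ e g1, ⟨N', fun l hl => ?_⟩, fun l => Submodule.smul_mem _ e (g3 l)⟩
    rw [Pi.smul_apply, hN' l hl, smul_zero]

/-- The Poisson coboundary `δ` on `M`-valued cochains. In the two sums `f_i` is moved to the end,
resp. `f_i, f_j` are moved to the front, of the list of arguments, which produces the
Koszul signs. -/
def delta (P : ExteriorPoisson k n) : (List (Homog k n) → M) →ₗ[k] (List (Homog k n) → M) :=
  LinearMap.pi fun l =>
    (∑ i : Fin l.length, (-1 : k) ^ ((i : ℕ) + 1 + (l.get i).1 * degSum (l.drop (i + 1))) •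
      (S.br (l.get i).val ∘ₗ LinearMap.proj (l.eraseIdx i))) +
    ∑ i : Fin l.length, ∑ j : Fin l.length, if i < j then
      (-1 : k) ^ ((i : ℕ) + j + (l.get i).1 * degSum (l.take i) +
          (l.get j).1 * degSum ((l.take j).eraseIdx i)) •
        LinearMap.proj (P.hbr (l.get i) (l.get j) :: (l.eraseIdx j).eraseIdx i)
    else 0

end Coefficients

namespace ExteriorPoisson

variable (P : ExteriorPoisson k n)

/-- The coefficients `Λ` with the action by multiplication and the Poisson bracket; the monomials
in `d` generators have homological degree `-d`. -/
def coeffSelf : Coefficients k n (Lam k n) where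
  gr e := ⨆ (d : ℕ) (_ : (d : ℤ) = -e), lamDeg k n d
  act := LinearMap.mul k (Lam k n)
  br := P.br.flip

/-- Postcomposition with `η^!`, `φ ↦ ι_φ η^!`. -/
def iotaEta : (List (Homog k n) → Lam k n) ≃ₗ[k] (List (Homog k n) → Dual k (Lam k n)) :=
  LinearEquiv.piCongrRight fun _ => frobEquiv k n

/-- The dual de Rham differential:
`(d^* Q)(f₁, …, f_p)(f₀) = (-1)^(p+1) Q(f₁, …, f_p, f₀)(1)`. -/
def dStar : (List (Homog k n) → Dual k (Lam k n)) →ₗ[k] (List (Homog k n) → Dual k (Lam k n)) where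
  toFun Q l := (monoBasis k n).constr k fun s =>
    (-1 : k) ^ (l.length + 1) * Q (l ++ [Homog.mono s]) 1
  map_add' Q R := by
    funext l
    refine (monoBasis k n).ext fun s => ?_
    simp only [Pi.add_apply, LinearMap.add_apply, Basis.constr_basis, mul_add]
  map_smul' c Q := by
    funext l
    refine (monoBasis k n).ext fun s => ?_
    simp only [Pi.smul_apply, LinearMap.smul_apply, Basis.constr_basis, smul_eq_mul,
      RingHom.id_apply, mul_left_comm]

/-- The divergence operator `Div = (ι_(-) η^!)⁻¹ ∘ d^* ∘ ι_(-) η^!`. -/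
def div : (List (Homog k n) → Lam k n) →ₗ[k] (List (Homog k n) → Lam k n) :=
  iotaEta.symm.toLinearMap ∘ₗ dStar ∘ₗ iotaEta.toLinearMap

/-- The Poisson bivector `π^!(f, g) = {f, g}`. -/
def bivector : List (Homog k n) → Lam k n
  | [f, g] => P.br f.val g.val
  | _ => 0

/-- The modular vector `ν^! = -Div(π^!)`, as a linear endomorphism of `Λ`. -/
def modularDerivation : Lam k n →ₗ[k] Lam k n :=
  -((monoBasis k n).constr k fun s => div P.bivector [Homog.mono s])

/-- The twisted dual coefficients `Λ^*_ν`: the action is `(m h)(c) = m(h c)` and the bracket is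
`{m, a}_ν(c) = m({a, c}) + m(ν(a) c)`. -/
def coeffDual : Coefficients k n (Dual k (Lam k n)) where
  gr e := ⨅ (d : ℕ) (_ : (d : ℤ) ≠ e), (lamDeg k n d).dualAnnihilator
  act := LinearMap.mk₂ k (fun m h => m ∘ₗ LinearMap.mul k (Lam k n) h)
    (fun _ _ _ => by ext; simp) (fun _ _ _ => by ext; simp)
    (fun _ _ _ => by ext; simp) (fun _ _ _ => by ext; simp)
  br := LinearMap.mk₂ k
    (fun a m => m ∘ₗ P.br a + m ∘ₗ LinearMap.mul k (Lam k n) (P.modularDerivation a))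
    (fun _ _ _ => by ext; simp; abel) (fun _ _ _ => by ext; simp)
    (fun _ _ _ => by ext; simp; abel) (fun _ _ _ => by ext; simp)

/-- The weight-zero cochains `CP_0(Λ, Λ^*_ν)` of degree `m`: those `Q` with
`Q(f₁, …, f_p)(f₀) = 0` whenever the `f_i` are eigenvectors of `ν` whose eigenvalues have
non-zero sum. -/
def weightZero (m : ℤ) : Submodule k (List (Homog k n) → Dual k (Lam k n)) where
  carrier := {Q | Q ∈ P.coeffDual.cochains m ∧ ∀ (f : Lam k n) (l : List (Homog k n)) (cs : List k),
    HasWeights P.modularDerivation (f :: l.map Homog.val) cs → cs.sum ≠ 0 → Q l f = 0}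
  zero_mem' := ⟨Submodule.zero_mem _, fun _ _ _ _ _ => rfl⟩
  add_mem' := by
    rintro P Q ⟨h1, h2⟩ ⟨g1, g2⟩
    refine ⟨Submodule.add_mem _ h1 g1, fun f l cs h hs => ?_⟩
    simp [h2 f l cs h hs, g2 f l cs h hs]
  smul_mem' := by
    rintro e Q ⟨g1, g2⟩
    refine ⟨Submodule.smul_mem _ e g1, fun f l cs h hs => ?_⟩
    simp [g2 f l cs h hs]

/-- Poisson cocycles of `Λ` of degree `t` (that is, of homological degree `-t`). -/
def cocycles (t : ℤ) : Submodule k (List (Homog k n) → Lam k n) :=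
  P.coeffSelf.cochains (-t) ⊓ LinearMap.ker (P.coeffSelf.delta P)

/-- Poisson coboundaries of `Λ` of degree `t`. -/
def coboundaries (t : ℤ) : Submodule k (List (Homog k n) → Lam k n) :=
  (P.coeffSelf.cochains (-(t - 1))).map (P.coeffSelf.delta P)

/-- The Poisson cohomology `HP^t(Λ)`, where `t` is the total degree. -/
def HP (t : ℤ) : Type _ := P.cocycles t ⧸ (P.coboundaries t).submoduleOf (P.cocycles t)

instance (t : ℤ) : AddCommGroup (P.HP t) :=
  inferInstanceAs (AddCommGroup (P.cocycles t ⧸ _))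

instance (t : ℤ) : Module k (P.HP t) :=
  inferInstanceAs (Module k (P.cocycles t ⧸ _))

/-- The class in `HP^•(Λ)` of a cocycle of degree `t`. -/
def hpClass (t : ℤ) (X : P.cocycles t) : ⨁ t : ℤ, P.HP t :=
  DirectSum.lof k ℤ P.HP t (Submodule.Quotient.mk X :
    P.cocycles t ⧸ (P.coboundaries t).submoduleOf (P.cocycles t))

/-- All ways of splitting a list into a sublist `l₁` and the complementary sublist `l₂`, each with
the (graded) sign of the shuffle that moves `l₁` in front of `l₂`. -/
def unshuffles : List (Homog k n) → List (ℤˣ × List (Homog k n) × List (Homog k n))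
  | [] => [(1, [], [])]
  | a :: l => (unshuffles l).flatMap fun x =>
      [(x.1, a :: x.2.1, x.2.2),
        (x.1 * (x.2.1.map fun b => (-1 : ℤˣ) ^ (1 + a.1 * b.1)).prod, x.2.1, a :: x.2.2)]

/-- The product of cochains `X` of degree `s` and `Y` of degree `t`:
`(X ∪ Y)(f₁, …, f_{p+q}) = ∑ ± X(f_{σ(1)}, …, f_{σ(p)}) Y(f_{σ(p+1)}, …, f_{σ(p+q)})`, the sum over
shuffles; apart from the sign of the shuffle there are the Koszul signs. -/
def wedge (s t : ℤ) (X Y : List (Homog k n) → Lam k n) (l : List (Homog k n)) : Lam k n :=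
  ((unshuffles l).map fun x =>
    (x.1 * ((s + x.2.1.length) * x.2.2.length + (t + x.2.2.length) * degSum x.2.1).negOnePow) •
      (X x.2.1 * Y x.2.2)).sum

end ExteriorPoisson

end Exterior

end PoissonGravity

end

open PoissonGravity

/-!
Both parts are instances of one argument about a Batalin-Vilkovisky operator and a Poisson bivector.

Consider polyvectors (or multiderivations) with the wedge product and a divergence `Δ`, an operator
of second order with `Δ² = 0` and `Δ 1 = 0`. An element is determined by the values obtained by
inserting functions into its slots, and the insertions are derivations anticommuting with `Δ`. Hence
an identity between operators follows by induction on insertions from its component without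
arguments. The structure `PolyCalculus` records these properties, and
`PolyCalculus.eq_zero_of_family` is the induction. It shows that the bracket
`Δ(xy) - Δ(x)y ∓ xΔ(y)` generated by `Δ` is a derivation of the product (`PolyCalculus.bkt_mul`),
and that a Poisson bivector `π` satisfies `[π, π] = 0` (`PolyCalculus.Bivector.bkt_pi_pi`), so that
`b = [π, -]` is a differential and a derivation (`PolyCalculus.Poisson.b_b`).

The commutator `L = bΔ + Δb` is the bracket with the modular vector `-Δπ`
(`PolyCalculus.Poisson.lie_eq`); so `b` and `Δ` anticommute exactly on `ker L`, the elements of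
weight zero, which are closed under the product. If `L` is semisimple, then a `b`-cycle of non-zero
weight `c` is the boundary of `c⁻¹ Δ` of itself. Therefore `ker L` computes the cohomology of `b`
(`PolyCalculus.Poisson.exists_cycle`, `PolyCalculus.Poisson.exists_bounding`), and it is a mixed
complex `(ker L, b, Δ)` whose homology inherits the product and the operator `Δ`
(`MixedComplex.BVChains.isBVAlgebra`).

For any mixed complex the maps of the long exact sequence satisfy `β π_* = 0`, and `π_* β` is the
operator on `HH` induced by `Δ`. The images `π_* x` are therefore `Δ`-closed, and an operator of
second order expands on a product of `Δ`-closed elements into the terms `Δ(x_i x_j) ∏ x_l`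
(`IsBVAlgebra.delta_listProd`). Applying `β` to this expansion gives the gravity identities
(`isGravityAlgebra`); `PolyCalculus.Poisson.exists_bv` puts everything together.

For a Poisson algebra with a volume form `η`, polyvectors are replaced by forms through contraction
with `η` (`FormCalculus.VolumeForm.calculus`): `Δ` becomes the de Rham differential and inserting
`f` becomes multiplication by `df`, so that most axioms are immediate. It remains to see that `b`
becomes `∂_ν`, that it corresponds to the Poisson coboundary on polyvectors
(`FormCalculus.VolumeForm.evalAt_b`), that products of polyvectors become composed contractions
(`FormCalculus.VolumeForm.contract_wedge`), and that `ker L` is the span of the forms of total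
weight zero (`FormCalculus.VolumeForm.mem_weightZero_iff`). Here `L` is semisimple because `A` is
spanned by eigenvectors, hence so are the forms.

For an exterior algebra the calculus is that of its multiderivations (`ExteriorPoisson.calculus`),
where `Δ` is defined by duality with respect to the Frobenius form. The Poisson coboundary is again
the bracket with the bivector (`ExteriorPoisson.delta_eq`), and composition with the Frobenius
isomorphism turns it into the coboundary with twisted dual coefficients
(`ExteriorPoisson.iotaEta_delta`). Since `A^!` has finite dimension, `L` satisfies on
multiderivations of bounded arity a polynomial equation whose simple roots are sums of eigenvalues
of the modular derivation, and so it is semisimple (`ExteriorPoisson.semisimple`).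
-/

set_option linter.unusedSectionVars false

noncomputable section

namespace PoissonGravity

/-! ### Signs -/

/-- The sign `(-1) ^ e` as an integer. -/
def sg (e : ℤ) : ℤ := if Even e then 1 else -1

lemma negOnePow_smul_eq {V : Type*} [AddCommGroup V] (e : ℤ) (x : V) :
    e.negOnePow • x = sg e • x := by
  unfold sg
  split_ifs with h
  · rw [Int.negOnePow_even e h, one_smul, one_smul]
  · rw [Int.negOnePow_odd e (Int.not_even_iff_odd.1 h), Units.neg_smul, one_smul, neg_smul, one_smul]

lemma sg_add (a b : ℤ) : sg (a + b) = sg a * sg b := by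
  by_cases ha : Even a <;> by_cases hb : Even b <;> simp [sg, Int.even_add, ha, hb]

lemma sg_sub (a b : ℤ) : sg (a - b) = sg a * sg b := by
  by_cases ha : Even a <;> by_cases hb : Even b <;> simp [sg, Int.even_sub, ha, hb]

lemma sg_mul_self (a : ℤ) : sg a * sg a = 1 := by
  by_cases ha : Even a <;> simp [sg, ha]

lemma sg_smul_sg_smul {V : Type*} [AddCommGroup V] (a b : ℤ) (x : V) :
    sg a • sg b • x = sg (a + b) • x := by rw [smul_smul, sg_add]

lemma sg_zero : sg 0 = 1 := by simp [sg]
lemma sg_one : sg 1 = -1 := by simp [sg]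
lemma sg_two : sg 2 = 1 := by simp [sg]

lemma sg_congr {a b : ℤ} (h : Even (a - b)) : sg a = sg b := by
  have : (Even a ↔ Even b) := Int.even_sub.1 h
  simp [sg, this]

lemma neg_one_pow_smul_eq {k V : Type*} [Ring k] [AddCommGroup V] [Module k V] (e : ℕ) (x : V) :
    (-1 : k) ^ e • x = sg e • x := by
  by_cases h : Even e
  · simp [sg, h]
  · rw [(Nat.not_even_iff_odd.1 h).neg_one_pow]; simp [sg, h]

lemma cast_sg_smul {k V : Type*} [Field k] [AddCommGroup V] [Module k V] (e : ℤ) (x : V) :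
    ((sg e : ℤ) : k) • x = sg e • x := Int.cast_smul_eq_zsmul k _ _

lemma sum_fin_cons {β M : Type*} [AddCommMonoid M] (a : β) (l : List β)
    (f : Fin (a :: l).length → M) :
    ∑ i, f i = f (0 : Fin (l.length + 1)) + ∑ i : Fin l.length, f i.succ :=
  Fin.sum_univ_succ f

/-! ### Gravity brackets from a Batalin-Vilkovisky operator -/

section Gravity

variable {k : Type*} [Field k] {V : Type*} [AddCommGroup V] [Module k V]

lemma totalDeg_nil : totalDeg ([] : List (ℤ × V)) = 0 := rfl
lemma totalDeg_cons (a : ℤ × V) (l : List (ℤ × V)) : totalDeg (a :: l) = a.1 + totalDeg l := by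
  simp [totalDeg]
lemma totalDeg_append (l l' : List (ℤ × V)) :
    totalDeg (l ++ l') = totalDeg l + totalDeg l' := by
  simp [totalDeg]

lemma decalageEps_cons (a : ℤ × V) (l : List (ℤ × V)) :
    decalageEps (a :: l) = l.length * a.1 + decalageEps l := by
  unfold decalageEps
  rw [sum_fin_cons]
  simp only [List.length_cons, List.get_eq_getElem, Fin.val_zero, Fin.val_succ,
    List.getElem_cons_zero, List.getElem_cons_succ]
  push_cast
  congr 1
  · ring
  · exact Finset.sum_congr rfl fun i _ => by ring

lemma decalageEps_nil : decalageEps ([] : List (ℤ × V)) = 0 := rfl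

lemma decalageEps_append (l l' : List (ℤ × V)) :
    decalageEps (l ++ l') = l'.length * totalDeg l + decalageEps l + decalageEps l' := by
  induction l with
  | nil => simp [totalDeg_nil, decalageEps_nil]
  | cons a l ih =>
    rw [List.cons_append, decalageEps_cons, ih, decalageEps_cons, totalDeg_cons]
    simp only [List.length_append, Nat.cast_add]
    ring

namespace IsBVAlgebra

variable {gr : ℤ → Submodule k V} {one : V} {mul : V →ₗ[k] V →ₗ[k] V} {Δ : V →ₗ[k] V}

/-- The product of a list of (degree, element) pairs. -/
def listProd (one : V) (mul : V →ₗ[k] V →ₗ[k] V) (l : List (ℤ × V)) : V :=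
  l.foldr (fun a b => mul a.2 b) one

@[simp] lemma listProd_nil : listProd one mul [] = one := rfl
@[simp] lemma listProd_cons (a : ℤ × V) (l : List (ℤ × V)) :
    listProd one mul (a :: l) = mul a.2 (listProd one mul l) := rfl

variable (H : IsBVAlgebra gr one mul Δ)
include H

lemma listProd_append (l l' : List (ℤ × V)) :
    listProd one mul (l ++ l') = mul (listProd one mul l) (listProd one mul l') := by
  induction l with
  | nil => simp [H.one_mul]
  | cons a l ih => simp [ih, H.mul_assoc]

lemma comm {i j : ℤ} {a b : V} (ha : a ∈ gr i) (hb : b ∈ gr j) : mul a b = sg (i * j) • mul b a := by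
  rw [H.mul_comm i j a ha b hb, negOnePow_smul_eq]

lemma mul_one {i : ℤ} {a : V} (ha : a ∈ gr i) : mul a one = a := by
  rw [H.comm ha H.one_mem, mul_zero, sg_zero, one_smul, H.one_mul]

lemma listProd_mem {l : List (ℤ × V)} (hl : IsHomogeneousList gr l) :
    listProd one mul l ∈ gr (totalDeg l) := by
  induction l with
  | nil => exact H.one_mem
  | cons a l ih =>
    rw [totalDeg_cons]
    exact H.mul_mem _ _ _ (hl a (by simp)) _ (ih fun b hb => hl b (by simp [hb]))

lemma delta_one : Δ one = 0 := by
  have h := H.second_order 0 0 0 one H.one_mem one H.one_mem one H.one_mem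
  have h1 : mul (Δ one) one = Δ one := H.mul_one (H.delta_mem _ _ H.one_mem)
  simp only [H.one_mul, h1, negOnePow_smul_eq] at h
  simp [sg] at h
  exact h

/-- The operator `Δ(a ·) ∓ a Δ(·)` is a derivation on products of `Δ`-closed elements. -/
lemma delta_mul_listProd {α : ℤ} {a : V} (ha : a ∈ gr α) (hΔ : Δ a = 0) {l : List (ℤ × V)}
    (hl : IsHomogeneousList gr l) (hlΔ : ∀ b ∈ l, Δ b.2 = 0) :
    Δ (mul a (listProd one mul l)) = sg α • mul a (Δ (listProd one mul l)) +
      ∑ j : Fin l.length, sg ((l.get j).1 * totalDeg (l.take j)) •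
        mul (Δ (mul a (l.get j).2)) (listProd one mul (l.eraseIdx j)) := by
  induction l with
  | nil => simp [H.mul_one ha, hΔ, H.delta_one]
  | cons b l ih =>
    have hb := hl b (by simp)
    have hbΔ := hlΔ b (by simp)
    have hl' : IsHomogeneousList gr l := fun c hc => hl c (by simp [hc])
    have ih := ih hl' fun c hc => hlΔ c (by simp [hc])
    have hP := H.listProd_mem hl'
    rw [sum_fin_cons]
    simp only [List.get_eq_getElem, List.length_cons, Fin.val_zero, List.getElem_cons_zero,
      List.take_zero, totalDeg_nil, mul_zero, sg_zero, one_smul, List.eraseIdx_cons_zero,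
      Fin.val_succ, List.getElem_cons_succ, List.take_succ_cons, List.eraseIdx_cons_succ,
      listProd_cons, totalDeg_cons]
    set P := listProd one mul l with hPdef
    have h7 := H.second_order _ _ _ a ha b.2 hb P hP
    rw [hΔ, hbΔ] at h7
    simp only [negOnePow_smul_eq, map_zero, LinearMap.zero_apply, smul_zero, sub_zero] at h7
    rw [← H.mul_assoc, h7, ih]
    have key : ∀ j : Fin l.length, mul b.2 (mul (Δ (mul a (l.get j).2))
        (listProd one mul (l.eraseIdx j))) = sg (b.1 * (α + (l.get j).1 - 1)) •
        mul (Δ (mul a (l.get j).2)) (mul b.2 (listProd one mul (l.eraseIdx j))) := by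
      intro j
      have hc := hl' (l.get j) (by simp)
      rw [← H.mul_assoc, H.comm hb (H.delta_mem _ _ (H.mul_mem _ _ _ ha _ hc)), map_zsmul,
        LinearMap.smul_apply, H.mul_assoc]
    simp only [map_add, map_sum, map_zsmul, smul_add, Finset.smul_sum]
    have e1 : mul b.2 (mul a (Δ P)) = sg (b.1 * α) • mul (mul a b.2) (Δ P) := by
      rw [← H.mul_assoc, H.comm hb ha, map_zsmul, LinearMap.smul_apply]
    rw [e1]
    have e2 : ∀ j : Fin l.length, sg ((α - 1) * b.1) • sg ((l.get j).1 * totalDeg (l.take j)) •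
        mul b.2 (mul (Δ (mul a (l.get j).2)) (listProd one mul (l.eraseIdx j))) =
        sg ((l.get j).1 * (b.1 + totalDeg (l.take j))) •
        mul (Δ (mul a (l.get j).2)) (mul b.2 (listProd one mul (l.eraseIdx j))) := by
      intro j
      rw [key]
      simp only [sg_smul_sg_smul]
      congr 1
      refine sg_congr ?_
      generalize (l.get j).1 = x
      generalize totalDeg (l.take j) = y
      have : (α - 1) * b.1 + (x * y + b.1 * (α + x - 1)) - x * (b.1 + y) = 2 * (b.1 * α - b.1) := by
        ring
      rw [this]; exact even_two_mul _
    have e2' := fun j => e2 j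
    simp only [List.get_eq_getElem] at e2'
    simp only [List.get_eq_getElem, e2']
    simp only [sg_smul_sg_smul]
    have e3 : sg ((α - 1) * b.1 + (α + b.1 * α)) = sg (α + b.1) := by
      refine sg_congr ⟨α * b.1 - b.1, by ring⟩
    rw [e3]
    abel

/-- An operator of second order with `Δ 1 = 0` expands on a product of `Δ`-closed elements as the
sum over pairs of factors, each pair `x, y` being replaced by `Δ (x y)` in front. -/
lemma delta_listProd {l : List (ℤ × V)}
    (hl : IsHomogeneousList gr l) (hlΔ : ∀ b ∈ l, Δ b.2 = 0) :
    Δ (listProd one mul l) =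
      ∑ i : Fin l.length, ∑ j : Fin l.length, if i < j then
        sg ((l.get i).1 * totalDeg (l.take i) + (l.get j).1 * (totalDeg (l.take j) - (l.get i).1)) •
        mul (Δ (mul (l.get i).2 (l.get j).2)) (listProd one mul ((l.eraseIdx j).eraseIdx i))
      else 0 := by
  induction l with
  | nil => simp [H.delta_one]
  | cons a l ih =>
    have ha := hl a (by simp)
    have hl' : IsHomogeneousList gr l := fun c hc => hl c (by simp [hc])
    have hlΔ' : ∀ b ∈ l, Δ b.2 = 0 := fun c hc => hlΔ c (by simp [hc])
    rw [listProd_cons, H.delta_mul_listProd ha (hlΔ a (by simp)) hl' hlΔ', ih hl' hlΔ',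
      sum_fin_cons, add_comm]
    congr 1
    · rw [sum_fin_cons]
      simp only [lt_self_iff_false, if_false, zero_add, Fin.succ_pos, if_true]
      refine Finset.sum_congr rfl fun j _ => ?_
      simp [totalDeg_cons, totalDeg_nil]
    · simp only [map_sum, Finset.smul_sum]
      refine Finset.sum_congr rfl fun i _ => ?_
      rw [sum_fin_cons]
      simp only [Fin.not_lt_zero, if_false, zero_add, Fin.succ_lt_succ_iff]
      refine Finset.sum_congr rfl fun j _ => ?_
      split_ifs with hij
      · have hi := hl' (l.get i) (by simp)
        have hj := hl' (l.get j) (by simp)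
        rw [map_zsmul, ← H.mul_assoc, H.comm ha (H.delta_mem _ _ (H.mul_mem _ _ _ hi _ hj)),
          map_zsmul, LinearMap.smul_apply, H.mul_assoc]
        simp only [sg_smul_sg_smul]
        simp only [List.get_eq_getElem, Fin.val_succ, List.getElem_cons_succ, List.take_succ_cons,
          totalDeg_cons, List.eraseIdx_cons_succ, listProd_cons]
        congr 1
        generalize l[(i : ℕ)].1 = x
        generalize l[(j : ℕ)].1 = y
        generalize totalDeg (l.take i) = D
        generalize totalDeg (l.take j) = D'
        exact sg_congr ⟨0, by ring⟩
      · simp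

end IsBVAlgebra

end Gravity

/-! ### Gravity brackets as multilinear maps -/

section Brackets

variable {k : Type*} [Field k] {V : Type*} [AddCommGroup V] [Module k V]
  {W : Type*} [AddCommGroup W] [Module k W]

/-- The product of `m` factors as a multilinear map. -/
def mulMultilinear (one : V) (mul : V →ₗ[k] V →ₗ[k] V) :
    (m : ℕ) → MultilinearMap k (fun _ : Fin m => V) V
  | 0 => MultilinearMap.constOfIsEmpty k _ one
  | m + 1 => LinearMap.uncurryLeft
      { toFun := fun x => (mul x).compMultilinearMap (mulMultilinear one mul m)
        map_add' := fun x y => by ext; simp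
        map_smul' := fun c x => by ext; simp }

lemma mulMultilinear_apply (one : V) (mul : V →ₗ[k] V →ₗ[k] V) (m : ℕ) (v : Fin m → V) :
    mulMultilinear one mul m v = (List.ofFn v).foldr (fun a b => mul a b) one := by
  induction m with
  | zero => simp [mulMultilinear]
  | succ m ih =>
    rw [List.ofFn_succ, List.foldr_cons, ← ih]
    rfl

/-- The brackets generated by a Batalin-Vilkovisky operator: `p` and `β` are the maps to and from
the Batalin-Vilkovisky algebra, `σ` is the parity operator; its powers produce the sign
`(-1) ^ ε_m`. -/
def gravityBracket (one : V) (mul : V →ₗ[k] V →ₗ[k] V) (p : W →ₗ[k] V) (β : V →ₗ[k] W)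
    (σ : W →ₗ[k] W) (m : ℕ) : MultilinearMap k (fun _ : Fin m => W) W :=
  (β.compMultilinearMap (mulMultilinear one mul m)).compLinearMap
    fun i => p ∘ₗ (σ ^ (m - 1 - (i : ℕ)))

/-- Apply a map to the elements of a list of (degree, element) pairs. -/
def mapSnd (p : W →ₗ[k] V) (l : List (ℤ × W)) : List (ℤ × V) := l.map fun a => (a.1, p a.2)

variable (p : W →ₗ[k] V)

lemma totalDeg_mapSnd (l : List (ℤ × W)) : totalDeg (mapSnd p l) = totalDeg l := by
  simp [totalDeg, mapSnd, Function.comp_def]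

lemma sg_sum {ι : Type*} (s : Finset ι) (f : ι → ℤ) : sg (∑ i ∈ s, f i) = ∏ i ∈ s, sg (f i) := by
  classical
  induction s using Finset.induction_on with
  | empty => simp [sg_zero]
  | insert a s ha ih => rw [Finset.sum_insert ha, Finset.prod_insert ha, sg_add, ih]

variable {grV : ℤ → Submodule k V} {grW : ℤ → Submodule k W}
  {one : V} {mul : V →ₗ[k] V →ₗ[k] V} {Δ : V →ₗ[k] V} {p} {β : V →ₗ[k] W} {σ : W →ₗ[k] W}

/-- The sign `(-1) ^ ε_m` of the gravity brackets is produced by applying powers of the grading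
operator `σ` to the factors. -/
lemma gravityBracket_apply (hσ : ∀ t, ∀ x ∈ grW t, σ x = sg t • x) {l : List (ℤ × W)}
    (hl : IsHomogeneousList grW l) :
    (bracketList (gravityBracket one mul p β σ) l).2 =
      sg (decalageEps l) • β (IsBVAlgebra.listProd one mul (mapSnd p l)) := by
  have hpow : ∀ (n : ℕ) t, ∀ x ∈ grW t, (σ ^ n) x = sg (n * t) • x := by
    intro n t x hx
    induction n with
    | zero => simp [sg_zero]
    | succ n ih =>
      rw [pow_succ', Module.End.mul_apply, ih, map_zsmul, hσ t x hx, sg_smul_sg_smul]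
      push_cast; ring_nf
  change β (mulMultilinear one mul l.length fun i : Fin l.length =>
    p ((σ ^ (l.length - 1 - (i : ℕ))) (l.get i).2)) = _
  have h1 : (fun i : Fin l.length => p ((σ ^ (l.length - 1 - (i : ℕ))) (l.get i).2)) =
      fun i => ((sg (((l.length : ℤ) - 1 - i) * (l.get i).1) : ℤ) : k) • p (l.get i).2 := by
    funext i
    rw [hpow _ _ _ (hl _ (l.get_mem i)), map_zsmul, cast_sg_smul]
    congr 3
    have := i.2
    omega
  rw [h1, MultilinearMap.map_smul_univ, map_smul, ← Int.cast_prod, ← sg_sum, cast_sg_smul,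
    mulMultilinear_apply]
  congr 2
  rw [IsBVAlgebra.listProd, mapSnd, List.foldr_map]
  have : (List.ofFn fun i : Fin l.length => p (l.get i).2) = l.map fun a => p a.2 := by
    conv_rhs => rw [← List.ofFn_get l, List.map_ofFn]
    rfl
  rw [this, List.foldr_map]

lemma exists_eq_append_of_lt {α : Type*} (xs : List α) {i j : Fin xs.length} (hij : i < j) :
    ∃ p a q b r, xs = p ++ a :: (q ++ b :: r) ∧ (i : ℕ) = p.length ∧
      (j : ℕ) = (p ++ a :: q).length ∧ xs.get i = a ∧ xs.get j = b := by
  have hj := j.2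
  have hij' : (i : ℕ) < j := hij
  refine ⟨xs.take i, xs.get i, (xs.drop (i + 1)).take (j - i - 1), xs.get j,
    xs.drop (j + 1), ?_, by simp, by simp; omega, rfl, rfl⟩
  have h1 : xs.drop (i + 1) = (xs.drop (i + 1)).take (j - i - 1) ++ xs.drop j := by
    conv_lhs => rw [← List.take_append_drop (j - i - 1) (xs.drop (i + 1)), List.drop_drop]
    congr 2; omega
  rw [List.get_eq_getElem, List.get_eq_getElem, ← List.drop_eq_getElem_cons j.2, ← h1,
    ← List.drop_eq_getElem_cons i.2, List.take_append_drop]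

/-- The signs in the gravity identities agree with the Koszul signs of a second order operator. -/
lemma gravity_sign (xs : List (ℤ × W)) {i j : Fin xs.length} (hij : i < j) (D s : ℤ) :
    sg ((gravityEps xs i j + i + j + 1) +
      ((((xs.length : ℤ) + s - 2) * ((xs.get i).1 + (xs.get j).1 - 1) +
        (s * totalDeg ((xs.eraseIdx j).eraseIdx i) + decalageEps ((xs.eraseIdx j).eraseIdx i) + D)) +
      (xs.get i).1) + ((xs.get i).1 * totalDeg (xs.take i) +
        (xs.get j).1 * (totalDeg (xs.take j) - (xs.get i).1))) =
    sg (xs.length + s + (s * totalDeg xs + decalageEps xs + D)) := by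
  obtain ⟨p, a, q, b, r, hxs, hi, hj, ha, hb⟩ := exists_eq_append_of_lt xs hij
  have hxs' : xs = (p ++ a :: q) ++ b :: r := by simp [hxs]
  have hti : xs.take i = p := by rw [hi, hxs]; simp
  have htj : xs.take j = p ++ a :: q := by rw [hj, hxs', List.take_left']; rfl
  have he : (xs.eraseIdx j).eraseIdx i = p ++ (q ++ r) := by
    rw [hj, hi, hxs', List.eraseIdx_append_of_length_le le_rfl, Nat.sub_self,
      List.eraseIdx_cons_zero, List.append_assoc, List.eraseIdx_append_of_length_le le_rfl]
    simp
  rw [gravityEps, ha, hb, hti, htj, he, hi, hj, hxs]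
  simp only [totalDeg_append, totalDeg_cons, decalageEps_append, decalageEps_cons,
    List.length_append, List.length_cons, Nat.cast_add, Nat.cast_one]
  refine sg_congr ⟨a.1 * totalDeg p + p.length * a.1 + p.length + b.1 * totalDeg p +
    b.1 * totalDeg q + p.length * b.1 + q.length * b.1 - r.length - s, ?_⟩
  ring

/-- Brackets generated by a Batalin-Vilkovisky operator `Δ = p ∘ β`, with `β ∘ p = 0`, satisfy the
gravity identities: the elements `p x` are `Δ`-closed, so the identities are `β` applied to the
expansion of `Δ (p x₁ ⋯ p x_r)` into two-element terms. -/
theorem isGravityAlgebra (H : IsBVAlgebra grV one mul Δ)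
    (hp : ∀ t, ∀ x ∈ grW t, p x ∈ grV t) (hβ : ∀ t, ∀ x ∈ grV t, β x ∈ grW (t - 1))
    (hβp : ∀ x, β (p x) = 0) (hpβ : ∀ x, p (β x) = Δ x)
    (hσ : ∀ t, ∀ x ∈ grW t, σ x = sg t • x) :
    IsGravityAlgebra grW (gravityBracket one mul p β σ) := by
  have hmap : ∀ l : List (ℤ × W), IsHomogeneousList grW l → IsHomogeneousList grV (mapSnd p l) := by
    intro l hl b hb
    obtain ⟨a, ha, rfl⟩ := List.mem_map.1 hb
    exact hp _ _ (hl a ha)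
  have hclosed : ∀ l : List (ℤ × W), ∀ b ∈ mapSnd p l, Δ b.2 = 0 := by
    intro l b hb
    obtain ⟨a, -, rfl⟩ := List.mem_map.1 hb
    rw [← hpβ, hβp, map_zero]
  have hmem : ∀ l, IsHomogeneousList grW l →
      (bracketList (gravityBracket one mul p β σ) l).2 ∈ grW (totalDeg l - 1) := by
    intro l hl
    rw [gravityBracket_apply hσ hl]
    refine zsmul_mem (hβ _ _ ?_) _
    rw [← totalDeg_mapSnd p]
    exact H.listProd_mem (hmap l hl)
  refine ⟨fun l _ hl => hmem l hl, ?_, ?_⟩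
  · intro l₁ l₂ a b hl
    have hl' : IsHomogeneousList grW (l₁ ++ b :: a :: l₂) := by
      intro c hc
      refine hl c ?_
      simp only [List.mem_append, List.mem_cons] at hc ⊢
      tauto
    have ha : p a.2 ∈ grV a.1 := hp _ _ (hl a (by simp))
    have hb : p b.2 ∈ grV b.1 := hp _ _ (hl b (by simp))
    rw [gravityBracket_apply hσ hl, gravityBracket_apply hσ hl', negOnePow_smul_eq]
    have e : IsBVAlgebra.listProd one mul (mapSnd p (l₁ ++ a :: b :: l₂)) =
        sg (a.1 * b.1) • IsBVAlgebra.listProd one mul (mapSnd p (l₁ ++ b :: a :: l₂)) := by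
      simp only [mapSnd, List.map_append, List.map_cons, H.listProd_append,
        IsBVAlgebra.listProd_cons]
      rw [← H.mul_assoc (p a.2), H.comm ha hb, map_zsmul, LinearMap.smul_apply, map_zsmul,
        H.mul_assoc]
    rw [e, map_zsmul, sg_smul_sg_smul, sg_smul_sg_smul, ← neg_smul]
    congr 1
    rw [← neg_one_mul, ← sg_one, ← sg_add]
    refine sg_congr ⟨-1 - b.1, ?_⟩
    simp only [decalageEps_append, decalageEps_cons, List.length_cons]
    push_cast
    ring
  · intro xs ys hxs hys _ _
    set br := gravityBracket one mul p β σ with hbr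
    set X := mapSnd p xs with hX
    set Py := IsBVAlgebra.listProd one mul (mapSnd p ys) with hPy
    have hin : ∀ l, IsHomogeneousList grW l → p (bracketList br l).2 =
        sg (decalageEps l) • Δ (IsBVAlgebra.listProd one mul (mapSnd p l)) := by
      intro l hl
      rw [hbr, gravityBracket_apply hσ hl, map_zsmul, hpβ]
    have hcons : ∀ l l', IsHomogeneousList grW l → IsHomogeneousList grW l' →
        IsHomogeneousList grW (bracketList br l :: l') := by
      intro l l' hl hl' c hc
      rcases List.mem_cons.1 hc with rfl | hc
      · exact hmem l hl
      · exact hl' c hc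
    have houter : ∀ l l', IsHomogeneousList grW l → IsHomogeneousList grW l' →
        (bracketList br (bracketList br l :: l')).2 =
        sg (l'.length * (totalDeg l - 1) + decalageEps l' + decalageEps l) •
          β (mul (Δ (IsBVAlgebra.listProd one mul (mapSnd p l)))
            (IsBVAlgebra.listProd one mul (mapSnd p l'))) := by
      intro l l' hl hl'
      rw [gravityBracket_apply hσ (hcons l l' hl hl'), decalageEps_cons]
      simp only [mapSnd, List.map_cons, IsBVAlgebra.listProd_cons]
      rw [hin l hl, map_zsmul, LinearMap.smul_apply, map_zsmul, sg_smul_sg_smul]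
      rfl
    have hsum : (∑ i : Fin xs.length, ∑ j : Fin xs.length, if i < j then
        (gravityEps xs i j + i + j + 1).negOnePow •
          (bracketList br (bracketList br [xs.get i, xs.get j] ::
              ((xs.eraseIdx j).eraseIdx i ++ ys))).2 else 0) =
        sg (xs.length + ys.length + (ys.length * totalDeg xs + decalageEps xs + decalageEps ys)) •
          β (mul (Δ (IsBVAlgebra.listProd one mul X)) Py) := by
      rw [H.delta_listProd (hmap xs hxs) (hclosed xs)]
      have hlen : (mapSnd p xs).length = xs.length := by simp [mapSnd]
      simp only [map_sum, LinearMap.sum_apply, Finset.smul_sum]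
      rw [← (finCongr hlen).sum_comp]
      refine Finset.sum_congr rfl fun i _ => ?_
      rw [← (finCongr hlen).sum_comp]
      refine Finset.sum_congr rfl fun j _ => ?_
      by_cases hij : i < j
      swap
      · rw [if_neg hij, if_neg (by simpa using hij)]; simp
      rw [if_pos hij, if_pos (by simpa using hij)]
      have hgi : (mapSnd p xs).get i = ((xs.get (finCongr hlen i)).1,
          p (xs.get (finCongr hlen i)).2) := List.getElem_map fun a : ℤ × W => (a.1, p a.2)
      have hgj : (mapSnd p xs).get j = ((xs.get (finCongr hlen j)).1,
          p (xs.get (finCongr hlen j)).2) := List.getElem_map fun a : ℤ × W => (a.1, p a.2)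
      have hti : totalDeg ((mapSnd p xs).take i) = totalDeg (xs.take i) := by
        rw [← totalDeg_mapSnd p (xs.take i)]; simp [mapSnd]
      have htj : totalDeg ((mapSnd p xs).take j) = totalDeg (xs.take j) := by
        rw [← totalDeg_mapSnd p (xs.take j)]; simp [mapSnd]
      have her : ((mapSnd p xs).eraseIdx j).eraseIdx i = mapSnd p ((xs.eraseIdx j).eraseIdx i) := by
        simp [mapSnd, List.eraseIdx_map]
      have hij' : finCongr hlen i < finCongr hlen j := by simpa using hij
      rw [hgi, hgj, hti, htj, her]
      have hci : ((finCongr hlen i : Fin xs.length) : ℕ) = i := by simp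
      have hcj : ((finCongr hlen j : Fin xs.length) : ℕ) = j := by simp
      rw [← hci, ← hcj]
      generalize finCongr hlen i = i' at *
      generalize finCongr hlen j = j' at *
      have hrest : IsHomogeneousList grW ((xs.eraseIdx j').eraseIdx i') := fun c hc =>
        hxs c (List.mem_of_mem_eraseIdx (List.mem_of_mem_eraseIdx hc))
      have hpair : IsHomogeneousList grW [xs.get i', xs.get j'] := by
        intro c hc
        simp only [List.mem_cons, List.not_mem_nil, or_false] at hc
        rcases hc with rfl | rfl
        · exact hxs _ (xs.get_mem i')
        · exact hxs _ (xs.get_mem j')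
      have hry : IsHomogeneousList grW ((xs.eraseIdx j').eraseIdx i' ++ ys) := by
        intro c hc
        rcases List.mem_append.1 hc with hc | hc
        · exact hrest c hc
        · exact hys c hc
      rw [negOnePow_smul_eq, houter _ _ hpair hry]
      have hb1 : IsBVAlgebra.listProd one mul (mapSnd p [xs.get i', xs.get j']) =
          mul (p (xs.get i').2) (p (xs.get j').2) := by
        simp only [mapSnd, List.map_cons, List.map_nil, IsBVAlgebra.listProd_cons,
          IsBVAlgebra.listProd_nil]
        rw [H.mul_one (hp _ _ (hpair (xs.get j') (by simp)))]
      have hb2 : IsBVAlgebra.listProd one mul (mapSnd p ((xs.eraseIdx j').eraseIdx i' ++ ys)) =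
          mul (IsBVAlgebra.listProd one mul (mapSnd p ((xs.eraseIdx j').eraseIdx i'))) Py := by
        rw [hPy, ← H.listProd_append]; simp [mapSnd]
      rw [hb1, hb2, map_zsmul, LinearMap.smul_apply, map_zsmul, H.mul_assoc, sg_smul_sg_smul,
        sg_smul_sg_smul]
      congr 1
      rw [sg_add _ ((xs.get i').1 * _ + _), ← gravity_sign xs hij' (decalageEps ys) ys.length,
        sg_add _ ((xs.get i').1 * _ + _), mul_assoc, sg_mul_self, _root_.mul_one]
      refine sg_congr ⟨0, ?_⟩
      have hle : (((xs.eraseIdx j').eraseIdx i').length : ℤ) = xs.length - 2 := by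
        have h1 : (xs.eraseIdx j').length = xs.length - 1 := List.length_eraseIdx_of_lt j'.2
        have h2 : ((xs.eraseIdx j').eraseIdx i').length = xs.length - 1 - 1 := by
          rw [List.length_eraseIdx_of_lt, h1]
          rw [h1]
          have : (i' : ℕ) < j' := hij'
          omega
        have : (i' : ℕ) < j' := hij'
        omega
      simp only [decalageEps_append, decalageEps_cons, decalageEps_nil, totalDeg_cons,
        totalDeg_nil, List.length_append, List.length_cons, List.length_nil, Nat.cast_add, hle]
      push_cast
      ring
    rw [hsum]
    split_ifs with hy
    · subst hy
      simp only [hPy, mapSnd, List.map_nil, IsBVAlgebra.listProd_nil]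
      rw [H.mul_one (H.delta_mem _ _ (H.listProd_mem (hmap xs hxs))), ← hpβ, hβp, smul_zero]
    · rw [negOnePow_smul_eq, houter _ _ hxs hys, sg_smul_sg_smul]
      congr 1
      exact sg_congr ⟨ys.length, by ring⟩

end Brackets

/-! ### Products on the homology of a mixed complex -/

namespace MixedComplex

variable {k : Type*} [Field k] {E : Type*} [AddCommGroup E] [Module k E] (M : MixedComplex k E)

lemma mem_cycles {m : ℤ} {z : E} : z ∈ M.cycles m ↔ z ∈ M.C m ∧ M.b z = 0 := Iff.rfl

/-- The class of `z` in `HH_m`, with value zero if `z` is not a cycle of degree `m`. -/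
def cls (m : ℤ) (z : E) : M.HHtot :=
  open Classical in if h : z ∈ M.cycles m then M.hhClass m ⟨z, h⟩ else 0

variable {M}

lemma cls_of_mem {m : ℤ} {z : E} (h : z ∈ M.cycles m) : M.cls m z = M.hhClass m ⟨z, h⟩ :=
  dif_pos h

/-- The projection from cycles to homology. -/
def hhMk (M : MixedComplex k E) (m : ℤ) : M.cycles m →ₗ[k] M.HH m :=
  ((M.boundaries m).submoduleOf (M.cycles m)).mkQ

/-- The projection from negative cyclic cycles to negative cyclic homology. -/
def hcMk (M : MixedComplex k E) (m : ℤ) : M.ncCycles m →ₗ[k] M.HC m :=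
  ((M.ncBoundaries m).submoduleOf (M.ncCycles m)).mkQ

lemma hhMk_surjective (m : ℤ) : Function.Surjective (hhMk M m) := Submodule.mkQ_surjective _
lemma hcMk_surjective (m : ℤ) : Function.Surjective (hcMk M m) := Submodule.mkQ_surjective _

lemma hhMk_eq_zero_iff {m : ℤ} (z : M.cycles m) : hhMk M m z = 0 ↔ (z : E) ∈ M.boundaries m :=
  Submodule.Quotient.mk_eq_zero _

lemma hcMk_eq_zero_iff {m : ℤ} (z : M.ncCycles m) :
    hcMk M m z = 0 ↔ (z : ℕ → E) ∈ M.ncBoundaries m :=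
  Submodule.Quotient.mk_eq_zero _

lemma hhClass_eq {m : ℤ} (z : M.cycles m) :
    M.hhClass m z = DirectSum.lof k ℤ M.HH m (hhMk M m z) := rfl

lemma piStar_hcMk {m : ℤ} (x : M.ncCycles m) :
    M.piStar m (hcMk M m x) = hhMk M m (M.piCycles m x) := rfl

lemma beta_hhMk {m : ℤ} (x : M.cycles m) :
    M.beta m (hhMk M m x) = hcMk M (m + 1) (M.betaCycles m x) := rfl

lemma betaTot_lof {m : ℤ} (x : M.HH m) :
    M.betaTot (DirectSum.lof k ℤ M.HH m x) = DirectSum.lof k ℤ M.HC (m + 1) (M.beta m x) := by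
  rw [betaTot, DirectSum.toModule_lof, LinearMap.comp_apply]

lemma piTot_lof {m : ℤ} (x : M.HC m) :
    M.piTot (DirectSum.lof k ℤ M.HC m x) = DirectSum.lof k ℤ M.HH m (M.piStar m x) := by
  rw [piTot, DirectSum.toModule_lof, LinearMap.comp_apply]

/-- `hhClass` as a linear map. -/
def hhClassₗ (M : MixedComplex k E) (m : ℤ) : M.cycles m →ₗ[k] M.HHtot :=
  DirectSum.lof k ℤ M.HH m ∘ₗ hhMk M m

lemma hhClassₗ_apply {m : ℤ} (z : M.cycles m) : hhClassₗ M m z = M.hhClass m z := rfl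

lemma cls_add {m : ℤ} {z w : E} (hz : z ∈ M.cycles m) (hw : w ∈ M.cycles m) :
    M.cls m (z + w) = M.cls m z + M.cls m w := by
  rw [cls_of_mem hz, cls_of_mem hw, cls_of_mem (add_mem hz hw), ← hhClassₗ_apply, ← hhClassₗ_apply,
    ← hhClassₗ_apply, ← map_add]
  rfl

lemma cls_smul {m : ℤ} {z : E} (c : k) (hz : z ∈ M.cycles m) :
    M.cls m (c • z) = c • M.cls m z := by
  rw [cls_of_mem hz, cls_of_mem (Submodule.smul_mem _ c hz), ← hhClassₗ_apply, ← hhClassₗ_apply,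
    ← map_smul]
  rfl

lemma cls_zsmul {m : ℤ} {z : E} (c : ℤ) (hz : z ∈ M.cycles m) :
    M.cls m (c • z) = c • M.cls m z := by
  rw [cls_of_mem hz, cls_of_mem (zsmul_mem hz c), ← hhClassₗ_apply, ← hhClassₗ_apply,
    ← map_zsmul]
  rfl

lemma cls_sub {m : ℤ} {z w : E} (hz : z ∈ M.cycles m) (hw : w ∈ M.cycles m) :
    M.cls m (z - w) = M.cls m z - M.cls m w := by
  rw [cls_of_mem hz, cls_of_mem hw, cls_of_mem (sub_mem hz hw), ← hhClassₗ_apply, ← hhClassₗ_apply,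
    ← hhClassₗ_apply, ← map_sub]
  rfl

lemma hhClassₗ_eq_zero_iff {m : ℤ} (z : M.cycles m) :
    hhClassₗ M m z = 0 ↔ (z : E) ∈ M.boundaries m := by
  rw [hhClassₗ, LinearMap.comp_apply, DirectSum.lof_eq_of,
    map_eq_zero_iff _ (DirectSum.of_injective m), hhMk_eq_zero_iff]

lemma cls_eq_zero {m : ℤ} {y : E} (hy : y ∈ M.C (m + 1)) : M.cls m (M.b y) = 0 := by
  by_cases h : M.b y ∈ M.cycles m
  · rw [cls_of_mem h, ← hhClassₗ_apply, hhClassₗ_eq_zero_iff]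
    exact ⟨y, hy, rfl⟩
  · exact dif_neg h

lemma mem_hhDeg {n t : ℤ} {a : M.HHtot} :
    a ∈ M.hhDeg n t ↔ ∃ z ∈ M.cycles (n - t), a = M.cls (n - t) z := by
  constructor
  · rintro ⟨x, rfl⟩
    obtain ⟨z, rfl⟩ := hhMk_surjective _ x
    exact ⟨z.1, z.2, (cls_of_mem z.2).symm⟩
  · rintro ⟨z, hz, rfl⟩
    rw [cls_of_mem hz]
    exact ⟨_, rfl⟩

lemma HHtot_induction {p : M.HHtot → Prop} (h0 : p 0)
    (h1 : ∀ m, ∀ z ∈ M.cycles m, p (M.cls m z)) (h2 : ∀ a b, p a → p b → p (a + b)) (a : M.HHtot) :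
    p a := by
  refine DirectSum.induction_on a h0 (fun m x => ?_) h2
  obtain ⟨z, rfl⟩ := hhMk_surjective _ x
  have := h1 m z.1 z.2
  rwa [cls_of_mem z.2] at this

lemma Bstar_cls {m : ℤ} {z : E} (hz : z ∈ M.cycles m) :
    M.Bstar (M.cls m z) = M.cls (m + 1) (M.B z) := by
  have hB : M.B z ∈ M.cycles (m + 1) := by
    refine ⟨M.B_mem m z hz.1, ?_⟩
    have h := M.b_B m z hz.1
    have hb : M.b z = 0 := hz.2
    rwa [hb, map_zero, add_zero] at h
  rw [cls_of_mem hz, cls_of_mem hB]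
  rw [Bstar, LinearMap.comp_apply, hhClass_eq, hhClass_eq, betaTot_lof, piTot_lof, beta_hhMk,
    piStar_hcMk]
  rfl

/-- `β ∘ π_* = 0`. -/
lemma betaTot_piTot (x : M.HCtot) : M.betaTot (M.piTot x) = 0 := by
  refine DirectSum.induction_on x (by simp) (fun m y => ?_) fun a b ha hb => by simp [ha, hb]
  obtain ⟨⟨y, hy⟩, rfl⟩ := hcMk_surjective _ y
  rw [← DirectSum.lof_eq_of k, piTot_lof, betaTot_lof, piStar_hcMk, beta_hhMk]
  have : hcMk M (m + 1) (M.betaCycles m (M.piCycles m ⟨y, hy⟩)) = 0 := by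
    refine (hcMk_eq_zero_iff _).2 ?_
    -- `(b + u B) (x₁ + x₂ u + ⋯) = - B x₀` because `∑ x_i u ^ i` is a cycle
    refine ⟨fun i => -(y (i + 1)), ?_, ?_⟩
    · refine M.mem_ncChains.2 fun i => Submodule.neg_mem _ ?_
      have h := M.mem_ncChains.1 hy.1 (i + 1)
      convert h using 2
      push_cast; ring
    · have hd : M.ncDiff y = 0 := hy.2
      funext i
      have h := congrFun hd (i + 1)
      rw [M.ncDiff_succ, Pi.zero_apply] at h
      change _ = (Pi.single (M := fun _ : ℕ => E) 0 (M.B (y 0)) : ℕ → E) i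
      match i with
      | 0 =>
        rw [M.ncDiff_zero, map_neg, Pi.single_eq_same]
        exact (eq_neg_of_add_eq_zero_right h).symm
      | j + 1 =>
        rw [M.ncDiff_succ, map_neg, map_neg, ← neg_add, h]
        simp
  rw [this, map_zero]

lemma piTot_mem {n t : ℤ} {x : M.HCtot} (hx : x ∈ M.hcDeg n t) : M.piTot x ∈ M.hhDeg n t := by
  obtain ⟨y, rfl⟩ := hx
  rw [piTot_lof]
  exact ⟨_, rfl⟩

lemma betaTot_mem {n t : ℤ} {x : M.HHtot} (hx : x ∈ M.hhDeg n t) :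
    M.betaTot x ∈ M.hcDeg n (t - 1) := by
  obtain ⟨y, rfl⟩ := hx
  rw [betaTot_lof, hcDeg, show n - (t - 1) = n - t + 1 by ring]
  exact ⟨_, rfl⟩

/-- The operator on `HC⁻_•` that multiplies the elements of degree `t` by `(-1) ^ t`. -/
def hcParity (M : MixedComplex k E) (n : ℤ) : M.HCtot →ₗ[k] M.HCtot :=
  DirectSum.toModule k ℤ _ fun m => sg (n - m) • DirectSum.lof k ℤ M.HC m

lemma hcParity_apply {n t : ℤ} {x : M.HCtot} (hx : x ∈ M.hcDeg n t) :
    hcParity M n x = sg t • x := by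
  obtain ⟨y, rfl⟩ := hx
  rw [hcParity, DirectSum.toModule_lof, LinearMap.smul_apply, sub_sub_cancel]

/-- A Batalin-Vilkovisky structure on Hochschild homology induces a gravity structure on negative
cyclic homology. -/
theorem hasInducedGravityStructure {n : ℤ} {one : M.HHtot} {mul : M.HHtot →ₗ[k] M.HHtot →ₗ[k] M.HHtot}
    (H : IsBVAlgebra (M.hhDeg n) one mul M.Bstar) : HasInducedGravityStructure M n one mul := by
  refine ⟨gravityBracket one mul M.piTot M.betaTot (hcParity M n),
    isGravityAlgebra H (fun t x hx => piTot_mem hx) (fun t x hx => betaTot_mem hx) betaTot_piTot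
      (fun x => rfl) (fun t x hx => hcParity_apply hx), fun l _ hl => ?_⟩
  rw [gravityBracket_apply (fun t x hx => hcParity_apply hx) hl, negOnePow_smul_eq]
  congr 2
  rw [IsBVAlgebra.listProd, mapSnd, List.foldr_map, List.foldr_map]

variable (M) in
/-- A product on the chains of a mixed complex that makes it a differential graded
Batalin-Vilkovisky algebra: elements of `C (n - s)` have degree `s`, and the product of elements of
degrees `s` and `t` is given by `mul s t`. -/
structure BVChains (n : ℤ) where
  mul : ℤ → ℤ → E →ₗ[k] E →ₗ[k] E
  one : E
  one_mem : one ∈ M.C n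
  b_one : M.b one = 0
  mul_mem : ∀ s t, ∀ x ∈ M.C (n - s), ∀ y ∈ M.C (n - t), mul s t x y ∈ M.C (n - (s + t))
  one_mul : ∀ t, ∀ y ∈ M.C (n - t), mul 0 t one y = y
  mul_comm : ∀ s t, ∀ x ∈ M.C (n - s), ∀ y ∈ M.C (n - t), mul s t x y = sg (s * t) • mul t s y x
  mul_assoc : ∀ s t r, ∀ x ∈ M.C (n - s), ∀ y ∈ M.C (n - t), ∀ z ∈ M.C (n - r),
    mul (s + t) r (mul s t x y) z = mul s (t + r) x (mul t r y z)
  b_mul : ∀ s t, ∀ x ∈ M.C (n - s), ∀ y ∈ M.C (n - t),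
    M.b (mul s t x y) = mul (s + 1) t (M.b x) y + sg s • mul s (t + 1) x (M.b y)
  second_order : ∀ s t r, ∀ x ∈ M.C (n - s), ∀ y ∈ M.C (n - t), ∀ z ∈ M.C (n - r),
    M.B (mul (s + t) r (mul s t x y) z) =
      mul (s + t - 1) r (M.B (mul s t x y)) z + sg s • mul s (t + r - 1) x (M.B (mul t r y z))
        + sg ((s - 1) * t) • mul t (s + r - 1) y (M.B (mul s r x z))
        - mul (s - 1 + t) r (mul (s - 1) t (M.B x) y) z
        - sg s • mul (s + (t - 1)) r (mul s (t - 1) x (M.B y)) z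
        - sg (s + t) • mul (s + t) (r - 1) (mul s t x y) (M.B z)

namespace BVChains

variable {n : ℤ} (S : M.BVChains n)

lemma mul_mem_cycles {s t : ℤ} {x y : E} (hx : x ∈ M.cycles (n - s)) (hy : y ∈ M.cycles (n - t)) :
    S.mul s t x y ∈ M.cycles (n - (s + t)) := by
  refine ⟨S.mul_mem s t x hx.1 y hy.1, ?_⟩
  have hx2 : M.b x = 0 := hx.2
  have hy2 : M.b y = 0 := hy.2
  change M.b _ = 0
  rw [S.b_mul s t x hx.1 y hy.1, hx2, hy2]
  simp

lemma mem_cast {m m' : ℤ} (h : m = m') {x : E} (hx : x ∈ M.cycles m) : x ∈ M.cycles m' := h ▸ hx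
lemma memC_cast {m m' : ℤ} (h : m = m') {x : E} (hx : x ∈ M.C m) : x ∈ M.C m' := h ▸ hx

lemma mulCycles_mem {m m' : ℤ} (z : M.cycles m) (w : M.cycles m') :
    S.mul (n - m) (n - m') z w ∈ M.cycles (m + m' - n) :=
  mem_cast (by ring) (S.mul_mem_cycles (mem_cast (sub_sub_cancel n m).symm z.2)
    (mem_cast (sub_sub_cancel n m').symm w.2))

/-- The product of cycles, with values in homology. -/
def mulCycles (m m' : ℤ) : M.cycles m →ₗ[k] M.cycles m' →ₗ[k] M.HHtot :=
  LinearMap.mk₂ k (fun z w => M.cls (m + m' - n) (S.mul (n - m) (n - m') z w))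
    (fun x y z => by rw [← cls_add (S.mulCycles_mem x z) (S.mulCycles_mem y z)]; simp)
    (fun c x z => by rw [← cls_smul c (S.mulCycles_mem x z)]; simp)
    (fun z x y => by rw [← cls_add (S.mulCycles_mem z x) (S.mulCycles_mem z y)]; simp)
    (fun c z x => by rw [← cls_smul c (S.mulCycles_mem z x)]; simp)

/-- The product of homology classes. -/
def mulHH (m m' : ℤ) : M.HH m →ₗ[k] M.HH m' →ₗ[k] M.HHtot :=
  Submodule.liftQ _ ((Submodule.liftQ ((M.boundaries m').submoduleOf (M.cycles m'))
    (S.mulCycles m m').flip (by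
      rintro ⟨w, hw⟩ hwb
      obtain ⟨y, hy, hyw⟩ := (Submodule.mem_comap.1 hwb : w ∈ M.boundaries m')
      refine LinearMap.ext fun z => ?_
      have hyw : M.b y = w := hyw
      change M.cls (m + m' - n) (S.mul (n - m) (n - m') z w) = 0
      have hz := memC_cast (sub_sub_cancel n m).symm z.2.1
      have hzb : M.b z = 0 := z.2.2
      have hy' : y ∈ M.C (n - (n - m' - 1)) := memC_cast (by ring) hy
      have h := S.b_mul (n - m) (n - m' - 1) z.1 hz y hy'
      rw [hzb, hyw, sub_add_cancel] at h
      have h2 : S.mul (n - m) (n - m') z.1 w =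
          M.b (sg (n - m) • S.mul (n - m) (n - m' - 1) z.1 y) := by
        rw [map_zsmul, h]
        simp [smul_smul, sg_mul_self]
      rw [h2]
      refine cls_eq_zero (zsmul_mem (memC_cast ?_ (S.mul_mem _ _ _ hz _ hy')) _)
      ring)).flip) (by
    rintro ⟨w, hw⟩ hwb
    obtain ⟨y, hy, hyw⟩ := (Submodule.mem_comap.1 hwb : w ∈ M.boundaries m)
    refine LinearMap.ext fun q => ?_
    obtain ⟨z, rfl⟩ := hhMk_surjective _ q
    have hyw : M.b y = w := hyw
    change M.cls (m + m' - n) (S.mul (n - m) (n - m') w z) = 0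
    have hz := memC_cast (sub_sub_cancel n m').symm z.2.1
    have hzb : M.b z = 0 := z.2.2
    have hy' : y ∈ M.C (n - (n - m - 1)) := memC_cast (by ring) hy
    have h := S.b_mul (n - m - 1) (n - m') y hy' z.1 hz
    rw [hzb, hyw, sub_add_cancel, map_zero, smul_zero, add_zero] at h
    rw [← h]
    refine cls_eq_zero (memC_cast ?_ (S.mul_mem _ _ _ hy' _ hz))
    ring)

/-- The product on total homology. -/
def hhMul : M.HHtot →ₗ[k] M.HHtot →ₗ[k] M.HHtot :=
  DirectSum.toModule k ℤ _ fun m =>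
    (DirectSum.toModule k ℤ (M.HH m →ₗ[k] M.HHtot) fun m' => (S.mulHH m m').flip).flip

lemma hhMul_cls {s t : ℤ} {x y : E} (hx : x ∈ M.cycles (n - s)) (hy : y ∈ M.cycles (n - t)) :
    S.hhMul (M.cls (n - s) x) (M.cls (n - t) y) = M.cls (n - (s + t)) (S.mul s t x y) := by
  have h : S.hhMul (M.cls (n - s) x) (M.cls (n - t) y) =
      M.cls (n - s + (n - t) - n) (S.mul (n - (n - s)) (n - (n - t)) x y) := by
    rw [cls_of_mem hx, cls_of_mem hy]
    rw [hhClass_eq, hhClass_eq, hhMul, DirectSum.toModule_lof, LinearMap.flip_apply,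
      DirectSum.toModule_lof, LinearMap.flip_apply]
    rfl
  rw [h, sub_sub_cancel, sub_sub_cancel]
  congr 1
  ring

/-- The Batalin-Vilkovisky structure on homology. -/
theorem isBVAlgebra : IsBVAlgebra (M.hhDeg n) (M.cls n S.one) S.hhMul M.Bstar := by
  have hone : S.one ∈ M.cycles n := ⟨S.one_mem, S.b_one⟩
  have hone' : S.one ∈ M.cycles (n - 0) := mem_cast (by ring) hone
  have hB : ∀ {t : ℤ} {z : E}, z ∈ M.cycles (n - t) → M.B z ∈ M.cycles (n - (t - 1)) := by
    intro t z hz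
    have hz2 : M.b z = 0 := hz.2
    have h := M.b_B _ z hz.1
    rw [hz2, map_zero, add_zero] at h
    exact mem_cast (by ring) (⟨M.B_mem _ z hz.1, h⟩ : M.B z ∈ M.cycles (n - t + 1))
  have hBs : ∀ {t : ℤ} {z : E}, z ∈ M.cycles (n - t) →
      M.Bstar (M.cls (n - t) z) = M.cls (n - (t - 1)) (M.B z) := by
    intro t z hz
    rw [Bstar_cls hz, show n - t + 1 = n - (t - 1) by ring]
  have hone_cls : M.cls n S.one = M.cls (n - 0) S.one := by rw [sub_zero]
  have hcycles : ∀ {m : ℤ} {z : E}, z ∈ M.cycles m → z ∈ M.cycles (n - (n - m)) :=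
    fun hz => mem_cast (sub_sub_cancel n _).symm hz
  have hc : ∀ {m m' : ℤ} (z : E), m = m' → M.cls m z = M.cls m' z := by
    rintro m _ z rfl; rfl
  refine ⟨?_, fun a => ?_, ?_, ?_, fun a b c => ?_, ?_, fun a => ?_, ?_⟩
  · exact mem_hhDeg.2 ⟨S.one, hone', hone_cls⟩
  · refine HHtot_induction (p := fun a => S.hhMul (M.cls n S.one) a = a) (by simp)
      (fun m z hz => ?_) (fun a b ha hb => by rw [map_add, ha, hb]) a
    rw [hone_cls, hc z (sub_sub_cancel n m).symm, S.hhMul_cls hone' (hcycles hz),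
      S.one_mul _ z (hcycles hz).1]
    exact hc z (by ring)
  · intro i j a ha b hb
    obtain ⟨x, hx, rfl⟩ := mem_hhDeg.1 ha
    obtain ⟨y, hy, rfl⟩ := mem_hhDeg.1 hb
    exact mem_hhDeg.2 ⟨_, S.mul_mem_cycles hx hy, S.hhMul_cls hx hy⟩
  · intro i j a ha b hb
    obtain ⟨x, hx, rfl⟩ := mem_hhDeg.1 ha
    obtain ⟨y, hy, rfl⟩ := mem_hhDeg.1 hb
    rw [S.hhMul_cls hx hy, S.hhMul_cls hy hx, negOnePow_smul_eq, S.mul_comm i j x hx.1 y hy.1,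
      hc _ (show n - (i + j) = n - (j + i) by ring), cls_zsmul _ (S.mul_mem_cycles hy hx)]
  · refine HHtot_induction (p := fun a => S.hhMul (S.hhMul a b) c = S.hhMul a (S.hhMul b c))
      (by simp) (fun m x hx => ?_)
      (fun a a' ha hb => by simp only [map_add, LinearMap.add_apply, ha, hb]) a
    refine HHtot_induction (p := fun b => S.hhMul (S.hhMul (M.cls m x) b) c = S.hhMul (M.cls m x) (S.hhMul b c))
      (by simp) (fun m' y hy => ?_)
      (fun a a' ha hb => by simp only [map_add, LinearMap.add_apply, ha, hb]) b
    refine HHtot_induction (p := fun c => S.hhMul (S.hhMul (M.cls m x) (M.cls m' y)) c =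
        S.hhMul (M.cls m x) (S.hhMul (M.cls m' y) c)) (by simp) (fun m'' z hz => ?_)
      (fun a a' ha hb => by simp only [map_add, ha, hb]) c
    rw [hc x (sub_sub_cancel n m).symm, hc y (sub_sub_cancel n m').symm,
      hc z (sub_sub_cancel n m'').symm]
    have hx := hcycles hx
    have hy := hcycles hy
    have hz := hcycles hz
    rw [S.hhMul_cls hx hy, S.hhMul_cls hy hz, S.hhMul_cls (S.mul_mem_cycles hx hy) hz,
      S.hhMul_cls hx (S.mul_mem_cycles hy hz), S.mul_assoc _ _ _ x hx.1 y hy.1 z hz.1]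
    exact hc _ (by ring)
  · intro i a ha
    obtain ⟨x, hx, rfl⟩ := mem_hhDeg.1 ha
    exact mem_hhDeg.2 ⟨_, hB hx, hBs hx⟩
  · refine HHtot_induction (p := fun a => M.Bstar (M.Bstar a) = 0) (by simp)
      (fun m z hz => ?_) (fun a b ha hb => by simp [ha, hb]) a
    rw [hc z (sub_sub_cancel n m).symm, hBs (hcycles hz), hBs (hB (hcycles hz)),
      M.B_B _ z (hcycles hz).1]
    have := cls_smul (M := M) (m := n - (n - m - 1 - 1)) (0 : k) (zero_mem _)
    simpa using this
  · intro i j l a ha b hb c hcc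
    obtain ⟨x, hx, rfl⟩ := mem_hhDeg.1 ha
    obtain ⟨y, hy, rfl⟩ := mem_hhDeg.1 hb
    obtain ⟨z, hz, rfl⟩ := mem_hhDeg.1 hcc
    have hxy := S.mul_mem_cycles hx hy
    have hyz := S.mul_mem_cycles hy hz
    have hxz := S.mul_mem_cycles hx hz
    have h1 := S.mul_mem_cycles (hB hxy) hz
    have h2 := S.mul_mem_cycles hx (hB hyz)
    have h3 := S.mul_mem_cycles hy (hB hxz)
    have h4 := S.mul_mem_cycles (S.mul_mem_cycles (hB hx) hy) hz
    have h5 := S.mul_mem_cycles (S.mul_mem_cycles hx (hB hy)) hz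
    have h6 := S.mul_mem_cycles hxy (hB hz)
    simp only [S.hhMul_cls hx hy, S.hhMul_cls hy hz, S.hhMul_cls hx hz, S.hhMul_cls hxy hz,
      hBs (S.mul_mem_cycles hxy hz), hBs hxy, hBs hyz, hBs hxz, hBs hx, hBs hy, hBs hz,
      S.hhMul_cls (hB hxy) hz, S.hhMul_cls hx (hB hyz), S.hhMul_cls hy (hB hxz),
      S.hhMul_cls (hB hx) hy, S.hhMul_cls hx (hB hy), S.hhMul_cls (S.mul_mem_cycles (hB hx) hy) hz,
      S.hhMul_cls (S.mul_mem_cycles hx (hB hy)) hz, S.hhMul_cls hxy (hB hz), negOnePow_smul_eq]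
    have e1 : n - (i + j - 1 + l) = n - (i + j + l - 1) := by ring
    have e2 : n - (i + (j + l - 1)) = n - (i + j + l - 1) := by ring
    have e3 : n - (j + (i + l - 1)) = n - (i + j + l - 1) := by ring
    have e4 : n - (i - 1 + j + l) = n - (i + j + l - 1) := by ring
    have e5 : n - (i + (j - 1) + l) = n - (i + j + l - 1) := by ring
    have e6 : n - (i + j + (l - 1)) = n - (i + j + l - 1) := by ring
    rw [e1] at h1 ⊢
    rw [e2] at h2 ⊢
    rw [e3] at h3 ⊢
    rw [e4] at h4 ⊢
    rw [e5] at h5 ⊢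
    rw [e6] at h6 ⊢
    rw [← cls_zsmul _ h2, ← cls_zsmul _ h3, ← cls_zsmul _ h5, ← cls_zsmul _ h6,
      ← cls_add h1 (zsmul_mem h2 _), ← cls_add (add_mem h1 (zsmul_mem h2 _)) (zsmul_mem h3 _),
      ← cls_sub (add_mem (add_mem h1 (zsmul_mem h2 _)) (zsmul_mem h3 _)) h4,
      ← cls_sub (sub_mem (add_mem (add_mem h1 (zsmul_mem h2 _)) (zsmul_mem h3 _)) h4)
        (zsmul_mem h5 _),
      ← cls_sub (sub_mem (sub_mem (add_mem (add_mem h1 (zsmul_mem h2 _)) (zsmul_mem h3 _)) h4)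
        (zsmul_mem h5 _)) (zsmul_mem h6 _),
      S.second_order i j l x hx.1 y hy.1 z hz.1]

end BVChains

end MixedComplex

/-! ### Second-order operators on algebras of polyvector type -/

/-- The formal properties shared by the polyvector fields of a Poisson algebra and the
multiderivations of a graded Poisson algebra, with a divergence operator `Δ` generating the
Schouten bracket. The space `X t` consists of the elements of degree `t`; `ins f` inserts the
function `f` into the first slot; `ev` takes the component without arguments; `cst h` is the
function `h` as an element without arguments. An element is determined by its iterated
insertions (`sep`), so that identities follow from their behaviour under `ins` and `ev`. -/
structure PolyCalculus (k : Type*) [Field k] (E : Type*) [AddCommGroup E] [Module k E]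
    (H : Type*) (R : Type*) [Ring R] [Module k R] where
  X : ℤ → Submodule k E
  mul : ℤ → ℤ → E →ₗ[k] E →ₗ[k] E
  one : E
  Δ : E →ₗ[k] E
  deg : H → ℤ
  ins : H → E →ₗ[k] E
  ev : E →ₗ[k] R
  cst : H → E
  one_mem : one ∈ X 0
  mul_mem : ∀ {s t : ℤ} {x y : E}, x ∈ X s → y ∈ X t → mul s t x y ∈ X (s + t)
  Δ_mem : ∀ {t : ℤ} {x : E}, x ∈ X t → Δ x ∈ X (t - 1)
  ins_mem : ∀ (f : H) {t : ℤ} {x : E}, x ∈ X t → ins f x ∈ X (t + deg f - 1)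
  cst_mem : ∀ h, cst h ∈ X (deg h)
  sep : ∀ {t : ℤ} {x : E}, x ∈ X t →
    (∀ l : List H, ev (l.foldl (fun y f => ins f y) x) = 0) → x = 0
  Δ_Δ : ∀ {t : ℤ} {x : E}, x ∈ X t → Δ (Δ x) = 0
  Δ_one : Δ one = 0
  ins_one : ∀ f, ins f one = 0
  ins_cst : ∀ f h, ins f (cst h) = 0
  ins_mul : ∀ (f : H) {s t : ℤ} {x y : E}, x ∈ X s → y ∈ X t →
    ins f (mul s t x y) = sg (t * deg f) • mul (s + deg f - 1) t (ins f x) y +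
      sg s • mul s (t + deg f - 1) x (ins f y)
  ins_Δ : ∀ (f : H) {t : ℤ} {x : E}, x ∈ X t → ins f (Δ x) = -Δ (ins f x)
  ins_ins : ∀ (f g : H) {t : ℤ} {x : E}, x ∈ X t →
    ins f (ins g x) = -(sg (deg f * deg g) • ins g (ins f x))
  ev_one_mul : ∀ {t : ℤ} {x : E}, x ∈ X t → ev (mul 0 t one x) = ev x
  ev_mul : ∀ {s t : ℤ} {x y : E}, x ∈ X s → y ∈ X t → ev (mul s t x y) = ev x * ev y
  ev_comm : ∀ {s t : ℤ} {x y : E}, x ∈ X s → y ∈ X t → ev x * ev y = sg (s * t) • (ev y * ev x)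
  ev_second_order : ∀ {s t r : ℤ} {x y z : E}, x ∈ X s → y ∈ X t → z ∈ X r →
    ev (Δ (mul s (t + r) x (mul t r y z)) - mul (s - 1) (t + r) (Δ x) (mul t r y z) -
        sg s • mul s (t + r - 1) x (Δ (mul t r y z))) =
      ev (Δ (mul s t x y) - mul (s - 1) t (Δ x) y - sg s • mul s (t - 1) x (Δ y)) * ev z +
      sg ((s - 1) * t) • (ev y *
        ev (Δ (mul s r x z) - mul (s - 1) r (Δ x) z - sg s • mul s (r - 1) x (Δ z)))
  ev_cst : ∀ (h : H) {t : ℤ} {x : E}, x ∈ X t →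
    ev (Δ (mul (deg h) t (cst h) x) - mul (deg h - 1) t (Δ (cst h)) x -
        sg (deg h) • mul (deg h) (t - 1) (cst h) (Δ x)) = sg (deg h * t) • ev (ins h x)
  ev_bkt : ∀ {s t : ℤ} {x y : E}, x ∈ X s → y ∈ X t → ev x = 0 → ev y = 0 →
    ev (Δ (mul s t x y) - mul (s - 1) t (Δ x) y - sg s • mul s (t - 1) x (Δ y)) = 0

namespace PolyCalculus

variable {k : Type*} [Field k] {E : Type*} [AddCommGroup E] [Module k E]
  {H : Type*} {R : Type*} [Ring R] [Module k R] (S : PolyCalculus k E H R)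

lemma mem_cast {s t : ℤ} (h : s = t) {x : E} (hx : x ∈ S.X s) : x ∈ S.X t := h ▸ hx

lemma mul_mem' {s t r : ℤ} {x y : E} (hx : x ∈ S.X s) (hy : y ∈ S.X t) (h : s + t = r) :
    S.mul s t x y ∈ S.X r := h ▸ S.mul_mem hx hy

/-- The induction on insertions: a family of homogeneous elements killed by `ev`, whose
insertions are combinations of members of the family, vanishes. -/
lemma eq_zero_of_family (D : Set E) (hD : ∀ x ∈ D, ∃ t, x ∈ S.X t) (h0 : ∀ x ∈ D, S.ev x = 0)
    (h1 : ∀ x ∈ D, ∀ f, S.ins f x ∈ Submodule.span k D) {x : E} (hx : x ∈ D) : x = 0 := by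
  obtain ⟨t, ht⟩ := hD x hx
  have key : ∀ l : List H, ∀ y ∈ Submodule.span k D,
      S.ev (l.foldl (fun y f => S.ins f y) y) = 0 := by
    intro l
    induction l with
    | nil =>
      intro y hy
      have : Submodule.span k D ≤ LinearMap.ker S.ev := Submodule.span_le.2 h0
      exact this hy
    | cons f l ih =>
      intro y hy
      have : Submodule.span k D ≤ (Submodule.span k D).comap (S.ins f) :=
        Submodule.span_le.2 fun z hz => h1 z hz f
      exact ih _ (this hy)
  exact S.sep ht fun l => key l x (Submodule.subset_span hx)

lemma one_mul {t : ℤ} {x : E} (hx : x ∈ S.X t) : S.mul 0 t S.one x = x := by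
  refine sub_eq_zero.1 (S.eq_zero_of_family
    {d | ∃ t x, x ∈ S.X t ∧ d = S.mul 0 t S.one x - x} ?_ ?_ ?_ ⟨t, x, hx, rfl⟩)
  · rintro _ ⟨t, x, hx, rfl⟩
    exact ⟨t, sub_mem (S.mul_mem' S.one_mem hx (zero_add t)) hx⟩
  · rintro _ ⟨t, x, hx, rfl⟩
    rw [map_sub, S.ev_one_mul hx, sub_self]
  · rintro _ ⟨t, x, hx, rfl⟩ f
    rw [map_sub, S.ins_mul f S.one_mem hx, S.ins_one, map_zero, LinearMap.zero_apply, smul_zero,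
      zero_add, sg_zero, one_smul]
    exact Submodule.subset_span ⟨_, _, S.ins_mem f hx, rfl⟩

lemma mul_assoc {s t r : ℤ} {x y z : E} (hx : x ∈ S.X s) (hy : y ∈ S.X t) (hz : z ∈ S.X r) :
    S.mul (s + t) r (S.mul s t x y) z = S.mul s (t + r) x (S.mul t r y z) := by
  let D : ℤ → ℤ → ℤ → E → E → E → E := fun s t r x y z =>
    S.mul (s + t) r (S.mul s t x y) z - S.mul s (t + r) x (S.mul t r y z)
  refine sub_eq_zero.1 (S.eq_zero_of_family
    {d | ∃ s t r x y z, x ∈ S.X s ∧ y ∈ S.X t ∧ z ∈ S.X r ∧ d = D s t r x y z} ?_ ?_ ?_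
    ⟨s, t, r, x, y, z, hx, hy, hz, rfl⟩)
  · rintro _ ⟨s, t, r, x, y, z, hx, hy, hz, rfl⟩
    exact ⟨s + t + r, sub_mem (S.mul_mem (S.mul_mem hx hy) hz)
      (S.mul_mem' hx (S.mul_mem hy hz) (by ring))⟩
  · rintro _ ⟨s, t, r, x, y, z, hx, hy, hz, rfl⟩
    simp only [D, map_sub]
    rw [S.ev_mul (S.mul_mem hx hy) hz, S.ev_mul hx hy, S.ev_mul hx (S.mul_mem hy hz),
      S.ev_mul hy hz, _root_.mul_assoc, sub_self]
  · rintro _ ⟨s, t, r, x, y, z, hx, hy, hz, rfl⟩ f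
    have e : S.ins f (D s t r x y z) =
        sg ((t + r) * S.deg f) • D (s + S.deg f - 1) t r (S.ins f x) y z +
        (sg (r * S.deg f + s) • D s (t + S.deg f - 1) r x (S.ins f y) z +
          sg (s + t) • D s t (r + S.deg f - 1) x y (S.ins f z)) := by
      simp only [D, map_sub]
      rw [S.ins_mul f (S.mul_mem hx hy) hz, S.ins_mul f hx (S.mul_mem hy hz), S.ins_mul f hx hy,
        S.ins_mul f hy hz, show s + t + S.deg f - 1 = s + S.deg f - 1 + t by ring]
      rw [show s + S.deg f - 1 + t = s + (t + S.deg f - 1) by ring,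
        show t + r + S.deg f - 1 = t + S.deg f - 1 + r by ring]
      simp only [map_add, map_zsmul, LinearMap.add_apply, LinearMap.smul_apply, smul_add,
        smul_sub, smul_smul, ← sg_add]
      rw [show t + S.deg f - 1 + r = t + (r + S.deg f - 1) by ring,
        show r * S.deg f + t * S.deg f = (t + r) * S.deg f by ring,
        show s + r * S.deg f = r * S.deg f + s by ring]
      abel
    rw [e]
    refine add_mem (zsmul_mem (Submodule.subset_span ?_) _)
      (add_mem (zsmul_mem (Submodule.subset_span ?_) _) (zsmul_mem (Submodule.subset_span ?_) _))
    · exact ⟨_, _, _, _, _, _, S.ins_mem f hx, hy, hz, rfl⟩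
    · exact ⟨_, _, _, _, _, _, hx, S.ins_mem f hy, hz, rfl⟩
    · exact ⟨_, _, _, _, _, _, hx, hy, S.ins_mem f hz, rfl⟩

lemma mul_comm {s t : ℤ} {x y : E} (hx : x ∈ S.X s) (hy : y ∈ S.X t) :
    S.mul s t x y = sg (s * t) • S.mul t s y x := by
  let D : ℤ → ℤ → E → E → E := fun s t x y => S.mul s t x y - sg (s * t) • S.mul t s y x
  refine sub_eq_zero.1 (S.eq_zero_of_family
    {d | ∃ s t x y, x ∈ S.X s ∧ y ∈ S.X t ∧ d = D s t x y} ?_ ?_ ?_ ⟨s, t, x, y, hx, hy, rfl⟩)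
  · rintro _ ⟨s, t, x, y, hx, hy, rfl⟩
    exact ⟨s + t, sub_mem (S.mul_mem hx hy) (zsmul_mem (S.mul_mem' hy hx (by ring)) _)⟩
  · rintro _ ⟨s, t, x, y, hx, hy, rfl⟩
    simp only [D, map_sub, map_zsmul]
    rw [S.ev_mul hx hy, S.ev_mul hy hx, S.ev_comm hx hy, sub_self]
  · rintro _ ⟨s, t, x, y, hx, hy, rfl⟩ f
    have e : S.ins f (D s t x y) =
        sg (t * S.deg f) • D (s + S.deg f - 1) t (S.ins f x) y +
        sg s • D s (t + S.deg f - 1) x (S.ins f y) := by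
      simp only [D, map_sub, map_zsmul]
      rw [S.ins_mul f hx hy, S.ins_mul f hy hx]
      simp only [smul_add, smul_sub, smul_smul, ← sg_add]
      rw [sg_congr (a := s * t + t) (b := t * S.deg f + (s + S.deg f - 1) * t)
          ⟨t - t * S.deg f, by ring⟩,
        sg_congr (a := s * t + s * S.deg f) (b := s + s * (t + S.deg f - 1)) ⟨0, by ring⟩]
      abel
    rw [e]
    refine add_mem (zsmul_mem (Submodule.subset_span ?_) _)
      (zsmul_mem (Submodule.subset_span ?_) _)
    · exact ⟨_, _, _, _, S.ins_mem f hx, hy, rfl⟩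
    · exact ⟨_, _, _, _, hx, S.ins_mem f hy, rfl⟩

/-- The bracket generated by `Δ`: its failure to be a derivation of the product. -/
def bkt (s t : ℤ) : E →ₗ[k] E →ₗ[k] E :=
  (S.mul s t).compr₂ S.Δ - S.mul (s - 1) t ∘ₗ S.Δ -
    (sg s : k) • (S.mul s (t - 1)).compl₂ S.Δ

lemma bkt_apply (s t : ℤ) (x y : E) : S.bkt s t x y =
    S.Δ (S.mul s t x y) - S.mul (s - 1) t (S.Δ x) y - sg s • S.mul s (t - 1) x (S.Δ y) := by
  rw [bkt, LinearMap.sub_apply, LinearMap.sub_apply, LinearMap.smul_apply, LinearMap.sub_apply,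
    LinearMap.sub_apply, LinearMap.smul_apply, cast_sg_smul]
  rfl

lemma bkt_mem {s t : ℤ} {x y : E} (hx : x ∈ S.X s) (hy : y ∈ S.X t) :
    S.bkt s t x y ∈ S.X (s + t - 1) := by
  rw [bkt_apply]
  exact sub_mem (sub_mem (S.Δ_mem (S.mul_mem hx hy)) (S.mul_mem' (S.Δ_mem hx) hy (by ring)))
    (zsmul_mem (S.mul_mem' hx (S.Δ_mem hy) (by ring)) _)

lemma bkt_mem' {s t r : ℤ} {x y : E} (hx : x ∈ S.X s) (hy : y ∈ S.X t) (h : s + t - 1 = r) :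
    S.bkt s t x y ∈ S.X r := h ▸ S.bkt_mem hx hy

lemma bkt_comm {s t : ℤ} {x y : E} (hx : x ∈ S.X s) (hy : y ∈ S.X t) :
    S.bkt s t x y = sg (s * t) • S.bkt t s y x := by
  rw [bkt_apply, bkt_apply, S.mul_comm hx hy, S.mul_comm (S.Δ_mem hx) hy,
    S.mul_comm hx (S.Δ_mem hy)]
  simp only [map_zsmul, smul_sub, smul_smul, ← sg_add]
  rw [sg_congr (a := (s - 1) * t) (b := s * t + t) ⟨-t, by ring⟩,
    sg_congr (a := s + s * (t - 1)) (b := s * t) ⟨0, by ring⟩]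
  abel

lemma ins_bkt (f : H) {s t : ℤ} {x y : E} (hx : x ∈ S.X s) (hy : y ∈ S.X t) :
    S.ins f (S.bkt s t x y) = -(sg (t * S.deg f) • S.bkt (s + S.deg f - 1) t (S.ins f x) y) -
      sg s • S.bkt s (t + S.deg f - 1) x (S.ins f y) := by
  rw [bkt_apply, bkt_apply, bkt_apply, map_sub, map_sub, map_zsmul, S.ins_Δ f (S.mul_mem hx hy),
    S.ins_mul f hx hy, S.ins_mul f (S.Δ_mem hx) hy, S.ins_mul f hx (S.Δ_mem hy), S.ins_Δ f hx,
    S.ins_Δ f hy, show s - 1 + S.deg f - 1 = s + S.deg f - 1 - 1 by ring,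
    show t - 1 + S.deg f - 1 = t + S.deg f - 1 - 1 by ring]
  simp only [map_zsmul, map_add, map_neg, LinearMap.neg_apply, smul_sub, smul_add, smul_neg,
    smul_smul, ← sg_add]
  rw [show sg (s - 1) = - sg s by rw [sg_sub, sg_one, mul_neg_one],
    sg_congr (a := s + (t - 1) * S.deg f) (b := t * S.deg f + (s + S.deg f - 1) + 1)
      ⟨-S.deg f, by ring⟩, sg_add _ 1, sg_one]
  simp only [mul_neg_one, neg_smul]
  abel

/-- The bracket is a derivation of the product: `Δ` is an operator of second order. -/
lemma bkt_mul {s t r : ℤ} {x y z : E} (hx : x ∈ S.X s) (hy : y ∈ S.X t) (hz : z ∈ S.X r) :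
    S.bkt s (t + r) x (S.mul t r y z) = S.mul (s + t - 1) r (S.bkt s t x y) z +
      sg ((s - 1) * t) • S.mul t (s + r - 1) y (S.bkt s r x z) := by
  let D : ℤ → ℤ → ℤ → E → E → E → E := fun s t r x y z =>
    S.bkt s (t + r) x (S.mul t r y z) - (S.mul (s + t - 1) r (S.bkt s t x y) z +
      sg ((s - 1) * t) • S.mul t (s + r - 1) y (S.bkt s r x z))
  refine sub_eq_zero.1 (S.eq_zero_of_family
    {d | ∃ s t r x y z, x ∈ S.X s ∧ y ∈ S.X t ∧ z ∈ S.X r ∧ d = D s t r x y z} ?_ ?_ ?_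
    ⟨s, t, r, x, y, z, hx, hy, hz, rfl⟩)
  · rintro _ ⟨s, t, r, x, y, z, hx, hy, hz, rfl⟩
    refine ⟨s + t + r - 1, sub_mem (S.bkt_mem' hx (S.mul_mem hy hz) (by ring))
      (add_mem (S.mul_mem' (S.bkt_mem hx hy) hz (by ring))
        (zsmul_mem (S.mul_mem' hy (S.bkt_mem hx hz) (by ring)) _))⟩
  · rintro _ ⟨s, t, r, x, y, z, hx, hy, hz, rfl⟩
    simp only [D]
    rw [map_sub, map_add, map_zsmul, S.ev_mul (S.bkt_mem hx hy) hz, S.ev_mul hy (S.bkt_mem hx hz),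
      bkt_apply, bkt_apply, bkt_apply, S.ev_second_order hx hy hz, sub_self]
  · rintro _ ⟨s, t, r, x, y, z, hx, hy, hz, rfl⟩ f
    have e : S.ins f (D s t r x y z) =
        sg ((t + r) * S.deg f + 1) • D (s + S.deg f - 1) t r (S.ins f x) y z +
        (sg (s + r * S.deg f + 1) • D s (t + S.deg f - 1) r x (S.ins f y) z +
          sg (s + t + 1) • D s t (r + S.deg f - 1) x y (S.ins f z)) := by
      simp only [D, map_sub, map_add, map_zsmul]
      rw [S.ins_bkt f hx (S.mul_mem hy hz), S.ins_mul f hy hz,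
        S.ins_mul f (S.bkt_mem hx hy) hz, S.ins_mul f hy (S.bkt_mem hx hz),
        S.ins_bkt f hx hy, S.ins_bkt f hx hz,
        show t + r + S.deg f - 1 = t + S.deg f - 1 + r by ring]
      rw [show s + S.deg f - 1 + t - 1 = s + t - 1 + S.deg f - 1 by ring,
        show s + S.deg f - 1 + r - 1 = s + r - 1 + S.deg f - 1 by ring,
        show s + (t + S.deg f - 1) - 1 = s + t - 1 + S.deg f - 1 by ring,
        show s + (r + S.deg f - 1) - 1 = s + r - 1 + S.deg f - 1 by ring,
        show t + (r + S.deg f - 1) = t + S.deg f - 1 + r by ring]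
      simp only [map_add, map_sub, map_neg, map_zsmul, LinearMap.sub_apply,
        LinearMap.neg_apply, LinearMap.smul_apply, smul_add, smul_neg,
        smul_sub, smul_smul, ← sg_add]
      rw [sg_congr (a := (t + r) * S.deg f + 1 + (s + S.deg f - 1 - 1) * t)
          (b := (s - 1) * t + t + r * S.deg f + 1) ⟨S.deg f * t - t, by ring⟩,
        sg_congr (a := s + r * S.deg f + 1 + (s - 1) * (t + S.deg f - 1))
          (b := (s - 1) * t + (s + r - 1) * S.deg f)
          ⟨1 , by ring⟩,
        sg_congr (a := s + t + 1 + (s - 1) * t) (b := (s - 1) * t + (t + s) + 1) ⟨0, by ring⟩,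
        show (t + r) * S.deg f = r * S.deg f + t * S.deg f by ring,
        sg_congr (a := s + r * S.deg f + 1) (b := r * S.deg f + s + 1) ⟨0, by ring⟩,
        sg_congr (a := s + t - 1) (b := s + t + 1) ⟨-1, by ring⟩]
      simp only [sg_add _ 1, sg_one, mul_neg_one, neg_smul]
      abel_nf
    rw [e]
    refine add_mem (zsmul_mem (Submodule.subset_span ?_) _)
      (add_mem (zsmul_mem (Submodule.subset_span ?_) _) (zsmul_mem (Submodule.subset_span ?_) _))
    · exact ⟨_, _, _, _, _, _, S.ins_mem f hx, hy, hz, rfl⟩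
    · exact ⟨_, _, _, _, _, _, hx, S.ins_mem f hy, hz, rfl⟩
    · exact ⟨_, _, _, _, _, _, hx, hy, S.ins_mem f hz, rfl⟩

/-- The bracket with a function is an insertion. -/
lemma bkt_cst (h : H) {t : ℤ} {x : E} (hx : x ∈ S.X t) :
    S.bkt (S.deg h) t (S.cst h) x = sg (S.deg h * t) • S.ins h x := by
  refine sub_eq_zero.1 (S.eq_zero_of_family
    {d | ∃ t x, x ∈ S.X t ∧ d = S.bkt (S.deg h) t (S.cst h) x - sg (S.deg h * t) • S.ins h x}
    ?_ ?_ ?_ ⟨t, x, hx, rfl⟩)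
  · rintro _ ⟨t, x, hx, rfl⟩
    exact ⟨_, sub_mem (S.bkt_mem (S.cst_mem h) hx)
      (zsmul_mem (S.mem_cast (by ring) (S.ins_mem h hx)) _)⟩
  · rintro _ ⟨t, x, hx, rfl⟩
    rw [map_sub, map_zsmul, bkt_apply, S.ev_cst h hx, sub_self]
  · rintro _ ⟨t, x, hx, rfl⟩ f
    rw [map_sub, S.ins_bkt f (S.cst_mem h) hx, S.ins_cst, map_zero, LinearMap.zero_apply,
      smul_zero, neg_zero, zero_sub, map_zsmul, S.ins_ins f h hx, smul_neg, sub_neg_eq_add,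
      smul_smul, ← sg_add, sg_congr (a := S.deg h * t + S.deg f * S.deg h)
        (b := S.deg h + S.deg h * (t + S.deg f - 1)) ⟨0, by ring⟩, sg_add, mul_smul,
        neg_add_eq_sub, ← smul_sub, ← neg_sub, smul_neg]
    refine neg_mem (zsmul_mem (Submodule.subset_span ?_) _)
    exact ⟨_, _, S.ins_mem f hx, rfl⟩

end PolyCalculus

namespace PolyCalculus

variable {k : Type*} [Field k] {E : Type*} [AddCommGroup E] [Module k E]
  {H : Type*} {R : Type*} [Ring R] [Module k R] (S : PolyCalculus k E H R)

lemma eq_zero_of_ins {t : ℤ} {x : E} (hx : x ∈ S.X t) (h0 : S.ev x = 0)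
    (h1 : ∀ f, S.ins f x = 0) : x = 0 := by
  refine S.eq_zero_of_family {x} ?_ ?_ ?_ rfl
  · rintro _ rfl; exact ⟨t, hx⟩
  · rintro _ rfl; exact h0
  · rintro _ rfl f
    rw [h1 f]
    exact zero_mem _

/-- A Poisson bivector `pi` in a calculus of polyvectors. Contracting it with two functions gives
their bracket `brH`, which satisfies the graded Jacobi identity. -/
structure Bivector where
  pi : E
  brH : H → H → H
  pi_mem : pi ∈ S.X 2
  deg_brH : ∀ f g, S.deg (brH f g) = S.deg f + S.deg g
  ev_pi : S.ev pi = 0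
  ev_ins_pi : ∀ f, S.ev (S.ins f pi) = 0
  ins_ins_pi : ∀ f g, S.ins g (S.ins f pi) = S.cst (brH f g)
  jacobi : ∀ f g h, S.cst (brH f (brH g h)) =
    S.cst (brH (brH f g) h) + sg (S.deg f * S.deg g) • S.cst (brH g (brH f h))

/-- A Poisson bivector together with the operator `b` of bracketing with it. -/
structure Poisson extends S.Bivector where
  b : E →ₗ[k] E
  b_apply : ∀ {t : ℤ} {x : E}, x ∈ S.X t → b x = S.bkt 2 t pi x

namespace Bivector

variable {S} (Q : S.Bivector)

lemma ins_pi_mem (f : H) : S.ins f Q.pi ∈ S.X (S.deg f + 1) :=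
  S.mem_cast (by ring) (S.ins_mem f Q.pi_mem)

lemma bkt_ham_cst (f a : H) :
    S.bkt (S.deg f + 1) (S.deg a) (S.ins f Q.pi) (S.cst a) = S.cst (Q.brH f a) := by
  rw [S.bkt_comm (Q.ins_pi_mem f) (S.cst_mem a), S.bkt_cst a (Q.ins_pi_mem f), smul_smul, ← sg_add,
    Q.ins_ins_pi, sg_congr (b := 0) ⟨S.deg a * (S.deg f + 1), by ring⟩, sg_zero, one_smul]

lemma ins_bkt_ham (f g : H) {t : ℤ} {x : E} (hx : x ∈ S.X t) :
    S.ins g (S.bkt (S.deg f + 1) t (S.ins f Q.pi) x) =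
      -(sg (t * S.deg f) • S.ins (Q.brH f g) x) +
        sg (S.deg f) • S.bkt (S.deg f + 1) (t + S.deg g - 1) (S.ins f Q.pi) (S.ins g x) := by
  rw [S.ins_bkt g (Q.ins_pi_mem f) hx, Q.ins_ins_pi,
    show S.deg f + 1 + S.deg g - 1 = S.deg (Q.brH f g) by rw [Q.deg_brH]; ring,
    S.bkt_cst _ hx, smul_smul, ← sg_add, Q.deg_brH,
    sg_congr (a := t * S.deg g + (S.deg f + S.deg g) * t) (b := t * S.deg f)
      ⟨t * S.deg g, by ring⟩, sg_add _ 1, sg_one, mul_neg_one, neg_smul, sub_neg_eq_add]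

lemma ins_bkt_pi (f : H) {t : ℤ} {x : E} (hx : x ∈ S.X t) :
    S.ins f (S.bkt 2 t Q.pi x) = -(sg (t * S.deg f) • S.bkt (S.deg f + 1) t (S.ins f Q.pi) x) -
      S.bkt 2 (t + S.deg f - 1) Q.pi (S.ins f x) := by
  rw [S.ins_bkt f Q.pi_mem hx, sg_two, one_smul, show 2 + S.deg f - 1 = S.deg f + 1 by ring]

lemma bkt_ham_pi (f : H) : S.bkt (S.deg f + 1) 2 (S.ins f Q.pi) Q.pi = 0 := by
  have m1 := S.bkt_mem (Q.ins_pi_mem f) Q.pi_mem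
  refine S.eq_zero_of_ins m1 ?_ fun g => ?_
  · rw [bkt_apply]
    exact S.ev_bkt (Q.ins_pi_mem f) Q.pi_mem (Q.ev_ins_pi f) Q.ev_pi
  · refine S.eq_zero_of_ins (S.ins_mem g m1) ?_ fun h => ?_
    · rw [Q.ins_bkt_ham f g Q.pi_mem, map_add, map_neg, map_zsmul, map_zsmul, Q.ev_ins_pi,
        bkt_apply, show (2 : ℤ) + S.deg g - 1 = S.deg g + 1 by ring,
        S.ev_bkt (Q.ins_pi_mem f) (Q.ins_pi_mem g) (Q.ev_ins_pi f) (Q.ev_ins_pi g)]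
      simp
    · rw [Q.ins_bkt_ham f g Q.pi_mem, map_add, map_neg, map_zsmul, map_zsmul, Q.ins_ins_pi,
        show (2 : ℤ) + S.deg g - 1 = S.deg g + 1 by ring, Q.ins_bkt_ham f h (Q.ins_pi_mem g),
        Q.ins_ins_pi, Q.ins_ins_pi,
        show S.deg g + 1 + S.deg h - 1 = S.deg (Q.brH g h) by rw [Q.deg_brH]; ring,
        Q.bkt_ham_cst, Q.jacobi f g h]
      simp only [smul_add, smul_neg, smul_smul, ← sg_add]
      rw [
        sg_congr (a := 2 * S.deg f) (b := 0) ⟨S.deg f, by ring⟩,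
        sg_congr (a := S.deg f + S.deg f) (b := 0) ⟨S.deg f, by ring⟩,
        sg_congr (a := S.deg f + (S.deg g + 1) * S.deg f) (b := S.deg f * S.deg g)
          ⟨S.deg f, by ring⟩,
        sg_congr (a := S.deg f + (S.deg f + S.deg f * S.deg g)) (b := S.deg f * S.deg g)
          ⟨S.deg f, by ring⟩, sg_zero, one_smul]
      abel

lemma bkt_pi_pi : S.bkt 2 2 Q.pi Q.pi = 0 := by
  refine S.eq_zero_of_ins (S.bkt_mem Q.pi_mem Q.pi_mem) ?_ fun f => ?_
  · rw [bkt_apply]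
    exact S.ev_bkt Q.pi_mem Q.pi_mem Q.ev_pi Q.ev_pi
  · rw [Q.ins_bkt_pi f Q.pi_mem, show (2 : ℤ) + S.deg f - 1 = S.deg f + 1 by ring,
      S.bkt_comm Q.pi_mem (Q.ins_pi_mem f), Q.bkt_ham_pi]
    simp

end Bivector

namespace Poisson

variable {S} (Q : S.Poisson)

lemma b_mem {t : ℤ} {x : E} (hx : x ∈ S.X t) : Q.b x ∈ S.X (t + 1) := by
  rw [Q.b_apply hx]
  exact S.bkt_mem' Q.pi_mem hx (by ring)

lemma b_mul {s t : ℤ} {x y : E} (hx : x ∈ S.X s) (hy : y ∈ S.X t) :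
    Q.b (S.mul s t x y) = S.mul (s + 1) t (Q.b x) y + sg s • S.mul s (t + 1) x (Q.b y) := by
  rw [Q.b_apply hx, Q.b_apply hy, Q.b_apply (S.mul_mem hx hy), S.bkt_mul Q.pi_mem hx hy,
    show (2 : ℤ) + s - 1 = s + 1 by ring, show (2 : ℤ) + t - 1 = t + 1 by ring,
    show ((2 : ℤ) - 1) * s = s by ring]

lemma b_pi : Q.b Q.pi = 0 := by rw [Q.b_apply Q.pi_mem, Q.bkt_pi_pi]

lemma b_one : Q.b S.one = 0 := by
  have h : S.mul 2 0 Q.pi S.one = Q.pi := by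
    rw [S.mul_comm Q.pi_mem S.one_mem, S.one_mul Q.pi_mem, mul_zero, sg_zero, one_smul]
  have h' : S.mul (2 - 1) 0 (S.Δ Q.pi) S.one = S.Δ Q.pi := by
    rw [S.mul_comm (S.Δ_mem Q.pi_mem) S.one_mem, S.one_mul (S.Δ_mem Q.pi_mem), mul_zero, sg_zero,
      one_smul]
  rw [Q.b_apply S.one_mem, bkt_apply, h, h', S.Δ_one, map_zero, smul_zero, sub_self, sub_zero]

/-- The commutator of `b` and `Δ`, a derivation: it is the bracket with the modular vector. -/
def lie : E →ₗ[k] E := Q.b ∘ₗ S.Δ + S.Δ ∘ₗ Q.b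

lemma lie_apply (x : E) : Q.lie x = Q.b (S.Δ x) + S.Δ (Q.b x) := rfl

/-- The modular vector `-Δ π`. -/
def modular : E := -S.Δ Q.pi

lemma modular_mem : Q.modular ∈ S.X 1 := neg_mem (S.mem_cast (by ring) (S.Δ_mem Q.pi_mem))

lemma lie_mem {t : ℤ} {x : E} (hx : x ∈ S.X t) : Q.lie x ∈ S.X t :=
  add_mem (S.mem_cast (by ring) (Q.b_mem (S.Δ_mem hx)))
    (S.mem_cast (by ring) (S.Δ_mem (Q.b_mem hx)))

lemma lie_eq {t : ℤ} {x : E} (hx : x ∈ S.X t) : Q.lie x = S.bkt 1 t Q.modular x := by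
  rw [lie_apply, Q.b_apply (S.Δ_mem hx), Q.b_apply hx, bkt_apply, bkt_apply, bkt_apply, modular,
    S.Δ_Δ hx, sg_two, sg_one, show (2 : ℤ) - 1 = 1 by ring, map_sub,
    map_sub, S.Δ_Δ (S.mul_mem Q.pi_mem hx), map_zsmul]
  simp only [map_neg, LinearMap.neg_apply, S.Δ_Δ Q.pi_mem, map_zero, LinearMap.zero_apply]
  simp

lemma lie_mul {s t : ℤ} {x y : E} (hx : x ∈ S.X s) (hy : y ∈ S.X t) :
    Q.lie (S.mul s t x y) = S.mul s t (Q.lie x) y + S.mul s t x (Q.lie y) := by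
  rw [Q.lie_eq hx, Q.lie_eq hy, Q.lie_eq (S.mul_mem hx hy), S.bkt_mul Q.modular_mem hx hy,
    show (1 : ℤ) + s - 1 = s by ring, show (1 : ℤ) + t - 1 = t by ring,
    show ((1 : ℤ) - 1) * s = 0 by ring, sg_zero, one_smul]

lemma lie_one : Q.lie S.one = 0 := by
  rw [lie_apply, S.Δ_one, Q.b_one, map_zero, map_zero, add_zero]

/-- The operator `b` squares to zero. With `[b, Δ] = L` and `b = [Δ, π] + ν`, where `b` commutes
with multiplication by `π`, one finds `2 b² = L(π) + b(ν)`, which vanishes by the definition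
of `L`. -/
lemma b_b [CharZero k] {t : ℤ} {x : E} (hx : x ∈ S.X t) : Q.b (Q.b x) = 0 := by
  have hb : ∀ {t : ℤ} {x : E}, x ∈ S.X t → Q.b x = S.Δ (S.mul 2 t Q.pi x) -
      S.mul 2 (t - 1) Q.pi (S.Δ x) + S.mul 1 t Q.modular x := by
    intro t x hx
    rw [Q.b_apply hx, bkt_apply, modular, sg_two, one_smul, map_neg, LinearMap.neg_apply,
      show (2 : ℤ) - 1 = 1 by ring]
    abel
  have hpi : ∀ {t : ℤ} {x : E}, x ∈ S.X t →
      Q.b (S.mul 2 t Q.pi x) = S.mul 2 (t + 1) Q.pi (Q.b x) := by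
    intro t x hx
    rw [Q.b_mul Q.pi_mem hx, Q.b_pi, map_zero, LinearMap.zero_apply, zero_add, sg_two, one_smul]
  have hΔ : ∀ {t : ℤ} {x : E}, x ∈ S.X t → Q.b (S.Δ x) = Q.lie x - S.Δ (Q.b x) := by
    intro t x _
    rw [lie_apply, add_sub_cancel_right]
  have hν : Q.b Q.modular = - Q.lie Q.pi := by
    rw [modular, map_neg, hΔ Q.pi_mem, Q.b_pi, map_zero, sub_zero]
  have h1 : Q.b (Q.b x) = - Q.b (Q.b x) := by
    conv_lhs => rw [hb hx]
    rw [map_add, map_sub, hΔ (S.mul_mem Q.pi_mem hx), hpi hx, Q.lie_mul Q.pi_mem hx,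
      hpi (S.Δ_mem hx), hΔ hx, Q.b_mul Q.modular_mem hx, hν, sg_one, hb (Q.b_mem hx),
      show t - 1 + 1 = t by ring, show t + 1 - 1 = t by ring, show (1 : ℤ) + 1 = 2 by ring]
    simp
    abel
  have h2 : (2 : k) • Q.b (Q.b x) = 0 := by
    rw [two_smul]
    nth_rewrite 1 [h1]
    exact neg_add_cancel _
  exact (smul_eq_zero.1 h2).resolve_left two_ne_zero

section WeightZero

variable [CharZero k]

lemma lie_b {t : ℤ} {x : E} (hx : x ∈ S.X t) : Q.lie (Q.b x) = Q.b (Q.lie x) := by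
  rw [lie_apply, lie_apply, Q.b_b hx, map_zero, add_zero, map_add, Q.b_b (S.Δ_mem hx), zero_add]

lemma lie_Δ {t : ℤ} {x : E} (hx : x ∈ S.X t) : Q.lie (S.Δ x) = S.Δ (Q.lie x) := by
  rw [lie_apply, lie_apply, S.Δ_Δ hx, map_zero, zero_add, map_add, S.Δ_Δ (Q.b_mem hx), add_zero]

/-- The derivation `Q.lie` acts semisimply on each degree. -/
def Semisimple (Q : S.Poisson) : Prop :=
  ∀ t, S.X t ≤ ⨆ c : k, S.X t ⊓ Module.End.eigenspace Q.lie c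

variable {Q} (hQ : Q.Semisimple)
include hQ

lemma exists_decomp {t : ℤ} {x : E} (hx : x ∈ S.X t) :
    ∃ x₀ ∈ S.X t, Q.lie x₀ = 0 ∧ ∃ y ∈ S.X t, x = x₀ + Q.lie (Q.lie y) := by
  refine Submodule.iSup_induction _ (motive := fun x => ∃ x₀ ∈ S.X t, Q.lie x₀ = 0 ∧
    ∃ y ∈ S.X t, x = x₀ + Q.lie (Q.lie y)) (hQ t hx) ?_ ?_ ?_
  · rintro c x ⟨hx, hxc⟩
    have hxc : Q.lie x = c • x := Module.End.mem_eigenspace_iff.1 hxc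
    by_cases hc : c = 0
    · exact ⟨x, hx, by rw [hxc, hc, zero_smul], 0, zero_mem _, by simp⟩
    · refine ⟨0, zero_mem _, map_zero _, c⁻¹ • c⁻¹ • x,
        Submodule.smul_mem _ _ (Submodule.smul_mem _ _ hx), ?_⟩
      simp only [map_smul, hxc, zero_add, smul_smul]
      field_simp
      simp
  · exact ⟨0, zero_mem _, map_zero _, 0, zero_mem _, by simp⟩
  · rintro _ _ ⟨x, hx, hx', y, hy, rfl⟩ ⟨z, hz, hz', w, hw, rfl⟩
    refine ⟨x + z, add_mem hx hz, by rw [map_add, hx', hz', add_zero], y + w, add_mem hy hw, ?_⟩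
    simp only [map_add]
    abel

lemma lie_eq_zero {t : ℤ} {x : E} (hx : x ∈ S.X t) (h : Q.lie (Q.lie x) = 0) : Q.lie x = 0 := by
  have h1 : ∀ x ∈ S.X t, Q.lie x ∈ ⨆ c : k, ⨆ (_ : c ≠ 0), Module.End.eigenspace Q.lie c := by
    intro x hx
    refine Submodule.iSup_induction _ (motive := fun x => Q.lie x ∈
      ⨆ c : k, ⨆ (_ : c ≠ 0), Module.End.eigenspace Q.lie c) (hQ t hx) ?_ ?_ ?_
    · rintro c x ⟨-, hxc⟩
      have hxc' : Q.lie x = c • x := Module.End.mem_eigenspace_iff.1 hxc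
      rw [hxc']
      by_cases hc : c = 0
      · rw [hc, zero_smul]; exact zero_mem _
      · exact Submodule.smul_mem _ _
          ((le_iSup₂_of_le c hc le_rfl : Module.End.eigenspace Q.lie c ≤ _) hxc)
    · rw [map_zero]; exact zero_mem _
    · intro x y hx hy
      rw [map_add]
      exact add_mem hx hy
  have h2 := Module.End.eigenspaces_iSupIndep Q.lie 0
  refine (Submodule.disjoint_def.1 h2) _ ?_ (h1 x hx)
  rw [Module.End.mem_eigenspace_iff, h, zero_smul]

/-- Every cycle is homologous to one of weight zero. -/
lemma exists_cycle {t : ℤ} {x : E} (hx : x ∈ S.X t) (hbx : Q.b x = 0) :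
    ∃ z ∈ S.X t, Q.lie z = 0 ∧ Q.b z = 0 ∧ ∃ y ∈ S.X (t - 1), x = z + Q.b y := by
  obtain ⟨z, hz, hz0, y, hy, rfl⟩ := exists_decomp hQ hx
  have hy' := Q.lie_mem hy
  have hby := Q.b_mem hy
  have e : Q.b (Q.lie (Q.lie y)) = Q.lie (Q.lie (Q.b y)) := by
    rw [← Q.lie_b hy', Q.lie_b hy]
  rw [map_add, e] at hbx
  have h1 : Q.lie (Q.lie (Q.b y)) = 0 := by
    refine lie_eq_zero hQ (Q.lie_mem hby) ?_
    rw [eq_neg_of_add_eq_zero_right hbx, map_neg, Q.lie_b hz, hz0, map_zero, neg_zero]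
  have h2 : Q.lie (Q.b y) = 0 := lie_eq_zero hQ hby h1
  refine ⟨z, hz, hz0, by simpa [h1] using hbx, S.Δ (Q.lie y), S.Δ_mem hy', ?_⟩
  rw [Q.lie_apply (Q.lie y), ← Q.lie_b hy, h2, map_zero, add_zero]

/-- A boundary of weight zero is the boundary of an element of weight zero. -/
lemma exists_bounding {t : ℤ} {y : E} (hy : y ∈ S.X t) (h : Q.lie (Q.b y) = 0) :
    ∃ z ∈ S.X t, Q.lie z = 0 ∧ Q.b z = Q.b y := by
  obtain ⟨z, hz, hz0, w, hw, rfl⟩ := exists_decomp hQ hy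
  have hbw := Q.b_mem hw
  have e : Q.b (Q.lie (Q.lie w)) = Q.lie (Q.lie (Q.b w)) := by
    rw [← Q.lie_b (Q.lie_mem hw), Q.lie_b hw]
  refine ⟨z, hz, hz0, ?_⟩
  rw [map_add, map_add, Q.lie_b hz, hz0, map_zero, zero_add, e] at h
  rw [map_add, e, lie_eq_zero hQ (Q.lie_mem hbw) h, add_zero]

end WeightZero

end Poisson
end PolyCalculus

/-! ### Comparison of homologies -/

namespace MixedComplex

variable {k : Type*} [Field k] {E : Type*} [AddCommGroup E] [Module k E] (M : MixedComplex k E)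

/-- A cohomology group `Z / B` mapped to `E`, compared with the homology of the mixed complex `M`
in degree `m`: every cycle of `M` comes from a cocycle, every cocycle differs from a cycle by a
coboundary, and the cycles coming from coboundaries are the boundaries. -/
theorem exists_homology_equiv {V : Type*} [AddCommGroup V] [Module k V] (m : ℤ)
    (Z B : Submodule k V) (φ : V →ₗ[k] E) (hφ : Function.Injective φ)
    (h1 : ∀ z ∈ M.cycles m, ∃ v ∈ Z, φ v = z)
    (h2 : ∀ v ∈ Z, ∃ z ∈ M.cycles m, ∃ w ∈ B, φ v = z + φ w)
    (h3 : ∀ v ∈ Z, φ v ∈ M.cycles m → (v ∈ B ↔ φ v ∈ M.boundaries m)) :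
    ∃ γ : (Z ⧸ B.submoduleOf Z) ≃ₗ[k] M.HH m,
      ∀ (v : Z) (z : M.cycles m), (∃ w ∈ B, φ v = z + φ w) →
        γ (Submodule.Quotient.mk v) = hhMk M m z := by
  let ψ : Z →ₗ[k] E := φ ∘ₗ Z.subtype
  have hψ : Function.Injective ψ := hφ.comp Z.injective_subtype
  let e : Z ≃ₗ[k] LinearMap.range ψ := LinearEquiv.ofInjective ψ hψ
  have hr : M.cycles m ≤ LinearMap.range ψ := fun z hz => by
    obtain ⟨v, hv, rfl⟩ := h1 z hz
    exact ⟨⟨v, hv⟩, rfl⟩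
  let ρ : M.cycles m →ₗ[k] Z := e.symm.toLinearMap ∘ₗ Submodule.inclusion hr
  have hρ : ∀ z, φ (ρ z) = z := fun z => by
    have : e (ρ z) = Submodule.inclusion hr z := e.apply_symm_apply _
    exact congrArg Subtype.val this
  have hle : (M.boundaries m).submoduleOf (M.cycles m) ≤ (B.submoduleOf Z).comap ρ := by
    intro z hz
    refine (h3 (ρ z) (ρ z).2 ?_).2 ?_
    · rw [hρ]; exact z.2
    · rw [hρ]; exact hz
  let g : M.HH m →ₗ[k] (Z ⧸ B.submoduleOf Z) := Submodule.mapQ _ _ ρ hle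
  have hg : ∀ z, g (hhMk M m z) = Submodule.Quotient.mk (ρ z) := fun z => rfl
  have hbij : Function.Bijective g := by
    constructor
    · rw [← LinearMap.ker_eq_bot, LinearMap.ker_eq_bot']
      intro q hq
      obtain ⟨z, rfl⟩ := hhMk_surjective m q
      rw [hg, Submodule.Quotient.mk_eq_zero] at hq
      rw [hhMk_eq_zero_iff]
      have := (h3 (ρ z) (ρ z).2 (by rw [hρ]; exact z.2)).1 hq
      rwa [hρ] at this
    · intro q
      obtain ⟨v, rfl⟩ := Submodule.Quotient.mk_surjective _ q
      obtain ⟨z, hz, w, hw, e⟩ := h2 v v.2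
      refine ⟨hhMk M m ⟨z, hz⟩, ?_⟩
      rw [hg, Submodule.Quotient.eq]
      have : (ρ ⟨z, hz⟩ : V) - v = -w := hφ (by
        rw [map_sub, hρ, map_neg, e]
        simp)
      change ((ρ ⟨z, hz⟩ : V) - v) ∈ B
      rw [this]
      exact neg_mem hw
  refine ⟨(LinearEquiv.ofBijective g hbij).symm, fun v z ⟨w, hw, e⟩ => ?_⟩
  rw [LinearEquiv.symm_apply_eq]
  change _ = g (hhMk M m z)
  rw [hg, Submodule.Quotient.eq]
  have : (v : V) - ρ z = w := hφ (by rw [map_sub, hρ, e]; simp)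
  change ((v : V) - ρ z) ∈ B
  rwa [this]

/-- An isomorphism of direct sums, assembled from isomorphisms `N i ≃ HH_{d i}`. -/
theorem exists_directSum_equiv {ι : Type*} [DecidableEq ι] (N : ι → Type*)
    [∀ i, AddCommGroup (N i)]
    [∀ i, Module k (N i)] (d : ι → ℤ) (hd : Function.Injective d)
    (h0 : ∀ m, (∀ i, d i ≠ m) → Subsingleton (M.HH m)) (γ : ∀ i, N i ≃ₗ[k] M.HH (d i)) :
    ∃ θ : (⨁ i, N i) ≃ₗ[k] M.HHtot,
      ∀ i x, θ (DirectSum.lof k ι N i x) = DirectSum.lof k ℤ M.HH (d i) (γ i x) := by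
  let f : (⨁ i, N i) →ₗ[k] M.HHtot :=
    DirectSum.toModule k ι _ fun i => DirectSum.lof k ℤ M.HH (d i) ∘ₗ (γ i).toLinearMap
  have hf : ∀ i x, f (DirectSum.lof k ι N i x) = DirectSum.lof k ℤ M.HH (d i) (γ i x) := by
    intro i x
    rw [DirectSum.toModule_lof]
    rfl
  have hc : ∀ i x, DirectSum.component k ℤ M.HH (d i) (f x) =
      γ i (DirectSum.component k ι N i x) := by
    intro i x
    refine DirectSum.induction_on x (by simp) (fun j y => ?_) (fun x y hx hy => ?_)
    · change DirectSum.component k ℤ M.HH (d i) (f (DirectSum.lof k ι N j y)) =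
        γ i (DirectSum.component k ι N i (DirectSum.lof k ι N j y))
      rw [hf]
      by_cases hij : i = j
      · subst hij
        rw [DirectSum.component.lof_self, DirectSum.component.lof_self]
      · rw [DirectSum.component.of, DirectSum.component.of, dif_neg (fun h => hij (hd h).symm),
          dif_neg (fun h => hij h.symm), map_zero]
    · rw [map_add, map_add, map_add, map_add, hx, hy]
  have hbij : Function.Bijective f := by
    constructor
    · rw [← LinearMap.ker_eq_bot, LinearMap.ker_eq_bot']
      intro x hx
      refine DirectSum.ext_component k fun i => ?_
      have := hc i x
      rw [hx, map_zero] at this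
      rw [map_zero]
      exact ((γ i).map_eq_zero_iff.1 this.symm)
    · rw [← LinearMap.range_eq_top, eq_top_iff]
      intro x _
      refine DirectSum.induction_on x (zero_mem _) (fun m y => ?_) (fun x y hx hy => add_mem hx hy)
      by_cases h : ∃ i, d i = m
      · obtain ⟨i, rfl⟩ := h
        refine ⟨DirectSum.lof k ι N i ((γ i).symm y), ?_⟩
        rw [hf, LinearEquiv.apply_symm_apply]
        rfl
      · have := h0 m (fun i hi => h ⟨i, hi⟩)
        rw [Subsingleton.elim y 0, map_zero]
        exact zero_mem _
  exact ⟨LinearEquiv.ofBijective f hbij, hf⟩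

end MixedComplex

/-! ### The mixed complex of weight zero and its homology -/

namespace PolyCalculus.Poisson

variable {k : Type*} [Field k] [CharZero k] {E : Type*} [AddCommGroup E] [Module k E]
  {H : Type*} {R : Type*} [Ring R] [Module k R] {S : PolyCalculus k E H R} (Q : S.Poisson)
  {E' : Type*} [AddCommGroup E'] [Module k E'] (e : E ≃ₗ[k] E') (n : ℤ)

/-- The elements of weight zero, transported along an isomorphism `e` and graded so that the
cohomological degree `t` becomes the chain degree `n - t`, as a mixed complex. -/
def mixed : MixedComplex k E' where
  C m := (S.X (n - m) ⊓ LinearMap.ker Q.lie).map e.toLinearMap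
  b := e.toLinearMap ∘ₗ Q.b ∘ₗ e.symm.toLinearMap
  B := e.toLinearMap ∘ₗ S.Δ ∘ₗ e.symm.toLinearMap
  b_mem := by
    rintro m _ ⟨x, ⟨hx, hx'⟩, rfl⟩
    refine ⟨Q.b x, ⟨S.mem_cast (by ring) (Q.b_mem hx), ?_⟩, by simp⟩
    change Q.lie _ = 0
    rw [Q.lie_b hx, LinearMap.mem_ker.1 hx', map_zero]
  B_mem := by
    rintro m _ ⟨x, ⟨hx, hx'⟩, rfl⟩
    refine ⟨S.Δ x, ⟨S.mem_cast (by ring) (S.Δ_mem hx), ?_⟩, by simp⟩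
    change Q.lie _ = 0
    rw [Q.lie_Δ hx, LinearMap.mem_ker.1 hx', map_zero]
  b_b := by
    rintro m _ ⟨x, ⟨hx, hx'⟩, rfl⟩
    simp [Q.b_b hx]
  B_B := by
    rintro m _ ⟨x, ⟨hx, hx'⟩, rfl⟩
    simp [S.Δ_Δ hx]
  b_B := by
    rintro m _ ⟨x, ⟨hx, hx'⟩, rfl⟩
    have : Q.lie x = 0 := hx'
    rw [lie_apply] at this
    simp [← map_add, this]

variable {Q e n}

lemma mixed_b (x : E) : (Q.mixed e n).b (e x) = e (Q.b x) := by simp [mixed]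
lemma mixed_B (x : E) : (Q.mixed e n).B (e x) = e (S.Δ x) := by simp [mixed]

lemma mem_mixed_C {m t : ℤ} (h : n - m = t) {x : E} :
    e x ∈ (Q.mixed e n).C m ↔ x ∈ S.X t ∧ Q.lie x = 0 := by
  subst h
  constructor
  · rintro ⟨y, hy, hyx⟩
    rw [← e.injective hyx]
    exact hy
  · intro hx
    exact ⟨x, hx, rfl⟩

lemma mem_mixed_cycles {m t : ℤ} (h : n - m = t) {x : E} :
    e x ∈ (Q.mixed e n).cycles m ↔ x ∈ S.X t ∧ Q.lie x = 0 ∧ Q.b x = 0 := by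
  rw [MixedComplex.mem_cycles, mem_mixed_C h, mixed_b, LinearEquiv.map_eq_zero_iff, and_assoc]

lemma exists_of_mem_mixed_C {s : ℤ} {x : E'} (hx : x ∈ (Q.mixed e n).C (n - s)) :
    ∃ y, y ∈ S.X s ∧ Q.lie y = 0 ∧ e y = x := by
  obtain ⟨y, rfl⟩ := e.surjective x
  obtain ⟨h1, h2⟩ := (mem_mixed_C (sub_sub_cancel n s)).1 hx
  exact ⟨y, h1, h2, rfl⟩

variable (Q e n)

/-- The product of polyvectors on the complex of weight zero. -/
def chains : (Q.mixed e n).BVChains n where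
  mul s t := ((S.mul s t).compl₁₂ e.symm.toLinearMap e.symm.toLinearMap).compr₂ e.toLinearMap
  one := e S.one
  one_mem := (mem_mixed_C (sub_self n)).2 ⟨S.one_mem, Q.lie_one⟩
  b_one := by rw [mixed_b, Q.b_one, map_zero]
  mul_mem := by
    intro s t x hx₀ y hy₀
    obtain ⟨x, hx, hx', rfl⟩ := exists_of_mem_mixed_C hx₀
    obtain ⟨y, hy, hy', rfl⟩ := exists_of_mem_mixed_C hy₀
    simp only [LinearMap.compr₂_apply, LinearMap.compl₁₂_apply, LinearEquiv.coe_coe,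
      LinearEquiv.symm_apply_apply]
    refine (mem_mixed_C (sub_sub_cancel n _)).2 ⟨S.mul_mem hx hy, ?_⟩
    rw [Q.lie_mul hx hy, hx', hy']
    simp
  one_mul := by
    intro t y hy₀
    obtain ⟨y, hy, hy', rfl⟩ := exists_of_mem_mixed_C hy₀
    simp [S.one_mul hy]
  mul_comm := by
    intro s t x hx₀ y hy₀
    obtain ⟨x, hx, hx', rfl⟩ := exists_of_mem_mixed_C hx₀
    obtain ⟨y, hy, hy', rfl⟩ := exists_of_mem_mixed_C hy₀
    simp only [LinearMap.compr₂_apply, LinearMap.compl₁₂_apply, LinearEquiv.coe_coe,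
      LinearEquiv.symm_apply_apply]
    rw [S.mul_comm hx hy, map_zsmul]
  mul_assoc := by
    intro s t r x hx₀ y hy₀ z hz₀
    obtain ⟨x, hx, hx', rfl⟩ := exists_of_mem_mixed_C hx₀
    obtain ⟨y, hy, hy', rfl⟩ := exists_of_mem_mixed_C hy₀
    obtain ⟨z, hz, hz', rfl⟩ := exists_of_mem_mixed_C hz₀
    simp only [LinearMap.compr₂_apply, LinearMap.compl₁₂_apply, LinearEquiv.coe_coe,
      LinearEquiv.symm_apply_apply]
    rw [S.mul_assoc hx hy hz]
  b_mul := by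
    intro s t x hx₀ y hy₀
    obtain ⟨x, hx, hx', rfl⟩ := exists_of_mem_mixed_C hx₀
    obtain ⟨y, hy, hy', rfl⟩ := exists_of_mem_mixed_C hy₀
    simp only [LinearMap.compr₂_apply, LinearMap.compl₁₂_apply, LinearEquiv.coe_coe,
      LinearEquiv.symm_apply_apply, mixed_b]
    rw [Q.b_mul hx hy, map_add, map_zsmul]
  second_order := by
    intro s t r x hx₀ y hy₀ z hz₀
    obtain ⟨x, hx, hx', rfl⟩ := exists_of_mem_mixed_C hx₀
    obtain ⟨y, hy, hy', rfl⟩ := exists_of_mem_mixed_C hy₀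
    obtain ⟨z, hz, hz', rfl⟩ := exists_of_mem_mixed_C hz₀
    simp only [LinearMap.compr₂_apply, LinearMap.compl₁₂_apply, LinearEquiv.coe_coe,
      LinearEquiv.symm_apply_apply, mixed_B]
    have h := S.bkt_mul hx hy hz
    rw [bkt_apply, bkt_apply, bkt_apply, ← S.mul_assoc hx hy hz, ← S.mul_assoc (S.Δ_mem hx) hy hz,
      map_sub, map_sub, LinearMap.sub_apply, LinearMap.sub_apply] at h
    have e1 : S.mul t (s + r - 1) y (S.mul (s - 1) r (S.Δ x) z) =
        sg ((s - 1) * t) • S.mul (s - 1 + t) r (S.mul (s - 1) t (S.Δ x) y) z := by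
      rw [show s + r - 1 = s - 1 + r by ring, ← S.mul_assoc hy (S.Δ_mem hx) hz,
        S.mul_comm hy (S.Δ_mem hx), map_zsmul, LinearMap.smul_apply,
        show t + (s - 1) = s - 1 + t by ring, show t * (s - 1) = (s - 1) * t by ring]
    have e2 : S.mul t (s + r - 1) y (S.mul s (r - 1) x (S.Δ z)) =
        sg (s * t) • S.mul (s + t) (r - 1) (S.mul s t x y) (S.Δ z) := by
      rw [show s + r - 1 = s + (r - 1) by ring, ← S.mul_assoc hy hx (S.Δ_mem hz),
        S.mul_comm hy hx, map_zsmul, LinearMap.smul_apply, add_comm t s, _root_.mul_comm t s]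
    have e3 : S.mul (s + t - 1) r (S.mul s (t - 1) x (S.Δ y)) z =
        S.mul (s + (t - 1)) r (S.mul s (t - 1) x (S.Δ y)) z := by
      rw [show s + t - 1 = s + (t - 1) by ring]
    have e4 : S.mul (s + t - 1) r (S.mul (s - 1) t (S.Δ x) y) z =
        S.mul (s - 1 + t) r (S.mul (s - 1) t (S.Δ x) y) z := by
      rw [show s + t - 1 = s - 1 + t by ring]
    rw [map_zsmul, LinearMap.smul_apply, map_sub, map_sub, map_zsmul, e1, e2, e3, e4] at h
    simp only [smul_sub, smul_smul, ← sg_add] at h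
    rw [sg_congr (a := (s - 1) * t + (s - 1) * t) (b := 0) ⟨(s - 1) * t, by ring⟩,
      sg_congr (a := (s - 1) * t + (s + s * t)) (b := s + t) ⟨s * t - t, by ring⟩, sg_zero,
      one_smul, sub_eq_iff_eq_add, sub_eq_iff_eq_add] at h
    rw [h]
    simp only [map_add, map_sub, map_zsmul]
    abel

lemma chains_mul (s t : ℤ) (x y : E) :
    (Q.chains e n).mul s t (e x) (e y) = e (S.mul s t x y) := by
  simp [chains]

/-- If `Q.lie` is semisimple, then the cohomology of `b` on all polyvectors is computed by the
weight-zero mixed complex, whose homology is then a Batalin-Vilkovisky algebra under the product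
of polyvectors, and whose negative cyclic homology is a gravity algebra. The cohomology of `b`
enters through models `Z i / B i`, embedded by `φ i` as the cocycles of degree `d i` modulo
coboundaries. -/
theorem exists_bv (hQ : Q.Semisimple) {ι : Type*} [DecidableEq ι] (d : ι → ℤ)
    (hd : Function.Injective d)
    (hX : ∀ t, (∀ i, d i ≠ t) → S.X t = ⊥) (V : ι → Type*) [∀ i, AddCommGroup (V i)]
    [∀ i, Module k (V i)] (Z B : ∀ i, Submodule k (V i)) (φ : ∀ i, V i →ₗ[k] E)
    (hφ : ∀ i, Function.Injective (φ i))
    (hZ : ∀ i x, (∃ v ∈ Z i, φ i v = x) ↔ (x ∈ S.X (d i) ∧ Q.b x = 0))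
    (hB : ∀ i x, (∃ v ∈ B i, φ i v = x) ↔ ∃ y ∈ S.X (d i - 1), Q.b y = x) :
    ∃ θ : (⨁ i, Z i ⧸ (B i).submoduleOf (Z i)) ≃ₗ[k] (Q.mixed e n).HHtot,
      (∀ i (v : Z i), ∃ z : (Q.mixed e n).cycles (n - d i),
        (∃ y ∈ S.X (d i - 1), e (φ i v) - z.1 = e (Q.b y)) ∧
        θ (DirectSum.lof k ι (fun i => Z i ⧸ (B i).submoduleOf (Z i)) i
          (Submodule.Quotient.mk v)) = (Q.mixed e n).hhClass _ z) ∧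
      ∃ (one : (Q.mixed e n).HHtot)
        (mul : (Q.mixed e n).HHtot →ₗ[k] (Q.mixed e n).HHtot →ₗ[k] (Q.mixed e n).HHtot),
        (∀ i j l (v : Z i) (w : Z j) (u : Z l), d l = d i + d j →
          φ l u = S.mul (d i) (d j) (φ i v) (φ j w) →
          mul (θ (DirectSum.lof k ι (fun i => Z i ⧸ (B i).submoduleOf (Z i)) i
            (Submodule.Quotient.mk v))) (θ (DirectSum.lof k ι
              (fun i => Z i ⧸ (B i).submoduleOf (Z i)) j (Submodule.Quotient.mk w))) =
          θ (DirectSum.lof k ι (fun i => Z i ⧸ (B i).submoduleOf (Z i)) l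
            (Submodule.Quotient.mk u))) ∧
        IsBVAlgebra ((Q.mixed e n).hhDeg n) one mul (Q.mixed e n).Bstar ∧
        HasInducedGravityStructure (Q.mixed e n) n one mul := by
  set M := Q.mixed e n with hM
  have key : ∀ i, ∃ γ : (Z i ⧸ (B i).submoduleOf (Z i)) ≃ₗ[k] M.HH (n - d i),
      ∀ (v : Z i) (z : M.cycles (n - d i)), (∃ w ∈ B i, e (φ i v) = z + e (φ i w)) →
        γ (Submodule.Quotient.mk v) = MixedComplex.hhMk M (n - d i) z := by
    intro i
    refine M.exists_homology_equiv (n - d i) (Z i) (B i) (e.toLinearMap ∘ₗ φ i)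
      (e.injective.comp (hφ i)) ?_ ?_ ?_
    · intro z hz
      obtain ⟨z, rfl⟩ := e.surjective z
      obtain ⟨h1, h2, h3⟩ := (mem_mixed_cycles (sub_sub_cancel n (d i))).1 hz
      obtain ⟨v, hv, rfl⟩ := (hZ i z).2 ⟨h1, h3⟩
      exact ⟨v, hv, rfl⟩
    · intro v hv
      obtain ⟨h1, h2⟩ := (hZ i (φ i v)).1 ⟨v, hv, rfl⟩
      obtain ⟨z, hz, hz0, hbz, y, hy, e1⟩ := exists_cycle hQ h1 h2
      obtain ⟨w, hw, hwy⟩ := (hB i (Q.b y)).2 ⟨y, hy, rfl⟩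
      refine ⟨e z, (mem_mixed_cycles (sub_sub_cancel n (d i))).2 ⟨hz, hz0, hbz⟩, w, hw, ?_⟩
      simp only [LinearMap.comp_apply, LinearEquiv.coe_coe]
      rw [e1, hwy, map_add]
    · intro v hv hvc
      obtain ⟨h1, h2, h3⟩ := (mem_mixed_cycles (sub_sub_cancel n (d i))).1 hvc
      constructor
      · intro hvB
        obtain ⟨y, hy, hyv⟩ := (hB i (φ i v)).1 ⟨v, hvB, rfl⟩
        obtain ⟨z, hz, hz0, hzy⟩ := exists_bounding hQ hy (by rw [hyv]; exact h2)
        refine ⟨e z, (mem_mixed_C (by ring)).2 ⟨hz, hz0⟩, ?_⟩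
        rw [hM, mixed_b, hzy, hyv]
        rfl
      · rintro ⟨y, hy, hyv⟩
        obtain ⟨y, rfl⟩ := e.surjective y
        rw [hM, mixed_b] at hyv
        have hyv : Q.b y = φ i v := e.injective hyv
        obtain ⟨w, hw, hwv⟩ := (hB i (φ i v)).2
          ⟨y, ((mem_mixed_C (t := d i - 1) (by ring)).1 hy).1, hyv⟩
        rwa [← hφ i hwv]
  choose γ hγ using key
  obtain ⟨θ, hθ⟩ := M.exists_directSum_equiv (fun i => Z i ⧸ (B i).submoduleOf (Z i))
    (fun i => n - d i) (fun i j h => hd (sub_right_injective h)) (fun m hm => ⟨fun p q => by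
      obtain ⟨x, rfl⟩ := MixedComplex.hhMk_surjective m p
      obtain ⟨y, rfl⟩ := MixedComplex.hhMk_surjective m q
      have h0 : ∀ z : M.cycles m, z = 0 := by
        rintro ⟨z, hz⟩
        obtain ⟨z, rfl⟩ := e.surjective z
        have h := ((mem_mixed_cycles (t := n - m) rfl).1 hz).1
        rw [hX (n - m) fun i hi => hm i (by rw [hi]; ring)] at h
        refine Subtype.ext ?_
        change e z = 0
        rw [(Submodule.mem_bot k).1 h, map_zero]
      rw [h0 x, h0 y]⟩) γ
  have rep : ∀ i (v : Z i), ∃ z, z ∈ S.X (d i) ∧ Q.b z = 0 ∧ e z ∈ M.cycles (n - d i) ∧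
      (∃ y ∈ S.X (d i - 1), φ i v = z + Q.b y) := by
    intro i v
    obtain ⟨h1, h2⟩ := (hZ i (φ i v)).1 ⟨v, v.2, rfl⟩
    obtain ⟨z, hz, hz0, hbz, y, hy, e1⟩ := exists_cycle hQ h1 h2
    exact ⟨z, hz, hbz, (mem_mixed_cycles (sub_sub_cancel n (d i))).2 ⟨hz, hz0, hbz⟩, y, hy, e1⟩
  have cls : ∀ i (v : Z i) (z : E), e z ∈ M.cycles (n - d i) →
      (∃ y ∈ S.X (d i - 1), φ i v = z + Q.b y) →
      θ (DirectSum.lof k ι (fun i => Z i ⧸ (B i).submoduleOf (Z i)) i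
          (Submodule.Quotient.mk v)) = M.cls (n - d i) (e z) := by
    rintro i v z hz ⟨y, hy, hyz⟩
    obtain ⟨w, hw, hwy⟩ := (hB i (Q.b y)).2 ⟨y, hy, rfl⟩
    rw [hθ, hγ i v ⟨e z, hz⟩ ⟨w, hw, by rw [hyz, hwy, map_add]⟩, MixedComplex.cls_of_mem hz]
    rfl
  refine ⟨θ, fun i v => ?_, M.cls n (Q.chains e n).one, (Q.chains e n).hhMul, ?_,
    (Q.chains e n).isBVAlgebra, MixedComplex.hasInducedGravityStructure
      (Q.chains e n).isBVAlgebra⟩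
  · obtain ⟨z, hz, hbz, hzc, y, hy, e1⟩ := rep i v
    refine ⟨⟨e z, hzc⟩, ⟨y, hy, by rw [e1, map_add]; simp⟩, ?_⟩
    rw [cls i v z hzc ⟨y, hy, e1⟩, MixedComplex.cls_of_mem hzc]
  · intro i j l v w u hl hu
    obtain ⟨z, hz, hbz, hzc, y, hy, e1⟩ := rep i v
    obtain ⟨z', hz', hbz', hzc', y', hy', e1'⟩ := rep j w
    rw [cls i v z hzc ⟨y, hy, e1⟩, cls j w z' hzc' ⟨y', hy', e1'⟩,
      (Q.chains e n).hhMul_cls hzc hzc', Q.chains_mul]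
    have hzz := (Q.chains e n).mul_mem_cycles hzc hzc'
    rw [Q.chains_mul, ← hl] at hzz
    rw [← hl, cls l u _ hzz]
    -- the two products differ by the boundary of `y z' ± (z + b y) y'`
    refine ⟨S.mul (d i - 1) (d j) y z' +
      sg (d i) • S.mul (d i) (d j - 1) (φ i v) y', ?_, ?_⟩
    · have hv := ((hZ i (φ i v)).1 ⟨v, v.2, rfl⟩).1
      exact add_mem (S.mul_mem' hy hz' (by rw [hl]; ring))
        (zsmul_mem (S.mul_mem' hv hy' (by rw [hl]; ring)) _)
    · obtain ⟨hv, hbv⟩ := (hZ i (φ i v)).1 ⟨v, v.2, rfl⟩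
      rw [hu, map_add, map_zsmul, Q.b_mul hy hz', Q.b_mul hv hy', hbv, hbz', sub_add_cancel,
        sub_add_cancel, e1']
      simp only [map_zero, smul_zero, add_zero, LinearMap.zero_apply, zero_add, map_add,
        smul_smul, sg_mul_self, one_smul]
      have h : S.mul (d i) (d j) (φ i v) z' =
          S.mul (d i) (d j) z z' + S.mul (d i) (d j) (Q.b y) z' := by
        rw [e1, map_add, LinearMap.add_apply]
      rw [h]
      abel

end PolyCalculus.Poisson

/-! ### Graded pieces of exterior algebras -/

section ExtZ

variable (R : Type*) [CommRing R] (M : Type*) [AddCommGroup M] [Module R M]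

/-- The part of degree `e` of the exterior algebra, for an integer `e`; it is zero for `e < 0`. -/
def extZ (e : ℤ) : Submodule R (ExteriorAlgebra R M) := ⨆ (d : ℕ) (_ : (d : ℤ) = e), ⋀[R]^d M

variable {R M}

lemma extZ_natCast (d : ℕ) : extZ R M d = ⋀[R]^d M := by
  refine le_antisymm (iSup₂_le fun i hi => ?_) (le_iSup₂_of_le d rfl le_rfl)
  rw [Nat.cast_injective hi]

lemma extZ_neg {e : ℤ} (h : e < 0) : extZ R M e = ⊥ :=
  le_bot_iff.1 (iSup₂_le fun i hi => absurd hi (by omega))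

lemma mem_extZ_iff {e : ℤ} {x : ExteriorAlgebra R M} :
    x ∈ extZ R M e ↔ x = 0 ∨ ∃ d : ℕ, (d : ℤ) = e ∧ x ∈ ⋀[R]^d M := by
  rcases lt_or_ge e 0 with h | h
  · rw [extZ_neg h, Submodule.mem_bot]
    exact ⟨Or.inl, fun h' => h'.elim id fun ⟨d, hd, _⟩ => absurd hd (by omega)⟩
  · obtain ⟨d, rfl⟩ := Int.eq_ofNat_of_zero_le h
    rw [extZ_natCast]
    refine ⟨fun hx => Or.inr ⟨d, rfl, hx⟩, ?_⟩
    rintro (rfl | ⟨i, hi, hx⟩)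
    · exact zero_mem _
    · rwa [← Nat.cast_injective hi]

lemma mem_extZ_of_mem {d : ℕ} {x : ExteriorAlgebra R M} (hx : x ∈ ⋀[R]^d M) {e : ℤ} (h : (d : ℤ) = e) :
    x ∈ extZ R M e := mem_extZ_iff.2 (Or.inr ⟨d, h, hx⟩)

lemma mem_natAbs_of_mem_extZ {e : ℤ} {x : ExteriorAlgebra R M} (hx : x ∈ extZ R M e) :
    x ∈ ⋀[R]^e.natAbs M := by
  rcases mem_extZ_iff.1 hx with rfl | ⟨d, rfl, hx'⟩
  · exact zero_mem _
  · simpa using hx'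

lemma extZ_cast {e e' : ℤ} (h : e = e') {x : ExteriorAlgebra R M} (hx : x ∈ extZ R M e) :
    x ∈ extZ R M e' := h ▸ hx

lemma mul_mem_extZ {a b : ℤ} {x y : ExteriorAlgebra R M} (hx : x ∈ extZ R M a)
    (hy : y ∈ extZ R M b) : x * y ∈ extZ R M (a + b) := by
  rcases mem_extZ_iff.1 hx with rfl | ⟨i, rfl, hx'⟩
  · rw [zero_mul]; exact zero_mem _
  rcases mem_extZ_iff.1 hy with rfl | ⟨j, rfl, hy'⟩
  · rw [mul_zero]; exact zero_mem _
  exact mem_extZ_of_mem (SetLike.mul_mem_graded hx' hy') (by push_cast; rfl)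

lemma ι_mul_of_mem {d : ℕ} {x : ExteriorAlgebra R M} (hx : x ∈ ⋀[R]^d M) (v : M) :
    ExteriorAlgebra.ι R v * x = sg d • (x * ExteriorAlgebra.ι R v) := by
  induction hx using Submodule.pow_induction_on_left' with
  | algebraMap r => simp [sg_zero, Algebra.commutes]
  | add x y i hx hy ihx ihy => rw [mul_add, ihx, ihy, add_mul, smul_add]
  | mem_mul m hm i x hx ih =>
    obtain ⟨w, rfl⟩ := hm
    rw [← mul_assoc, eq_neg_of_add_eq_zero_left (ExteriorAlgebra.ι_add_mul_swap v w), neg_mul,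
      mul_assoc, ih]
    push_cast
    rw [sg_add, sg_one, mul_smul_comm, ← mul_assoc]
    simp

/-- Exterior algebras are graded commutative. -/
lemma mul_comm_of_mem_extZ {a b : ℤ} {x y : ExteriorAlgebra R M} (hx : x ∈ extZ R M a)
    (hy : y ∈ extZ R M b) : x * y = sg (a * b) • (y * x) := by
  rcases mem_extZ_iff.1 hx with rfl | ⟨i, rfl, hx'⟩
  · simp
  rcases mem_extZ_iff.1 hy with rfl | ⟨j, rfl, hy'⟩
  · simp
  clear hx
  induction hx' using Submodule.pow_induction_on_left' with
  | algebraMap r => simp [sg_zero, Algebra.commutes]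
  | add x x' i hx hx' ihx ihx' =>
    rw [add_mul, ihx, ihx', mul_add, smul_add]
  | mem_mul m hm i x hx ih =>
    obtain ⟨w, rfl⟩ := hm
    rw [mul_assoc, ih, mul_smul_comm, ← mul_assoc, ι_mul_of_mem hy',
      smul_mul_assoc, smul_smul, ← sg_add, mul_assoc]
    push_cast
    rw [show (i : ℤ) * j + j = (i + 1) * j by ring]

end ExtZ

/-! ### The volume functional on a finite exterior algebra -/

section Lam

open Module

variable {k : Type u} [Field k] {n : ℕ}

lemma lam_induction {d : ℕ} {p : Lam k n → Prop} {x : Lam k n} (hx : x ∈ lamDeg k n d)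
    (h0 : p 0) (ha : ∀ x y, p x → p y → p (x + y)) (hs : ∀ (c : k) x, p x → p (c • x))
    (hm : ∀ s : Finset (Fin n), s.card = d → p (monoBasis k n s)) : p x := by
  let W : Submodule k (Lam k n) :=
    { carrier := {x | p x}, zero_mem' := h0, add_mem' := fun {a b} => ha a b,
      smul_mem' := hs }
  have hle : LinearMap.range (lamDeg k n d).subtype ≤ W := by
    rw [LinearMap.range_eq_map, ← ((Pi.basisFun k (Fin n)).exteriorPower d).span_eq,
      Submodule.map_span, Submodule.span_le]
    rintro _ ⟨_, ⟨s, rfl⟩, rfl⟩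
    change p _
    have := hm s.1 s.2
    rwa [show monoBasis k n s.1 = _ from ExteriorAlgebra.basis_eq_coe_basis _ s] at this
  exact hle ⟨⟨x, hx⟩, rfl⟩

lemma mono_mem_extZ (s : Finset (Fin n)) : monoBasis k n s ∈ extZ k (Fin n → k) s.card :=
  mem_extZ_of_mem (monoBasis_mem k n s) rfl

lemma vol_eq_zero_of_mem {e : ℤ} {x : Lam k n} (hx : x ∈ extZ k (Fin n → k) e) (he : e ≠ n) :
    vol k n x = 0 := by
  rcases mem_extZ_iff.1 hx with rfl | ⟨d, rfl, hx'⟩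
  · exact map_zero _
  refine lam_induction (p := fun x => vol k n x = 0) hx' (map_zero _)
    (fun x y hx hy => by rw [map_add, hx, hy, add_zero]) (fun c x hx => by rw [map_smul, hx, smul_zero])
    fun s hs => ?_
  rw [vol, Basis.coord_apply, Basis.repr_self, Finsupp.single_eq_of_ne]
  rintro rfl
  simp at hs
  omega

lemma repr_mul_vol (x : Lam k n) (s : Finset (Fin n)) :
    vol k n (x * monoBasis k n sᶜ) =
      (monoBasis k n).repr x s * vol k n (monoBasis k n s * monoBasis k n sᶜ) := by
  conv_lhs => rw [← (monoBasis k n).sum_repr x]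
  rw [Finset.sum_mul, map_sum, Finset.sum_eq_single s]
  · rw [smul_mul_assoc, map_smul, smul_eq_mul]
  · intro t _ hts
    rw [smul_mul_assoc, map_smul, vol_mono_mul_of_ne k n hts, smul_zero]
  · simp

/-- An element is determined by the volumes of its products with homogeneous elements; moreover
its degree is detected in the same way. -/
lemma mem_extZ_of_vol {e : ℤ} {x : Lam k n}
    (h : ∀ (d : ℕ), ∀ c ∈ lamDeg k n d, (d : ℤ) ≠ n - e → vol k n (x * c) = 0) :
    x ∈ extZ k (Fin n → k) e := by
  rw [← (monoBasis k n).sum_repr x]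
  refine sum_mem fun s _ => ?_
  by_cases hs : (s.card : ℤ) = e
  · exact Submodule.smul_mem _ _ (extZ_cast hs (mono_mem_extZ s))
  · have h1 := h _ _ (monoBasis_mem k n sᶜ) (by
      have := Finset.card_compl_add_card s
      simp only [Fintype.card_fin] at this
      omega)
    rw [repr_mul_vol] at h1
    rw [(mul_eq_zero.1 h1).resolve_right (vol_mono_mul_compl k n s), zero_smul]
    exact zero_mem _

lemma mem_extZ_iff_vol {e : ℤ} {x : Lam k n} : x ∈ extZ k (Fin n → k) e ↔
    ∀ (d : ℕ), ∀ c ∈ lamDeg k n d, (d : ℤ) ≠ n - e → vol k n (x * c) = 0 :=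
  ⟨fun hx d c hc hd => vol_eq_zero_of_mem (mul_mem_extZ hx (mem_extZ_of_mem hc rfl)) (by omega),
    mem_extZ_of_vol⟩

lemma eq_zero_of_vol {x : Lam k n} (h : ∀ (d : ℕ), ∀ c ∈ lamDeg k n d, vol k n (x * c) = 0) :
    x = 0 := by
  refine (monoBasis k n).ext_elem fun s => ?_
  have h1 := h _ _ (monoBasis_mem k n sᶜ)
  rw [repr_mul_vol] at h1
  rw [(mul_eq_zero.1 h1).resolve_right (vol_mono_mul_compl k n s), map_zero, Finsupp.zero_apply]

lemma eq_of_vol {x y : Lam k n} (h : ∀ c : Homog k n, vol k n (x * c.val) = vol k n (y * c.val)) :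
    x = y := by
  refine sub_eq_zero.1 (eq_zero_of_vol fun d c hc => ?_)
  rw [sub_mul, map_sub, sub_eq_zero]
  exact h ⟨d, c, hc⟩

lemma linearMap_ext_homog {M : Type*} [AddCommGroup M] [Module k M] {f g : Lam k n →ₗ[k] M}
    (h : ∀ c : Homog k n, f c.val = g c.val) : f = g :=
  (monoBasis k n).ext fun s => h (Homog.mono s)

namespace Homog

lemma ext' {a b : Homog k n} (h : a.1 = b.1) (hv : a.val = b.val) : a = b :=
  Sigma.subtype_ext h hv

lemma val_mem (a : Homog k n) : a.val ∈ extZ k (Fin n → k) a.1 := mem_extZ_of_mem a.2.2 rfl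

lemma val_mem' (a : Homog k n) : a.val ∈ lamDeg k n a.1 := a.2.2

lemma val_mul (a b : Homog k n) : (a.mul b).val = a.val * b.val := rfl

lemma fst_mul (a b : Homog k n) : (a.mul b).1 = a.1 + b.1 := rfl

/-- The unit as a homogeneous element. -/
def one : Homog k n := ⟨0, 1, SetLike.GradedOne.one_mem⟩

/-- A homogeneous element of an integral degree `e`, as an element of degree `|e|`. -/
def ofMem {e : ℤ} {x : Lam k n} (hx : x ∈ extZ k (Fin n → k) e) : Homog k n :=
  ⟨e.natAbs, x, mem_natAbs_of_mem_extZ hx⟩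

end Homog

lemma sg_natAbs_mul (a b : ℤ) : sg (a.natAbs * b) = sg (a * b) := by
  rcases Int.natAbs_eq a with h | h
  · rw [← h]
  · exact sg_congr ⟨a.natAbs * b, by nth_rewrite 2 [h]; ring⟩

lemma sg_mul_natAbs (a b : ℤ) : sg (b * a.natAbs) = sg (b * a) := by
  rw [mul_comm, sg_natAbs_mul, mul_comm]

end Lam

/-! ### Multiderivations of a finite exterior algebra -/

namespace ExteriorPoisson

variable {k : Type u} [Field k] {n : ℕ} (P : ExteriorPoisson k n)

/-- The sums of multiderivations of cohomological degree `t`. -/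
abbrev poly (t : ℤ) : Submodule k (List (Homog k n) → Lam k n) := P.coeffSelf.cochains (-t)

variable {P}

lemma mem_poly_iff {t : ℤ} {X : List (Homog k n) → Lam k n} : X ∈ P.poly t ↔
    ((∀ l₁ l₂ (d : ℕ) (x y : lamDeg k n d),
      X (l₁ ++ ⟨d, x + y⟩ :: l₂) = X (l₁ ++ ⟨d, x⟩ :: l₂) + X (l₁ ++ ⟨d, y⟩ :: l₂)) ∧
    (∀ l₁ l₂ (d : ℕ) (c : k) (x : lamDeg k n d),
      X (l₁ ++ ⟨d, c • x⟩ :: l₂) = c • X (l₁ ++ ⟨d, x⟩ :: l₂)) ∧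
    (∀ l₁ l₂ a b, X (l₁ ++ a :: b :: l₂) = -(sg (a.1 * b.1) • X (l₁ ++ b :: a :: l₂))) ∧
    (∀ l a b, X (l ++ [a.mul b]) =
      X (l ++ [a]) * b.val + sg (a.1 * b.1) • (X (l ++ [b]) * a.val)) ∧
    (∃ N : ℕ, ∀ l, N < l.length → X l = 0) ∧
    ∀ l, X l ∈ extZ k (Fin n → k) (t - l.length + degSum l)) := by
  change ((_ ∧ _ ∧ _ ∧ _) ∧ _ ∧ _) ↔ _
  have hg : ∀ l : List (Homog k n), P.coeffSelf.gr (-t + l.length - degSum l) =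
      extZ k (Fin n → k) (t - l.length + degSum l) := fun l => by
    change extZ k (Fin n → k) (-(-t + l.length - degSum l)) = _
    congr 1
    ring
  simp only [hg, neg_one_pow_smul_eq, Nat.cast_mul, and_assoc]
  rfl

section Mem

variable {s t : ℤ} {X Y : List (Homog k n) → Lam k n}

lemma poly_add (hX : X ∈ P.poly t) (l₁ l₂ : List (Homog k n)) {d : ℕ} (x y : lamDeg k n d) :
    X (l₁ ++ ⟨d, x + y⟩ :: l₂) = X (l₁ ++ ⟨d, x⟩ :: l₂) + X (l₁ ++ ⟨d, y⟩ :: l₂) :=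
  (mem_poly_iff.1 hX).1 l₁ l₂ d x y

lemma poly_smul (hX : X ∈ P.poly t) (l₁ l₂ : List (Homog k n)) {d : ℕ} (c : k)
    (x : lamDeg k n d) : X (l₁ ++ ⟨d, c • x⟩ :: l₂) = c • X (l₁ ++ ⟨d, x⟩ :: l₂) :=
  (mem_poly_iff.1 hX).2.1 l₁ l₂ d c x

lemma poly_skew (hX : X ∈ P.poly t) (l₁ l₂ : List (Homog k n)) (a b : Homog k n) :
    X (l₁ ++ a :: b :: l₂) = -(sg (a.1 * b.1) • X (l₁ ++ b :: a :: l₂)) :=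
  (mem_poly_iff.1 hX).2.2.1 l₁ l₂ a b

lemma poly_mul (hX : X ∈ P.poly t) (l : List (Homog k n)) (a b : Homog k n) :
    X (l ++ [a.mul b]) = X (l ++ [a]) * b.val + sg (a.1 * b.1) • (X (l ++ [b]) * a.val) :=
  (mem_poly_iff.1 hX).2.2.2.1 l a b

lemma poly_bdd (hX : X ∈ P.poly t) : ∃ N : ℕ, ∀ l, N < l.length → X l = 0 :=
  (mem_poly_iff.1 hX).2.2.2.2.1

lemma poly_deg (hX : X ∈ P.poly t) (l : List (Homog k n)) :
    X l ∈ extZ k (Fin n → k) (t - l.length + degSum l) :=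
  (mem_poly_iff.1 hX).2.2.2.2.2 l

lemma degSum_cons (a : Homog k n) (l : List (Homog k n)) : degSum (a :: l) = a.1 + degSum l := by
  simp [degSum]

lemma degSum_append (l l' : List (Homog k n)) : degSum (l ++ l') = degSum l + degSum l' := by
  simp [degSum]

lemma degSum_nil : degSum ([] : List (Homog k n)) = 0 := rfl

/-- Insertion of the first argument. -/
def ins (f : Homog k n) : (List (Homog k n) → Lam k n) →ₗ[k] (List (Homog k n) → Lam k n) where
  toFun X l := X (f :: l)
  map_add' _ _ := rfl
  map_smul' _ _ := rfl

@[simp] lemma ins_apply (f : Homog k n) (X : List (Homog k n) → Lam k n) (l : List (Homog k n)) :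
    ins f X l = X (f :: l) := rfl

lemma ins_mem (f : Homog k n) (hX : X ∈ P.poly t) : ins f X ∈ P.poly (t + f.1 - 1) := by
  refine mem_poly_iff.2 ⟨fun l₁ l₂ d x y => poly_add hX (f :: l₁) l₂ x y,
    fun l₁ l₂ d c x => poly_smul hX (f :: l₁) l₂ c x,
    fun l₁ l₂ a b => poly_skew hX (f :: l₁) l₂ a b, fun l a b => poly_mul hX (f :: l) a b, ?_,
    fun l => ?_⟩
  · obtain ⟨N, hN⟩ := poly_bdd hX
    exact ⟨N, fun l hl => hN _ (hl.trans (by simp))⟩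
  · refine extZ_cast ?_ (poly_deg hX (f :: l))
    rw [degSum_cons, List.length_cons]
    push_cast
    ring

lemma poly_zero_arg (hX : X ∈ P.poly t) (l₁ l₂ : List (Homog k n)) {a : Homog k n}
    (ha : a.val = 0) : X (l₁ ++ a :: l₂) = 0 := by
  obtain ⟨d, a⟩ := a
  have : a = (0 : k) • a := by
    rw [zero_smul]
    exact Subtype.ext ha
  rw [this, poly_smul hX, zero_smul]

lemma poly_one (hX : X ∈ P.poly t) (l : List (Homog k n)) : X (l ++ [Homog.one]) = 0 := by
  have h := poly_mul hX l Homog.one Homog.one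
  have h1 : (Homog.one : Homog k n).mul Homog.one = Homog.one :=
    Homog.ext' rfl (one_mul _)
  have hv : (Homog.one : Homog k n).val = 1 := rfl
  have h0 : (Homog.one : Homog k n).1 = 0 := rfl
  rw [h1, hv, h0, mul_one, Nat.cast_zero, mul_zero, sg_zero, one_smul] at h
  exact left_eq_add.1 h

/-- Linearity in the last argument reduces a statement on `vol (X (l ++ [c]))` to the
monomials `c`. -/
lemma vol_last_ext (hX : X ∈ P.poly t) (l : List (Homog k n)) (g : Lam k n →ₗ[k] k)
    (h : ∀ s : Finset (Fin n), vol k n (X (l ++ [Homog.mono s])) = g (monoBasis k n s))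
    (c : Homog k n) : vol k n (X (l ++ [c])) = g c.val := by
  obtain ⟨d, c, hc⟩ := c
  let p : Lam k n → Prop := fun c => ∃ hc : c ∈ lamDeg k n d, vol k n (X (l ++ [⟨d, c, hc⟩])) = g c
  have h1 : p c := by
    have e0 : p 0 := by
      have h0 : (0 : Lam k n) ∈ lamDeg k n d := Submodule.zero_mem _
      refine ⟨h0, ?_⟩
      have := poly_zero_arg hX l [] (a := ⟨d, 0, h0⟩) rfl
      rw [this, map_zero, map_zero]
    have e1 : ∀ x y, p x → p y → p (x + y) := by
      rintro x y ⟨hx, hx'⟩ ⟨hy, hy'⟩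
      refine ⟨Submodule.add_mem _ hx hy, ?_⟩
      rw [map_add, ← hx', ← hy', ← map_add]
      exact congrArg _ (poly_add hX l [] ⟨x, hx⟩ ⟨y, hy⟩)
    have e2 : ∀ (e : k) x, p x → p (e • x) := by
      rintro e x ⟨hx, hx'⟩
      refine ⟨Submodule.smul_mem _ e hx, ?_⟩
      rw [map_smul, ← hx', ← map_smul]
      exact congrArg _ (poly_smul hX l [] e ⟨x, hx⟩)
    have e3 : ∀ s : Finset (Fin n), s.card = d → p (monoBasis k n s) := by
      rintro s rfl
      exact ⟨monoBasis_mem k n s, h s⟩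
    exact lam_induction hc e0 e1 e2 e3
  obtain ⟨_, h1⟩ := h1
  exact h1

end Mem

/-! ### The divergence -/

section Div

variable {t : ℤ} {X : List (Homog k n) → Lam k n}

lemma vol_div_mono (X : List (Homog k n) → Lam k n) (l : List (Homog k n)) (s : Finset (Fin n)) :
    vol k n (div X l * monoBasis k n s) = sg (l.length + 1) • vol k n (X (l ++ [Homog.mono s])) := by
  have h : iotaEta (div X) = dStar (iotaEta X) := by
    change iotaEta (iotaEta.symm (dStar (iotaEta X))) = _
    rw [LinearEquiv.apply_symm_apply]
  have h2 := LinearMap.congr_fun (congrFun h l) (monoBasis k n s)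
  change vol k n (div X l * monoBasis k n s) = (monoBasis k n).constr k _ _ at h2
  rw [h2, Module.Basis.constr_basis]
  change (-1 : k) ^ (l.length + 1) * vol k n (X (l ++ [Homog.mono s]) * 1) = _
  rw [mul_one, ← smul_eq_mul, neg_one_pow_smul_eq]
  push_cast
  rfl

/-- The divergence of a multiderivation, in terms of the volume functional. -/
lemma vol_div (hX : X ∈ P.poly t) (l : List (Homog k n)) (c : Homog k n) :
    vol k n (div X l * c.val) = sg (l.length + 1) • vol k n (X (l ++ [c])) := by
  have h := vol_last_ext hX l (sg (l.length + 1) • (vol k n ∘ₗ LinearMap.mulLeft k (div X l)))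
    (fun s => by
      rw [LinearMap.smul_apply, LinearMap.comp_apply, LinearMap.mulLeft_apply, vol_div_mono,
        smul_smul, sg_mul_self, one_smul]) c
  rw [h, LinearMap.smul_apply, smul_smul, sg_mul_self, one_smul]
  rfl

lemma vol_smul_mul (e : ℤ) (x y : Lam k n) : vol k n ((sg e • x) * y) = sg e • vol k n (x * y) := by
  rw [smul_mul_assoc, map_zsmul]

/-- The divergence of a multiderivation is a multiderivation. -/
lemma div_mem (hX : X ∈ P.poly t) : div X ∈ P.poly (t - 1) := by
  refine mem_poly_iff.2 ⟨fun l₁ l₂ d x y => eq_of_vol fun c => ?_,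
    fun l₁ l₂ d e x => eq_of_vol fun c => ?_, fun l₁ l₂ a b => eq_of_vol fun c => ?_,
    fun l a b => eq_of_vol fun c => ?_, ?_, fun l => ?_⟩
  · rw [add_mul, map_add, vol_div hX, vol_div hX, vol_div hX, List.append_assoc, List.cons_append,
      poly_add hX, map_add, smul_add]
    simp
  · rw [smul_mul_assoc, map_smul, vol_div hX, vol_div hX, List.append_assoc, List.cons_append,
      poly_smul hX, map_smul, smul_comm]
    simp
  · rw [neg_mul, map_neg, vol_smul_mul, vol_div hX, vol_div hX, List.append_assoc,
      List.cons_append, List.cons_append, poly_skew hX, map_neg, map_zsmul, smul_neg, smul_comm]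
    simp
  · have h1 : vol k n (div X (l ++ [a]) * b.val * c.val) =
        vol k n (div X (l ++ [a]) * (b.mul c).val) := by rw [mul_assoc, Homog.val_mul]
    have h2 : vol k n (div X (l ++ [b]) * a.val * c.val) =
        vol k n (div X (l ++ [b]) * (a.mul c).val) := by rw [mul_assoc, Homog.val_mul]
    have e1 : X (l ++ [b] ++ [a]) = -(sg (a.1 * b.1) • X (l ++ [a] ++ [b])) := by
      simp only [List.append_assoc, List.cons_append, List.nil_append]
      rw [poly_skew hX, mul_comm]
    have e2 : X (l ++ [a.mul b] ++ [c]) =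
        -(sg ((a.1 + b.1) * c.1) • (X (l ++ [c] ++ [a]) * b.val +
          sg (a.1 * b.1) • (X (l ++ [c] ++ [b]) * a.val))) := by
      rw [← poly_mul hX]
      simp only [List.append_assoc, List.cons_append, List.nil_append]
      rw [poly_skew hX, Homog.fst_mul]
      push_cast
      rfl
    have e3 : ∀ a : Homog k n, X (l ++ [c] ++ [a]) = -(sg (a.1 * c.1) • X (l ++ [a] ++ [c])) := by
      intro a
      simp only [List.append_assoc, List.cons_append, List.nil_append]
      rw [poly_skew hX, mul_comm]
    rw [add_mul, map_add, vol_smul_mul, h1, h2, vol_div hX, vol_div hX, vol_div hX, poly_mul hX,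
      poly_mul hX, e2, e1, e3, e3]
    simp only [List.length_append, List.length_cons, List.length_nil, Nat.cast_add, Nat.cast_one,
      neg_mul, smul_mul_assoc, map_add, map_neg, map_zsmul, smul_add, smul_neg, smul_smul,
      zero_add, ← sg_add]
    rw [sg_congr (a := (l.length : ℤ) + 1 + 1 + ((a.1 + b.1) * c.1 + a.1 * c.1))
        (b := l.length + 1 + 1 + b.1 * c.1) ⟨a.1 * c.1, by ring⟩,
      sg_congr (a := (l.length : ℤ) + 1 + 1 + ((a.1 + b.1) * c.1 + (a.1 * b.1 + b.1 * c.1)))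
        (b := a.1 * b.1 + (l.length + 1 + 1 + a.1 * c.1)) ⟨b.1 * c.1, by ring⟩,
      sg_congr (a := (a.1 * b.1 : ℤ) + (l.length + 1 + 1 + a.1 * b.1)) (b := l.length + 1 + 1)
        ⟨a.1 * b.1, by ring⟩]
    abel
  · obtain ⟨N, hN⟩ := poly_bdd hX
    refine ⟨N, fun l hl => eq_of_vol fun c => ?_⟩
    rw [vol_div hX, hN _ (by simp; omega), map_zero, smul_zero, zero_mul, map_zero]
  · refine mem_extZ_of_vol fun d c hc hd => ?_
    have h := vol_div hX l ⟨d, c, hc⟩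
    rw [show Homog.val ⟨d, ⟨c, hc⟩⟩ = c from rfl] at h
    rw [h, vol_eq_zero_of_mem (poly_deg hX _), smul_zero]
    rw [degSum_append, List.length_append]
    change t - ((l.length + 1 : ℕ) : ℤ) + ((degSum l + (d + 0) : ℕ) : ℤ) ≠ n
    push_cast
    intro h
    omega

lemma div_div (hX : X ∈ P.poly t) : div (div X) = 0 := by
  funext l
  refine eq_of_vol fun c => ?_
  have h : vol k n (div X (l ++ [c]) * (Homog.one : Homog k n).val) = 0 := by
    rw [vol_div hX, poly_one hX, map_zero, smul_zero]
  rw [vol_div (div_mem hX), ← mul_one (div X _)]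
  rw [show vol k n (div X (l ++ [c]) * 1) = 0 from h]
  simp

lemma ins_div (f : Homog k n) (hX : X ∈ P.poly t) : ins f (div X) = -div (ins f X) := by
  funext l
  refine eq_of_vol fun c => ?_
  rw [Pi.neg_apply, neg_mul, map_neg, vol_div (ins_mem f hX), ins_apply, ins_apply, vol_div hX,
    List.length_cons, List.cons_append]
  push_cast
  rw [sg_add _ 1, sg_one, mul_neg_one, neg_smul]

end Div

/-! ### Functions as multiderivations without arguments -/

/-- A homogeneous element, as a multiderivation without arguments. -/
def cst (h : Homog k n) (l : List (Homog k n)) : Lam k n := if l = [] then h.val else 0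

lemma cst_nil (h : Homog k n) : cst h [] = h.val := if_pos rfl

lemma cst_of_ne (h : Homog k n) {l : List (Homog k n)} (hl : l ≠ []) : cst h l = 0 := if_neg hl

lemma ins_cst (f h : Homog k n) : ins f (cst h) = 0 := by
  funext l
  exact cst_of_ne h (l := f :: l) (by simp)

lemma cst_mem (h : Homog k n) : cst h ∈ P.poly h.1 := by
  refine mem_poly_iff.2 ⟨?_, ?_, ?_, ?_, ⟨0, fun l hl => ?_⟩, fun l => ?_⟩
  · intro l₁ l₂ d x y
    rw [cst_of_ne h (by simp), cst_of_ne h (by simp), cst_of_ne h (by simp), add_zero]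
  · intro l₁ l₂ d c x
    rw [cst_of_ne h (by simp), cst_of_ne h (by simp), smul_zero]
  · intro l₁ l₂ a b
    rw [cst_of_ne h (by simp), cst_of_ne h (by simp), smul_zero, neg_zero]
  · intro l a b
    rw [cst_of_ne h (by simp), cst_of_ne h (by simp), cst_of_ne h (by simp)]
    simp
  · exact cst_of_ne h (by rintro rfl; simp at hl)
  · by_cases hl : l = []
    · subst hl
      rw [cst_nil]
      exact extZ_cast (by simp [degSum_nil]) h.val_mem
    · rw [cst_of_ne h hl]; exact zero_mem _

lemma div_cst (h : Homog k n) (P : ExteriorPoisson k n) : div (cst h) = 0 := by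
  funext l
  refine eq_of_vol fun c => ?_
  rw [vol_div (cst_mem h : cst h ∈ P.poly h.1), cst_of_ne h (by simp)]
  simp

/-! ### The wedge product -/

lemma wedge_eq (s t : ℤ) (X Y : List (Homog k n) → Lam k n) (l : List (Homog k n)) :
    wedge s t X Y l = ((unshuffles l).map fun x =>
      x.1 • sg ((s + x.2.1.length) * x.2.2.length + (t + x.2.2.length) * degSum x.2.1) •
        (X x.2.1 * Y x.2.2)).sum := by
  unfold wedge
  congr 2
  funext x
  rw [mul_smul, negOnePow_smul_eq]

lemma wedge_nil (s t : ℤ) (X Y : List (Homog k n) → Lam k n) : wedge s t X Y [] = X [] * Y [] := by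
  rw [wedge_eq]
  simp [unshuffles, sg_zero, degSum_nil]

lemma sum_flatMap_pair {α β M : Type*} [AddCommMonoid M] (L : List α) (g h : α → β) (F : β → M) :
    ((L.flatMap fun x => [g x, h x]).map F).sum =
      (L.map fun x => F (g x)).sum + (L.map fun x => F (h x)).sum := by
  induction L with
  | nil => simp
  | cons a L ih =>
    simp only [List.flatMap_cons, List.cons_append, List.nil_append, List.map_cons, List.sum_cons, ih]
    abel

lemma smul_list_sum {α : Type*} (e : ℤ) (L : List α) (F : α → Lam k n) :
    e • (L.map F).sum = (L.map fun x => e • F x).sum := by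
  induction L with
  | nil => simp
  | cons a L ih => simp [ih, smul_add]

lemma prod_units_smul (f : ℕ) (l : List (Homog k n)) (x : Lam k n) :
    (l.map fun b => (-1 : ℤˣ) ^ (1 + f * b.1)).prod • x = sg (l.length + f * degSum l) • x := by
  induction l with
  | nil => simp [degSum_nil, sg_zero]
  | cons a l ih =>
    rw [List.map_cons, List.prod_cons, mul_smul, ih, degSum_cons, List.length_cons]
    have h : ∀ (m : ℕ) (y : Lam k n), ((-1 : ℤˣ) ^ m) • y = sg m • y := fun m y => by
      by_cases hm : Even m
      · rw [hm.neg_one_pow]; simp [sg, hm]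
      · rw [(Nat.not_even_iff_odd.1 hm).neg_one_pow]
        simp [sg, hm]
    rw [h, smul_smul, ← sg_add]
    congr 2
    push_cast
    ring

/-- Inserting a first argument into a wedge product. -/
lemma wedge_cons (s t : ℤ) (X Y : List (Homog k n) → Lam k n) (f : Homog k n)
    (l : List (Homog k n)) : wedge s t X Y (f :: l) =
      sg (t * f.1) • wedge (s + f.1 - 1) t (ins f X) Y l +
        sg s • wedge s (t + f.1 - 1) X (ins f Y) l := by
  rw [wedge_eq, wedge_eq, wedge_eq, unshuffles, sum_flatMap_pair, smul_list_sum, smul_list_sum]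
  congr 2
  · refine List.map_congr_left fun x _ => ?_
    simp only [ins_apply]
    rw [smul_comm (sg _), smul_smul (sg _), ← sg_add, degSum_cons, List.length_cons]
    congr 2
    refine sg_congr ⟨x.2.2.length, ?_⟩
    push_cast
    ring
  · refine List.map_congr_left fun x _ => ?_
    simp only [ins_apply]
    rw [smul_comm (sg _), smul_smul (sg _), ← sg_add, mul_smul, prod_units_smul, smul_smul, ← sg_add,
      List.length_cons]
    congr 2
    refine sg_congr ⟨x.2.1.length + degSum x.2.1, ?_⟩
    push_cast
    ring

lemma ins_wedge (s t : ℤ) (X Y : List (Homog k n) → Lam k n) (f : Homog k n) :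
    ins f (wedge s t X Y) = sg (t * f.1) • wedge (s + f.1 - 1) t (ins f X) Y +
      sg s • wedge s (t + f.1 - 1) X (ins f Y) :=
  funext fun l => wedge_cons s t X Y f l

lemma wedge_add_left (s t : ℤ) (X X' Y : List (Homog k n) → Lam k n) :
    wedge s t (X + X') Y = wedge s t X Y + wedge s t X' Y := by
  funext l
  simp only [wedge, Pi.add_apply, add_mul, smul_add]
  exact List.sum_map_add

lemma wedge_add_right (s t : ℤ) (X Y Y' : List (Homog k n) → Lam k n) :
    wedge s t X (Y + Y') = wedge s t X Y + wedge s t X Y' := by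
  funext l
  simp only [wedge, Pi.add_apply, mul_add, smul_add]
  exact List.sum_map_add

lemma wedge_smul_left (s t : ℤ) (c : k) (X Y : List (Homog k n) → Lam k n) :
    wedge s t (c • X) Y = c • wedge s t X Y := by
  funext l
  simp only [wedge, Pi.smul_apply, smul_mul_assoc, List.smul_sum, List.map_map]
  congr 2
  funext x
  exact smul_comm _ _ _

lemma wedge_smul_right (s t : ℤ) (c : k) (X Y : List (Homog k n) → Lam k n) :
    wedge s t X (c • Y) = c • wedge s t X Y := by
  funext l
  simp only [wedge, Pi.smul_apply, mul_smul_comm, List.smul_sum, List.map_map]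
  congr 2
  funext x
  exact smul_comm _ _ _

/-- The wedge product as a bilinear map. -/
def wedgeₗ (s t : ℤ) : (List (Homog k n) → Lam k n) →ₗ[k] (List (Homog k n) → Lam k n) →ₗ[k]
    (List (Homog k n) → Lam k n) :=
  LinearMap.mk₂ k (wedge s t) (wedge_add_left s t) (wedge_smul_left s t) (wedge_add_right s t)
    (fun c X Y => wedge_smul_right s t c X Y)

lemma wedgeₗ_apply (s t : ℤ) (X Y : List (Homog k n) → Lam k n) :
    wedgeₗ s t X Y = wedge s t X Y := rfl

lemma length_unshuffles (l : List (Homog k n)) :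
    ∀ x ∈ unshuffles l, x.2.1.length + x.2.2.length = l.length := by
  induction l with
  | nil => simp [unshuffles]
  | cons a l ih =>
    intro x hx
    rw [unshuffles, List.mem_flatMap] at hx
    obtain ⟨y, hy, hx⟩ := hx
    have := ih y hy
    simp only [List.mem_cons, List.not_mem_nil, or_false] at hx
    rcases hx with rfl | rfl <;> simp <;> omega

section WedgeMem

variable {s t : ℤ} {X Y : List (Homog k n) → Lam k n}

lemma wedge_deg (hX : X ∈ P.poly s) (hY : Y ∈ P.poly t) (l : List (Homog k n)) :
    wedge s t X Y l ∈ extZ k (Fin n → k) (s + t - l.length + degSum l) := by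
  induction l generalizing s t X Y with
  | nil =>
    rw [wedge_nil]
    refine extZ_cast ?_ (mul_mem_extZ (poly_deg hX []) (poly_deg hY []))
    simp [degSum_nil]
  | cons f l ih =>
    rw [wedge_cons]
    refine add_mem (zsmul_mem (extZ_cast ?_ (ih (ins_mem f hX) hY)) _)
      (zsmul_mem (extZ_cast ?_ (ih hX (ins_mem f hY))) _)
    all_goals
      rw [degSum_cons, List.length_cons]
      push_cast
      ring

lemma ins_add (hX : X ∈ P.poly s) {d : ℕ} (x y : lamDeg k n d) :
    ins ⟨d, x + y⟩ X = ins ⟨d, x⟩ X + ins ⟨d, y⟩ X :=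
  funext fun l => poly_add hX [] l x y

lemma ins_smul (hX : X ∈ P.poly s) {d : ℕ} (c : k) (x : lamDeg k n d) :
    ins ⟨d, c • x⟩ X = c • ins ⟨d, x⟩ X :=
  funext fun l => poly_smul hX [] l c x

lemma ins_ins (hX : X ∈ P.poly s) (a b : Homog k n) :
    ins a (ins b X) = -(sg (a.1 * b.1) • ins b (ins a X)) :=
  funext fun l => by
    have := poly_skew hX [] l b a
    rw [mul_comm (b.1 : ℤ)] at this
    exact this

lemma wedge_append_add (hX : X ∈ P.poly s) (hY : Y ∈ P.poly t) (l₁ l₂ : List (Homog k n)) {d : ℕ}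
    (x y : lamDeg k n d) : wedge s t X Y (l₁ ++ ⟨d, x + y⟩ :: l₂) =
      wedge s t X Y (l₁ ++ ⟨d, x⟩ :: l₂) + wedge s t X Y (l₁ ++ ⟨d, y⟩ :: l₂) := by
  induction l₁ generalizing s t X Y with
  | nil =>
    simp only [List.nil_append]
    rw [wedge_cons, wedge_cons, wedge_cons, ins_add hX, ins_add hY, wedge_add_left, wedge_add_right]
    simp only [Pi.add_apply, smul_add]
    abel
  | cons f l ih =>
    simp only [List.cons_append]
    rw [wedge_cons, wedge_cons, wedge_cons, ih (ins_mem f hX) hY, ih hX (ins_mem f hY)]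
    simp only [smul_add]
    abel

lemma wedge_append_smul (hX : X ∈ P.poly s) (hY : Y ∈ P.poly t) (l₁ l₂ : List (Homog k n)) {d : ℕ}
    (c : k) (x : lamDeg k n d) : wedge s t X Y (l₁ ++ ⟨d, c • x⟩ :: l₂) =
      c • wedge s t X Y (l₁ ++ ⟨d, x⟩ :: l₂) := by
  induction l₁ generalizing s t X Y with
  | nil =>
    simp only [List.nil_append]
    rw [wedge_cons, wedge_cons, ins_smul hX, ins_smul hY, wedge_smul_left, wedge_smul_right]
    simp only [Pi.smul_apply, smul_add, smul_comm c]
  | cons f l ih =>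
    simp only [List.cons_append]
    rw [wedge_cons, wedge_cons, ih (ins_mem f hX) hY, ih hX (ins_mem f hY)]
    simp only [smul_add, smul_comm c]

lemma wedge_zsmul_left (e : ℤ) (X Y : List (Homog k n) → Lam k n) :
    wedge s t (e • X) Y = e • wedge s t X Y := by
  rw [← wedgeₗ_apply, map_zsmul, LinearMap.smul_apply, wedgeₗ_apply]

lemma wedge_zsmul_right (e : ℤ) (X Y : List (Homog k n) → Lam k n) :
    wedge s t X (e • Y) = e • wedge s t X Y := by
  rw [← wedgeₗ_apply, map_zsmul, wedgeₗ_apply]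

lemma wedge_neg_left (X Y : List (Homog k n) → Lam k n) :
    wedge s t (-X) Y = - wedge s t X Y := by
  rw [← wedgeₗ_apply, map_neg, LinearMap.neg_apply, wedgeₗ_apply]

lemma wedge_neg_right (X Y : List (Homog k n) → Lam k n) :
    wedge s t X (-Y) = - wedge s t X Y := by
  rw [← wedgeₗ_apply, map_neg, wedgeₗ_apply]

lemma wedge_append_skew (hX : X ∈ P.poly s) (hY : Y ∈ P.poly t) (l₁ l₂ : List (Homog k n))
    (a b : Homog k n) : wedge s t X Y (l₁ ++ a :: b :: l₂) =
      -(sg (a.1 * b.1) • wedge s t X Y (l₁ ++ b :: a :: l₂)) := by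
  induction l₁ generalizing s t X Y with
  | nil =>
    simp only [List.nil_append]
    rw [wedge_cons, wedge_cons, wedge_cons, wedge_cons, wedge_cons, wedge_cons, ins_ins hX b a,
      ins_ins hY b a, wedge_neg_left, wedge_neg_right, wedge_zsmul_left, wedge_zsmul_right]
    simp only [smul_add, smul_neg, Pi.neg_apply, Pi.smul_apply, smul_smul, ← sg_add]
    rw [show s + (a.1 : ℤ) - 1 + b.1 - 1 = s + b.1 - 1 + a.1 - 1 by ring,
      show t + (a.1 : ℤ) - 1 + b.1 - 1 = t + b.1 - 1 + a.1 - 1 by ring,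
      sg_congr (a := t * a.1 + (t * b.1 + b.1 * a.1)) (b := a.1 * b.1 + (t * b.1 + t * a.1))
        ⟨0, by ring⟩,
      sg_congr (a := t * a.1 + (s + a.1 - 1)) (b := a.1 * b.1 + (s + (t + b.1 - 1) * a.1) + 1)
        ⟨a.1 - b.1 * a.1 - 1, by ring⟩,
      sg_congr (a := s + (t + a.1 - 1) * b.1) (b := a.1 * b.1 + (t * b.1 + (s + b.1 - 1)) + 1)
        ⟨-b.1, by ring⟩,
      sg_congr (a := s + (s + b.1 * a.1)) (b := a.1 * b.1 + (s + s)) ⟨0, by ring⟩,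
      sg_add _ 1, sg_one, sg_add _ 1, sg_one]
    simp only [mul_neg_one, neg_smul]
    abel
  | cons f l ih =>
    simp only [List.cons_append]
    rw [wedge_cons, wedge_cons, ih (ins_mem f hX) hY, ih hX (ins_mem f hY)]
    simp only [smul_add, smul_neg, smul_comm (sg (a.1 * b.1))]
    abel

lemma wedge_append_mul (hX : X ∈ P.poly s) (hY : Y ∈ P.poly t) (l : List (Homog k n))
    (a b : Homog k n) : wedge s t X Y (l ++ [a.mul b]) =
      wedge s t X Y (l ++ [a]) * b.val + sg (a.1 * b.1) • (wedge s t X Y (l ++ [b]) * a.val) := by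
  induction l generalizing s t X Y with
  | nil =>
    simp only [List.nil_append, wedge_cons, wedge_nil, ins_apply]
    have h1 := poly_mul hX [] a b
    have h2 := poly_mul hY [] a b
    simp only [List.nil_append] at h1 h2
    have c1 : ∀ h : Homog k n, h.val * Y [] = sg (t * h.1) • (Y [] * h.val) := fun h => by
      rw [mul_comm_of_mem_extZ h.val_mem (poly_deg hY []), degSum_nil]
      simp [mul_comm]
    rw [h1, h2, add_mul, mul_assoc, c1, smul_mul_assoc, mul_assoc, c1, Homog.fst_mul]
    simp only [add_mul, mul_add, smul_add, mul_smul_comm, smul_mul_assoc, smul_smul, ← sg_add,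
      mul_assoc]
    push_cast
    rw [sg_congr (a := t * (a.1 + b.1) + t * b.1) (b := t * a.1) ⟨t * b.1, by ring⟩,
      sg_congr (a := t * (a.1 + b.1) + (a.1 * b.1 + t * a.1)) (b := a.1 * b.1 + t * b.1)
        ⟨t * a.1, by ring⟩, add_comm s ((a.1 : ℤ) * b.1)]
    abel
  | cons f l ih =>
    simp only [List.cons_append]
    rw [wedge_cons, wedge_cons, wedge_cons, ih (ins_mem f hX) hY, ih hX (ins_mem f hY)]
    simp only [smul_add, add_mul, smul_mul_assoc, smul_comm (sg (a.1 * b.1))]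
    abel

lemma wedge_mem (hX : X ∈ P.poly s) (hY : Y ∈ P.poly t) : wedge s t X Y ∈ P.poly (s + t) := by
  refine mem_poly_iff.2 ⟨fun l₁ l₂ d => wedge_append_add hX hY l₁ l₂,
    fun l₁ l₂ d => wedge_append_smul hX hY l₁ l₂, wedge_append_skew hX hY, wedge_append_mul hX hY,
    ?_, wedge_deg hX hY⟩
  obtain ⟨N, hN⟩ := poly_bdd hX
  obtain ⟨N', hN'⟩ := poly_bdd hY
  refine ⟨N + N', fun l hl => ?_⟩
  rw [wedge_eq]
  refine List.sum_eq_zero fun y hy => ?_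
  obtain ⟨x, hx, rfl⟩ := List.mem_map.1 hy
  have h := length_unshuffles l x hx
  by_cases h1 : N < x.2.1.length
  · rw [hN _ h1, zero_mul, smul_zero, smul_zero]
  · rw [hN' x.2.2 (by omega), mul_zero, smul_zero, smul_zero]

end WedgeMem

end ExteriorPoisson

namespace ExteriorPoisson

variable {k : Type u} [Field k] {n : ℕ} {P : ExteriorPoisson k n}

/-! ### The calculus of multiderivations of a finite exterior algebra -/

section Base

variable {s t r : ℤ} {X Y Z : List (Homog k n) → Lam k n}

lemma nil_mem (hX : X ∈ P.poly t) : X [] ∈ extZ k (Fin n → k) t :=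
  extZ_cast (by simp [degSum_nil]) (poly_deg hX [])

/-- The component without arguments, as a homogeneous element. -/
def nilArg (hX : X ∈ P.poly t) : Homog k n := Homog.ofMem (nil_mem hX)

lemma nilArg_val (hX : X ∈ P.poly t) : (nilArg hX).val = X [] := rfl
lemma nilArg_fst (hX : X ∈ P.poly t) : (nilArg hX).1 = t.natAbs := rfl

lemma single_mem (hX : X ∈ P.poly t) (c : Homog k n) : X [c] ∈ extZ k (Fin n → k) (t - 1 + c.1) :=
  extZ_cast (by simp [degSum_cons, degSum_nil]) (poly_deg hX [c])

lemma apply_single_mul (hX : X ∈ P.poly t) (a b : Homog k n) :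
    X [a.mul b] = X [a] * b.val + sg (a.1 * b.1) • (X [b] * a.val) := poly_mul hX [] a b

/-- The function component of the bracket generated by the divergence. -/
lemma bkt_nil (hX : X ∈ P.poly s) (hY : Y ∈ P.poly t) :
    div (wedge s t X Y) [] - div X [] * Y [] - sg s • (X [] * div Y []) =
      X [nilArg hY] + sg (s * t) • Y [nilArg hX] := by
  refine eq_of_vol fun c => ?_
  have e1 : vol k n (div X [] * Y [] * c.val) = vol k n (div X [] * ((nilArg hY).mul c).val) := by
    rw [mul_assoc]; rfl
  have e2 : X [] * div Y [] * c.val = sg (s * (t - 1)) • (div Y [] * ((nilArg hX).mul c).val) := by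
    rw [mul_comm_of_mem_extZ (nil_mem hX) (nil_mem (div_mem hY)), smul_mul_assoc, mul_assoc]
    rfl
  have e3 : Y [c] * X [] = sg (s * (t - 1 + c.1)) • (X [] * Y [c]) := by
    rw [mul_comm_of_mem_extZ (single_mem hY c) (nil_mem hX), mul_comm s]
  rw [sub_mul, sub_mul, map_sub, map_sub, vol_div (wedge_mem hX hY), e1, vol_div hX,
    smul_mul_assoc, e2, map_zsmul, map_zsmul, vol_div hY, List.nil_append, wedge_cons, wedge_nil,
    wedge_nil, List.nil_append, List.nil_append, apply_single_mul hX, apply_single_mul hY,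
    nilArg_val, nilArg_fst, nilArg_val, nilArg_fst, e3, sg_natAbs_mul, sg_natAbs_mul]
  simp only [List.length_nil, Nat.cast_zero, zero_add, sg_one, ins_apply, map_add, map_zsmul,
    smul_add, add_mul, smul_mul_assoc, neg_smul, one_smul, smul_neg]
  simp only [smul_smul, ← sg_add]
  rw [sg_congr (a := s + s * (t - 1)) (b := s * t) ⟨0, by ring⟩,
    sg_congr (a := s + (s * (t - 1) + (s * c.1 + s * (t - 1 + c.1)))) (b := s)
      ⟨s * c.1 + s * t - s, by ring⟩]
  abel

lemma wedge_single (s t : ℤ) (X Y : List (Homog k n) → Lam k n) (c : Homog k n) :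
    wedge s t X Y [c] = sg (t * c.1) • (X [c] * Y []) + sg s • (X [] * Y [c]) := by
  rw [wedge_cons, wedge_nil, wedge_nil, ins_apply, ins_apply]

lemma bkt_nil_wedge (hX : X ∈ P.poly s) (hY : Y ∈ P.poly t) (hZ : Z ∈ P.poly r) :
    X [nilArg (wedge_mem hY hZ)] + sg (s * (t + r)) • wedge t r Y Z [nilArg hX] =
      (X [nilArg hY] + sg (s * t) • Y [nilArg hX]) * Z [] +
        sg ((s - 1) * t) • (Y [] * (X [nilArg hZ] + sg (s * r) • Z [nilArg hX])) := by
  have h1 : X [nilArg (wedge_mem hY hZ)] = X [(nilArg hY).mul (nilArg hZ)] := by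
    have hv : (nilArg (wedge_mem hY hZ)).val = ((nilArg hY).mul (nilArg hZ)).val := wedge_nil _ _ _ _
    by_cases h0 : ((nilArg hY).mul (nilArg hZ)).val = 0
    · rw [show [nilArg (wedge_mem hY hZ)] = [] ++ [nilArg (wedge_mem hY hZ)] from rfl,
        show [(nilArg hY).mul (nilArg hZ)] = [] ++ [(nilArg hY).mul (nilArg hZ)] from rfl,
        poly_zero_arg hX [] [] (hv.trans h0), poly_zero_arg hX [] [] h0]
    · have hy : Y [] ≠ 0 := fun h => h0 (by rw [Homog.val_mul, nilArg_val, h, zero_mul])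
      have hz : Z [] ≠ 0 := fun h => h0 (by rw [Homog.val_mul, nilArg_val, nilArg_val, h, mul_zero])
      have ht : 0 ≤ t := not_lt.1 fun h => hy (by
        have := nil_mem hY; rwa [extZ_neg h, Submodule.mem_bot] at this)
      have hr : 0 ≤ r := not_lt.1 fun h => hz (by
        have := nil_mem hZ; rwa [extZ_neg h, Submodule.mem_bot] at this)
      have : nilArg (wedge_mem hY hZ) = (nilArg hY).mul (nilArg hZ) :=
        Homog.ext' (by rw [Homog.fst_mul, nilArg_fst, nilArg_fst, nilArg_fst]; omega) hv
      rw [this]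
  have h2 : Y [] * X [nilArg hZ] = sg (t * (s - 1 + r)) • (X [nilArg hZ] * Y []) := by
    rw [mul_comm_of_mem_extZ (nil_mem hY) (single_mem hX (nilArg hZ)), nilArg_fst, mul_add, sg_add,
      sg_mul_natAbs, ← sg_add, ← mul_add]
  rw [h1, apply_single_mul hX, wedge_single t r, nilArg_val, nilArg_val, nilArg_fst, nilArg_fst,
    nilArg_fst, sg_natAbs_mul, sg_mul_natAbs, sg_mul_natAbs, mul_add (Y []), h2]
  simp only [smul_add, add_mul, smul_mul_assoc, mul_smul_comm, smul_smul, ← sg_add]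
  rw [sg_congr (a := s * (t + r) + r * s) (b := s * t) ⟨s * r, by ring⟩,
    sg_congr (a := s * (t + r) + t) (b := (s - 1) * t + s * r) ⟨t, by ring⟩,
    sg_congr (a := (s - 1) * t + t * (s - 1 + r)) (b := t * r) ⟨(s - 1) * t, by ring⟩]
  abel

end Base

lemma foldl_ins (l : List (Homog k n)) (X : List (Homog k n) → Lam k n) :
    l.foldl (fun y f => ins f y) X [] = X l := by
  induction l generalizing X with
  | nil => rfl
  | cons f l ih => rw [List.foldl_cons, ih, ins_apply]

variable (P) in
/-- The multiderivations of a finite exterior algebra, with the divergence of the Frobenius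
form. -/
def calculus : PolyCalculus k (List (Homog k n) → Lam k n) (Homog k n) (Lam k n) where
  X := P.poly
  mul := wedgeₗ
  one := cst Homog.one
  Δ := div
  deg f := f.1
  ins := ins
  ev := LinearMap.proj []
  cst := cst
  one_mem := cst_mem Homog.one
  mul_mem hx hy := wedge_mem hx hy
  Δ_mem hx := div_mem hx
  ins_mem f _ _ hx := ins_mem f hx
  cst_mem h := cst_mem h
  sep := fun {t x} hx h => funext fun l => (foldl_ins l x).symm.trans (h l)
  Δ_Δ hx := div_div hx
  Δ_one := div_cst Homog.one P
  ins_one f := ins_cst f _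
  ins_cst := ins_cst
  ins_mul f s t x y hx hy := ins_wedge s t x y f
  ins_Δ f _ _ hx := ins_div f hx
  ins_ins f g _ _ hx := ins_ins hx f g
  ev_one_mul := fun {t x} hx => by
    change wedge 0 t (cst Homog.one) x [] = x []
    rw [wedge_nil, cst_nil]
    exact one_mul _
  ev_mul := fun {s t x y} hx hy => wedge_nil s t x y
  ev_comm hx hy := mul_comm_of_mem_extZ (nil_mem hx) (nil_mem hy)
  ev_second_order := fun {s t r x y z} hx hy hz => by
    change div (wedge s (t + r) x (wedge t r y z)) [] - wedge (s - 1) (t + r) (div x) (wedge t r y z) [] -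
      sg s • wedge s (t + r - 1) x (div (wedge t r y z)) [] = (div (wedge s t x y) [] -
      wedge (s - 1) t (div x) y [] - sg s • wedge s (t - 1) x (div y) []) * z [] +
      sg ((s - 1) * t) • (y [] * (div (wedge s r x z) [] - wedge (s - 1) r (div x) z [] -
        sg s • wedge s (r - 1) x (div z) []))
    rw [wedge_nil, wedge_nil _ _ _ (div _), wedge_nil (s - 1), wedge_nil s (t - 1),
      wedge_nil (s - 1), wedge_nil s (r - 1), bkt_nil hx (wedge_mem hy hz), bkt_nil hx hy,
      bkt_nil hx hz, bkt_nil_wedge hx hy hz]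
  ev_cst h t x hx := by
    change div (wedge h.1 t (cst h) x) [] - wedge (h.1 - 1) t (div (cst h)) x [] -
      sg h.1 • wedge h.1 (t - 1) (cst h) (div x) [] = sg (h.1 * t) • x [h]
    have hh : nilArg (cst_mem h : cst h ∈ P.poly h.1) = h := Homog.ext' rfl (cst_nil h)
    rw [wedge_nil, wedge_nil, bkt_nil (cst_mem h : cst h ∈ P.poly h.1) hx, hh,
      cst_of_ne h (by simp), zero_add]
  ev_bkt := fun {s t x y} hx hy h1 h2 => by
    change div (wedge s t x y) [] - wedge (s - 1) t (div x) y [] -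
      sg s • wedge s (t - 1) x (div y) [] = 0
    rw [wedge_nil, wedge_nil, bkt_nil hx hy, poly_zero_arg hx [] [] (a := nilArg hy) h2 |>
      (show x [nilArg hy] = 0 from ·), poly_zero_arg hy [] [] (a := nilArg hx) h1 |>
      (show y [nilArg hx] = 0 from ·), smul_zero, add_zero]

end ExteriorPoisson

namespace ExteriorPoisson

variable {k : Type u} [Field k] {n : ℕ} {P : ExteriorPoisson k n}

/-! ### The Poisson bivector and the coboundary of a finite exterior algebra -/

lemma br_skew (a b : Homog k n) : P.br a.val b.val = -(sg (a.1 * b.1) • P.br b.val a.val) := by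
  rw [P.skew _ _ _ a.val_mem' _ b.val_mem', neg_one_pow_smul_eq]
  push_cast
  rfl

lemma br_leibniz (a b : Homog k n) (c : Lam k n) :
    P.br a.val (b.val * c) = P.br a.val b.val * c + sg (a.1 * b.1) • (b.val * P.br a.val c) := by
  rw [P.leibniz _ _ _ a.val_mem' _ b.val_mem', neg_one_pow_smul_eq]
  push_cast
  rfl

lemma br_jacobi (a b : Homog k n) (c : Lam k n) : P.br a.val (P.br b.val c) =
    P.br (P.br a.val b.val) c + sg (a.1 * b.1) • P.br b.val (P.br a.val c) := by
  rw [P.jacobi _ _ _ a.val_mem' _ b.val_mem', neg_one_pow_smul_eq]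
  push_cast
  rfl

lemma br_mem_extZ (a b : Homog k n) : P.br a.val b.val ∈ extZ k (Fin n → k) (a.1 + b.1) :=
  mem_extZ_of_mem (P.br_mem _ _ _ a.val_mem' _ b.val_mem') (by push_cast; rfl)

lemma br_one (a : Homog k n) : P.br a.val 1 = 0 := by
  have h := P.br_leibniz a Homog.one 1
  have hv : (Homog.one : Homog k n).val = 1 := rfl
  have h0 : (Homog.one : Homog k n).1 = 0 := rfl
  rw [hv, h0, mul_one, mul_one, one_mul, Nat.cast_zero, mul_zero, sg_zero, one_smul] at h
  exact left_eq_add.1 h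

lemma bivector_of_length_ne {l : List (Homog k n)} (h : l.length ≠ 2) : P.bivector l = 0 := by
  match l, h with
  | [], _ => rfl
  | [_], _ => rfl
  | [_, _], h => exact absurd rfl h
  | _ :: _ :: _ :: _, _ => rfl

lemma bivector_mem : P.bivector ∈ P.poly 2 := by
  refine mem_poly_iff.2 ⟨?_, ?_, ?_, ?_, ⟨2, fun l hl => bivector_of_length_ne (by omega)⟩, ?_⟩
  · intro l₁ l₂ d x y
    match l₁, l₂ with
    | [], [b] => exact LinearMap.map_add₂ P.br _ _ _
    | [a], [] => exact map_add _ _ _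
    | [], [] => simp [bivector]
    | [], _ :: _ :: _ => simp [bivector]
    | [_], _ :: _ => simp [bivector]
    | _ :: _ :: _, _ =>
      rw [bivector_of_length_ne (by simp), bivector_of_length_ne (by simp),
        bivector_of_length_ne (by simp), add_zero]
  · intro l₁ l₂ d c x
    match l₁, l₂ with
    | [], [b] => exact LinearMap.map_smul₂ P.br _ _ _
    | [a], [] => exact map_smul _ _ _
    | [], [] => simp [bivector]
    | [], _ :: _ :: _ => simp [bivector]
    | [_], _ :: _ => simp [bivector]
    | _ :: _ :: _, _ =>
      rw [bivector_of_length_ne (by simp), bivector_of_length_ne (by simp),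
        smul_zero]
  · intro l₁ l₂ a b
    match l₁, l₂ with
    | [], [] => exact br_skew a b
    | [], _ :: _ => simp [bivector]
    | _ :: _, _ =>
      rw [bivector_of_length_ne (by simp; omega), bivector_of_length_ne (by simp; omega)]
      simp
  · intro l a b
    match l with
    | [] => simp [bivector]
    | [c] =>
      have h : b.val * P.br c.val a.val = sg (b.1 * (c.1 + a.1)) • (P.br c.val a.val * b.val) :=
        mul_comm_of_mem_extZ b.val_mem (br_mem_extZ c a)
      have h' : a.val * P.br c.val b.val = sg (a.1 * (c.1 + b.1)) • (P.br c.val b.val * a.val) :=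
        mul_comm_of_mem_extZ a.val_mem (br_mem_extZ c b)
      change P.br c.val (a.val * b.val) = P.br c.val a.val * b.val +
        sg (a.1 * b.1) • (P.br c.val b.val * a.val)
      rw [br_leibniz, h', smul_smul, ← sg_add, sg_congr (a := (c.1 : ℤ) * a.1 + a.1 * (c.1 + b.1))
        (b := a.1 * b.1) ⟨(c.1 : ℤ) * a.1, by ring⟩]
    | _ :: _ :: _ =>
      rw [bivector_of_length_ne (by simp), bivector_of_length_ne (by simp),
        bivector_of_length_ne (by simp)]
      simp
  · intro l
    match l with
    | [a, b] =>
      exact extZ_cast (by simp [degSum_cons, degSum_nil]) (br_mem_extZ a b)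
    | [] => exact zero_mem _
    | [_] => exact zero_mem _
    | _ :: _ :: _ :: _ => exact zero_mem _

/-- The terms of the Poisson coboundary that involve a given first argument `f`. -/
def hamAt (P : ExteriorPoisson k n) (f : Homog k n) (t : ℤ) (X : List (Homog k n) → Lam k n)
    (l : List (Homog k n)) : Lam k n :=
  sg (f.1 * (t - l.length)) • P.br f.val (X l) +
    ∑ j : Fin l.length, sg ((j : ℤ) + 1 + (l.get j).1 * degSum (l.take j)) •
      X (P.hbr f (l.get j) :: l.eraseIdx j)

lemma hamAt_nil (f : Homog k n) (t : ℤ) (X : List (Homog k n) → Lam k n) :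
    P.hamAt f t X [] = sg (f.1 * t) • P.br f.val (X []) := by
  simp [hamAt]

lemma hamAt_cons {t : ℤ} {X : List (Homog k n) → Lam k n} (hX : X ∈ P.poly t) (f g : Homog k n)
    (l : List (Homog k n)) : P.hamAt f t X (g :: l) =
      -X (P.hbr f g :: l) + sg (f.1 * g.1) • P.hamAt f (t + g.1 - 1) (ins g X) l := by
  unfold hamAt
  rw [sum_fin_cons]
  simp only [List.get_eq_getElem, Fin.val_zero, Fin.val_succ, List.getElem_cons_zero,
    List.getElem_cons_succ, List.take_zero, List.eraseIdx_cons_zero, List.eraseIdx_cons_succ,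
    List.take_succ_cons, degSum_nil, degSum_cons, ins_apply, List.length_cons]
  have h : ∀ j : Fin l.length, X (P.hbr f l[(j : ℕ)] :: g :: l.eraseIdx j) =
      -(sg ((f.1 + (l[(j : ℕ)]).1) * g.1) • X (g :: P.hbr f l[(j : ℕ)] :: l.eraseIdx j)) := by
    intro j
    have := poly_skew hX [] (l.eraseIdx j) (P.hbr f l[(j : ℕ)]) g
    rw [show (P.hbr f l[(j : ℕ)]).1 = f.1 + (l[(j : ℕ)]).1 from rfl] at this
    push_cast at this
    exact this
  simp only [h, smul_add, Finset.smul_sum, smul_neg, smul_smul, ← sg_add]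
  rw [sg_congr (a := (f.1 : ℤ) * (t - ((l.length + 1 : ℕ) : ℤ)))
    (b := f.1 * g.1 + f.1 * (t + g.1 - 1 - l.length)) ⟨-(f.1 * g.1), by push_cast; ring⟩,
    show sg (((0 : ℕ) : ℤ) + 1 + (g.1 : ℤ) * ((0 : ℕ) : ℤ)) = -1 by simp [sg_one], neg_one_smul,
    add_left_comm]
  congr 2
  refine Finset.sum_congr rfl fun j _ => ?_
  rw [← neg_smul, ← mul_neg_one, ← sg_one, ← sg_add]
  congr 1
  refine sg_congr ⟨(l[(j : ℕ)]).1 * g.1 + 1, ?_⟩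
  push_cast
  ring

lemma delta_nil (X : List (Homog k n) → Lam k n) : P.coeffSelf.delta P X [] = 0 := by
  simp [Coefficients.delta]

lemma delta_apply (X : List (Homog k n) → Lam k n) (l : List (Homog k n)) :
    P.coeffSelf.delta P X l =
      (∑ i : Fin l.length, sg ((i : ℤ) + 1 + (l.get i).1 * degSum (l.drop (i + 1))) •
        P.br (X (l.eraseIdx i)) (l.get i).val) +
      ∑ i : Fin l.length, ∑ j : Fin l.length, if i < j then
        sg ((i : ℤ) + j + (l.get i).1 * degSum (l.take i) +
          (l.get j).1 * degSum ((l.take j).eraseIdx i)) •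
          X (P.hbr (l.get i) (l.get j) :: (l.eraseIdx j).eraseIdx i)
      else 0 := by
  simp only [Coefficients.delta, LinearMap.pi_apply, LinearMap.add_apply, LinearMap.sum_apply,
    LinearMap.smul_apply, LinearMap.comp_apply, LinearMap.proj_apply, neg_one_pow_smul_eq]
  congr 1
  refine Finset.sum_congr rfl fun i _ => Finset.sum_congr rfl fun j _ => ?_
  split_ifs with h
  · rw [LinearMap.smul_apply, LinearMap.proj_apply, neg_one_pow_smul_eq]
    push_cast
    rfl
  · rfl

lemma br_right_skew {e : ℤ} {x : Lam k n} (hx : x ∈ extZ k (Fin n → k) e) (f : Homog k n) :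
    P.br x f.val = -(sg (f.1 * e) • P.br f.val x) := by
  have h := br_skew (P := P) (Homog.ofMem hx) f
  rw [show (Homog.ofMem hx).val = x from rfl, show (Homog.ofMem hx).1 = e.natAbs from rfl,
    sg_natAbs_mul, mul_comm] at h
  exact h

/-- The coboundary, by induction on the arguments. -/
lemma delta_cons {t : ℤ} {X : List (Homog k n) → Lam k n} (hX : X ∈ P.poly t) (f : Homog k n)
    (l : List (Homog k n)) : P.coeffSelf.delta P X (f :: l) =
      -P.coeffSelf.delta P (ins f X) l + P.hamAt f t X l := by
  rw [delta_apply, delta_apply, sum_fin_cons, sum_fin_cons]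
  simp only [List.get_eq_getElem, Fin.val_zero, Fin.val_succ, List.getElem_cons_zero,
    List.getElem_cons_succ, List.take_zero, List.eraseIdx_cons_zero, List.eraseIdx_cons_succ,
    List.take_succ_cons, degSum_nil, ins_apply, List.drop_succ_cons,
    List.drop_zero]
  have e0 : (∑ j : Fin (f :: l).length, if (0 : Fin (l.length + 1)) < j then
      sg (((0 : ℕ) : ℤ) + ((j : ℕ) : ℤ) + (f.1 : ℤ) * ((0 : ℕ) : ℤ) + (((f :: l)[(j : ℕ)]).1 : ℤ) *
        degSum (((f :: l).take j).eraseIdx 0)) •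
        X (P.hbr f (f :: l)[(j : ℕ)] :: ((f :: l).eraseIdx j).eraseIdx 0) else 0) =
      ∑ j : Fin l.length, sg ((j : ℤ) + 1 + (l.get j).1 * degSum (l.take j)) •
        X (P.hbr f (l.get j) :: l.eraseIdx j) := by
    rw [sum_fin_cons]
    rw [if_neg (lt_irrefl _), zero_add]
    refine Finset.sum_congr rfl fun j _ => ?_
    rw [if_pos (Fin.succ_pos j)]
    simp
  have e1 : ∀ i : Fin l.length, (∑ j : Fin (f :: l).length, if i.succ < j then
      sg (((i + 1 : ℕ) : ℤ) + ((j : ℕ) : ℤ) + ((l[(i : ℕ)]).1 : ℤ) * degSum (f :: l.take i) +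
        (((f :: l)[(j : ℕ)]).1 : ℤ) * degSum (((f :: l).take j).eraseIdx (i + 1))) •
        X (P.hbr l[(i : ℕ)] (f :: l)[(j : ℕ)] :: ((f :: l).eraseIdx j).eraseIdx (i + 1)) else 0) =
      -∑ j : Fin l.length, if i < j then
        sg ((i : ℤ) + j + (l[(i : ℕ)]).1 * degSum (l.take i) +
          (l[(j : ℕ)]).1 * degSum ((l.take j).eraseIdx i)) •
          X (f :: P.hbr l[(i : ℕ)] l[(j : ℕ)] :: (l.eraseIdx j).eraseIdx i) else 0 := by
    intro i
    rw [sum_fin_cons]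
    rw [if_neg (Fin.not_lt_zero _), zero_add, ← Finset.sum_neg_distrib]
    refine Finset.sum_congr rfl fun j _ => ?_
    by_cases hij : i < j
    · rw [if_pos (Fin.succ_lt_succ_iff.2 hij), if_pos hij]
      simp only [Fin.val_succ, List.getElem_cons_succ, List.take_succ_cons,
        List.eraseIdx_cons_succ, degSum_cons]
      have := poly_skew hX [] ((l.eraseIdx j).eraseIdx i) (P.hbr l[(i : ℕ)] l[(j : ℕ)]) f
      rw [show (P.hbr l[(i : ℕ)] l[(j : ℕ)]).1 = (l[(i : ℕ)]).1 + (l[(j : ℕ)]).1 from rfl] at this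
      simp only [List.nil_append] at this
      rw [this, smul_neg, smul_smul, ← sg_add]
      congr 2
      refine sg_congr ⟨1 + f.1 * l[(i : ℕ)].1 + f.1 * l[(j : ℕ)].1, ?_⟩
      push_cast
      ring
    · rw [if_neg (fun h => hij (Fin.succ_lt_succ_iff.1 h)), if_neg hij, neg_zero]
  have e2 : ∀ i : Fin l.length, sg (((i + 1 : ℕ) : ℤ) + 1 + (l[(i : ℕ)]).1 * degSum (l.drop (i + 1))) •
      P.br (X (f :: l.eraseIdx i)) (l[(i : ℕ)]).val =
      -(sg ((i : ℤ) + 1 + (l[(i : ℕ)]).1 * degSum (l.drop (i + 1))) •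
      P.br (X (f :: l.eraseIdx i)) (l[(i : ℕ)]).val) := by
    intro i
    rw [← neg_smul, ← mul_neg_one, ← sg_one, ← sg_add]
    congr 2
    push_cast
    ring
  have e3 : sg (((0 : ℕ) : ℤ) + 1 + (f.1 : ℤ) * degSum l) • P.br (X l) f.val =
      sg (f.1 * (t - l.length)) • P.br f.val (X l) := by
    rw [br_right_skew (poly_deg hX l), smul_neg, smul_smul, ← sg_add, ← neg_smul, ← mul_neg_one,
      ← sg_one, ← sg_add]
    congr 1
    exact sg_congr ⟨1 + f.1 * degSum l, by push_cast; ring⟩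
  rw [e3, hamAt]
  erw [e0]
  simp only [e2, Finset.sum_neg_distrib]
  erw [Finset.sum_congr rfl fun i _ => e1 i]
  simp only [Finset.sum_neg_distrib, List.get_eq_getElem]
  abel

end ExteriorPoisson

/-! ### The Poisson coboundary as a bracket with the bivector -/

namespace ExteriorPoisson

variable {k : Type u} [Field k] {n : ℕ} (P : ExteriorPoisson k n)

/-- The negative of the bracket of homogeneous elements. -/
def negBr (f g : Homog k n) : Homog k n :=
  ⟨f.1 + g.1, -P.br f.val g.val, neg_mem (P.br_mem _ _ _ f.val_mem' _ g.val_mem')⟩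

lemma negBr_val (f g : Homog k n) : (P.negBr f g).val = -P.br f.val g.val := rfl

lemma cst_eq_of_val {a b c : Homog k n} {e : ℤ} (h : a.val = b.val + sg e • c.val) :
    cst a = cst b + sg e • cst c := by
  funext l
  by_cases hl : l = []
  · subst hl
    rw [Pi.add_apply, Pi.smul_apply, cst_nil, cst_nil, cst_nil, h]
  · rw [Pi.add_apply, Pi.smul_apply, cst_of_ne _ hl, cst_of_ne _ hl, cst_of_ne _ hl, smul_zero,
      add_zero]

/-- The bivector `-π` in the calculus of multiderivations. With this sign, bracketing with it is
the Poisson coboundary. -/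
def biv : P.calculus.Bivector where
  pi := -P.bivector
  brH := P.negBr
  pi_mem := neg_mem bivector_mem
  deg_brH f g := by
    change ((f.1 + g.1 : ℕ) : ℤ) = f.1 + g.1
    push_cast
    rfl
  ev_pi := neg_zero
  ev_ins_pi f := neg_zero
  ins_ins_pi f g := by
    funext l
    change -P.bivector (f :: g :: l) = cst (P.negBr f g) l
    cases l with
    | nil => rfl
    | cons a l => exact neg_zero
  jacobi f g h := cst_eq_of_val (by
    simp only [negBr_val, map_neg, neg_neg, LinearMap.neg_apply]
    exact P.br_jacobi f g h.val)

variable {P}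

lemma calculus_bkt_nil {s t : ℤ} {X Y : List (Homog k n) → Lam k n} (hX : X ∈ P.poly s)
    (hY : Y ∈ P.poly t) : P.calculus.bkt s t X Y [] =
      X [nilArg hY] + sg (s * t) • Y [nilArg hX] := by
  rw [PolyCalculus.bkt_apply]
  change div (wedge s t X Y) [] - wedge (s - 1) t (div X) Y [] -
      sg s • wedge s (t - 1) X (div Y) [] = _
  rw [wedge_nil, wedge_nil, bkt_nil hX hY]

lemma hamAt_eq (f : Homog k n) (l : List (Homog k n)) {t : ℤ} {X : List (Homog k n) → Lam k n}
    (hX : X ∈ P.poly t) : P.hamAt f t X l =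
      -(sg (t * f.1) • P.calculus.bkt (f.1 + 1) t (ins f P.biv.pi) X l) := by
  have hf : ins f P.biv.pi ∈ P.poly (f.1 + 1) := P.biv.ins_pi_mem f
  induction l generalizing t X with
  | nil =>
    rw [hamAt_nil, calculus_bkt_nil hf hX,
      show X [nilArg hf] = 0 from poly_zero_arg hX [] [] (a := nilArg hf) neg_zero, smul_zero,
      add_zero, show ins f P.biv.pi [nilArg hX] = -P.br f.val (X []) from rfl, smul_neg, neg_neg,
      mul_comm]
  | cons g l ih =>
    have h := congrFun (P.biv.ins_bkt_ham f g (t := t) (x := X) hX) l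
    change P.calculus.bkt (f.1 + 1) t (ins f P.biv.pi) X (g :: l) =
      -(sg (t * f.1) • X (P.negBr f g :: l)) +
        sg f.1 • P.calculus.bkt (f.1 + 1) (t + g.1 - 1) (ins f P.biv.pi) (ins g X) l at h
    have hn : X (P.negBr f g :: l) = -X (P.hbr f g :: l) := by
      have h1 := poly_smul hX [] l (-1 : k) (P.hbr f g).2
      rw [neg_one_smul] at h1
      refine Eq.trans (congrArg (fun c => X (c :: l)) ?_) h1
      exact Homog.ext' rfl (neg_one_smul k _).symm
    rw [hamAt_cons hX, ih (ins_mem g hX), h, hn]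
    simp only [smul_add, smul_neg, neg_add_rev, smul_smul, ← sg_add, neg_neg]
    rw [sg_congr (a := t * f.1 + t * f.1) (b := 0) ⟨t * f.1, by ring⟩, sg_zero, one_smul,
      sg_congr (a := (f.1 * g.1 : ℤ) + (t + g.1 - 1) * f.1) (b := t * f.1 + f.1)
        ⟨f.1 * g.1 - f.1, by ring⟩, add_comm]

/-- The Poisson coboundary is the bracket with the bivector. -/
lemma delta_eq (l : List (Homog k n)) {t : ℤ} {X : List (Homog k n) → Lam k n}
    (hX : X ∈ P.poly t) : P.coeffSelf.delta P X l = P.calculus.bkt 2 t P.biv.pi X l := by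
  induction l generalizing t X with
  | nil =>
    have hpi : P.biv.pi ∈ P.poly 2 := P.biv.pi_mem
    rw [delta_nil, calculus_bkt_nil hpi hX,
      show X [nilArg hpi] = 0 from poly_zero_arg hX [] [] (a := nilArg hpi) neg_zero, smul_zero,
      add_zero]
    exact neg_zero.symm
  | cons f l ih =>
    have h := congrFun (P.biv.ins_bkt_pi f (t := t) (x := X) hX) l
    change P.calculus.bkt 2 t P.biv.pi X (f :: l) =
      -(sg (t * f.1) • P.calculus.bkt (f.1 + 1) t (ins f P.biv.pi) X l) -
        P.calculus.bkt 2 (t + f.1 - 1) P.biv.pi (ins f X) l at h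
    rw [delta_cons hX, ih (ins_mem f hX), hamAt_eq f l hX, h]
    abel

variable (P) in
/-- The Poisson structure of the calculus of multiderivations. -/
def poisson : P.calculus.Poisson where
  toBivector := P.biv
  b := P.coeffSelf.delta P
  b_apply hx := funext fun l => delta_eq l hx

/-! ### The modular derivation of a finite exterior algebra -/

lemma div_bivector_mem : div P.bivector ∈ P.poly 1 := by
  have h := div_mem (bivector_mem (P := P))
  rwa [show (2 : ℤ) - 1 = 1 by norm_num] at h

lemma modularDerivation_apply (a : Homog k n) :
    P.modularDerivation a.val = -div P.bivector [a] := by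
  have h : ∀ c, c ∈ lamDeg k n a.1 →
      ∃ hc : c ∈ lamDeg k n a.1, P.modularDerivation c = -div P.bivector [⟨a.1, c, hc⟩] := by
    intro c hc
    let p : Lam k n → Prop := fun c =>
      ∃ hc : c ∈ lamDeg k n a.1, P.modularDerivation c = -div P.bivector [⟨a.1, c, hc⟩]
    have e0 : p 0 := by
      have h0 : (0 : Lam k n) ∈ lamDeg k n a.1 := Submodule.zero_mem _
      refine ⟨h0, ?_⟩
      have := poly_zero_arg (P := P) div_bivector_mem [] [] (a := ⟨a.1, 0, h0⟩) rfl
      rw [List.nil_append] at this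
      rw [this, map_zero, neg_zero]
    have e1 : ∀ x y, p x → p y → p (x + y) := by
      rintro x y ⟨hx, hx'⟩ ⟨hy, hy'⟩
      refine ⟨Submodule.add_mem _ hx hy, ?_⟩
      rw [map_add, hx', hy', ← neg_add]
      exact congrArg _ (poly_add (P := P) div_bivector_mem [] [] ⟨x, hx⟩ ⟨y, hy⟩).symm
    have e2 : ∀ (e : k) x, p x → p (e • x) := by
      rintro e x ⟨hx, hx'⟩
      refine ⟨Submodule.smul_mem _ e hx, ?_⟩
      rw [map_smul, hx', smul_neg]
      exact congrArg _ (poly_smul (P := P) div_bivector_mem [] [] e ⟨x, hx⟩).symm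
    have e3 : ∀ s : Finset (Fin n), s.card = a.1 → p (monoBasis k n s) := by
      intro s hs
      refine ⟨hs ▸ monoBasis_mem k n s, ?_⟩
      rw [modularDerivation, LinearMap.neg_apply, Module.Basis.constr_basis]
      rw [show Homog.mono s = (⟨a.1, monoBasis k n s, hs ▸ monoBasis_mem k n s⟩ : Homog k n) from
        Homog.ext' hs rfl]
    exact lam_induction hc e0 e1 e2 e3
  obtain ⟨_, h⟩ := h a.val a.val_mem'
  exact h

lemma modularDerivation_mem (a : Homog k n) : P.modularDerivation a.val ∈ lamDeg k n a.1 := by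
  rw [modularDerivation_apply]
  have h := single_mem (P := P) div_bivector_mem a
  rw [show (1 : ℤ) - 1 + a.1 = (a.1 : ℕ) by ring, extZ_natCast] at h
  exact neg_mem h

/-- The modular derivation applied to a homogeneous element. -/
def modH (P : ExteriorPoisson k n) (a : Homog k n) : Homog k n :=
  ⟨a.1, P.modularDerivation a.val, modularDerivation_mem a⟩

/-- Hamiltonian derivations preserve the volume functional up to the modular derivation. -/
lemma vol_modular_mul (a : Homog k n) (y : Lam k n) :
    vol k n (P.modularDerivation a.val * y) = -vol k n (P.br a.val y) := by
  have h : (vol k n ∘ₗ LinearMap.mulLeft k (P.modularDerivation a.val)) =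
      -(vol k n ∘ₗ P.br a.val) := linearMap_ext_homog fun c => by
    rw [LinearMap.comp_apply, LinearMap.mulLeft_apply, modularDerivation_apply, neg_mul, map_neg,
      vol_div (P := P) bivector_mem]
    simp only [List.length_cons, List.length_nil, LinearMap.neg_apply, LinearMap.comp_apply]
    rw [show sg (((0 + 1 : ℕ) : ℤ) + 1) = 1 from sg_two, one_smul]
    rfl
  exact LinearMap.congr_fun h y

lemma vol_modular (y : Lam k n) : vol k n (P.modularDerivation y) = 0 := by
  have h : vol k n ∘ₗ P.modularDerivation = 0 := linearMap_ext_homog fun c => by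
    have := vol_modular_mul (P := P) c 1
    rw [mul_one, br_one, map_zero, neg_zero] at this
    exact this
  exact LinearMap.congr_fun h y

lemma modularDerivation_mul (a b : Homog k n) : P.modularDerivation (a.val * b.val) =
    P.modularDerivation a.val * b.val + a.val * P.modularDerivation b.val := by
  have h := apply_single_mul (P := P) div_bivector_mem a b
  have h2 := modularDerivation_apply (P := P) (a.mul b)
  have h3 : a.val * P.modularDerivation b.val =
      sg (a.1 * b.1) • (P.modularDerivation b.val * a.val) :=
    mul_comm_of_mem_extZ a.val_mem (mem_extZ_of_mem (modularDerivation_mem b) rfl)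
  rw [Homog.val_mul] at h2
  rw [h2, h, h3, modularDerivation_apply, modularDerivation_apply, neg_add, neg_mul, neg_mul, smul_neg]

/-- The modular derivation is skew-adjoint for the Frobenius form. -/
lemma vol_modular_skew (y c : Lam k n) :
    vol k n (P.modularDerivation y * c) = -vol k n (y * P.modularDerivation c) := by
  have h : ∀ a b : Homog k n, vol k n (P.modularDerivation a.val * b.val) =
      -vol k n (a.val * P.modularDerivation b.val) := fun a b => by
    have := vol_modular (P := P) (a.val * b.val)
    rw [modularDerivation_mul, map_add] at this
    exact eq_neg_of_add_eq_zero_left this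
  have h1 : ∀ a : Homog k n, vol k n ∘ₗ LinearMap.mulLeft k (P.modularDerivation a.val) =
      -(vol k n ∘ₗ LinearMap.mulLeft k a.val ∘ₗ P.modularDerivation) :=
    fun a => linearMap_ext_homog fun b => h a b
  have h2 : vol k n ∘ₗ LinearMap.mulRight k c ∘ₗ P.modularDerivation =
      -(vol k n ∘ₗ LinearMap.mulRight k (P.modularDerivation c)) :=
    linearMap_ext_homog fun a => LinearMap.congr_fun (h1 a) c
  exact LinearMap.congr_fun h2 y

/-! ### Transport to the dual coefficients -/

/-- Under the Frobenius isomorphism the Poisson bracket becomes the twisted action on the dual: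
the modular derivation in the twist compensates the divergence of the Hamiltonian derivation. -/
lemma frob_br (m : Lam k n) (a : Homog k n) :
    frobEquiv k n (P.br m a.val) = P.coeffDual.br a.val (frobEquiv k n m) := by
  have h : ∀ m : Homog k n, frobEquiv k n (P.br m.val a.val) =
      P.coeffDual.br a.val (frobEquiv k n m.val) := by
    intro m
    refine LinearMap.ext fun c => ?_
    change vol k n (P.br m.val a.val * c) =
      vol k n (m.val * P.br a.val c) + vol k n (m.val * (P.modularDerivation a.val * c))
    have h1 := vol_modular_mul (P := P) a (m.val * c)
    rw [br_leibniz, map_add, map_zsmul] at h1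
    have h2 : m.val * (P.modularDerivation a.val * c) =
        sg (m.1 * a.1) • (P.modularDerivation a.val * (m.val * c)) := by
      rw [← mul_assoc, mul_comm_of_mem_extZ m.val_mem
        (mem_extZ_of_mem (modularDerivation_mem a) rfl), smul_mul_assoc, mul_assoc]
    rw [h2, map_zsmul, h1, br_skew, neg_mul, map_neg, vol_smul_mul, smul_neg, smul_add, smul_smul,
      ← sg_add, sg_congr (a := (m.1 * a.1 : ℤ) + a.1 * m.1) (b := 0) ⟨m.1 * a.1, by ring⟩, sg_zero,
      one_smul]
    abel
  have h2 : (frobEquiv k n).toLinearMap ∘ₗ P.br.flip a.val =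
      P.coeffDual.br a.val ∘ₗ (frobEquiv k n).toLinearMap :=
    linearMap_ext_homog fun m => h m
  exact LinearMap.congr_fun h2 m

/-- The isomorphism `η^!` intertwines the Poisson coboundaries with coefficients in `Λ` and in the
twisted dual. -/
lemma iotaEta_delta (X : List (Homog k n) → Lam k n) :
    iotaEta (P.coeffSelf.delta P X) = P.coeffDual.delta P (iotaEta X) := by
  funext l
  change frobEquiv k n (P.coeffSelf.delta P X l) = _
  simp only [Coefficients.delta, LinearMap.pi_apply, LinearMap.add_apply, LinearMap.sum_apply,
    LinearMap.smul_apply, LinearMap.comp_apply, LinearMap.proj_apply, map_add, map_sum, map_smul]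
  congr 1
  · refine Finset.sum_congr rfl fun i _ => ?_
    congr 1
    exact frob_br _ _
  · refine Finset.sum_congr rfl fun i _ => Finset.sum_congr rfl fun j _ => ?_
    split_ifs
    · rw [LinearMap.smul_apply, LinearMap.smul_apply, map_smul]
      rfl
    · exact map_zero _

lemma frob_act (m : Lam k n) (b : Lam k n) :
    frobEquiv k n (m * b) = P.coeffDual.act (frobEquiv k n m) b :=
  LinearMap.ext fun c => congrArg (vol k n) (mul_assoc m b c)

lemma frob_mem_gr {e : ℤ} {x : Lam k n} :
    frobEquiv k n x ∈ P.coeffDual.gr e ↔ x ∈ extZ k (Fin n → k) (n - e) := by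
  rw [mem_extZ_iff_vol]
  change frobEquiv k n x ∈ (⨅ (d : ℕ) (_ : (d : ℤ) ≠ e), (lamDeg k n d).dualAnnihilator) ↔ _
  simp only [Submodule.mem_iInf, Submodule.mem_dualAnnihilator, sub_sub_cancel]
  exact ⟨fun h d c hc hd => h d hd c hc, fun h d hd c hc => h d c hc hd⟩

lemma iotaEta_mem {t : ℤ} {X : List (Homog k n) → Lam k n} :
    iotaEta X ∈ P.coeffDual.cochains (n - t) ↔ X ∈ P.poly t := by
  have inj := (frobEquiv k n).injective
  have hg : ∀ l, iotaEta X l ∈ P.coeffDual.gr (n - t + l.length - degSum l) ↔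
      X l ∈ extZ k (Fin n → k) (t - l.length + degSum l) := fun l => by
    change frobEquiv k n (X l) ∈ _ ↔ _
    rw [frob_mem_gr]
    rw [show (n : ℤ) - (n - t + l.length - degSum l) = t - l.length + degSum l by ring]
  have ha : ∀ l (a b : Homog k n), iotaEta X (l ++ [a.mul b]) =
      P.coeffDual.act (iotaEta X (l ++ [a])) b.val +
        (-1 : k) ^ (a.1 * b.1) • P.coeffDual.act (iotaEta X (l ++ [b])) a.val ↔
      X (l ++ [a.mul b]) = X (l ++ [a]) * b.val + sg (a.1 * b.1) • (X (l ++ [b]) * a.val) := by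
    intro l a b
    have h := neg_one_pow_smul_eq (k := k) (a.1 * b.1) (X (l ++ [b]) * a.val)
    push_cast at h
    rw [← h, ← inj.eq_iff, map_add, map_smul, frob_act (P := P), frob_act (P := P)]
    rfl
  rw [mem_poly_iff]
  change ((_ ∧ _ ∧ _ ∧ _) ∧ _ ∧ _) ↔ _
  simp only [hg, and_assoc]
  refine and_congr ?_ (and_congr ?_ (and_congr ?_ (and_congr ?_ (and_congr ?_ Iff.rfl))))
  · refine forall₅_congr fun l₁ l₂ d x y => ?_
    rw [← inj.eq_iff, map_add]
    rfl
  · refine forall₅_congr fun l₁ l₂ d x y => ?_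
    rw [← inj.eq_iff, map_smul]
    rfl
  · refine forall₄_congr fun l₁ l₂ a b => ?_
    have h := neg_one_pow_smul_eq (k := k) (a.1 * b.1) (X (l₁ ++ b :: a :: l₂))
    push_cast at h
    rw [← h, ← inj.eq_iff, map_neg, map_smul]
    rfl
  · exact forall₃_congr ha
  · refine exists_congr fun N => forall₂_congr fun l _ => ?_
    rw [← inj.eq_iff, map_zero]
    rfl

end ExteriorPoisson

/-! ### Diagonalizability from an annihilating polynomial -/

section Diagonal

open Polynomial

variable {k : Type*} [Field k] {E : Type*} [AddCommGroup E] [Module k E] {L : Module.End k E}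
  {W : Submodule k E}

lemma aeval_apply_mem (hW : ∀ x ∈ W, L x ∈ W) (p : k[X]) {x : E} (hx : x ∈ W) :
    aeval L p x ∈ W := by
  have hpow : ∀ (m : ℕ), (L ^ m) x ∈ W := fun m => by
    induction m with
    | zero => exact hx
    | succ m ih => rw [pow_succ']; exact hW _ ih
  induction p using Polynomial.induction_on' with
  | add p q hp hq => rw [map_add]; exact add_mem hp hq
  | monomial m c =>
    rw [aeval_monomial, Module.algebraMap_end_eq_smul_id, smul_mul_assoc]
    exact Submodule.smul_mem _ _ (hpow m)

/-- A functional that is an eigenvector for the transpose of `L` on an invariant subspace. -/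
lemma functional_aeval_apply (hW : ∀ x ∈ W, L x ∈ W) (φ : E →ₗ[k] k) (s : k)
    (h : ∀ x ∈ W, φ (L x) = s * φ x) (p : k[X]) {x : E} (hx : x ∈ W) :
    φ (aeval L p x) = p.eval s * φ x := by
  have hpow : ∀ (m : ℕ), (L ^ m) x ∈ W ∧ φ ((L ^ m) x) = s ^ m * φ x := fun m => by
    induction m with
    | zero => exact ⟨hx, by simp⟩
    | succ m ih =>
      rw [pow_succ', Module.End.mul_apply]
      refine ⟨hW _ ih.1, ?_⟩
      rw [h _ ih.1, ih.2, pow_succ', mul_assoc]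
  induction p using Polynomial.induction_on' with
  | add p q hp hq => rw [map_add, LinearMap.add_apply, map_add, hp, hq, eval_add, add_mul]
  | monomial m c =>
    rw [aeval_monomial, Module.algebraMap_end_eq_smul_id, smul_mul_assoc, eval_monomial, mul_assoc,
      ← (hpow m).2]
    exact map_smul φ c ((L ^ m) x)

/-- A vector of an invariant subspace, annihilated by a product of distinct linear factors in `L`,
is a sum of eigenvectors in that subspace. -/
lemma mem_iSup_eigenspace_of_aeval (hW : ∀ x ∈ W, L x ∈ W) (U : Finset k) {x : E} (hx : x ∈ W)
    (h : aeval L (∏ c ∈ U, (X - C c)) x = 0) :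
    x ∈ ⨆ c ∈ U, W ⊓ Module.End.eigenspace L c := by
  classical
  induction U using Finset.induction_on generalizing x with
  | empty =>
    rw [Finset.prod_empty, map_one] at h
    rw [show x = 0 from h]
    exact zero_mem _
  | insert c U hc ih =>
    have hy : L x - c • x ∈ W := sub_mem (hW x hx) (Submodule.smul_mem _ _ hx)
    rw [Finset.prod_insert hc, mul_comm, map_mul, Module.End.mul_apply] at h
    have e : aeval L (X - C c) x = L x - c • x := by simp
    rw [e] at h
    have h1 := ih hy h
    have h2 : ∃ z ∈ ⨆ c ∈ U, W ⊓ Module.End.eigenspace L c, L z - c • z = L x - c • x := by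
      have : (⨆ c ∈ U, W ⊓ Module.End.eigenspace L c) ≤
          (⨆ c ∈ U, W ⊓ Module.End.eigenspace L c).map (L - algebraMap k _ c) := by
        refine iSup₂_le fun a ha y hy => ?_
        have hya : L y = a • y := Module.End.mem_eigenspace_iff.1 hy.2
        have hac : a - c ≠ 0 := sub_ne_zero.2 fun e => hc (e ▸ ha)
        refine ⟨(a - c)⁻¹ • y, Submodule.smul_mem _ _
          ((le_iSup₂_of_le a ha le_rfl : W ⊓ Module.End.eigenspace L a ≤ _) hy), ?_⟩
        rw [map_smul, LinearMap.sub_apply, hya, Module.algebraMap_end_apply, ← sub_smul, smul_smul,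
          inv_mul_cancel₀ hac, one_smul]
      obtain ⟨z, hz, hz'⟩ := this h1
      exact ⟨z, hz, hz'⟩
    obtain ⟨z, hz, hzx⟩ := h2
    rw [Finset.iSup_insert]
    have hzW : z ∈ W := (iSup₂_le fun a _ => inf_le_left :
      (⨆ c ∈ U, W ⊓ Module.End.eigenspace L c) ≤ W) hz
    rw [← sub_add_cancel x z]
    refine Submodule.add_mem_sup ⟨sub_mem hx hzW, Module.End.mem_eigenspace_iff.2 ?_⟩ hz
    rw [map_sub, smul_sub]
    rw [sub_eq_iff_eq_add] at hzx
    rw [hzx]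
    abel

end Diagonal

lemma finite_setOf_list_sum {α : Type*} [AddCommMonoid α] {Λ : Set α} (hΛ : Λ.Finite) (N : ℕ) :
    {s | ∃ cs : List α, cs.length ≤ N ∧ (∀ c ∈ cs, c ∈ Λ) ∧ cs.sum = s}.Finite := by
  induction N with
  | zero =>
    refine (Set.finite_singleton 0).subset ?_
    rintro _ ⟨cs, h, -, rfl⟩
    rw [List.length_eq_zero_iff.1 (Nat.le_zero.1 h)]
    rfl
  | succ N ih =>
    refine ((Set.finite_singleton 0).union (Set.Finite.image2 (· + ·) hΛ ih)).subset ?_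
    rintro _ ⟨cs, h, hcs, rfl⟩
    cases cs with
    | nil => exact Or.inl rfl
    | cons c cs =>
      refine Or.inr ⟨c, hcs c List.mem_cons_self, _, ⟨cs, ?_, fun a ha => hcs a
        (List.mem_cons_of_mem _ ha), rfl⟩, List.sum_cons.symm⟩
      simpa using h

namespace ExteriorPoisson

variable {k : Type u} [Field k] {n : ℕ} {P : ExteriorPoisson k n}

/-! ### Weights of multiderivations of a finite exterior algebra -/

lemma modular_apply (a : Homog k n) (l : List (Homog k n)) :
    P.poisson.modular (a :: l) = -cst (modH P a) l := by
  have hm : P.poisson.modular = div P.bivector := by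
    change -div (-P.bivector) = div P.bivector
    rw [map_neg, neg_neg]
  rw [hm]
  cases l with
  | nil =>
    rw [cst_nil]
    change _ = -P.modularDerivation a.val
    rw [modularDerivation_apply, neg_neg]
  | cons b l =>
    rw [cst_of_ne _ (List.cons_ne_nil _ _), neg_zero]
    refine eq_of_vol fun c => ?_
    rw [vol_div (P := P) bivector_mem, bivector_of_length_ne (by simp), map_zero, smul_zero, zero_mul,
      map_zero]

lemma lie_cons {t : ℤ} {X : List (Homog k n) → Lam k n} (hX : X ∈ P.poly t) (a : Homog k n)
    (l : List (Homog k n)) :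
    P.poisson.lie X (a :: l) = X (modH P a :: l) + P.poisson.lie (ins a X) l := by
  have h := P.calculus.ins_bkt a P.poisson.modular_mem (show X ∈ P.calculus.X t from hX)
  have e : P.calculus.ins a P.poisson.modular = -cst (modH P a) := funext fun l => modular_apply a l
  have h1 := P.calculus.bkt_cst (modH P a) (show X ∈ P.calculus.X t from hX)
  have h2 : P.poisson.lie (ins a X) = P.calculus.bkt 1 (t + a.1 - 1) P.poisson.modular (ins a X) :=
    P.poisson.lie_eq (ins_mem a hX)
  rw [h2, P.poisson.lie_eq (show X ∈ P.calculus.X t from hX)]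
  have h3 : P.calculus.bkt (1 + P.calculus.deg a - 1) t (P.calculus.ins a P.poisson.modular) X =
      -(sg (P.calculus.deg a * t) • ins (modH P a) X) := by
    rw [e, map_neg, LinearMap.neg_apply, add_sub_cancel_left]
    exact congrArg _ h1
  rw [h3, sg_one, smul_neg, neg_neg, smul_smul, ← sg_add,
    sg_congr (a := t * P.calculus.deg a + P.calculus.deg a * t) (b := 0)
      ⟨P.calculus.deg a * t, by ring⟩, sg_zero, one_smul, neg_one_smul, sub_neg_eq_add] at h
  exact congrFun h l

lemma lie_nil {t : ℤ} {X : List (Homog k n) → Lam k n} (hX : X ∈ P.poly t) :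
    P.poisson.lie X [] = -P.modularDerivation (X []) := by
  rw [P.poisson.lie_eq (show X ∈ P.calculus.X t from hX),
    calculus_bkt_nil (P.poisson.modular_mem) hX, modular_apply, cst_nil]
  have h0 : P.poisson.modular [] = 0 := by
    have hm : P.poisson.modular = div P.bivector := by
      change -div (-P.bivector) = div P.bivector
      rw [map_neg, neg_neg]
    rw [hm]
    refine eq_of_vol fun c => ?_
    rw [vol_div (P := P) bivector_mem, bivector_of_length_ne (by simp), map_zero, smul_zero, zero_mul,
      map_zero]
  rw [show X [nilArg (P.poisson.modular_mem : _ ∈ P.poly 1)] = 0 from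
    poly_zero_arg hX [] [] (a := nilArg (P.poisson.modular_mem : _ ∈ P.poly 1)) h0, smul_zero,
    add_zero]
  rfl

/-- On arguments that are eigenvectors of the modular derivation, the Lie derivative along the
modular vector is multiplication by the sum of the eigenvalues. -/
lemma vol_lie_of_hasWeights {t : ℤ} {X : List (Homog k n) → Lam k n} (hX : X ∈ P.poly t)
    {f : Lam k n} {c : k} (hf : P.modularDerivation f = c • f) (l : List (Homog k n)) {cs : List k}
    (hl : HasWeights P.modularDerivation (l.map Homog.val) cs) :
    vol k n (P.poisson.lie X l * f) = (c :: cs).sum * vol k n (X l * f) := by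
  induction l generalizing t X cs with
  | nil =>
    cases hl
    rw [lie_nil hX, neg_mul, map_neg, vol_modular_skew, neg_neg, hf, mul_smul_comm, map_smul]
    simp
  | cons a l ih =>
    cases hl with
    | @cons _ b _ bs ha hl =>
      rw [lie_cons hX, add_mul, map_add, ih (ins_mem a hX) hl]
      have h : X (modH P a :: l) = b • X (a :: l) := by
        refine Eq.trans ?_ (poly_smul hX [] l b a.2)
        exact congrArg (fun x => X (x :: l)) (Homog.ext' rfl ha)
      rw [h, smul_mul_assoc, map_smul, smul_eq_mul]
      change b * vol k n (X (a :: l) * f) + (c :: bs).sum * vol k n (X (a :: l) * f) = _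
      simp only [List.sum_cons]
      ring

instance : Module.Finite k (Lam k n) := Module.Finite.of_basis (monoBasis k n)

lemma lamDeg_le_iSup (hν : IsDiagonalizable P.modularDerivation) (d : ℕ) :
    lamDeg k n d ≤ ⨆ c : k, lamDeg k n d ⊓ Module.End.eigenspace P.modularDerivation c := by
  have h := Submodule.inf_iSup_genEigenspace (p := lamDeg k n d) (f := P.modularDerivation)
    (fun x hx => modularDerivation_mem ⟨d, x, hx⟩) 1
  have hν' : ⨆ c : k, Module.End.genEigenspace P.modularDerivation c 1 = ⊤ := hν
  rw [hν', inf_top_eq] at h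
  exact h.le

/-- A multiderivation that vanishes on eigenvectors of the modular derivation is zero. -/
lemma eq_zero_of_eigenvectors (hν : IsDiagonalizable P.modularDerivation) {t : ℤ}
    {X : List (Homog k n) → Lam k n} (hX : X ∈ P.poly t)
    (h : ∀ (f : Lam k n) (c : k) (l : List (Homog k n)) (cs : List k),
      P.modularDerivation f = c • f → HasWeights P.modularDerivation (l.map Homog.val) cs →
      (∀ b ∈ c :: cs, Module.End.HasEigenvalue P.modularDerivation b) →
      vol k n (X l * f) = 0) : X = 0 := by
  have key : ∀ (l : List (Homog k n)) {t : ℤ} {X : List (Homog k n) → Lam k n}, X ∈ P.poly t →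
      (∀ (f : Lam k n) (c : k) (l : List (Homog k n)) (cs : List k),
        P.modularDerivation f = c • f → HasWeights P.modularDerivation (l.map Homog.val) cs →
        (∀ b ∈ c :: cs, Module.End.HasEigenvalue P.modularDerivation b) →
        vol k n (X l * f) = 0) → X l = 0 := by
    intro l
    induction l with
    | nil =>
      intro t X hX h
      refine eq_zero_of_vol fun d f _ => ?_
      have hf : f ∈ ⨆ c : k, Module.End.eigenspace P.modularDerivation c := hν ▸ Submodule.mem_top
      refine Submodule.iSup_induction _ (motive := fun f => vol k n (X [] * f) = 0) hf ?_ ?_ ?_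
      · intro c f hf
        by_cases hf0 : f = 0
        · rw [hf0, mul_zero, map_zero]
        · refine h f c [] [] (Module.End.mem_eigenspace_iff.1 hf) List.Forall₂.nil fun b hb => ?_
          rw [List.mem_singleton.1 hb]
          exact Module.End.hasEigenvalue_of_hasEigenvector ⟨hf, hf0⟩
      · rw [mul_zero, map_zero]
      · intro x y hx hy
        rw [mul_add, map_add, hx, hy, add_zero]
    | cons a l ih =>
      intro t X hX h
      have ha := lamDeg_le_iSup hν a.1 a.val_mem'
      have : ∃ hc : a.val ∈ lamDeg k n a.1, X (⟨a.1, a.val, hc⟩ :: l) = 0 := by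
        refine Submodule.iSup_induction _ (motive := fun x =>
          ∃ hc : x ∈ lamDeg k n a.1, X (⟨a.1, x, hc⟩ :: l) = 0) ha ?_ ?_ ?_
        · rintro c x ⟨hx, hxc⟩
          refine ⟨hx, ?_⟩
          by_cases hx0 : x = 0
          · exact poly_zero_arg hX [] l hx0
          · refine ih (X := ins ⟨a.1, x, hx⟩ X) (ins_mem _ hX) fun f b l bs hf hl hb => ?_
            refine h f b (⟨a.1, x, hx⟩ :: l) (c :: bs) hf
              (List.Forall₂.cons (Module.End.mem_eigenspace_iff.1 hxc) hl) fun e he => ?_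
            rcases List.mem_cons.1 he with rfl | he
            · exact hb _ List.mem_cons_self
            · rcases List.mem_cons.1 he with rfl | he
              · exact Module.End.hasEigenvalue_of_hasEigenvector ⟨hxc, hx0⟩
              · exact hb _ (List.mem_cons_of_mem _ he)
        · exact ⟨zero_mem _, poly_zero_arg hX [] l rfl⟩
        · rintro x y ⟨hx, hx'⟩ ⟨hy, hy'⟩
          refine ⟨add_mem hx hy, ?_⟩
          have := poly_add hX [] l ⟨x, hx⟩ ⟨y, hy⟩
          exact this.trans (by
            change X (⟨a.1, x, hx⟩ :: l) + X (⟨a.1, y, hy⟩ :: l) = 0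
            rw [hx', hy', add_zero])
      obtain ⟨_, h0⟩ := this
      exact h0
  exact funext fun l => key l hX h

variable [CharZero k]

/-- If the modular derivation is diagonalizable, so is the Lie derivative along it: on
multiderivations of bounded arity it satisfies a polynomial equation with simple roots, the sums of
boundedly many eigenvalues. -/
lemma semisimple (hν : IsDiagonalizable P.modularDerivation) : P.poisson.Semisimple := by
  intro t X hX
  obtain ⟨N, hN⟩ := poly_bdd (show X ∈ P.poly t from hX)
  have hW : ∀ x ∈ P.poly t, P.poisson.lie x ∈ P.poly t := fun x hx => P.poisson.lie_mem hx
  have hfin : {c : k | Module.End.HasEigenvalue P.modularDerivation c}.Finite :=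
    Module.End.finite_hasEigenvalue _
  have hfin' := finite_setOf_list_sum hfin (N + 1)
  have hle : (⨆ c ∈ hfin'.toFinset, P.poly t ⊓ Module.End.eigenspace P.poisson.lie c) ≤
      ⨆ c : k, P.poly t ⊓ Module.End.eigenspace P.poisson.lie c :=
    iSup_mono fun c => iSup_le fun _ => le_rfl
  refine hle (mem_iSup_eigenspace_of_aeval hW hfin'.toFinset hX ?_)
  refine eq_zero_of_eigenvectors hν (aeval_apply_mem hW _ hX) fun f c l cs hf hl hcs => ?_
  let φ : (List (Homog k n) → Lam k n) →ₗ[k] k :=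
    vol k n ∘ₗ LinearMap.mulRight k f ∘ₗ LinearMap.proj l
  have h := functional_aeval_apply hW φ (c :: cs).sum
    (fun x hx => vol_lie_of_hasWeights hx hf l hl)
    (∏ c ∈ hfin'.toFinset, (Polynomial.X - Polynomial.C c)) hX
  refine Eq.trans h ?_
  by_cases hlN : N < l.length
  · have : φ X = 0 := by
      change vol k n (X l * f) = 0
      rw [hN l hlN, zero_mul, map_zero]
    rw [this, mul_zero]
  · rw [Polynomial.eval_prod, Finset.prod_eq_zero (i := (c :: cs).sum), zero_mul]
    · rw [Set.Finite.mem_toFinset]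
      refine ⟨c :: cs, ?_, hcs, rfl⟩
      have := hl.length_eq
      rw [List.length_map] at this
      rw [List.length_cons, ← this]
      omega
    · simp

lemma mixed_C_eq (hν : IsDiagonalizable P.modularDerivation) :
    (P.poisson.mixed iotaEta n).C = P.weightZero := by
  funext m
  ext Y
  have hc : P.coeffDual.cochains (n - (n - m)) = P.coeffDual.cochains m := by
    rw [sub_sub_cancel]
  constructor
  · rintro ⟨X, ⟨hX, hX0⟩, rfl⟩
    refine ⟨hc ▸ iotaEta_mem.2 hX, fun f l cs hw hs => ?_⟩
    cases hw with
    | cons hf hl =>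
      have h := vol_lie_of_hasWeights hX hf l hl
      rw [show P.poisson.lie X = 0 from hX0, Pi.zero_apply, zero_mul, map_zero] at h
      exact (mul_eq_zero.1 h.symm).resolve_left hs
  · rintro ⟨hY, hw⟩
    obtain ⟨X, rfl⟩ := iotaEta.surjective Y
    have hX : X ∈ P.poly (n - m) := iotaEta_mem.1 (hc.symm ▸ hY)
    refine ⟨X, ⟨hX, ?_⟩, rfl⟩
    refine eq_zero_of_eigenvectors hν (P.poisson.lie_mem hX) fun f c l cs hf hl _ => ?_
    rw [vol_lie_of_hasWeights hX hf l hl]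
    by_cases hs : (c :: cs).sum = 0
    · rw [hs, zero_mul]
    · rw [show vol k n (X l * f) = 0 from hw f l (c :: cs) (List.Forall₂.cons hf hl) hs, mul_zero]

/-- The weight-zero cochains with coefficients in the twisted dual of a finite exterior algebra
compute Poisson cohomology, and carry the Batalin-Vilkovisky and gravity structures. -/
theorem exists_gravity (hν : IsDiagonalizable P.modularDerivation) :
    ∃ M : MixedComplex k (List (Homog k n) → Module.Dual k (Lam k n)),
        M.C = P.weightZero ∧
        M.b = P.coeffDual.delta P ∧
        M.B = ExteriorPoisson.dStar ∧
        ∃ θ : (⨁ t : ℤ, P.HP t) ≃ₗ[k] M.HHtot,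
          (∀ (t : ℤ) (X : P.cocycles t), ∃ z : M.cycles ((n : ℤ) - t),
            ExteriorPoisson.iotaEta X.1 - z.1 ∈ (P.coeffDual.cochains ((n : ℤ) - t + 1)).map M.b ∧
            θ (P.hpClass t X) = M.hhClass _ z) ∧
          ∃ (one : M.HHtot) (mul : M.HHtot →ₗ[k] M.HHtot →ₗ[k] M.HHtot),
            (∀ (s t : ℤ) (X : P.cocycles s) (Y : P.cocycles t),
              ∃ h : ExteriorPoisson.wedge s t X.1 Y.1 ∈ P.cocycles (s + t),
                mul (θ (P.hpClass s X)) (θ (P.hpClass t Y)) =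
                  θ (P.hpClass (s + t) ⟨ExteriorPoisson.wedge s t X.1 Y.1, h⟩)) ∧
            IsBVAlgebra (M.hhDeg n) one mul M.Bstar ∧
            HasInducedGravityStructure M n one mul := by
  obtain ⟨θ, h1, one, mul, h2, h3, h4⟩ := P.poisson.exists_bv (iotaEta (k := k) (n := n)) n
    (semisimple hν) (fun t : ℤ => t) (fun _ _ h => h) (fun t h => absurd rfl (h t))
    (fun _ => List (Homog k n) → Lam k n) P.cocycles P.coboundaries (fun _ => LinearMap.id)
    (fun _ _ _ h => h) (fun t x => ⟨by rintro ⟨v, hv, rfl⟩; exact hv, fun h => ⟨x, h, rfl⟩⟩)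
    (fun t x => ⟨by rintro ⟨v, hv, rfl⟩; exact hv, fun h => ⟨x, h, rfl⟩⟩)
  refine ⟨P.poisson.mixed iotaEta n, mixed_C_eq hν, ?_, ?_, θ, ?_, one, mul, ?_, h3, h4⟩
  · refine LinearMap.ext fun Y => ?_
    obtain ⟨X, rfl⟩ := iotaEta.surjective Y
    exact (P.poisson.mixed_b X).trans (iotaEta_delta X)
  · refine LinearMap.ext fun Y => ?_
    obtain ⟨X, rfl⟩ := iotaEta.surjective Y
    refine (P.poisson.mixed_B X).trans ?_
    exact LinearEquiv.apply_symm_apply _ _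
  · intro t X
    obtain ⟨z, ⟨y, hy, hyz⟩, hz⟩ := h1 t X
    refine ⟨z, ⟨iotaEta y, ?_, ?_⟩, hz⟩
    · have : iotaEta y ∈ P.coeffDual.cochains (n - (t - 1)) := iotaEta_mem.2 hy
      rwa [show (n : ℤ) - (t - 1) = n - t + 1 by ring] at this
    · rw [P.poisson.mixed_b]
      exact hyz.symm
  · intro s t X Y
    have h : wedge s t X.1 Y.1 ∈ P.cocycles (s + t) := by
      refine ⟨wedge_mem X.2.1 Y.2.1, ?_⟩
      have hb := P.poisson.b_mul (x := X.1) (y := Y.1) X.2.1 Y.2.1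
      have hX : P.poisson.b X.1 = 0 := X.2.2
      have hY : P.poisson.b Y.1 = 0 := Y.2.2
      rw [hX, hY, map_zero, map_zero, LinearMap.zero_apply, smul_zero, add_zero] at hb
      exact hb
    exact ⟨h, h2 s t (s + t) X Y ⟨_, h⟩ rfl rfl⟩

end ExteriorPoisson

/-! ### Shuffle products of alternating maps -/

section Shuffle

open Equiv

/-- The permutations of `Fin (N + 1)` with the position of the value `0` singled out. -/
lemma sum_perm_succ {M V : Type*} [AddCommGroup V] {N : ℕ} (G : (Fin (N + 1) → M) → V)
    (v : Fin (N + 1) → M) :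
    ∑ σ : Perm (Fin (N + 1)), ((Perm.sign σ : ℤˣ) : ℤ) • G (v ∘ σ) =
      ∑ u : Fin (N + 1), ∑ e : Perm (Fin N), ((-1 : ℤ) ^ (u : ℕ) * ((Perm.sign e : ℤˣ) : ℤ)) •
        G (u.insertNth (v 0) (Fin.tail v ∘ e)) := by
  let F : Fin (N + 1) × Perm (Fin N) → Perm (Fin (N + 1)) := fun x =>
    Perm.decomposeFin.symm (0, x.2) * x.1.cycleRange
  have hF : Function.Bijective F := by
    refine (Fintype.bijective_iff_injective_and_card F).2 ⟨?_, ?_⟩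
    · rintro ⟨u, e⟩ ⟨u', e'⟩ h
      have hu : u = u' := by
        have h0 : ∀ x : Fin (N + 1) × Perm (Fin N), F x x.1 = 0 := fun x => by
          change Perm.decomposeFin.symm (0, x.2) (x.1.cycleRange x.1) = 0
          rw [Fin.cycleRange_self, Perm.decomposeFin_symm_apply_zero]
        refine (F (u, e)).injective ?_
        rw [h0 (u, e), h, h0 (u', e')]
      subst hu
      have h1 := mul_right_cancel h
      have h2 := Perm.decomposeFin.symm.injective h1
      exact Prod.ext rfl (Prod.ext_iff.1 h2).2
    · rw [Fintype.card_prod, Fintype.card_perm, Fintype.card_perm, Fintype.card_fin,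
        Fintype.card_fin, Nat.factorial_succ]
  refine (hF.sum_comp _).symm.trans ((Finset.sum_congr rfl fun x _ => ?_).trans
    (Fintype.sum_prod_type' fun (u : Fin (N + 1)) (e : Perm (Fin N)) =>
      ((-1 : ℤ) ^ (u : ℕ) * ((Perm.sign e : ℤˣ) : ℤ)) • G (u.insertNth (v 0) (Fin.tail v ∘ e))))
  obtain ⟨u, e⟩ := x
  have hs : ((Perm.sign (F (u, e)) : ℤˣ) : ℤ) = (-1 : ℤ) ^ (u : ℕ) * ((Perm.sign e : ℤˣ) : ℤ) := by
    change ((Perm.sign (Perm.decomposeFin.symm (0, e) * u.cycleRange) : ℤˣ) : ℤ) = _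
    rw [Perm.sign_mul, Fin.sign_cycleRange, Perm.decomposeFin.symm_sign]
    push_cast
    simp [mul_comm]
  rw [hs]
  congr 2
  funext j
  change v (Perm.decomposeFin.symm (0, e) (u.cycleRange j)) = _
  rcases Fin.eq_self_or_eq_succAbove u j with rfl | ⟨i, rfl⟩
  · rw [Fin.cycleRange_self, Perm.decomposeFin_symm_apply_zero, Fin.insertNth_apply_same]
  · rw [Fin.cycleRange_succAbove, Perm.decomposeFin_symm_apply_succ, swap_self,
      Fin.insertNth_apply_succAbove]
    rfl

lemma nsmul_cancel (k : Type*) [Field k] [CharZero k] {A : Type*} [CommRing A] [Algebra k A]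
    {V : Type*} [AddCommGroup V] [Module A V] {m : ℕ} (hm : m ≠ 0) {x y : V}
    (h : m • x = m • y) : x = y := by
  have h1 : algebraMap k A ((m : k)⁻¹) * (m : A) = 1 := by
    rw [← map_natCast (algebraMap k A), ← map_mul, inv_mul_cancel₀ (Nat.cast_ne_zero.2 hm), map_one]
  rw [← Nat.cast_smul_eq_nsmul A, ← Nat.cast_smul_eq_nsmul A] at h
  rw [← one_smul A x, ← one_smul A y, ← h1, mul_smul, mul_smul, h]

variable {A : Type*} [CommRing A] {M : Type*} [AddCommGroup M] [Module A M]
  {V : Type*} [AddCommGroup V] [Module A V] {p q N : ℕ}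

/-- The shuffle product of a scalar-valued alternating map with `p` arguments and a vector-valued
one with `q` arguments. -/
def shuffle (h : p + q = N) (a : M [⋀^Fin p]→ₗ[A] A) (b : M [⋀^Fin q]→ₗ[A] V) :
    M [⋀^Fin N]→ₗ[A] V :=
  ((TensorProduct.lid A V).toLinearMap.compAlternatingMap (a.domCoprod b)).domDomCongr
    (finSumFinEquiv.trans (finCongr h))

/-- The shuffle product as a sum over all permutations. -/
lemma shuffle_apply (h : p + q = N) (a : M [⋀^Fin p]→ₗ[A] A) (b : M [⋀^Fin q]→ₗ[A] V)
    (v : Fin N → M) : (p.factorial * q.factorial) • shuffle h a b v =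
      ∑ σ : Perm (Fin N), ((Perm.sign σ : ℤˣ) : ℤ) •
        (a (fun i => (v ∘ σ) (Fin.cast h (Fin.castAdd q i))) •
          b (fun j => (v ∘ σ) (Fin.cast h (Fin.natAdd p j)))) := by
  subst h
  have e := congrArg (fun f => f (v ∘ finSumFinEquiv)) (MultilinearMap.domCoprod_alternization_eq a b)
  have e2 := congrArg (TensorProduct.lid A V) e
  simp only [Fintype.card_fin] at e2
  have e3 : (p.factorial * q.factorial) • shuffle rfl a b v = TensorProduct.lid A V
      (((p.factorial * q.factorial) • a.domCoprod b) (v ∘ finSumFinEquiv)) := by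
    rw [AlternatingMap.smul_apply, map_nsmul]
    rfl
  rw [e3, ← e2, MultilinearMap.alternatization_apply, map_sum]
  refine (Equiv.sum_comp (finSumFinEquiv (m := p) (n := q)).permCongr.symm _).symm.trans ?_
  refine Finset.sum_congr rfl fun σ _ => ?_
  have hs : Perm.sign ((finSumFinEquiv (m := p) (n := q)).permCongr.symm σ) = Perm.sign σ := by
    have := Perm.sign_permCongr (finSumFinEquiv (m := p) (n := q)).symm σ
    exact this
  rw [hs, Units.smul_def, map_zsmul]
  congr 1
  simp only [MultilinearMap.domDomCongr_apply, MultilinearMap.domCoprod_apply,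
    TensorProduct.lid_tmul]
  refine congrArg₂ (· • ·) (congrArg a (funext fun i => ?_)) (congrArg b (funext fun i => ?_)) <;>
  · simp

lemma shuffle_smul_left (h : p + q = N) (c : A) (a : M [⋀^Fin p]→ₗ[A] A)
    (b : M [⋀^Fin q]→ₗ[A] V) : shuffle h (c • a) b = c • shuffle h a b := by
  have : (c • a).domCoprod b = c • a.domCoprod b := by
    simp only [← AlternatingMap.domCoprod'_apply, ← TensorProduct.smul_tmul', map_smul]
  unfold shuffle
  rw [this]
  ext v
  simp

variable (k : Type*) [Field k] [CharZero k] [Algebra k A]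
include k

lemma shuffle_comp {V' : Type*} [AddCommGroup V'] [Module A V'] (h : p + q = N)
    (a : M [⋀^Fin p]→ₗ[A] A) (b : M [⋀^Fin q]→ₗ[A] V) (g : V →ₗ[A] V') :
    shuffle h a (g.compAlternatingMap b) = g.compAlternatingMap (shuffle h a b) := by
  ext v
  refine nsmul_cancel k (A := A) (mul_ne_zero p.factorial_ne_zero q.factorial_ne_zero) ?_
  rw [LinearMap.compAlternatingMap_apply, ← map_nsmul g, shuffle_apply, shuffle_apply, map_sum]
  simp [map_zsmul]

lemma shuffle_zero_left (h : 0 + N = N) (a : M [⋀^Fin 0]→ₗ[A] A) (b : M [⋀^Fin N]→ₗ[A] V) :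
    shuffle h a b = a 0 • b := by
  ext v
  refine nsmul_cancel k (A := A) (mul_ne_zero (Nat.factorial_ne_zero 0) N.factorial_ne_zero) ?_
  rw [shuffle_apply]
  have : ∀ σ : Perm (Fin N), ((Perm.sign σ : ℤˣ) : ℤ) •
      (a (fun i => (v ∘ σ) (Fin.cast h (Fin.castAdd N i))) •
          b (fun j => (v ∘ σ) (Fin.cast h (Fin.natAdd 0 j)))) = a 0 • b v := by
    intro σ
    rw [Subsingleton.elim (fun i => (v ∘ σ) (Fin.cast h (Fin.castAdd N i))) 0,
      show (fun j => (v ∘ σ) (Fin.cast h (Fin.natAdd 0 j))) = v ∘ σ from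
        funext fun j => congrArg (v ∘ σ) (Fin.ext (by simp)),
      b.map_perm, ← smul_comm, Units.smul_def, smul_smul, ← Units.val_mul, Int.units_mul_self,
      Units.val_one, one_smul]
  rw [Finset.sum_congr rfl fun σ _ => this σ, Finset.sum_const, Finset.card_univ,
    Fintype.card_perm, Fintype.card_fin, Nat.factorial_zero, one_mul]
  rfl

lemma shuffle_zero_right (h : N + 0 = N) (a : M [⋀^Fin N]→ₗ[A] A) (b : M [⋀^Fin 0]→ₗ[A] V)
    (v : Fin N → M) : shuffle h a b v = a v • b 0 := by
  refine nsmul_cancel k (A := A) (mul_ne_zero N.factorial_ne_zero (Nat.factorial_ne_zero 0)) ?_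
  rw [shuffle_apply]
  have : ∀ σ : Perm (Fin N), ((Perm.sign σ : ℤˣ) : ℤ) •
      (a (fun i => (v ∘ σ) (Fin.cast h (Fin.castAdd 0 i))) •
          b (fun j => (v ∘ σ) (Fin.cast h (Fin.natAdd N j)))) = a v • b 0 := by
    intro σ
    rw [Subsingleton.elim (fun j => (v ∘ σ) (Fin.cast h (Fin.natAdd N j))) 0,
      show (fun j => (v ∘ σ) (Fin.cast h (Fin.castAdd 0 j))) = v ∘ σ from
        funext fun j => congrArg (v ∘ σ) (Fin.ext (by simp)),
      a.map_perm, Units.smul_def, smul_assoc, smul_smul, ← Units.val_mul, Int.units_mul_self,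
      Units.val_one, one_smul]
  rw [Finset.sum_congr rfl fun σ _ => this σ, Finset.sum_const, Finset.card_univ,
    Fintype.card_perm, Fintype.card_fin, Nat.factorial_zero, mul_one]

/-- Filling the first argument of a shuffle product, when both factors have arguments. -/
lemma shuffle_cons (h : p + 1 + (q + 1) = N + 1) (h₁ : p + (q + 1) = N) (h₂ : p + 1 + q = N)
    (a : M [⋀^Fin (p + 1)]→ₗ[A] A) (b : M [⋀^Fin (q + 1)]→ₗ[A] V) (x : M) :
    (shuffle h a b).curryLeft x = shuffle h₁ (a.curryLeft x) b +
      (-1 : ℤ) ^ (p + 1) • shuffle h₂ a (b.curryLeft x) := by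
  ext v
  refine nsmul_cancel k (A := A)
    (mul_ne_zero (p + 1).factorial_ne_zero (q + 1).factorial_ne_zero) ?_
  rw [AlternatingMap.curryLeft_apply_apply, shuffle_apply, sum_perm_succ
    (G := fun w : Fin (N + 1) → M => a (fun i => w (Fin.cast h (Fin.castAdd (q + 1) i))) •
          b (fun j => w (Fin.cast h (Fin.natAdd (p + 1) j)))),
    ← Equiv.sum_comp (finCongr h), Fin.sum_univ_add]
  have hx : (Matrix.vecCons x v : Fin (N + 1) → M) 0 = x := rfl
  have hv : Fin.tail (Matrix.vecCons x v : Fin (N + 1) → M) = v := rfl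
  rw [hx, hv]
  -- the values of the factors when `x` is inserted into the first or into the second block
  have e1 : ∀ (i : Fin (p + 1)) (e : Perm (Fin N)),
      (fun i' => ((finCongr h (Fin.castAdd (q + 1) i)).insertNth x (v ∘ e) : Fin (N + 1) → M)
        (Fin.cast h (Fin.castAdd (q + 1) i'))) =
      i.insertNth x (fun i' => (v ∘ e) (Fin.cast h₁ (Fin.castAdd (q + 1) i'))) := by
    intro i e
    funext i'
    rcases Fin.eq_self_or_eq_succAbove i i' with rfl | ⟨j, rfl⟩
    · rw [Fin.insertNth_apply_same]
      exact Fin.insertNth_apply_same (α := fun _ => M) _ _ _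
    · rw [Fin.insertNth_apply_succAbove]
      refine Eq.trans (congrArg _ ?_) (Fin.insertNth_apply_succAbove (α := fun _ => M)
        (finCongr h (Fin.castAdd (q + 1) i)) x (v ∘ e) (Fin.cast h₁ (Fin.castAdd (q + 1) j)))
      ext
      simp only [Fin.succAbove, Fin.lt_def, finCongr_apply]
      split_ifs <;> simp_all <;> omega
  have e2 : ∀ (i : Fin (p + 1)) (e : Perm (Fin N)),
      (fun j => ((finCongr h (Fin.castAdd (q + 1) i)).insertNth x (v ∘ e) : Fin (N + 1) → M)
        (Fin.cast h (Fin.natAdd (p + 1) j))) =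
      fun j => (v ∘ e) (Fin.cast h₁ (Fin.natAdd p j)) := by
    intro i e
    funext j
    refine Eq.trans (congrArg _ ?_) (Fin.insertNth_apply_succAbove (α := fun _ => M)
        (finCongr h (Fin.castAdd (q + 1) i)) x (v ∘ e) (Fin.cast h₁ (Fin.natAdd p j)))
    have := i.2
    ext
    simp only [Fin.succAbove, Fin.lt_def, finCongr_apply]
    split_ifs with h
    · simp at h
      omega
    · simp
      omega
  have e3 : ∀ (j : Fin (q + 1)) (e : Perm (Fin N)),
      (fun i' => ((finCongr h (Fin.natAdd (p + 1) j)).insertNth x (v ∘ e) : Fin (N + 1) → M)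
        (Fin.cast h (Fin.castAdd (q + 1) i'))) =
      fun i' => (v ∘ e) (Fin.cast h₂ (Fin.castAdd q i')) := by
    intro j e
    funext i'
    refine Eq.trans (congrArg _ ?_) (Fin.insertNth_apply_succAbove (α := fun _ => M)
        (finCongr h (Fin.natAdd (p + 1) j)) x (v ∘ e) (Fin.cast h₂ (Fin.castAdd q i')))
    have := i'.2
    ext
    simp only [Fin.succAbove, Fin.lt_def, finCongr_apply]
    split_ifs with h
    · simp
    · simp at h
      omega
  have e4 : ∀ (j : Fin (q + 1)) (e : Perm (Fin N)),
      (fun j' => ((finCongr h (Fin.natAdd (p + 1) j)).insertNth x (v ∘ e) : Fin (N + 1) → M)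
        (Fin.cast h (Fin.natAdd (p + 1) j'))) =
      j.insertNth x (fun j' => (v ∘ e) (Fin.cast h₂ (Fin.natAdd (p + 1) j'))) := by
    intro i e
    funext i'
    rcases Fin.eq_self_or_eq_succAbove i i' with rfl | ⟨j, rfl⟩
    · rw [Fin.insertNth_apply_same]
      exact Fin.insertNth_apply_same (α := fun _ => M) _ _ _
    · rw [Fin.insertNth_apply_succAbove]
      refine Eq.trans (congrArg _ ?_) (Fin.insertNth_apply_succAbove (α := fun _ => M)
        (finCongr h (Fin.natAdd (p + 1) i)) x (v ∘ e) (Fin.cast h₂ (Fin.natAdd (p + 1) j)))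
      ext
      simp only [Fin.succAbove, Fin.lt_def, finCongr_apply]
      split_ifs <;> simp_all <;> omega
  have s1 : ∀ i : Fin (p + 1), ∑ e : Perm (Fin N),
      ((-1 : ℤ) ^ ((finCongr h (Fin.castAdd (q + 1) i) : Fin (N + 1)) : ℕ) *
        ((Perm.sign e : ℤˣ) : ℤ)) •
      (a (fun i' => ((finCongr h (Fin.castAdd (q + 1) i)).insertNth x (v ∘ e) : Fin (N + 1) → M)
        (Fin.cast h (Fin.castAdd (q + 1) i'))) •
      b (fun j => ((finCongr h (Fin.castAdd (q + 1) i)).insertNth x (v ∘ e) : Fin (N + 1) → M)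
        (Fin.cast h (Fin.natAdd (p + 1) j)))) =
      (p.factorial * (q + 1).factorial) • shuffle h₁ (a.curryLeft x) b v := by
    intro i
    rw [shuffle_apply]
    refine Finset.sum_congr rfl fun e _ => ?_
    rw [e1, e2, AlternatingMap.map_insertNth, mul_comm, mul_smul]
    congr 1
    have : ((finCongr h (Fin.castAdd (q + 1) i) : Fin (N + 1)) : ℕ) = i := rfl
    rw [this, smul_assoc, smul_smul, ← pow_add, Even.neg_one_pow ⟨_, rfl⟩, one_smul]
    rfl
  have s2 : ∀ j : Fin (q + 1), ∑ e : Perm (Fin N),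
      ((-1 : ℤ) ^ ((finCongr h (Fin.natAdd (p + 1) j) : Fin (N + 1)) : ℕ) *
        ((Perm.sign e : ℤˣ) : ℤ)) •
      (a (fun i' => ((finCongr h (Fin.natAdd (p + 1) j)).insertNth x (v ∘ e) : Fin (N + 1) → M)
        (Fin.cast h (Fin.castAdd (q + 1) i'))) •
      b (fun j' => ((finCongr h (Fin.natAdd (p + 1) j)).insertNth x (v ∘ e) : Fin (N + 1) → M)
        (Fin.cast h (Fin.natAdd (p + 1) j')))) =
      ((p + 1).factorial * q.factorial) • ((-1 : ℤ) ^ (p + 1) •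
        shuffle h₂ a (b.curryLeft x) v) := by
    intro j
    rw [smul_comm, shuffle_apply, Finset.smul_sum]
    refine Finset.sum_congr rfl fun e _ => ?_
    rw [e3, e4, AlternatingMap.map_insertNth, smul_smul]
    have : ((finCongr h (Fin.natAdd (p + 1) j) : Fin (N + 1)) : ℕ) = p + 1 + j := rfl
    rw [this, mul_comm, mul_comm _ ((Perm.sign e : ℤˣ) : ℤ), mul_smul, mul_smul]
    congr 1
    rw [pow_add, mul_smul]
    congr 1
    rw [smul_comm (a _), smul_smul, ← pow_add, Even.neg_one_pow ⟨_, rfl⟩, one_smul]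
    rfl
  rw [Finset.sum_congr rfl fun i _ => s1 i, Finset.sum_congr rfl fun i _ => s2 i]
  simp only [Finset.sum_const, Finset.card_univ, Fintype.card_fin]
  rw [AlternatingMap.add_apply, smul_add, ← mul_smul, ← mul_smul, ← mul_assoc, ← Nat.factorial_succ,
    mul_left_comm, ← Nat.factorial_succ]
  rfl

end Shuffle

namespace FormCalculus

variable {k : Type u} [Field k] {A : Type v} [CommRing A] [Algebra k A]
  {Ω : Type w} [AddCommGroup Ω] [Module A Ω] [Module k Ω] [IsScalarTower k A Ω]
  (F : FormCalculus k A Ω)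

/-! ### Differential forms -/

/-- The exterior differential of a function, as a form. -/
def dfun (f : A) : F.Forms := ExteriorAlgebra.ι A (F.D f)

lemma dwedge_nil : F.dwedge [] = 1 := rfl

lemma dwedge_cons (f : A) (l : List A) : F.dwedge (f :: l) = F.dfun f * F.dwedge l := rfl

lemma dfun_mul_dfun (f g : A) : F.dfun f * F.dfun g = -(F.dfun g * F.dfun f) :=
  eq_neg_of_add_eq_zero_left (ExteriorAlgebra.ι_add_mul_swap _ _)

lemma dfun_comm (f g : A) (x : F.Forms) :
    F.dfun f * (F.dfun g * x) = -(F.dfun g * (F.dfun f * x)) := by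
  rw [← mul_assoc, dfun_mul_dfun, neg_mul, mul_assoc]

/-- The forms of degree `e` over the ground field. -/
def formDeg (_F : FormCalculus k A Ω) (e : ℤ) : Submodule k (ExteriorAlgebra A Ω) :=
  (extZ A Ω e).restrictScalars k

variable {F}

lemma mem_formDeg {e : ℤ} {x : F.Forms} : x ∈ F.formDeg e ↔ x ∈ extZ A Ω e := Iff.rfl

lemma dfun_mul_mem (f : A) {e : ℤ} {x : F.Forms} (hx : x ∈ F.formDeg e) :
    F.dfun f * x ∈ F.formDeg (e + 1) := by
  have h : F.dfun f ∈ extZ A Ω 1 := mem_extZ_of_mem (d := 1) (by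
    rw [ExteriorAlgebra.exteriorPower, pow_one]
    exact LinearMap.mem_range_self _ _) rfl
  exact extZ_cast (by ring) (mul_mem_extZ h hx)

lemma smul_mem_formDeg (a : A) {e : ℤ} {x : F.Forms} (hx : x ∈ F.formDeg e) :
    a • x ∈ F.formDeg e := Submodule.smul_mem (extZ A Ω e) a hx

lemma one_mem_formDeg : (1 : F.Forms) ∈ F.formDeg 0 :=
  mem_extZ_of_mem (d := 0) (SetLike.GradedOne.one_mem (A := fun i : ℕ => ⋀[A]^i Ω)) rfl

lemma dwedge_mem (l : List A) : F.dwedge l ∈ F.formDeg l.length := by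
  induction l with
  | nil => exact one_mem_formDeg
  | cons f l ih =>
    have := dfun_mul_mem f ih
    rw [dwedge_cons, List.length_cons]
    push_cast
    exact this

/-- Forms of degree `m` are sums of the forms `a df₁ ∧ ⋯ ∧ df_m`. -/
lemma form_induction {p : F.Forms → Prop} {m : ℕ}
    (h : ∀ (a : A) (l : List A), l.length = m → p (a • F.dwedge l)) (h0 : p 0)
    (hadd : ∀ x y, p x → p y → p (x + y)) {x : F.Forms} (hx : x ∈ F.formDeg m) : p x := by
  rw [mem_formDeg, extZ_natCast] at hx
  have key : ⋀[A]^m Ω ≤ Submodule.span A (F.dwedge '' {l | l.length = m}) := by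
    clear hx h h0 hadd
    induction m with
    | zero =>
      rw [ExteriorAlgebra.exteriorPower, pow_zero, Submodule.one_le]
      exact Submodule.subset_span ⟨[], rfl, rfl⟩
    | succ m ih =>
      rw [ExteriorAlgebra.exteriorPower, pow_succ', Submodule.mul_le]
      rintro _ ⟨α, rfl⟩ y hy
      have hα : α ∈ Submodule.span A (Set.range F.D) := by rw [F.span_D]; trivial
      replace hy := ih hy
      induction hα using Submodule.span_induction with
      | mem α hα =>
        obtain ⟨f, rfl⟩ := hα
        clear ih
        induction hy using Submodule.span_induction with
        | mem y hy =>
          obtain ⟨l, hl, rfl⟩ := hy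
          exact Submodule.subset_span ⟨f :: l, by simpa using hl, rfl⟩
        | zero => rw [mul_zero]; exact zero_mem _
        | add x y _ _ hx hy => rw [mul_add]; exact add_mem hx hy
        | smul a x _ hx => rw [mul_smul_comm]; exact Submodule.smul_mem _ _ hx
      | zero => rw [map_zero, zero_mul]; exact zero_mem _
      | add x y _ _ hx hy => rw [map_add, add_mul]; exact add_mem hx hy
      | smul a x _ hx => rw [map_smul, smul_mul_assoc]; exact Submodule.smul_mem _ _ hx
  refine Submodule.span_induction (p := fun x _ => ∀ a : A, p (a • x)) ?_ ?_ ?_ ?_ (key hx) 1 |>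
    fun h => by rwa [one_smul] at h
  · rintro _ ⟨l, hl, rfl⟩ a
    exact h a l hl
  · intro a
    rwa [smul_zero]
  · intro x y _ _ hx hy a
    rw [smul_add]
    exact hadd _ _ (hx a) (hy a)
  · intro b x _ hx a
    rw [smul_smul]
    exact hx _

/-- All forms are sums of the forms `a df₁ ∧ ⋯ ∧ df_m`. -/
lemma form_induction_all {p : F.Forms → Prop}
    (h : ∀ (a : A) (l : List A), p (a • F.dwedge l)) (h0 : p 0)
    (hadd : ∀ x y, p x → p y → p (x + y)) (x : F.Forms) : p x := by
  have hx : x ∈ ⨆ m : ℕ, ⋀[A]^m Ω := by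
    rw [(DirectSum.Decomposition.isInternal fun m : ℕ => ⋀[A]^m Ω).submodule_iSup_eq_top]
    trivial
  refine Submodule.iSup_induction _ (motive := p) hx (fun m x hx => ?_) h0 hadd
  exact form_induction (m := m) (fun a l _ => h a l) h0 hadd (by
    rwa [mem_formDeg, extZ_natCast])

lemma d_smul_dwedge (a : A) (l : List A) : F.d (a • F.dwedge l) = F.dfun a * F.dwedge l :=
  F.d_apply a l

lemma dfun_one : F.dfun 1 = 0 := by
  rw [dfun, Derivation.map_one_eq_zero, map_zero]

lemma dfun_mul (f g : A) : F.dfun (f * g) = f • F.dfun g + g • F.dfun f := by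
  rw [dfun, Derivation.leibniz, map_add, map_smul, map_smul]
  rfl

lemma dfun_add (f g : A) : F.dfun (f + g) = F.dfun f + F.dfun g := by
  rw [dfun, map_add, map_add]; rfl

lemma dfun_smul (c : k) (f : A) : F.dfun (c • f) = c • F.dfun f := by
  rw [dfun, Derivation.map_smul, ← algebraMap_smul A c (F.D f), map_smul, algebraMap_smul]; rfl

lemma d_dwedge (l : List A) : F.d (F.dwedge l) = 0 := by
  have := F.d_smul_dwedge 1 l
  rwa [one_smul, dfun_one, zero_mul] at this

lemma d_d (x : F.Forms) : F.d (F.d x) = 0 := by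
  refine form_induction_all (p := fun x => F.d (F.d x) = 0) (fun a l => ?_) (by simp)
    (fun x y hx hy => by rw [map_add, map_add, hx, hy, add_zero]) x
  rw [d_smul_dwedge, ← dwedge_cons, d_dwedge]

lemma d_smul (a : A) (x : F.Forms) : F.d (a • x) = F.dfun a * x + a • F.d x := by
  refine form_induction_all (p := fun x => F.d (a • x) = F.dfun a * x + a • F.d x)
    (fun b l => ?_) (by simp)
    (fun x y hx hy => by rw [smul_add, map_add, hx, hy, map_add, mul_add, smul_add]; abel) x
  rw [smul_smul, d_smul_dwedge, d_smul_dwedge, dfun_mul, add_mul, smul_mul_assoc, smul_mul_assoc,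
    mul_smul_comm, add_comm]

lemma d_dfun_mul (f : A) (x : F.Forms) : F.d (F.dfun f * x) = -(F.dfun f * F.d x) := by
  refine form_induction_all (p := fun x => F.d (F.dfun f * x) = -(F.dfun f * F.d x))
    (fun b l => ?_) (by simp)
    (fun x y hx hy => by rw [mul_add, map_add, hx, hy, map_add, mul_add, neg_add]) x
  rw [mul_smul_comm, ← dwedge_cons, d_smul_dwedge, d_smul_dwedge, dwedge_cons, dfun_comm]

lemma d_mem {e : ℤ} {x : F.Forms} (hx : x ∈ F.formDeg e) : F.d x ∈ F.formDeg (e + 1) := by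
  rcases lt_or_ge e 0 with he | he
  · rw [mem_formDeg, extZ_neg he, Submodule.mem_bot] at hx
    rw [hx, map_zero]
    exact zero_mem _
  · obtain ⟨m, rfl⟩ := Int.eq_ofNat_of_zero_le he
    refine form_induction (p := fun x => F.d x ∈ F.formDeg ((m : ℤ) + 1)) (fun a l hl => ?_)
      (by rw [map_zero]; exact zero_mem _)
      (fun x y hx hy => by rw [map_add]; exact add_mem hx hy) hx
    rw [d_smul_dwedge, ← hl]
    exact dfun_mul_mem a (dwedge_mem l)

/-! ### Contraction with polyvectors -/

variable [CharZero k]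

/-- Insertion of a one-form into the first argument of a polyvector. -/
def curry {p : ℕ} (P : F.Polyvector (p + 1)) (α : Ω) : F.Polyvector p := P.alt.curryLeft α

lemma curry_alt {p : ℕ} (P : F.Polyvector (p + 1)) (α : Ω) (v : Fin p → Ω) :
    (curry P α).alt v = P.alt (Matrix.vecCons α v) := rfl

/-- The alternating maps defining the contraction with a polyvector, without its overall sign. -/
def contractAlt {p : ℕ} (P : F.Polyvector p) (i : ℕ) : Ω [⋀^Fin i]→ₗ[A] ExteriorAlgebra A Ω :=
  if h : p ≤ i then shuffle (Nat.add_sub_of_le h) P.alt (ExteriorAlgebra.ιMulti A (M := Ω) (i - p))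
  else 0

lemma contract_eq {p : ℕ} (P : F.Polyvector p) (x : F.Forms) : F.contract P x =
    (-1 : A) ^ (p * (p - 1) / 2) • ExteriorAlgebra.liftAlternating (contractAlt P) x := rfl

lemma contractAlt_eq {p q i : ℕ} (h : p + q = i) (P : F.Polyvector p) :
    contractAlt P i = shuffle h P.alt (ExteriorAlgebra.ιMulti A (M := Ω) q) := by
  subst h
  have hp : p ≤ p + q := Nat.le_add_right p q
  rw [contractAlt, dif_pos hp]
  have : ∀ (r : ℕ) (hr : p + r = p + q), shuffle hr P.alt (ExteriorAlgebra.ιMulti A (M := Ω) r) =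
      shuffle rfl P.alt (ExteriorAlgebra.ιMulti A (M := Ω) q) := by
    intro r hr
    obtain rfl : r = q := Nat.add_left_cancel hr
    rfl
  exact this _ _

lemma contractAlt_of_lt {p i : ℕ} (h : i < p) (P : F.Polyvector p) : contractAlt P i = 0 :=
  dif_neg (not_le.2 h)

lemma curryLeft_ιMulti (q : ℕ) (α : Ω) :
    (ExteriorAlgebra.ιMulti A (M := Ω) (q + 1)).curryLeft α =
      (LinearMap.mulLeft A (ExteriorAlgebra.ι A α)).compAlternatingMap
        (ExteriorAlgebra.ιMulti A q) := by
  ext v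
  exact ExteriorAlgebra.ιMulti_succ_apply _

lemma contractAlt_cons {p : ℕ} (P : F.Polyvector (p + 1)) (α : Ω) (i : ℕ) :
    (contractAlt P (i + 1)).curryLeft α = contractAlt (curry P α) i +
      (-1 : ℤ) ^ (p + 1) •
        (LinearMap.mulLeft A (ExteriorAlgebra.ι A α)).compAlternatingMap (contractAlt P i) := by
  rcases lt_trichotomy i p with h | rfl | h
  · rw [contractAlt_of_lt (by omega), contractAlt_of_lt (by omega), contractAlt_of_lt (by omega)]
    ext v
    simp
  · rw [contractAlt_of_lt (Nat.lt_succ_self i), contractAlt_eq (p := i + 1) (q := 0) (i := i + 1) rfl,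
      contractAlt_eq (p := i) (q := 0) (i := i) rfl]
    ext v
    rw [AlternatingMap.curryLeft_apply_apply, shuffle_zero_right k, AlternatingMap.add_apply,
      shuffle_zero_right k]
    simp [curry_alt]
  · obtain ⟨q, rfl⟩ := Nat.exists_eq_add_of_lt h
    have h1 : p + 1 + q = p + q + 1 := by omega
    rw [contractAlt_eq (p := p + 1) (q := q + 1) (i := p + q + 1 + 1) (by omega),
      contractAlt_eq (p := p + 1) (q := q) h1,
      contractAlt_eq (p := p) (q := q + 1) (i := p + q + 1) rfl,
      shuffle_cons k _ rfl h1, curryLeft_ιMulti, shuffle_comp k]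
    rfl

lemma contract_zero (P : F.Polyvector 0) (x : F.Forms) : F.contract P x = P.alt 0 • x := by
  have h : contractAlt P = P.alt 0 • fun i => ExteriorAlgebra.ιMulti A (M := Ω) i :=
    funext fun i => by
      rw [contractAlt_eq (q := i) (zero_add i), shuffle_zero_left k]
      rfl
  rw [contract_eq, h, map_smul, ExteriorAlgebra.liftAlternating_ιMulti]
  simp

lemma neg_one_pow_half_succ (p : ℕ) :
    (-1 : A) ^ ((p + 1) * (p + 1 - 1) / 2) = (-1) ^ (p * (p - 1) / 2) * (-1) ^ p := by
  rw [← pow_add]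
  congr 1
  rw [← Nat.triangle_succ, Nat.add_sub_cancel]

/-- The commutation rule between contractions and the exterior product with a one-form. -/
lemma contract_ι_mul {p : ℕ} (P : F.Polyvector (p + 1)) (α : Ω) (x : F.Forms) :
    F.contract P (ExteriorAlgebra.ι A α * x) = sg p • F.contract (curry P α) x +
      sg (p + 1) • (ExteriorAlgebra.ι A α * F.contract P x) := by
  have h : ExteriorAlgebra.liftAlternating (contractAlt P) (ExteriorAlgebra.ι A α * x) =
      ExteriorAlgebra.liftAlternating (contractAlt (curry P α)) x + (-1 : A) ^ (p + 1) •
        (ExteriorAlgebra.ι A α * ExteriorAlgebra.liftAlternating (contractAlt P) x) := by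
    rw [ExteriorAlgebra.liftAlternating_ι_mul]
    have : (fun i => (contractAlt P (i + 1)).curryLeft α) = contractAlt (curry P α) +
        (-1 : A) ^ (p + 1) • fun i => (LinearMap.mulLeft A (ExteriorAlgebra.ι A α)).compAlternatingMap
          (contractAlt P i) := by
      funext i
      rw [contractAlt_cons, Pi.add_apply, Pi.smul_apply]
      congr 1
      ext v
      rw [AlternatingMap.smul_apply, AlternatingMap.smul_apply, ← Int.cast_smul_eq_zsmul A]
      simp
    rw [show (fun i => (contractAlt P (Nat.succ i)).curryLeft α) = _ from this, map_add, map_smul,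
      ExteriorAlgebra.liftAlternating_comp]
    rfl
  have s1 : ∀ (q : ℕ) (y : F.Forms), sg q • y = (-1 : A) ^ q • y := fun q y =>
    (neg_one_pow_smul_eq q y).symm
  have s2 := s1 (p + 1)
  push_cast at s2
  rw [contract_eq, contract_eq, contract_eq, h, neg_one_pow_half_succ, smul_add, s1, s2,
    mul_smul_comm]
  have e : (-1 : A) ^ p * (-1) ^ p = 1 := by rw [← pow_add, Even.neg_one_pow ⟨_, rfl⟩]
  simp only [smul_smul]
  congr 2
  · ring
  · ring

lemma contract_dfun_mul {p : ℕ} (P : F.Polyvector (p + 1)) (f : A) (x : F.Forms) :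
    F.contract P (F.dfun f * x) = sg p • F.contract (curry P (F.D f)) x +
      sg (p + 1) • (F.dfun f * F.contract P x) := contract_ι_mul P (F.D f) x

lemma dfun_mul_contract {p : ℕ} (P : F.Polyvector (p + 1)) (f : A) (x : F.Forms) :
    F.dfun f * F.contract P x = F.contract (curry P (F.D f)) x +
      sg (p + 1) • F.contract P (F.dfun f * x) := by
  rw [contract_dfun_mul, smul_add, smul_smul, smul_smul, ← sg_add, sg_mul_self, one_smul,
    show ((p : ℤ) + 1 + p) = 1 + (p + p) by ring, sg_add, sg_add, sg_mul_self, sg_one]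
  simp

lemma contract_smul {p : ℕ} (P : F.Polyvector p) (a : A) (x : F.Forms) :
    F.contract P (a • x) = a • F.contract P x := map_smul _ _ _

lemma contract_one {p : ℕ} (P : F.Polyvector (p + 1)) : F.contract P 1 = 0 := by
  rw [contract_eq, ExteriorAlgebra.liftAlternating_one, contractAlt_of_lt (Nat.succ_pos p),
    AlternatingMap.zero_apply, smul_zero]

lemma contract_mem {p : ℕ} (P : F.Polyvector p) {e : ℤ} {x : F.Forms} (hx : x ∈ F.formDeg e) :
    F.contract P x ∈ F.formDeg (e - p) := by
  have key : ∀ (l : List A) {p : ℕ} (P : F.Polyvector p),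
      F.contract P (F.dwedge l) ∈ F.formDeg ((l.length : ℤ) - p) := by
    intro l
    induction l with
    | nil =>
      intro p P
      cases p with
      | zero =>
        rw [contract_zero]
        exact smul_mem_formDeg _ (by simpa using dwedge_mem (F := F) [])
      | succ p =>
        rw [dwedge_nil, contract_one]
        exact zero_mem _
    | cons f l ih =>
      intro p P
      cases p with
      | zero =>
        rw [contract_zero]
        exact smul_mem_formDeg _ (by simpa using dwedge_mem (F := F) (f :: l))
      | succ p =>
        rw [dwedge_cons, contract_dfun_mul]
        refine add_mem (zsmul_mem ?_ _) (zsmul_mem ?_ _)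
        · have := ih (curry P (F.D f))
          rwa [show ((f :: l).length : ℤ) - (p + 1 : ℕ) = l.length - p by simp]
        · have := dfun_mul_mem f (ih P)
          rwa [show ((f :: l).length : ℤ) - (p + 1 : ℕ) = l.length - (p + 1 : ℕ) + 1 by
            simp; ring]
  rcases lt_or_ge e 0 with he | he
  · rw [mem_formDeg, extZ_neg he, Submodule.mem_bot] at hx
    rw [hx, map_zero]
    exact zero_mem _
  · obtain ⟨m, rfl⟩ := Int.eq_ofNat_of_zero_le he
    refine form_induction (p := fun x => F.contract P x ∈ F.formDeg ((m : ℤ) - p))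
      (fun a l hl => ?_) (by rw [map_zero]; exact zero_mem _)
      (fun x y hx hy => by rw [map_add]; exact add_mem hx hy) hx
    rw [contract_smul, ← hl]
    exact smul_mem_formDeg a (key l P)

lemma wedge_eq_shuffle {p q : ℕ} (P : F.Polyvector p) (Q : F.Polyvector q) :
    (F.wedge P Q).alt = shuffle rfl P.alt Q.alt := by
  have h : LinearMap.mul' A A = (TensorProduct.lid A A).toLinearMap :=
    TensorProduct.ext' fun a b => by simp
  change AlternatingMap.domDomCongr _ _ = _
  rw [h]
  rfl

lemma contract_add_left {p : ℕ} (P Q : F.Polyvector p) (x : F.Forms) :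
    F.contract (P + Q) x = F.contract P x + F.contract Q x := (F.contractForm x p).map_add P Q

lemma contract_smul_left {p : ℕ} (c : k) (P : F.Polyvector p) (x : F.Forms) :
    F.contract (c • P) x = c • F.contract P x := (F.contractForm x p).map_smul c P

lemma contract_zsmul_left {p : ℕ} (c : ℤ) (P : F.Polyvector p) (x : F.Forms) :
    F.contract (c • P) x = c • F.contract P x := map_zsmul (F.contractForm x p) c P

/-- The product of a function and a polyvector. -/
def fsmul {p : ℕ} (a : A) (P : F.Polyvector p) : F.Polyvector p := a • P.alt

lemma contract_fsmul {p : ℕ} (a : A) (P : F.Polyvector p) (x : F.Forms) :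
    F.contract (fsmul a P) x = a • F.contract P x := by
  have : contractAlt (fsmul a P) = a • contractAlt P := by
    funext i
    rw [Pi.smul_apply]
    unfold contractAlt
    split_ifs with h
    · exact shuffle_smul_left _ a _ _
    · rw [smul_zero]
  rw [contract_eq, contract_eq, this, map_smul, LinearMap.smul_apply, smul_comm]

end FormCalculus

namespace FormCalculus.VolumeForm

variable {k : Type u} [Field k] [CharZero k] {A : Type v} [CommRing A] [Algebra k A]
  {Ω : Type w} [AddCommGroup Ω] [Module A Ω] [Module k Ω] [IsScalarTower k A Ω]
  {F : FormCalculus k A Ω} {n : ℕ} (η : F.VolumeForm n)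

/-! ### Polyvectors as forms, through a volume form -/

lemma form_mem' : η.form ∈ F.formDeg n := mem_extZ_of_mem η.form_mem rfl

lemma contract_form_mem {p : ℕ} (P : F.Polyvector p) : F.contract P η.form ∈ F.formDeg (n - p) :=
  contract_mem P η.form_mem'

lemma equiv_lof {p : ℕ} (P : F.Polyvector p) :
    η.equiv (DirectSum.lof k ℕ F.Polyvector p P) = F.contract P η.form :=
  DirectSum.toModule_lof k p P

lemma contract_form_injective {p : ℕ} : Function.Injective (F.contractForm η.form p) := by
  intro P Q h
  have h1 : η.equiv (DirectSum.lof k ℕ F.Polyvector p P) =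
      η.equiv (DirectSum.lof k ℕ F.Polyvector p Q) := by
    rw [equiv_lof, equiv_lof]
    exact h
  exact DirectSum.of_injective p (η.equiv.injective h1)

lemma eq_zero_of_contract_form {p : ℕ} {P : F.Polyvector p} (h : F.contract P η.form = 0) :
    P = 0 :=
  η.contract_form_injective (h.trans (map_zero (F.contractForm η.form p)).symm)

/-- The component of degree `m` of a form. -/
def formProj (F : FormCalculus k A Ω) (m : ℕ) : F.Forms →ₗ[k] F.Forms :=
  (GradedAlgebra.proj (fun i : ℕ => ⋀[A]^i Ω) m).restrictScalars k

lemma formProj_of_mem {m : ℕ} {x : F.Forms} (hx : x ∈ F.formDeg m) : formProj F m x = x := by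
  rw [mem_formDeg, extZ_natCast] at hx
  exact DirectSum.decompose_of_mem_same (fun i : ℕ => ⋀[A]^i Ω) hx

lemma formProj_of_mem_ne {m : ℕ} {e : ℤ} {x : F.Forms} (hx : x ∈ F.formDeg e) (h : e ≠ m) :
    formProj F m x = 0 := by
  rw [mem_formDeg] at hx
  have hx' := mem_natAbs_of_mem_extZ hx
  rcases lt_or_ge e 0 with he | he
  · rw [extZ_neg he, Submodule.mem_bot] at hx
    rw [hx, map_zero]
  · exact DirectSum.decompose_of_mem_ne (fun i : ℕ => ⋀[A]^i Ω) hx' (by omega)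

lemma formProj_equiv (m p : ℕ) (h : m + p = n) (Y : ⨁ p : ℕ, F.Polyvector p) :
    formProj F m (η.equiv Y) = F.contract (Y p) η.form := by
  have : formProj F m ∘ₗ η.equiv.toLinearMap =
      F.contractForm η.form p ∘ₗ DirectSum.component k ℕ F.Polyvector p := by
    refine DirectSum.linearMap_ext k fun q => LinearMap.ext fun Q => ?_
    change formProj F m (η.equiv (DirectSum.lof k ℕ F.Polyvector q Q)) =
      F.contractForm η.form p (DirectSum.component k ℕ F.Polyvector p
        (DirectSum.lof k ℕ F.Polyvector q Q))
    rw [equiv_lof]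
    by_cases hq : q = p
    · subst hq
      rw [DirectSum.component.lof_self]
      have := η.contract_form_mem Q
      rw [show (n : ℤ) - q = m by omega] at this
      exact formProj_of_mem this
    · rw [formProj_of_mem_ne (η.contract_form_mem Q) (by omega)]
      have h0 : DirectSum.component k ℕ F.Polyvector p (DirectSum.lof k ℕ F.Polyvector q Q) = 0 :=
        DirectSum.of_eq_of_ne _ _ _ (Ne.symm hq)
      rw [h0, map_zero]
  exact LinearMap.congr_fun this Y

lemma formProj_of_gt (η : F.VolumeForm n) (m : ℕ) (h : n < m) (x : F.Forms) : formProj F m x = 0 := by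
  obtain ⟨Y, rfl⟩ := η.equiv.surjective x
  have : formProj F m ∘ₗ η.equiv.toLinearMap = 0 := by
    refine DirectSum.linearMap_ext k fun q => LinearMap.ext fun Q => ?_
    change formProj F m (η.equiv (DirectSum.lof k ℕ F.Polyvector q Q)) = 0
    rw [equiv_lof]
    exact formProj_of_mem_ne (η.contract_form_mem Q) (by omega)
  exact LinearMap.congr_fun this Y

/-- There are no forms of degree larger than that of the volume form. -/
lemma eq_zero_of_gt (η : F.VolumeForm n) {e : ℤ} (h : n < e) {x : F.Forms}
    (hx : x ∈ F.formDeg e) : x = 0 := by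
  obtain ⟨m, rfl⟩ := Int.eq_ofNat_of_zero_le (show 0 ≤ e by omega)
  rw [← formProj_of_mem hx]
  exact η.formProj_of_gt m (by omega) x

lemma exists_contract {p : ℕ} {x : F.Forms} (hx : x ∈ F.formDeg (n - p)) :
    ∃ P : F.Polyvector p, F.contract P η.form = x := by
  rcases Nat.lt_or_ge n p with h | h
  · rw [mem_formDeg, extZ_neg (by omega), Submodule.mem_bot] at hx
    exact ⟨0, by rw [hx]; exact map_zero (F.contractForm η.form p)⟩
  · obtain ⟨m, rfl⟩ := Nat.exists_eq_add_of_le' h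
    rw [show ((m + p : ℕ) : ℤ) - p = m by push_cast; ring] at hx
    refine ⟨η.equiv.symm x p, ?_⟩
    rw [← η.formProj_equiv m p rfl, LinearEquiv.apply_symm_apply, formProj_of_mem hx]

lemma equiv_symm_contract {p : ℕ} (P : F.Polyvector p) :
    η.equiv.symm (F.contract P η.form) = DirectSum.lof k ℕ F.Polyvector p P := by
  rw [← equiv_lof, LinearEquiv.symm_apply_apply]

/-- The value of a polyvector without arguments. -/
def evalZero (F : FormCalculus k A Ω) : F.Polyvector 0 →ₗ[k] A where
  toFun P := P.alt 0
  map_add' _ _ := rfl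
  map_smul' _ _ := rfl

/-- The function `a` in the component `a η` of highest degree of a form. -/
def ev : F.Forms →ₗ[k] A :=
  evalZero F ∘ₗ DirectSum.component k ℕ F.Polyvector 0 ∘ₗ η.equiv.symm.toLinearMap

lemma ev_contract_zero (P : F.Polyvector 0) : η.ev (F.contract P η.form) = P.alt 0 := by
  change evalZero F (DirectSum.component k ℕ F.Polyvector 0 (η.equiv.symm _)) = _
  rw [equiv_symm_contract, DirectSum.component.lof_self]
  rfl

lemma ev_contract_succ {p : ℕ} (P : F.Polyvector (p + 1)) : η.ev (F.contract P η.form) = 0 := by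
  change evalZero F (DirectSum.component k ℕ F.Polyvector 0 (η.equiv.symm _)) = _
  rw [equiv_symm_contract]
  have h0 : DirectSum.component k ℕ F.Polyvector 0 (DirectSum.lof k ℕ F.Polyvector (p + 1) P) = 0 :=
    DirectSum.of_eq_of_ne (p + 1) 0 P (Nat.succ_ne_zero p).symm
  rw [h0, map_zero]

lemma ev_eq_zero {t : ℤ} (ht : t ≠ 0) {x : F.Forms} (hx : x ∈ F.formDeg (n - t)) : η.ev x = 0 := by
  rcases lt_or_ge t 0 with h | h
  · rw [η.eq_zero_of_gt (by omega) hx, map_zero]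
  · obtain ⟨p, rfl⟩ := Int.eq_ofNat_of_zero_le h
    obtain ⟨P, rfl⟩ := η.exists_contract hx
    cases p with
    | zero => exact absurd rfl ht
    | succ p => exact η.ev_contract_succ P

lemma eq_ev_smul {x : F.Forms} (hx : x ∈ F.formDeg (n - (0 : ℤ))) : x = η.ev x • η.form := by
  obtain ⟨P, rfl⟩ := η.exists_contract (p := 0) hx
  rw [ev_contract_zero, contract_zero]

/-- A function as a polyvector without arguments. -/
def scalar (F : FormCalculus k A Ω) (a : A) : F.Polyvector 0 := AlternatingMap.constOfIsEmpty A Ω (Fin 0) a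

lemma contract_scalar (a : A) (x : F.Forms) : F.contract (scalar F a) x = a • x := contract_zero _ _

lemma ev_smul_form (a : A) : η.ev (a • η.form) = a := by
  rw [← contract_scalar, ev_contract_zero]
  rfl

lemma ev_smul (a : A) (x : F.Forms) : η.ev (a • x) = a * η.ev x := by
  have h : η.ev ∘ₗ (LinearMap.lsmul A F.Forms a).restrictScalars k ∘ₗ η.equiv.toLinearMap =
      LinearMap.mulLeft k a ∘ₗ η.ev ∘ₗ η.equiv.toLinearMap := by
    refine DirectSum.linearMap_ext k fun q => LinearMap.ext fun Q => ?_
    change η.ev (a • η.equiv (DirectSum.lof k ℕ F.Polyvector q Q)) =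
      a * η.ev (η.equiv (DirectSum.lof k ℕ F.Polyvector q Q))
    rw [equiv_lof, ← contract_fsmul]
    cases q with
    | zero => rw [ev_contract_zero, ev_contract_zero]; rfl
    | succ q => rw [ev_contract_succ, ev_contract_succ, mul_zero]
  obtain ⟨Y, rfl⟩ := η.equiv.surjective x
  exact LinearMap.congr_fun h Y

/-- The product of polyvectors, transported to forms: `ι_P η • y = ι_P y`. -/
def mul : F.Forms →ₗ[k] F.Forms →ₗ[k] F.Forms :=
  DirectSum.toModule k ℕ (F.Forms →ₗ[k] F.Forms) (fun p =>
    LinearMap.mk₂ k (fun (P : F.Polyvector p) (x : F.Forms) => F.contract P x)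
      contract_add_left contract_smul_left
      (fun _ _ _ => map_add _ _ _)
      (fun c P x => (F.contract P).map_smul_of_tower c x)) ∘ₗ η.equiv.symm.toLinearMap

lemma mul_contract {p : ℕ} (P : F.Polyvector p) (x : F.Forms) :
    η.mul (F.contract P η.form) x = F.contract P x := by
  change (DirectSum.toModule k ℕ (F.Forms →ₗ[k] F.Forms) _ (η.equiv.symm _)) x = _
  rw [equiv_symm_contract, DirectSum.toModule_lof]
  rfl

lemma mul_smul_form (a : A) (x : F.Forms) : η.mul (a • η.form) x = a • x := by
  rw [← contract_scalar a η.form, mul_contract, contract_scalar]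

lemma mul_smul_right {t : ℤ} {x : F.Forms} (hx : x ∈ F.formDeg (n - t)) (a : A) (y : F.Forms) :
    η.mul x (a • y) = a • η.mul x y := by
  rcases lt_or_ge t 0 with h | h
  · rw [η.eq_zero_of_gt (by omega) hx, map_zero]
    simp
  · obtain ⟨p, rfl⟩ := Int.eq_ofNat_of_zero_le h
    obtain ⟨P, rfl⟩ := η.exists_contract hx
    rw [mul_contract, mul_contract, contract_smul]

lemma mul_form {t : ℤ} {x : F.Forms} (hx : x ∈ F.formDeg (n - t)) : η.mul x η.form = x := by
  rcases lt_or_ge t 0 with h | h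
  · rw [η.eq_zero_of_gt (by omega) hx, map_zero]
    rfl
  · obtain ⟨p, rfl⟩ := Int.eq_ofNat_of_zero_le h
    obtain ⟨P, rfl⟩ := η.exists_contract hx
    rw [mul_contract]

lemma mul_mem {s t : ℤ} {x y : F.Forms} (hx : x ∈ F.formDeg (n - s)) (hy : y ∈ F.formDeg (n - t)) :
    η.mul x y ∈ F.formDeg (n - (s + t)) := by
  rcases lt_or_ge s 0 with h | h
  · rw [η.eq_zero_of_gt (by omega) hx, map_zero]
    exact zero_mem _
  · obtain ⟨p, rfl⟩ := Int.eq_ofNat_of_zero_le h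
    obtain ⟨P, rfl⟩ := η.exists_contract hx
    rw [mul_contract]
    have := contract_mem P hy
    rwa [show (n : ℤ) - t - p = n - (p + t) by ring] at this

lemma dfun_mul_form (f : A) : F.dfun f * η.form = 0 :=
  η.eq_zero_of_gt (by omega) (dfun_mul_mem f η.form_mem')

lemma d_form : F.d η.form = 0 := η.eq_zero_of_gt (by omega) (d_mem η.form_mem')

lemma dfun_mul_contract_form {p : ℕ} (P : F.Polyvector (p + 1)) (f : A) :
    F.dfun f * F.contract P η.form = F.contract (curry P (F.D f)) η.form := by
  rw [dfun_mul_contract, dfun_mul_form, map_zero, smul_zero, add_zero]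

lemma dfun_mul_mul (f : A) {s : ℤ} {x : F.Forms} (hx : x ∈ F.formDeg (n - s)) (y : F.Forms) :
    F.dfun f * η.mul x y = η.mul (F.dfun f * x) y + sg s • η.mul x (F.dfun f * y) := by
  rcases lt_or_ge s 0 with h | h
  · rw [η.eq_zero_of_gt (by omega) hx]
    simp
  · obtain ⟨p, rfl⟩ := Int.eq_ofNat_of_zero_le h
    obtain ⟨P, rfl⟩ := η.exists_contract hx
    cases p with
    | zero =>
      rw [contract_zero, mul_smul_form, mul_smul_form, mul_smul_comm, mul_smul_comm, dfun_mul_form,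
        smul_zero, map_zero η.mul, LinearMap.zero_apply, zero_add, Nat.cast_zero, sg_zero, one_smul]
    | succ p =>
      rw [mul_contract, mul_contract, dfun_mul_contract, dfun_mul_contract_form, mul_contract]
      push_cast
      rfl

lemma dfun_mul_smul_form (f a : A) : F.dfun f * (a • η.form) = 0 := by
  rw [mul_smul_comm, dfun_mul_form, smul_zero]

lemma d_smul_form (a : A) : F.d (a • η.form) = 0 := by
  rw [d_smul, dfun_mul_form, d_form, smul_zero, add_zero]

/-- A polyvector is determined by its iterated insertions of differentials. -/
lemma foldl_contract (p : ℕ) (P : F.Polyvector p)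
    (h : ∀ l : List A, η.ev (l.foldl (fun y f => F.dfun f * y) (F.contract P η.form)) = 0) :
    P = 0 := by
  induction p with
  | zero =>
    have := h []
    rw [List.foldl_nil, ev_contract_zero] at this
    refine AlternatingMap.ext fun v => ?_
    rw [Subsingleton.elim v 0]
    exact this
  | succ p ih =>
    have hc : ∀ f, curry P (F.D f) = 0 := fun f => ih _ fun l => by
      have := h (f :: l)
      rwa [List.foldl_cons, dfun_mul_contract_form] at this
    have h1 : P.alt.curryLeft = 0 := F.linearMap_ext hc
    refine AlternatingMap.ext fun v => ?_
    have := congrArg (fun g => g (v 0) (Fin.tail v)) h1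
    refine Eq.trans ?_ this
    change _ = P.alt (Matrix.vecCons (v 0) (Fin.tail v))
    exact congrArg P.alt (Fin.cons_self_tail v).symm

lemma eq_zero_of_foldl {t : ℤ} {x : F.Forms} (hx : x ∈ F.formDeg (n - t))
    (h : ∀ l : List A, η.ev (l.foldl (fun y f => F.dfun f * y) x) = 0) : x = 0 := by
  rcases lt_or_ge t 0 with ht | ht
  · exact η.eq_zero_of_gt (by omega) hx
  · obtain ⟨p, rfl⟩ := Int.eq_ofNat_of_zero_le ht
    obtain ⟨P, rfl⟩ := η.exists_contract hx
    rw [η.foldl_contract p P h]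
    exact map_zero (F.contractForm η.form p)

/-- The deviation of the divergence from being a derivation, in the component without arguments. -/
lemma ev_bracket {s t : ℤ} {x y : F.Forms} (hx : x ∈ F.formDeg (n - s))
    (hy : y ∈ F.formDeg (n - t)) :
    η.ev (F.d (η.mul x y) - η.mul (F.d x) y - sg s • η.mul x (F.d y)) =
      η.ev (F.dfun (η.ev x) * y) + η.ev (F.dfun (η.ev y) * x) := by
  have hm : F.d (η.mul x y) - η.mul (F.d x) y - sg s • η.mul x (F.d y) ∈
      F.formDeg (n - (s + t - 1)) := by
    have h1 := d_mem (η.mul_mem hx hy)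
    have h2 := η.mul_mem (s := s - 1) (by
      have := d_mem hx
      rwa [show (n : ℤ) - s + 1 = n - (s - 1) by ring] at this) hy
    have h3 := η.mul_mem (t := t - 1) hx (by
      have := d_mem hy
      rwa [show (n : ℤ) - t + 1 = n - (t - 1) by ring] at this)
    rw [show (n : ℤ) - (s + t) + 1 = n - (s + t - 1) by ring] at h1
    rw [show s - 1 + t = s + t - 1 by ring] at h2
    rw [show s + (t - 1) = s + t - 1 by ring] at h3
    exact sub_mem (sub_mem h1 h2) (zsmul_mem h3 _)
  by_cases hs0 : s = 0
  · subst hs0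
    rw [η.eq_ev_smul hx, ev_smul_form, mul_smul_form, d_smul, d_smul_form, map_zero,
      LinearMap.zero_apply, sub_zero, mul_smul_form, sg_zero, one_smul, add_sub_cancel_right,
      dfun_mul_smul_form, map_zero, add_zero]
  by_cases ht0 : t = 0
  · subst ht0
    rw [η.eq_ev_smul hy, ev_smul_form, η.mul_smul_right hx, η.mul_form hx, d_smul, d_smul_form,
      map_zero, smul_zero, sub_zero, dfun_mul_smul_form, map_zero, zero_add]
    have h2 : F.d x ∈ F.formDeg (n - (s - 1)) := by
      have := d_mem hx
      rwa [show (n : ℤ) - s + 1 = n - (s - 1) by ring] at this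
    rw [η.mul_smul_right h2, η.mul_form h2, add_sub_cancel_right]
  rw [η.ev_eq_zero hs0 hx, η.ev_eq_zero ht0 hy]
  have h0 : F.dfun (0 : A) = 0 := by rw [dfun, map_zero, map_zero]
  rw [h0, zero_mul, zero_mul, map_zero, add_zero]
  by_cases hst : s + t - 1 = 0
  · rcases lt_or_ge s 0 with h | h
    · rw [η.eq_zero_of_gt (by omega) hx]
      simp
    · rw [η.eq_zero_of_gt (by omega) hy]
      simp
  · exact η.ev_eq_zero hst hm

lemma ev_mul {s t : ℤ} {x y : F.Forms} (hx : x ∈ F.formDeg (n - s)) (hy : y ∈ F.formDeg (n - t)) :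
    η.ev (η.mul x y) = η.ev x * η.ev y := by
  by_cases hs0 : s = 0
  · subst hs0
    rw [η.eq_ev_smul hx, mul_smul_form, ev_smul, ev_smul_form]
  by_cases ht0 : t = 0
  · subst ht0
    rw [η.eq_ev_smul hy, η.mul_smul_right hx, η.mul_form hx, ev_smul, ev_smul_form, mul_comm]
  rw [η.ev_eq_zero hs0 hx, zero_mul]
  by_cases hst : s + t = 0
  · rcases lt_or_ge s 0 with h | h
    · rw [η.eq_zero_of_gt (by omega) hx]
      simp
    · rw [η.eq_zero_of_gt (by omega) hy]
      simp
  · exact η.ev_eq_zero hst (η.mul_mem hx hy)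

lemma ev_dfun_mul_mul (f : A) {s t : ℤ} {x y : F.Forms} (hx : x ∈ F.formDeg (n - s))
    (hy : y ∈ F.formDeg (n - t)) : η.ev (F.dfun f * η.mul x y) =
      η.ev (F.dfun f * x) * η.ev y + sg s • (η.ev x * η.ev (F.dfun f * y)) := by
  have h1 : F.dfun f * x ∈ F.formDeg (n - (s - 1)) := by
    have := dfun_mul_mem f hx
    rwa [show (n : ℤ) - s + 1 = n - (s - 1) by ring] at this
  have h2 : F.dfun f * y ∈ F.formDeg (n - (t - 1)) := by
    have := dfun_mul_mem f hy
    rwa [show (n : ℤ) - t + 1 = n - (t - 1) by ring] at this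
  rw [η.dfun_mul_mul f hx, map_add, map_zsmul, η.ev_mul h1 hy, η.ev_mul hx h2]

/-- The polyvectors of an algebra with a volume form, realised as forms. The divergence becomes the
de Rham differential, and inserting a function becomes multiplication by its differential. -/
def calculus : PolyCalculus k F.Forms A A where
  X t := F.formDeg (n - t)
  mul _ _ := η.mul
  one := η.form
  Δ := F.d
  deg _ := 0
  ins f := LinearMap.mulLeft k (F.dfun f)
  ev := η.ev
  cst a := a • η.form
  one_mem := by simpa using η.form_mem'
  mul_mem hx hy := η.mul_mem hx hy
  Δ_mem := fun {t x} hx => by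
    have := d_mem hx
    rwa [show (n : ℤ) - t + 1 = n - (t - 1) by ring] at this
  ins_mem := fun f {t x} hx => by
    have := dfun_mul_mem f hx
    rwa [show (n : ℤ) - t + 1 = n - (t + 0 - 1) by ring] at this
  cst_mem a := smul_mem_formDeg a (by simpa using η.form_mem')
  sep := fun {t x} hx h => η.eq_zero_of_foldl hx h
  Δ_Δ _ := d_d _
  Δ_one := η.d_form
  ins_one f := η.dfun_mul_form f
  ins_cst f a := η.dfun_mul_smul_form f a
  ins_mul := fun f {s t x y} hx hy => by
    simp only [mul_zero, sg_zero, one_smul, LinearMap.mulLeft_apply]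
    exact η.dfun_mul_mul f hx y
  ins_Δ := fun f {t x} hx => by
    simp only [LinearMap.mulLeft_apply]
    rw [d_dfun_mul, neg_neg]
  ins_ins := fun f g {t x} hx => by
    simp only [mul_zero, sg_zero, one_smul, LinearMap.mulLeft_apply]
    exact dfun_comm F f g x
  ev_one_mul := fun {t x} hx => by
    rw [← one_smul A η.form, mul_smul_form, one_smul]
  ev_mul hx hy := η.ev_mul hx hy
  ev_comm := fun {s t x y} hx hy => by
    by_cases hs : s = 0
    · rw [hs, zero_mul, sg_zero, one_smul, mul_comm]
    · rw [η.ev_eq_zero hs hx, zero_mul, mul_zero, smul_zero]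
  ev_second_order := fun {s t r x y z} hx hy hz => by
    rw [η.ev_bracket hx (η.mul_mem hy hz), η.ev_bracket hx hy, η.ev_bracket hx hz,
      η.ev_dfun_mul_mul _ hy hz, η.ev_mul hy hz, dfun_mul, add_mul, map_add, smul_mul_assoc,
      smul_mul_assoc, ev_smul, ev_smul]
    by_cases ht : t = 0
    · subst ht
      simp only [mul_zero, sg_zero, one_smul]
      ring
    · rw [η.ev_eq_zero ht hy]
      simp only [zero_mul, smul_zero, add_zero, zero_add]
      ring
  ev_cst := fun a {t x} hx => by
    simp only [zero_mul, sg_zero, one_smul, LinearMap.mulLeft_apply]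
    rw [mul_smul_form, d_smul, d_smul_form, map_zero, LinearMap.zero_apply, sub_zero, mul_smul_form,
      add_sub_cancel_right]
  ev_bkt := fun {s t x y} hx hy h1 h2 => by
    have h0 : F.dfun (0 : A) = 0 := by rw [dfun, map_zero, map_zero]
    rw [η.ev_bracket hx hy, h1, h2, h0, zero_mul, zero_mul, map_zero, add_zero]

end FormCalculus.VolumeForm

namespace FormCalculus.VolumeForm

variable {k : Type u} [Field k] [CharZero k] {A : Type v} [CommRing A] [Algebra k A]
  {Ω : Type w} [AddCommGroup Ω] [Module A Ω] [Module k Ω] [IsScalarTower k A Ω]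
  {F : FormCalculus k A Ω} {n : ℕ} (η : F.VolumeForm n) (P : PoissonBracket k A)

/-! ### The Poisson structure on forms -/

lemma bivector_apply (f g : A) : (F.bivector P).alt ![F.D f, F.D g] = P.br f g :=
  (F.exists_bivector P).choose_spec f g

/-- The Poisson bivector in the calculus of polyvectors realised as forms. -/
def biv : η.calculus.Bivector where
  pi := F.contract (F.bivector P) η.form
  brH f g := P.br f g
  pi_mem := η.contract_form_mem (F.bivector P)
  deg_brH f g := rfl
  ev_pi := η.ev_contract_succ (F.bivector P)
  ev_ins_pi f := by
    change η.ev (F.dfun f * F.contract (F.bivector P) η.form) = 0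
    rw [η.dfun_mul_contract_form, ev_contract_succ]
  ins_ins_pi f g := by
    change F.dfun g * (F.dfun f * F.contract (F.bivector P) η.form) = P.br f g • η.form
    rw [η.dfun_mul_contract_form, η.dfun_mul_contract_form, contract_zero, ← bivector_apply (F := F)]
    congr 1
    change (F.bivector P).alt _ = (F.bivector P).alt _
    congr 1
    funext i
    refine Fin.cases rfl (fun i => ?_) i
    obtain rfl : i = 0 := Subsingleton.elim i (0 : Fin 1)
    rfl
  jacobi f g h := by
    change P.br f (P.br g h) • η.form = P.br (P.br f g) h • η.form +
      sg (0 * 0) • P.br g (P.br f h) • η.form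
    rw [P.jacobi, add_smul, mul_zero, sg_zero, one_smul]

/-- The Poisson structure of the calculus of polyvectors realised as forms. -/
def poisson : η.calculus.Poisson where
  toBivector := η.biv P
  b := η.calculus.bkt 2 0 (η.biv P).pi
  b_apply _ := rfl

lemma contract_modularVector :
    F.contract (η.modularVector P) η.form = (η.poisson P).modular := by
  have hm : F.d (F.contract (F.bivector P) η.form) ∈ F.formDeg (n - (1 : ℕ)) := by
    have := d_mem (η.contract_form_mem (F.bivector P))
    rwa [show (n : ℤ) - (2 : ℕ) + 1 = n - (1 : ℕ) by push_cast; ring] at this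
  obtain ⟨V, hV⟩ := η.exists_contract hm
  have h : η.modularVector P = -V := by
    change -(η.equiv.symm (F.d (η.equiv (DirectSum.lof k ℕ F.Polyvector 2 (F.bivector P)))) 1) = -V
    rw [equiv_lof, ← hV, equiv_symm_contract]
    exact congrArg Neg.neg (DirectSum.component.lof_self k (M := F.Polyvector) 1 V)
  rw [h]
  have h2 : F.contract (-V) η.form = -F.contract V η.form := map_neg (F.contractForm η.form 1) V
  rw [h2, hV]
  rfl

lemma dfun_mul_modular (f : A) :
    F.dfun f * (η.poisson P).modular = η.modularDerivation P f • η.form := by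
  rw [← contract_modularVector, η.dfun_mul_contract_form, contract_zero]
  congr 1
  change (η.modularVector P).alt _ = (η.modularVector P).alt _
  congr 1
  funext i
  exact Fin.cases rfl (fun j => j.elim0) i

variable {P}

/-- The operator `[X_f, -]` on forms, for the Hamiltonian vector field `X_f` of a function. -/
def ham (P : PoissonBracket k A) (f : A) : F.Forms →ₗ[k] F.Forms :=
  η.calculus.bkt 1 0 (F.dfun f * (η.biv P).pi)

lemma ham_dfun_mul (f g : A) {t : ℤ} {x : F.Forms} (hx : x ∈ F.formDeg (n - t)) :
    η.ham P f (F.dfun g * x) = F.dfun g * η.ham P f x + F.dfun (P.br f g) * x := by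
  have h : F.dfun g * η.ham P f x = -(sg (t * 0) • (F.dfun (P.br f g) * x)) +
      sg 0 • η.ham P f (F.dfun g * x) := (η.biv P).ins_bkt_ham f g (t := t) (x := x) hx
  rw [h, mul_zero, sg_zero, one_smul, one_smul]
  abel

lemma b_dfun_mul (f : A) {t : ℤ} {x : F.Forms} (hx : x ∈ F.formDeg (n - t)) :
    (η.poisson P).b (F.dfun f * x) = -(F.dfun f * (η.poisson P).b x) - η.ham P f x := by
  have h : F.dfun f * (η.poisson P).b x = -(sg (t * 0) • η.ham P f x) -
      (η.poisson P).b (F.dfun f * x) := (η.biv P).ins_bkt_pi f (t := t) (x := x) hx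
  rw [h, mul_zero, sg_zero, one_smul]
  abel

lemma lie_dfun_mul (f : A) {t : ℤ} {x : F.Forms} (hx : x ∈ F.formDeg (n - t)) :
    (η.poisson P).lie (F.dfun f * x) = F.dfun f * (η.poisson P).lie x +
      F.dfun (η.modularDerivation P f) * x := by
  have hx' : x ∈ η.calculus.X t := hx
  have h1 := η.calculus.ins_bkt f (η.poisson P).modular_mem hx'
  have h2 := η.calculus.bkt_cst (η.modularDerivation P f) hx'
  have e : η.calculus.ins f (η.poisson P).modular = η.calculus.cst (η.modularDerivation P f) :=
    η.dfun_mul_modular P f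
  have e2 : η.calculus.bkt (1 + η.calculus.deg f - 1) t (η.calculus.ins f (η.poisson P).modular) x =
      sg (0 * t) • (F.dfun (η.modularDerivation P f) * x) := by rw [e]; exact h2
  have h3 : (η.poisson P).lie (F.dfun f * x) =
      η.calculus.bkt 1 (t + η.calculus.deg f - 1) (η.poisson P).modular (η.calculus.ins f x) :=
    (η.poisson P).lie_eq (η.calculus.ins_mem f hx')
  rw [← h3, e2, zero_mul, sg_zero, one_smul, sg_one, ← (η.poisson P).lie_eq hx'] at h1
  have h4 : F.dfun f * (η.poisson P).lie x = -(sg (t * 0) • (F.dfun (η.modularDerivation P f) * x)) -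
      (-1 : ℤ) • (η.poisson P).lie (F.dfun f * x) := h1
  rw [h4, mul_zero, sg_zero, one_smul, neg_one_smul]
  abel

lemma smul_one_mem (m : A) : m • (1 : F.Forms) ∈ F.formDeg (n - (n : ℤ)) := by
  rw [sub_self]
  exact smul_mem_formDeg m one_mem_formDeg

lemma smul_dwedge_mem (m : A) (l : List A) :
    m • F.dwedge l ∈ F.formDeg (n - ((n : ℤ) - l.length)) := by
  rw [sub_sub_cancel]
  exact smul_mem_formDeg m (dwedge_mem l)

lemma contract_d_function {p : ℕ} (X : F.Polyvector (p + 1)) (m : A) :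
    F.contract X (F.d (m • 1)) = sg p • F.contract (curry X (F.D m)) 1 := by
  rw [← dwedge_nil, d_smul_dwedge, dwedge_nil, contract_dfun_mul, contract_one, mul_zero,
    smul_zero, add_zero]

/-- The operator `[X_f, -]` acts on functions as `m ↦ {f, m} - ν(f) m`: under the identification of
functions with polyvectors of highest degree it is a Lie derivative twisted by the divergence. -/
lemma ham_smul_one (f m : A) :
    η.ham P f (m • 1) = (P.br f m - η.modularDerivation P f * m) • 1 := by
  have h : η.ham P f (m • 1) = F.d (η.mul (F.dfun f * F.contract (F.bivector P) η.form) (m • 1)) -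
      η.mul (F.d (F.dfun f * F.contract (F.bivector P) η.form)) (m • 1) -
      sg 1 • η.mul (F.dfun f * F.contract (F.bivector P) η.form) (F.d (m • 1)) :=
    η.calculus.bkt_apply 1 0 _ _
  have hd : F.d (F.dfun f * F.contract (F.bivector P) η.form) =
      η.modularDerivation P f • η.form := by
    rw [d_dfun_mul, ← dfun_mul_modular]
    change _ = F.dfun f * -(F.d _)
    rw [mul_neg]
    rfl
  have hb : F.dfun f * F.contract (F.bivector P) η.form =
      F.contract (curry (F.bivector P) (F.D f)) η.form := η.dfun_mul_contract_form _ _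
  have hc : (curry (curry (F.bivector P) (F.D f)) (F.D m)).alt 0 = P.br f m := by
    have := (η.biv P).ins_ins_pi f m
    have e : F.dfun m * (F.dfun f * F.contract (F.bivector P) η.form) = P.br f m • η.form := this
    rw [hb, dfun_mul_contract_form, contract_zero] at e
    have := congrArg η.ev e
    rwa [ev_smul_form, ev_smul_form] at this
  rw [h, hd, hb, mul_contract, mul_contract, contract_smul, contract_one, smul_zero, map_zero,
    mul_smul_form, contract_d_function, contract_zero, hc, sg_one, Nat.cast_zero, sg_zero, one_smul,
    neg_one_smul, zero_sub, sub_neg_eq_add, smul_smul, sub_smul]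
  abel

lemma lie_smul_one (m : A) : (η.poisson P).lie (m • 1) = η.modularDerivation P m • 1 := by
  have h0 : (m • 1 : F.Forms) ∈ η.calculus.X n := smul_one_mem m
  have h := (η.poisson P).lie_eq h0
  rw [PolyCalculus.bkt_apply] at h
  have h' : (η.poisson P).lie (m • 1) = F.d (η.mul (η.poisson P).modular (m • 1)) -
      η.mul (F.d (η.poisson P).modular) (m • 1) - sg 1 • η.mul (η.poisson P).modular (F.d (m • 1)) := h
  have hd : F.d (η.poisson P).modular = 0 := by
    change F.d (-(F.d _)) = 0
    rw [map_neg, d_d, neg_zero]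
  have hc : (curry (η.modularVector P) (F.D m)).alt 0 = η.modularDerivation P m := by
    have e := η.dfun_mul_modular P m
    rw [← contract_modularVector, dfun_mul_contract_form, contract_zero] at e
    have := congrArg η.ev e
    rwa [ev_smul_form, ev_smul_form] at this
  rw [h', hd, ← contract_modularVector, mul_contract, mul_contract, contract_smul, contract_one,
    smul_zero, map_zero, map_zero, LinearMap.zero_apply, contract_d_function, contract_zero, hc,
    sg_one, Nat.cast_zero, sg_zero, one_smul, neg_one_smul, zero_sub, neg_zero, zero_sub, neg_neg]

lemma b_smul_one (m : A) : (η.poisson P).b (m • 1) = 0 := by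
  have h : (η.poisson P).b (m • 1) = F.d (η.mul (F.contract (F.bivector P) η.form) (m • 1)) -
      η.mul (F.d (F.contract (F.bivector P) η.form)) (m • 1) -
      sg 2 • η.mul (F.contract (F.bivector P) η.form) (F.d (m • 1)) :=
    η.calculus.bkt_apply 2 0 _ _
  have hd : F.d (F.contract (F.bivector P) η.form) = -F.contract (η.modularVector P) η.form := by
    rw [contract_modularVector]
    exact (neg_neg _).symm
  rw [h, hd, map_neg, LinearMap.neg_apply, mul_contract, mul_contract, mul_contract, contract_smul,
    contract_one, smul_zero, map_zero, contract_smul, contract_one, smul_zero, contract_d_function,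
    contract_one]
  simp

lemma ham_smul_dwedge (f m : A) (l : List A) : η.ham P f (m • F.dwedge l) =
    (P.br f m - η.modularDerivation P f * m) • F.dwedge l +
      ∑ j : Fin l.length, ((-1 : A) ^ (j : ℕ) * m) •
        F.dwedge (P.br f (l.get j) :: l.eraseIdx j) := by
  induction l with
  | nil =>
    rw [dwedge_nil, ham_smul_one]
    simp
  | cons g l ih =>
    rw [dwedge_cons, ← mul_smul_comm, η.ham_dfun_mul f g (smul_dwedge_mem m l), ih, sum_fin_cons,
      mul_add, mul_smul_comm, Finset.mul_sum, mul_smul_comm, dwedge_cons]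
    simp only [List.eraseIdx_cons_zero, List.eraseIdx_cons_succ, pow_zero, one_mul, dwedge_cons,
      List.get_cons_zero, List.get_cons_succ', Fin.val_zero, Fin.val_succ]
    have e : ∀ j : Fin l.length, F.dfun g * (((-1 : A) ^ (j : ℕ) * m) •
        (F.dfun (P.br f (l.get j)) * F.dwedge (l.eraseIdx j))) =
        ((-1 : A) ^ ((j : ℕ) + 1) * m) •
          (F.dfun (P.br f (l.get j)) * (F.dfun g * F.dwedge (l.eraseIdx j))) := fun j => by
      rw [mul_smul_comm, dfun_comm, pow_succ, smul_neg, ← neg_smul]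
      congr 1
      ring
    rw [Finset.sum_congr rfl fun j _ => e j]
    abel

end FormCalculus.VolumeForm

namespace FormCalculus.VolumeForm

variable {k : Type u} [Field k] [CharZero k] {A : Type v} [CommRing A] [Algebra k A]
  {Ω : Type w} [AddCommGroup Ω] [Module A Ω] [Module k Ω] [IsScalarTower k A Ω]
  {F : FormCalculus k A Ω} {n : ℕ} (η : F.VolumeForm n) (P : PoissonBracket k A)

/-! ### The twisted Poisson boundary and the Poisson coboundary -/

lemma br_skew (P : PoissonBracket k A) (a b : A) : P.br a b = -P.br b a := by
  have h := P.br_self (a + b)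
  simp only [map_add, LinearMap.add_apply, P.br_self] at h
  exact eq_neg_of_add_eq_zero_right (by simpa using h)

/-- Bracketing with the bivector, on forms, is the boundary with coefficients twisted by the
modular derivation. Both operators satisfy the same recursion in the first differential, the terms
containing it being `ham_smul_dwedge`. -/
lemma isPoissonBoundary_b :
    F.IsPoissonBoundary P (η.modularDerivation P) (η.poisson P).b := by
  intro m l
  induction l with
  | nil =>
    rw [dwedge_nil, b_smul_one]
    simp
  | cons f l ih =>
    rw [dwedge_cons, ← mul_smul_comm, η.b_dfun_mul f (smul_dwedge_mem m l), ih, ham_smul_dwedge,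
      sum_fin_cons, sum_fin_cons]
    simp only [List.get_eq_getElem, Fin.val_zero, Fin.val_succ, List.getElem_cons_zero,
      List.getElem_cons_succ, List.eraseIdx_cons_zero, List.eraseIdx_cons_succ]
    have e0 : (∑ j : Fin (f :: l).length, if (0 : Fin (l.length + 1)) < j then
        ((-1 : A) ^ ((j : ℕ) - 0) * m) •
          F.dwedge (P.br f (f :: l)[(j : ℕ)] :: ((f :: l).eraseIdx j).eraseIdx 0) else 0) =
        -∑ j : Fin l.length, ((-1 : A) ^ (j : ℕ) * m) •
          F.dwedge (P.br f l[(j : ℕ)] :: l.eraseIdx j) := by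
      rw [sum_fin_cons, if_neg (lt_irrefl _), zero_add, ← Finset.sum_neg_distrib]
      refine Finset.sum_congr rfl fun j _ => ?_
      rw [if_pos (Fin.succ_pos j), ← neg_smul]
      simp [pow_succ]
    have e1 : ∀ i : Fin l.length, (∑ j : Fin (f :: l).length, if i.succ < j then
        ((-1 : A) ^ ((j : ℕ) - ((i : ℕ) + 1)) * m) •
          F.dwedge (P.br l[(i : ℕ)] (f :: l)[(j : ℕ)] ::
            ((f :: l).eraseIdx j).eraseIdx (i + 1)) else 0) =
        -(F.dfun f * ∑ j : Fin l.length, if i < j then ((-1 : A) ^ ((j : ℕ) - (i : ℕ)) * m) •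
          F.dwedge (P.br l[(i : ℕ)] l[(j : ℕ)] :: (l.eraseIdx j).eraseIdx i) else 0) := by
      intro i
      rw [sum_fin_cons, if_neg (Fin.not_lt_zero _), zero_add, Finset.mul_sum,
        ← Finset.sum_neg_distrib]
      refine Finset.sum_congr rfl fun j _ => ?_
      by_cases hij : i < j
      · rw [if_pos (Fin.succ_lt_succ_iff.2 hij), if_pos hij]
        simp only [Fin.val_succ, List.getElem_cons_succ, List.eraseIdx_cons_succ, dwedge_cons,
          Nat.add_sub_add_right]
        rw [mul_smul_comm, dfun_comm, smul_neg]
      · rw [if_neg (fun h => hij (Fin.succ_lt_succ_iff.1 h)), if_neg hij, mul_zero, neg_zero]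
    have e2 : ∀ i : Fin l.length, ((-1 : A) ^ ((i : ℕ) + 1) *
        twistedBr P (η.modularDerivation P) m l[(i : ℕ)]) • F.dwedge (f :: l.eraseIdx i) =
        -(F.dfun f * (((-1 : A) ^ (i : ℕ) * twistedBr P (η.modularDerivation P) m l[(i : ℕ)]) •
          F.dwedge (l.eraseIdx i))) := by
      intro i
      rw [dwedge_cons, mul_smul_comm, ← neg_smul, pow_succ]
      congr 1
      ring
    have e3 : twistedBr P (η.modularDerivation P) m f =
        -(P.br f m - η.modularDerivation P f * m) := by
      rw [twistedBr, br_skew]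
      ring
    erw [e0]
    erw [Finset.sum_congr rfl fun i _ => e1 i]
    simp only [e2, e3, pow_zero, one_mul, neg_smul, Finset.sum_neg_distrib, Finset.mul_sum, mul_add,
      neg_add]
    abel

/-- The value of a polyvector, realised as a form, at a list of functions. -/
def evalAt (x : F.Forms) (l : List A) : A := η.ev (l.foldl (fun y f => F.dfun f * y) x)

lemma evalAt_nil (x : F.Forms) : η.evalAt x [] = η.ev x := rfl

lemma evalAt_cons (x : F.Forms) (f : A) (l : List A) :
    η.evalAt x (f :: l) = η.evalAt (F.dfun f * x) l := rfl

lemma evalAt_add (x y : F.Forms) (l : List A) :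
    η.evalAt (x + y) l = η.evalAt x l + η.evalAt y l := by
  induction l generalizing x y with
  | nil => exact map_add _ _ _
  | cons f l ih => rw [evalAt_cons, mul_add, ih]; rfl

lemma evalAt_neg (x : F.Forms) (l : List A) : η.evalAt (-x) l = -η.evalAt x l := by
  induction l generalizing x with
  | nil => exact map_neg _ _
  | cons f l ih => rw [evalAt_cons, mul_neg, ih]; rfl

lemma evalAt_swap (x : F.Forms) (f g : A) (l : List A) :
    η.evalAt x (f :: g :: l) = -η.evalAt x (g :: f :: l) := by
  rw [evalAt_cons, evalAt_cons, dfun_comm, evalAt_neg]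
  rfl

lemma eval_cons {p : ℕ} (X : F.Polyvector (p + 1)) (f : A) (l : List A) :
    F.eval X (f :: l) = F.eval (curry X (F.D f)) l := by
  change X.alt _ = X.alt _
  congr 1
  funext r
  exact Fin.cases rfl (fun _ => rfl) r

lemma evalAt_contract {p : ℕ} (X : F.Polyvector p) {l : List A} (hl : l.length = p) :
    η.evalAt (F.contract X η.form) l = F.eval X l := by
  induction l generalizing p with
  | nil =>
    subst hl
    rw [evalAt_nil, ev_contract_zero]
    exact congrArg X.alt (funext fun r => r.elim0)
  | cons f l ih =>
    subst hl
    rw [evalAt_cons, dfun_mul_contract_form, ih _ rfl, eval_cons]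

/-- The terms of the Poisson coboundary that involve a given first argument `f`. -/
def hamTerms (P : PoissonBracket k A) (f : A) (X : List A → A) (l : List A) : A :=
  P.br f (X l) - ∑ j : Fin l.length, (-1 : A) ^ (j : ℕ) * X (P.br f (l.get j) :: l.eraseIdx j)

/-- The Poisson coboundary of a function of lists of arguments. -/
def coboundaryAt (P : PoissonBracket k A) (X : List A → A) (l : List A) : A :=
  (∑ i : Fin l.length, (-1 : A) ^ (i : ℕ) * P.br (l.get i) (X (l.eraseIdx i))) +
  ∑ i : Fin l.length, ∑ j : Fin l.length, if i < j then
    (-1 : A) ^ (i + j : ℕ) * X (P.br (l.get i) (l.get j) :: (l.eraseIdx j).eraseIdx i)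
  else 0

lemma hamTerms_cons (P : PoissonBracket k A) (f g : A) (x : F.Forms) (l : List A) :
    hamTerms P f (η.evalAt x) (g :: l) = hamTerms P f (η.evalAt (F.dfun g * x)) l -
      η.evalAt x (P.br f g :: l) := by
  unfold hamTerms
  rw [sum_fin_cons]
  simp only [List.get_eq_getElem, Fin.val_zero, Fin.val_succ, List.getElem_cons_zero,
    List.getElem_cons_succ, List.eraseIdx_cons_zero, List.eraseIdx_cons_succ, pow_zero, one_mul,
    ← evalAt_cons]
  have h : ∀ j : Fin l.length, (-1 : A) ^ ((j : ℕ) + 1) *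
      η.evalAt x (P.br f l[(j : ℕ)] :: g :: l.eraseIdx j) =
      (-1 : A) ^ (j : ℕ) * η.evalAt x (g :: P.br f l[(j : ℕ)] :: l.eraseIdx j) := fun j => by
    rw [evalAt_swap, pow_succ]
    ring
  rw [Finset.sum_congr rfl fun j _ => h j]
  ring

lemma coboundaryAt_cons (f : A) (x : F.Forms) (l : List A) :
    coboundaryAt P (η.evalAt x) (f :: l) = -coboundaryAt P (η.evalAt (F.dfun f * x)) l +
      hamTerms P f (η.evalAt x) l := by
  unfold coboundaryAt hamTerms
  rw [sum_fin_cons, sum_fin_cons]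
  simp only [List.get_eq_getElem, Fin.val_zero, Fin.val_succ, List.getElem_cons_zero,
    List.getElem_cons_succ, List.eraseIdx_cons_zero, List.eraseIdx_cons_succ, pow_zero, one_mul,
    ← evalAt_cons]
  have e0 : (∑ j : Fin (f :: l).length, if (0 : Fin (l.length + 1)) < j then
      (-1 : A) ^ (0 + (j : ℕ)) *
        η.evalAt x (P.br f (f :: l)[(j : ℕ)] :: ((f :: l).eraseIdx j).eraseIdx 0) else 0) =
      -∑ j : Fin l.length, (-1 : A) ^ (j : ℕ) *
        η.evalAt x (P.br f l[(j : ℕ)] :: l.eraseIdx j) := by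
    rw [sum_fin_cons, if_neg (lt_irrefl _), zero_add, ← Finset.sum_neg_distrib]
    refine Finset.sum_congr rfl fun j _ => ?_
    rw [if_pos (Fin.succ_pos j)]
    simp [pow_succ]
  have e1 : ∀ i : Fin l.length, (∑ j : Fin (f :: l).length, if i.succ < j then
      (-1 : A) ^ ((i : ℕ) + 1 + (j : ℕ)) *
        η.evalAt x (P.br l[(i : ℕ)] (f :: l)[(j : ℕ)] ::
          ((f :: l).eraseIdx j).eraseIdx (i + 1)) else 0) =
      -∑ j : Fin l.length, if i < j then (-1 : A) ^ ((i : ℕ) + (j : ℕ)) *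
        η.evalAt x (f :: P.br l[(i : ℕ)] l[(j : ℕ)] :: (l.eraseIdx j).eraseIdx i) else 0 := by
    intro i
    rw [sum_fin_cons, if_neg (Fin.not_lt_zero _), zero_add, ← Finset.sum_neg_distrib]
    refine Finset.sum_congr rfl fun j _ => ?_
    by_cases hij : i < j
    · rw [if_pos (Fin.succ_lt_succ_iff.2 hij), if_pos hij]
      simp only [Fin.val_succ, List.getElem_cons_succ, List.eraseIdx_cons_succ]
      rw [evalAt_swap]
      ring
    · rw [if_neg (fun h => hij (Fin.succ_lt_succ_iff.1 h)), if_neg hij, neg_zero]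
  have e2 : ∀ i : Fin l.length, (-1 : A) ^ ((i : ℕ) + 1) *
      P.br l[(i : ℕ)] (η.evalAt x (f :: l.eraseIdx i)) =
      -((-1 : A) ^ (i : ℕ) * P.br l[(i : ℕ)] (η.evalAt x (f :: l.eraseIdx i))) := by
    intro i
    ring
  erw [e0]
  erw [Finset.sum_congr rfl fun i _ => e1 i]
  simp only [e2, Finset.sum_neg_distrib]
  abel

lemma evalAt_ham (f : A) (l : List A) {t : ℤ} {x : F.Forms} (hx : x ∈ F.formDeg (n - t)) :
    η.evalAt (η.ham P f x) l = hamTerms P f (η.evalAt x) l := by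
  induction l generalizing t x with
  | nil =>
    simp only [hamTerms, evalAt_nil, List.length_nil, Finset.univ_eq_empty, Finset.sum_empty,
      sub_zero]
    by_cases ht : t = 0
    · subst ht
      have h : η.ham P f (η.ev x • η.form) = P.br f (η.ev x) • η.form :=
        (η.biv P).bkt_ham_cst f (η.ev x)
      rw [η.eq_ev_smul hx, h, ev_smul_form, ev_smul_form]
    · have h : η.ham P f x ∈ F.formDeg (n - t) :=
        η.calculus.bkt_mem' (s := 1) (t := t) ((η.biv P).ins_pi_mem f) hx (by ring)
      rw [η.ev_eq_zero ht hx, η.ev_eq_zero ht h, map_zero]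
  | cons g l ih =>
    have hx' : F.dfun g * x ∈ F.formDeg (n - (t - 1)) := by
      have := dfun_mul_mem g hx
      rwa [show (n : ℤ) - t + 1 = n - (t - 1) by ring] at this
    have h : F.dfun g * η.ham P f x =
        η.ham P f (F.dfun g * x) + -(F.dfun (P.br f g) * x) := by
      rw [η.ham_dfun_mul f g hx]
      abel
    rw [evalAt_cons, h, evalAt_add, ih hx', evalAt_neg, hamTerms_cons, sub_eq_add_neg]
    rfl

/-- Bracketing with the bivector is the negative of the Poisson coboundary. -/
lemma evalAt_b (l : List A) {t : ℤ} {x : F.Forms} (hx : x ∈ F.formDeg (n - t)) :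
    η.evalAt ((η.poisson P).b x) l = -coboundaryAt P (η.evalAt x) l := by
  induction l generalizing t x with
  | nil =>
    have h : η.ev ((η.poisson P).b x) = 0 := by
      by_cases ht : t + 1 = 0
      · rw [η.eq_zero_of_gt (by omega) hx, map_zero, map_zero]
      · exact η.ev_eq_zero ht ((η.poisson P).b_mem hx)
    rw [evalAt_nil, h]
    simp [coboundaryAt]
  | cons f l ih =>
    have hx' : F.dfun f * x ∈ F.formDeg (n - (t - 1)) := by
      have := dfun_mul_mem f hx
      rwa [show (n : ℤ) - t + 1 = n - (t - 1) by ring] at this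
    have h : F.dfun f * (η.poisson P).b x =
        -((η.poisson P).b (F.dfun f * x) + η.ham P f x) := by
      rw [η.b_dfun_mul f hx]
      abel
    rw [evalAt_cons, h, evalAt_neg, evalAt_add, ih hx', η.evalAt_ham P f l hx, coboundaryAt_cons]

lemma toFunction_eq_evalAt {p : ℕ} (Z : F.Polyvector p) (f : Fin p → A) :
    F.toFunction p Z f = η.evalAt (F.contract Z η.form) (List.ofFn f) := by
  rw [evalAt_contract _ _ (List.length_ofFn)]
  change Z.alt _ = Z.alt _
  congr 1
  funext r
  simp

lemma toFunction_injective (p : ℕ) : Function.Injective (F.toFunction p) := by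
  intro X Y h
  have : X.alt = Y.alt := AlternatingMap.coe_multilinearMap_injective
    (F.multilinear_ext fun a => congrFun h a)
  exact this

lemma toFunction_eq_neg_delta {p : ℕ} (X : F.Polyvector p) (Z : F.Polyvector (p + 1))
    (h : F.contract Z η.form = (η.poisson P).b (F.contract X η.form)) :
    F.toFunction (p + 1) Z = -F.delta P p X := by
  funext f
  rw [η.toFunction_eq_evalAt, h, η.evalAt_b P _ (η.contract_form_mem X)]
  change -_ = -F.deltaAt P X (List.ofFn f)
  congr 1
  have hl : (List.ofFn f).length = p + 1 := List.length_ofFn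
  generalize List.ofFn f = l at hl
  unfold coboundaryAt deltaAt
  congr 1
  · refine Finset.sum_congr rfl fun i _ => ?_
    rw [evalAt_contract _ _ (by rw [List.length_eraseIdx_of_lt i.2]; omega)]
  · refine Finset.sum_congr rfl fun i _ => Finset.sum_congr rfl fun j _ => ?_
    split_ifs with hij
    · have hij' : (i : ℕ) < j := hij
      have hj := j.2
      rw [evalAt_contract]
      rw [List.length_cons, List.length_eraseIdx_of_lt, List.length_eraseIdx_of_lt hj]
      · omega
      · rw [List.length_eraseIdx_of_lt hj]
        omega
    · rfl

lemma exists_contract_b {p : ℕ} (X : F.Polyvector p) :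
    ∃ Z : F.Polyvector (p + 1), F.contract Z η.form = (η.poisson P).b (F.contract X η.form) := by
  have h := (η.poisson P).b_mem (t := p) (η.contract_form_mem X)
  have h' : (η.poisson P).b (F.contract X η.form) ∈ F.formDeg (n - ((p + 1 : ℕ) : ℤ)) := by
    push_cast
    exact h
  exact η.exists_contract h'

lemma mem_cocycles_iff {p : ℕ} (X : F.Polyvector p) :
    X ∈ F.cocycles P p ↔ (η.poisson P).b (F.contract X η.form) = 0 := by
  obtain ⟨Z, hZ⟩ := η.exists_contract_b P X
  have h := η.toFunction_eq_neg_delta P X Z hZ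
  rw [← hZ]
  constructor
  · intro hX
    rw [show F.delta P p X = 0 from hX, neg_zero, ← map_zero (F.toFunction (p + 1))] at h
    rw [toFunction_injective _ h]
    exact map_zero (F.contractForm η.form (p + 1))
  · intro hX
    rw [η.eq_zero_of_contract_form hX, map_zero] at h
    exact neg_eq_zero.1 h.symm

lemma mem_coboundaries_succ_iff {p : ℕ} (X : F.Polyvector (p + 1)) :
    X ∈ F.coboundaries P (p + 1) ↔
      ∃ Y : F.Polyvector p, (η.poisson P).b (F.contract Y η.form) = F.contract X η.form := by
  have key : ∀ Y : F.Polyvector p, F.delta P p Y = F.toFunction (p + 1) X ↔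
      (η.poisson P).b (F.contract (-Y) η.form) = F.contract X η.form := by
    intro Y
    obtain ⟨Z, hZ⟩ := η.exists_contract_b P (-Y)
    have h := η.toFunction_eq_neg_delta P (-Y) Z hZ
    rw [map_neg, neg_neg] at h
    rw [← h, ← hZ]
    exact ⟨fun e => by rw [toFunction_injective _ e],
      fun e => congrArg _ (η.contract_form_injective e)⟩
  constructor
  · rintro ⟨Y, hY⟩
    exact ⟨-Y, (key Y).1 hY⟩
  · rintro ⟨Y, hY⟩
    exact ⟨-Y, (key (-Y)).2 (by rwa [neg_neg])⟩

end FormCalculus.VolumeForm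

namespace FormCalculus.VolumeForm

variable {k : Type u} [Field k] [CharZero k] {A : Type v} [CommRing A] [Algebra k A]
  {Ω : Type w} [AddCommGroup Ω] [Module A Ω] [Module k Ω] [IsScalarTower k A Ω]
  {F : FormCalculus k A Ω} {n : ℕ} (η : F.VolumeForm n) (P : PoissonBracket k A)

/-! ### The wedge product of polyvectors as a composition of contractions -/

/-- Contracting `η` with `P ∧ Q` is contracting with `Q`, then with `P`. Both sides satisfy the same
Leibniz rule for inserting a function, so that induction on the arity applies. -/
lemma contract_form_eq_of_shuffle {N : ℕ} : ∀ {p q : ℕ} (h : p + q = N) (X : F.Polyvector p)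
    (Y : F.Polyvector q) (W : F.Polyvector N), W.alt = shuffle h X.alt Y.alt →
    F.contract W η.form = F.contract X (F.contract Y η.form) := by
  induction N with
  | zero =>
    intro p q h X Y W hW
    obtain rfl : p = 0 := by omega
    obtain rfl : q = 0 := by omega
    rw [shuffle_zero_left k] at hW
    rw [show W = fsmul (X.alt 0) Y from hW, contract_fsmul, contract_zero X]
  | succ N ih =>
    intro p q h X Y W hW
    cases p with
    | zero =>
      obtain rfl : q = N + 1 := by omega
      rw [shuffle_zero_left k] at hW
      rw [show W = fsmul (X.alt 0) Y from hW, contract_fsmul, contract_zero X]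
    | succ p =>
      cases q with
      | zero =>
        obtain rfl : p = N := by omega
        have hW' : W = fsmul (Y.alt 0) X := by
          refine AlternatingMap.ext fun v => ?_
          refine (congrArg (fun g => g v) hW).trans ?_
          rw [shuffle_zero_right k, smul_eq_mul, _root_.mul_comm]
          rfl
        rw [hW', contract_fsmul, contract_zero Y, contract_smul]
      | succ q =>
        have h₁ : p + (q + 1) = N := by omega
        have h₂ : p + 1 + q = N := by omega
        have hXY : F.contract X (F.contract Y η.form) ∈ F.formDeg (n - ((N + 1 : ℕ) : ℤ)) := by
          have := contract_mem X (η.contract_form_mem Y)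
          rwa [show (n : ℤ) - (q + 1 : ℕ) - (p + 1 : ℕ) = n - ((N + 1 : ℕ) : ℤ) by omega] at this
        refine sub_eq_zero.1 (η.calculus.eq_zero_of_ins (t := ((N + 1 : ℕ) : ℤ))
          (sub_mem (η.contract_form_mem W) hXY) ?_ fun f => ?_)
        · exact η.ev_eq_zero (by omega) (sub_mem (η.contract_form_mem W) hXY)
        · change F.dfun f * (_ - _) = 0
          rw [mul_sub, η.dfun_mul_contract_form W, dfun_mul_contract X, η.dfun_mul_contract_form Y,
            sub_eq_zero]
          obtain ⟨W₁, hW₁⟩ : ∃ W₁ : F.Polyvector N,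
              W₁.alt = shuffle h₁ (curry X (F.D f)).alt Y.alt := ⟨shuffle h₁ _ _, rfl⟩
          obtain ⟨W₂, hW₂⟩ : ∃ W₂ : F.Polyvector N,
              W₂.alt = shuffle h₂ X.alt (curry Y (F.D f)).alt := ⟨shuffle h₂ _ _, rfl⟩
          have hc : curry W (F.D f) = W₁ + (-1 : ℤ) ^ (p + 1) • W₂ := by
            have h0 := shuffle_cons k h h₁ h₂ X.alt Y.alt (F.D f)
            have h1 : (X.alt.curryLeft (F.D f)) = (curry X (F.D f)).alt := rfl
            have h2 : (Y.alt.curryLeft (F.D f)) = (curry Y (F.D f)).alt := rfl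
            rw [h1, h2, ← hW₁, ← hW₂, ← hW] at h0
            exact h0
          have e : ((-1 : ℤ) ^ (p + 1)) = sg (p + 1) := by
            have := neg_one_pow_smul_eq (k := ℤ) (p + 1) (1 : ℤ)
            push_cast at this
            simpa using this
          rw [hc, contract_add_left, contract_zsmul_left, ih h₁ _ _ _ hW₁,
            ih h₂ _ _ _ hW₂, e]

lemma contract_wedge {p q : ℕ} (X : F.Polyvector p) (Y : F.Polyvector q) :
    F.contract (F.wedge X Y) η.form = F.contract X (F.contract Y η.form) :=
  η.contract_form_eq_of_shuffle rfl X Y _ (wedge_eq_shuffle X Y)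

/-! ### Weights of forms -/

/-- The forms of degree `m` and weight `c`: the span of the `f₀ df₁ ∧ ⋯ ∧ df_m` with
eigenvectors `f_i` of `ν` whose eigenvalues add up to `c`. -/
def weightSpace (F : FormCalculus k A Ω) (ν : A →ₗ[k] A) (m : ℕ) (c : k) : Submodule k F.Forms :=
  Submodule.span k {x | ∃ (f : A) (l : List A) (cs : List k),
    l.length = m ∧ HasWeights ν (f :: l) cs ∧ cs.sum = c ∧ x = f • F.dwedge l}

lemma weightSpace_le_formDeg (ν : A →ₗ[k] A) (m : ℕ) (c : k) :
    weightSpace F ν m c ≤ F.formDeg m := by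
  refine Submodule.span_le.2 ?_
  rintro _ ⟨f, l, cs, rfl, -, -, rfl⟩
  exact smul_mem_formDeg f (dwedge_mem l)

lemma lie_smul_dwedge {f : A} {c : k} (hf : η.modularDerivation P f = c • f) (l : List A)
    {cs : List k} (hl : HasWeights (η.modularDerivation P) l cs) :
    (η.poisson P).lie (f • F.dwedge l) = (c + cs.sum) • f • F.dwedge l := by
  induction l generalizing cs with
  | nil =>
    cases hl
    rw [dwedge_nil, lie_smul_one, hf, List.sum_nil, add_zero, smul_assoc]
  | cons g l ih =>
    cases hl with
    | @cons _ b _ bs hg hl =>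
      rw [dwedge_cons, ← mul_smul_comm, η.lie_dfun_mul g (smul_dwedge_mem f l), ih hl, hg,
        dfun_smul, mul_smul_comm, smul_mul_assoc, ← add_smul, List.sum_cons]
      congr 1
      ring

lemma weightSpace_le_eigenspace (m : ℕ) (c : k) :
    weightSpace F (η.modularDerivation P) m c ≤ Module.End.eigenspace (η.poisson P).lie c := by
  refine Submodule.span_le.2 ?_
  rintro _ ⟨f, l, cs, rfl, hw, rfl, rfl⟩
  cases hw with
  | cons hf hl =>
    rw [List.sum_cons]
    exact Module.End.mem_eigenspace_iff.2 (η.lie_smul_dwedge P hf l hl)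

lemma dfun_mul_mem_weightSpace {ν : A →ₗ[k] A} {m : ℕ} {b c : k} {g : A} (hg : ν g = b • g)
    {x : F.Forms} (hx : x ∈ weightSpace F ν m c) :
    F.dfun g * x ∈ weightSpace F ν (m + 1) (c + b) := by
  induction hx using Submodule.span_induction with
  | mem x hx =>
    obtain ⟨f, l, cs, rfl, hw, rfl, rfl⟩ := hx
    cases hw with
    | @cons _ a _ as hf hl =>
      refine Submodule.subset_span ⟨f, g :: l, a :: b :: as, rfl,
        List.Forall₂.cons hf (List.Forall₂.cons hg hl), ?_, ?_⟩
      · simp only [List.sum_cons]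
        ring
      · rw [dwedge_cons, mul_smul_comm]
  | zero => rw [mul_zero]; exact zero_mem _
  | add x y _ _ hx hy => rw [mul_add]; exact add_mem hx hy
  | smul a x _ hx => rw [mul_smul_comm]; exact Submodule.smul_mem _ _ hx

/-- If `ν` is diagonalizable, every form is a sum of forms with a weight. -/
lemma formDeg_le_iSup_weightSpace {ν : A →ₗ[k] A} (hν : IsDiagonalizable ν) (m : ℕ) :
    F.formDeg m ≤ ⨆ c : k, weightSpace F ν m c := by
  have hA : ∀ a : A, a ∈ ⨆ c : k, Module.End.eigenspace ν c := fun a => hν ▸ Submodule.mem_top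
  have hle : ∀ (m : ℕ) (c : k), weightSpace F ν m c ≤ ⨆ c : k, weightSpace F ν m c :=
    fun m c => le_iSup (fun c => weightSpace F ν m c) c
  have h1 : ∀ (m : ℕ) (g : A) (x : F.Forms), x ∈ ⨆ c : k, weightSpace F ν m c →
      F.dfun g * x ∈ ⨆ c : k, weightSpace F ν (m + 1) c := by
    intro m g x hx
    refine Submodule.iSup_induction _ (motive := fun g =>
      F.dfun g * x ∈ ⨆ c : k, weightSpace F ν (m + 1) c) (hA g) ?_ ?_ ?_
    · intro b g hg
      refine Submodule.iSup_induction _ (motive := fun x =>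
        F.dfun g * x ∈ ⨆ c : k, weightSpace F ν (m + 1) c) hx ?_ ?_ ?_
      · intro c x hx
        exact hle _ _ (dfun_mul_mem_weightSpace (Module.End.mem_eigenspace_iff.1 hg) hx)
      · rw [mul_zero]; exact zero_mem _
      · intro x y hx hy
        rw [mul_add]
        exact add_mem hx hy
    · rw [dfun, map_zero, map_zero, zero_mul]; exact zero_mem _
    · intro f g hf hg
      rw [dfun_add, add_mul]
      exact add_mem hf hg
  have h2 : ∀ (l : List A) (a : A), a • F.dwedge l ∈ ⨆ c : k, weightSpace F ν l.length c := by
    intro l a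
    induction l with
    | nil =>
      refine Submodule.iSup_induction _ (motive := fun a =>
        a • F.dwedge [] ∈ ⨆ c : k, weightSpace F ν 0 c) (hA a) ?_ ?_ ?_
      · intro c a ha
        exact hle _ c (Submodule.subset_span ⟨a, [], [c], rfl,
          List.Forall₂.cons (Module.End.mem_eigenspace_iff.1 ha) List.Forall₂.nil,
          List.sum_singleton, rfl⟩)
      · rw [zero_smul]; exact zero_mem _
      · intro a b ha hb
        rw [add_smul]
        exact add_mem ha hb
    | cons g l ih =>
      rw [dwedge_cons, ← mul_smul_comm]
      exact h1 _ g _ ih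
  intro x hx
  refine form_induction (p := fun x => x ∈ ⨆ c : k, weightSpace F ν m c) (fun a l hl => ?_)
    (zero_mem _) (fun x y hx hy => add_mem hx hy) hx
  rw [← hl]
  exact h2 l a

variable {P}

lemma semisimple (hν : IsDiagonalizable (η.modularDerivation P)) : (η.poisson P).Semisimple := by
  intro t x hx
  have hx' : x ∈ F.formDeg (n - t) := hx
  rcases lt_or_ge ((n : ℤ) - t) 0 with h | h
  · rw [mem_formDeg, extZ_neg h, Submodule.mem_bot] at hx'
    rw [hx']
    exact zero_mem _
  · obtain ⟨m, hm⟩ := Int.eq_ofNat_of_zero_le h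
    rw [hm] at hx'
    refine iSup_mono (fun c => le_inf ?_ (η.weightSpace_le_eigenspace P m c))
      (formDeg_le_iSup_weightSpace hν m hx')
    change _ ≤ F.formDeg (n - t)
    rw [hm]
    exact weightSpace_le_formDeg _ m c

/-- The forms of weight zero are the kernel of the Lie derivative along the modular vector. -/
lemma mem_weightZero_iff (hν : IsDiagonalizable (η.modularDerivation P)) {m : ℤ} {x : F.Forms} :
    x ∈ F.weightZero (η.modularDerivation P) m ↔ x ∈ F.formDeg m ∧ (η.poisson P).lie x = 0 := by
  rcases lt_or_ge m 0 with h | h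
  · have h1 : F.weightZero (η.modularDerivation P) m = ⊥ := by
      refine Submodule.span_eq_bot.2 ?_
      rintro _ ⟨f, l, cs, hl, -⟩
      omega
    have h2 : x ∈ F.formDeg m ↔ x = 0 := by
      rw [mem_formDeg, extZ_neg h, Submodule.mem_bot]
    rw [h1, Submodule.mem_bot, h2]
    exact ⟨fun e => ⟨e, by rw [e, map_zero]⟩, fun e => e.1⟩
  · obtain ⟨m, rfl⟩ := Int.eq_ofNat_of_zero_le h
    have h1 : F.weightZero (η.modularDerivation P) m =
        weightSpace F (η.modularDerivation P) m 0 := by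
      simp only [weightZero, weightSpace, Nat.cast_inj]
    rw [h1]
    constructor
    · intro hx
      have := Module.End.mem_eigenspace_iff.1 (η.weightSpace_le_eigenspace P m 0 hx)
      exact ⟨weightSpace_le_formDeg _ m 0 hx, by rwa [zero_smul] at this⟩
    · rintro ⟨hx, hx0⟩
      have hx' := formDeg_le_iSup_weightSpace hν m hx
      rw [iSup_split_single (fun c => weightSpace F (η.modularDerivation P) m c) 0] at hx'
      obtain ⟨y, hy, z, hz, rfl⟩ := Submodule.mem_sup.1 hx'
      have hy0 := Module.End.mem_eigenspace_iff.1 (η.weightSpace_le_eigenspace P m 0 hy)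
      have hz0 : z = 0 := by
        refine (Submodule.disjoint_def.1
          (Module.End.eigenspaces_iSupIndep (η.poisson P).lie 0)) z ?_ ?_
        · rw [Module.End.mem_eigenspace_iff, zero_smul]
          rwa [map_add, hy0, zero_smul, zero_add] at hx0
        · exact iSup₂_mono (fun c _ => η.weightSpace_le_eigenspace P m c) hz
      rw [hz0, add_zero]
      exact hy

/-! ### The structures on the homology of a Poisson algebra with a volume form -/

/-- The weight-zero forms of a Poisson algebra with a volume form and semisimple modular vector
compute Poisson cohomology, and carry the Batalin-Vilkovisky and gravity structures. -/
theorem exists_gravity (hν : IsDiagonalizable (η.modularDerivation P)) :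
    ∃ M : MixedComplex k F.Forms,
        M.C = F.weightZero (η.modularDerivation P) ∧
        F.IsPoissonBoundary P (η.modularDerivation P) M.b ∧
        M.B = F.d ∧
        ∃ θ : (⨁ p : ℕ, F.HP P p) ≃ₗ[k] M.HHtot,
          (∀ (p : ℕ) (X : F.cocycles P p), ∃ z : M.cycles ((n : ℤ) - p),
            F.contract X.1 η.form - z.1 ∈ LinearMap.range M.b ∧
            θ (F.hpClass P p X) = M.hhClass _ z) ∧
          ∃ (one : M.HHtot) (mul : M.HHtot →ₗ[k] M.HHtot →ₗ[k] M.HHtot),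
            (∀ (p q : ℕ) (X : F.cocycles P p) (Y : F.cocycles P q),
              ∃ h : F.wedge X.1 Y.1 ∈ F.cocycles P (p + q),
                mul (θ (F.hpClass P p X)) (θ (F.hpClass P q Y)) =
                  θ (F.hpClass P (p + q) ⟨F.wedge X.1 Y.1, h⟩)) ∧
            IsBVAlgebra (M.hhDeg n) one mul M.Bstar ∧
            HasInducedGravityStructure M n one mul := by
  have hX : ∀ t : ℤ, (∀ p : ℕ, (p : ℤ) ≠ t) → η.calculus.X t = ⊥ := by
    intro t ht
    have ht0 : t < 0 := by
      by_contra h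
      obtain ⟨p, rfl⟩ := Int.eq_ofNat_of_zero_le (not_lt.1 h)
      exact ht p rfl
    exact (Submodule.eq_bot_iff _).2 fun x hx => η.eq_zero_of_gt (by omega) hx
  have hZ : ∀ (p : ℕ) (x : F.Forms), (∃ X ∈ F.cocycles P p, F.contractForm η.form p X = x) ↔
      (x ∈ η.calculus.X p ∧ (η.poisson P).b x = 0) := by
    intro p x
    constructor
    · rintro ⟨X, hX, rfl⟩
      exact ⟨η.contract_form_mem X, (η.mem_cocycles_iff P X).1 hX⟩
    · rintro ⟨hx, hb⟩
      obtain ⟨X, rfl⟩ := η.exists_contract hx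
      exact ⟨X, (η.mem_cocycles_iff P X).2 hb, rfl⟩
  have hB : ∀ (p : ℕ) (x : F.Forms), (∃ X ∈ F.coboundaries P p, F.contractForm η.form p X = x) ↔
      ∃ y ∈ η.calculus.X ((p : ℤ) - 1), (η.poisson P).b y = x := by
    intro p x
    cases p with
    | zero =>
      constructor
      · rintro ⟨X, hX, rfl⟩
        rw [show X = 0 from hX, map_zero]
        exact ⟨0, zero_mem _, map_zero _⟩
      · rintro ⟨y, hy, rfl⟩
        have hy0 : y = 0 := η.eq_zero_of_gt (e := n - ((0 : ℕ) - 1 : ℤ)) (by omega) hy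
        rw [hy0, map_zero]
        exact ⟨0, zero_mem _, map_zero _⟩
    | succ p =>
      rw [show ((p + 1 : ℕ) : ℤ) - 1 = p by push_cast; ring]
      constructor
      · rintro ⟨X, hX, rfl⟩
        obtain ⟨Y, hY⟩ := (η.mem_coboundaries_succ_iff P X).1 hX
        exact ⟨_, η.contract_form_mem Y, hY⟩
      · rintro ⟨y, hy, rfl⟩
        obtain ⟨Y, rfl⟩ := η.exists_contract hy
        obtain ⟨Z, hZ⟩ := η.exists_contract_b P Y
        exact ⟨Z, (η.mem_coboundaries_succ_iff P Z).2 ⟨Y, hZ.symm⟩, hZ⟩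
  obtain ⟨θ, h1, one, mul, h2, h3, h4⟩ := (η.poisson P).exists_bv (LinearEquiv.refl k F.Forms) n
    (η.semisimple hν) (fun p : ℕ => (p : ℤ)) Nat.cast_injective hX
    F.Polyvector (F.cocycles P) (F.coboundaries P) (F.contractForm η.form)
    (fun _ => η.contract_form_injective) hZ hB
  refine ⟨(η.poisson P).mixed (LinearEquiv.refl k F.Forms) n, ?_, ?_, ?_, θ, ?_, one, mul, ?_,
    h3, h4⟩
  · funext m
    ext x
    rw [η.mem_weightZero_iff hν]
    have h := PolyCalculus.Poisson.mem_mixed_C (Q := η.poisson P) (e := LinearEquiv.refl k F.Forms)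
      (n := n) (m := m) (t := n - m) rfl (x := x)
    refine h.trans ?_
    change x ∈ F.formDeg (n - (n - m)) ∧ _ ↔ _
    rw [sub_sub_cancel]
  · have h : ((η.poisson P).mixed (LinearEquiv.refl k F.Forms) n).b = (η.poisson P).b :=
      LinearMap.ext fun x => (η.poisson P).mixed_b (e := LinearEquiv.refl k F.Forms) x
    rw [h]
    exact η.isPoissonBoundary_b P
  · exact LinearMap.ext fun x => (η.poisson P).mixed_B (e := LinearEquiv.refl k F.Forms) x
  · intro p X
    obtain ⟨z, ⟨y, hy, hyz⟩, hz⟩ := h1 p X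
    refine ⟨z, ⟨y, ?_⟩, hz⟩
    exact ((η.poisson P).mixed_b (e := LinearEquiv.refl k F.Forms) y).trans hyz.symm
  · intro p q X Y
    have hm : F.contract (F.wedge X.1 Y.1) η.form =
        η.mul (F.contract X.1 η.form) (F.contract Y.1 η.form) := by
      rw [mul_contract, contract_wedge]
    have h : F.wedge X.1 Y.1 ∈ F.cocycles P (p + q) := by
      rw [η.mem_cocycles_iff, hm]
      have hb := (η.poisson P).b_mul (s := p) (t := q) (η.contract_form_mem X.1)
        (η.contract_form_mem Y.1)
      rw [(η.mem_cocycles_iff P X.1).1 X.2, (η.mem_cocycles_iff P Y.1).1 Y.2, map_zero, map_zero,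
        LinearMap.zero_apply, smul_zero, add_zero] at hb
      exact hb
    exact ⟨h, h2 p q (p + q) X Y ⟨_, h⟩ (Nat.cast_add p q) hm⟩

end FormCalculus.VolumeForm

end PoissonGravity

end

theorem mainTheorem3 {k : Type u} [Field k] [CharZero k] :
    (∀ (A : Type v) [CommRing A] [Algebra k A]
      (Ω : Type w) [AddCommGroup Ω] [Module A Ω] [Module k Ω] [IsScalarTower k A Ω]
      (F : FormCalculus k A Ω) (P : PoissonBracket k A) (n : ℕ) (η : F.VolumeForm n),
      IsDiagonalizable (η.modularDerivation P) →
      ∃ M : MixedComplex k F.Forms,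
        M.C = F.weightZero (η.modularDerivation P) ∧
        F.IsPoissonBoundary P (η.modularDerivation P) M.b ∧
        M.B = F.d ∧
        ∃ θ : (⨁ p : ℕ, F.HP P p) ≃ₗ[k] M.HHtot,
          (∀ (p : ℕ) (X : F.cocycles P p), ∃ z : M.cycles ((n : ℤ) - p),
            F.contract X.1 η.form - z.1 ∈ LinearMap.range M.b ∧
            θ (F.hpClass P p X) = M.hhClass _ z) ∧
          ∃ (one : M.HHtot) (mul : M.HHtot →ₗ[k] M.HHtot →ₗ[k] M.HHtot),
            (∀ (p q : ℕ) (X : F.cocycles P p) (Y : F.cocycles P q),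
              ∃ h : F.wedge X.1 Y.1 ∈ F.cocycles P (p + q),
                mul (θ (F.hpClass P p X)) (θ (F.hpClass P q Y)) =
                  θ (F.hpClass P (p + q) ⟨F.wedge X.1 Y.1, h⟩)) ∧
            IsBVAlgebra (M.hhDeg n) one mul M.Bstar ∧
            HasInducedGravityStructure M n one mul) ∧
    (∀ (n : ℕ) (P : ExteriorPoisson k n),
      IsDiagonalizable P.modularDerivation →
      ∃ M : MixedComplex k (List (Homog k n) → Module.Dual k (Lam k n)),
        M.C = P.weightZero ∧
        M.b = P.coeffDual.delta P ∧
        M.B = ExteriorPoisson.dStar ∧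
        ∃ θ : (⨁ t : ℤ, P.HP t) ≃ₗ[k] M.HHtot,
          (∀ (t : ℤ) (X : P.cocycles t), ∃ z : M.cycles ((n : ℤ) - t),
            ExteriorPoisson.iotaEta X.1 - z.1 ∈ (P.coeffDual.cochains ((n : ℤ) - t + 1)).map M.b ∧
            θ (P.hpClass t X) = M.hhClass _ z) ∧
          ∃ (one : M.HHtot) (mul : M.HHtot →ₗ[k] M.HHtot →ₗ[k] M.HHtot),
            (∀ (s t : ℤ) (X : P.cocycles s) (Y : P.cocycles t),
              ∃ h : ExteriorPoisson.wedge s t X.1 Y.1 ∈ P.cocycles (s + t),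
                mul (θ (P.hpClass s X)) (θ (P.hpClass t Y)) =
                  θ (P.hpClass (s + t) ⟨ExteriorPoisson.wedge s t X.1 Y.1, h⟩)) ∧
            IsBVAlgebra (M.hhDeg n) one mul M.Bstar ∧
            HasInducedGravityStructure M n one mul) := by
  exact ⟨fun _ _ _ _ _ _ _ _ _ _ _ η hν => η.exists_gravity hν,
    fun _ _ hν => ExteriorPoisson.exists_gravity hν⟩
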